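/- **Setting.** Let $k\ge 1$ be an integer and $\alpha>-1$. Put $\sigma_1=\begin{pmatrix}0&1\\1&0\end{pmatrix}$, $\sigma_3=\begin{pmatrix}1&0\\0&-1\end{pmatrix}$, $\sigma_+=\begin{pmatrix}0&1\\0&0\end{pmatrix}$, $\sigma_-=\begin{pmatrix}0&0\\1&0\end{pmatrix}$. For $s>0$ let $$\Gamma_1^{(s)}=(-s,0),\quad \Gamma_2^{(s)}=-s+e^{-\pi i/3}(-\infty,0),\quad \Gamma_3^{(s)}=(-\infty,-s),\quad \Gamma_4^{(s)}=-s+e^{\pi i/3}(-\infty,0),$$ all oriented from left to right, let $\Omega_s=\mathbb C\setminus(\bigcup_j\Gamma^{(s)}_j\cup\{-s,0\})$, and let II, III, IV, V be the sectors $0<\arg(z+s)<\frac{2\pi}3$, $\frac{2\pi}3<\arg(z+s)<\pi$, $-\pi<\arg(z+s)<-\frac{2\pi}3$, $-\frac{2\pi}3<\arg(z+s)<0$. All powers and logarithms are principal branches. For $\lambda>0$ and $s>0$ let $M(z)=M(z;\lambda,s)$ be the $2\times2$ matrix-valued solution of the following Riemann–Hilbert problem. 1. $M$ is analytic in $\Omega_s$.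 2. $M$ has limiting values $M_+$ (from the left) and $M_-$ (from the right) on each $\Gamma_j^{(s)}$, and $M_+=M_-J_j$ there, with $$J_1=\begin{pmatrix}e^{\alpha\pi i}&0\\0&e^{-\alpha\pi i}\end{pmatrix},\quad J_2=\begin{pmatrix}1&0\\e^{\alpha\pi i}&1\end{pmatrix},\quad J_3=\begin{pmatrix}0&1\\-1&0\end{pmatrix},\quad J_4=\begin{pmatrix}1&0\\e^{-\alpha\pi i}&1\end{pmatrix}.$$ 3. As $z\to\infty$, $$M(z)=\begin{pmatrix}1&0\\a(\lambda;s)&1\end{pmatrix}\Big(I+\frac{M_\infty}{z}+O(z^{-2})\Big)e^{\frac{\pi i}4\sigma_3}z^{-\frac14\sigma_3}\frac{I+i\sigma_1}{\sqrt2}e^{\lambda z^{1/2}\sigma_3},\qquad a(\lambda;s)=(M_\infty)_{12}.$$ 4. Near $z=0$, $M(z)=M^{(0)}(z)\,e^{\frac{(-1)^{k+1}}{z^k}\sigma_3}z^{\frac\alpha2\sigma_3}$ with $M^{(0)}$ analytic at $0$. 5. Near $z=-s$, $M(z)=M^{(s)}(z)\big(I+\frac1{2\pi i}\log(z+s)\,\sigma_+\big)E^{(s)}(z)$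 with $M^{(s)}$ analytic at $-s$, where $E^{(s)}$ equals, with $e=e^{\alpha\pi i/2}$, $$\begin{pmatrix}e&0\\0&e^{-1}\end{pmatrix},\quad \begin{pmatrix}e&0\\-e&e^{-1}\end{pmatrix},\quad\begin{pmatrix}e^{-1}&0\\e^{-1}&e\end{pmatrix},\quad\begin{pmatrix}e^{-1}&0\\0&e\end{pmatrix}$$ in II, III, IV, V respectively. **Proposition 6.3.** With $'=\frac{d}{d\lambda}$, there are functions $b_1(\lambda;s),\dots,b_{k+1}(\lambda;s)$, twice differentiable in $\lambda$, such that, with $b_{k+2}:=0$, for all $\lambda,s>0$ the function $a$ is differentiable in $\lambda$ and in $s$, $M$ is differentiable in $z$, $\lambda$ and $s$ at every $z\in\Omega_s$, and $$\frac{\partial M}{\partial z}=\Big(\sum_{j=1}^{k+1}\frac{A_j}{z^j}+\frac{A_0}{z+s}+\frac\lambda2\sigma_-\Big)M,\qquad \frac{\partial M}{\partial\lambda}=\begin{pmatrix}0&1\\z+2a'&0\end{pmatrix}M,\qquad \frac{\partial M}{\partial s}=\Big(\frac{\partial a}{\partial s}\sigma_-+\frac{A_0}{z+s}\Big)M,$$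 where $$A_j=\begin{pmatrix}-\frac{b_j'}2&b_j\\-\frac{b_j''}2+2a'b_j+b_{j+1}&\frac{b_j'}2\end{pmatrix}\ (1\le j\le k+1),\qquad A_0=\begin{pmatrix}-\frac14+\frac{b_1'}2&\frac\lambda2-b_1\\\frac{b_1''}2+(2a'-s)(\frac\lambda2-b_1)&\frac14-\frac{b_1'}2\end{pmatrix}.$$ Moreover, $a,b_1,\dots,b_{k+1}$ satisfy the coupled Painlevé III system $$(\lambda-2b_1)b_1''+\big(b_1'-\tfrac12\big)^2+(2a'-s)(\lambda-2b_1)^2=0,$$ $$\sum_{m=j-k-1}^{k+1}\Big(-b_{j-m}b_m''+\frac{b_{j-m}'b_m'}2+4a'b_{j-m}b_m+2b_{j-m}b_{m+1}\Big)=\Lambda_j,\qquad k+2\le j\le 2k+2,$$ where $\Lambda_{2k+2}=2k^2$, $\Lambda_{k+2}=(-1)^k2\alpha k$ and $\Lambda_j=0$ for $k+2<j<2k+2$, and also the relation $$\frac{\partial a}{\partial s}=\frac\lambda2-b_1.$$ -/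

import Mathlib

open Filter Topology Asymptotics

noncomputable section

namespace CoupledPIII

/-- Two by two complex matrices. -/
abbrev Mat : Type := Matrix (Fin 2) (Fin 2) ℂ

def sigma1 : Mat := !![0, 1; 1, 0]

def sigmaPlus : Mat := !![0, 1; 0, 0]

def sigmaMinus : Mat := !![0, 0; 1, 0]

/-- `e^{w σ₃}`. -/
def expSigma3 (w : ℂ) : Mat := !![Complex.exp w, 0; 0, Complex.exp (-w)]

/-- `z^{c σ₃}`, with principal branches. -/
def powSigma3 (z c : ℂ) : Mat := !![z ^ c, 0; 0, z ^ (-c)]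

/-! ### The contour

All four arcs are oriented from left to right.  The arc `Γ₂` lies in the upper half plane and
`Γ₄` in the lower one. -/

def Gamma1 (s : ℝ) : Set ℂ := {z | ∃ x : ℝ, -s < x ∧ x < 0 ∧ z = (x : ℂ)}

def Gamma2 (s : ℝ) : Set ℂ :=
  {z | ∃ x : ℝ, x < 0 ∧ z = -(s : ℂ) + Complex.exp (-(Real.pi / 3 * Complex.I)) * x}

def Gamma3 (s : ℝ) : Set ℂ := {z | ∃ x : ℝ, x < -s ∧ z = (x : ℂ)}

def Gamma4 (s : ℝ) : Set ℂ :=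
  {z | ∃ x : ℝ, x < 0 ∧ z = -(s : ℂ) + Complex.exp (Real.pi / 3 * Complex.I) * x}

/-- The complement of the closed contour (the four arcs with the end points `-s` and `0`). -/
def Omega (s : ℝ) : Set ℂ :=
  (Gamma1 s ∪ Gamma2 s ∪ Gamma3 s ∪ Gamma4 s ∪ {-(s : ℂ), 0})ᶜ

/-! The four open sectors with vertex `-s` cut out by the contour and by the half line
`(-s, +∞)`.  Near `-s`, and next to the arcs of the contour, they are the regions II, III, IV, V
on the two sides of the arcs. -/

def sectorII (s : ℝ) : Set ℂ :=
  {z | 0 < (z + s).arg ∧ (z + s).arg < 2 * Real.pi / 3}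

def sectorIII (s : ℝ) : Set ℂ :=
  {z | 2 * Real.pi / 3 < (z + s).arg ∧ (z + s).arg < Real.pi}

def sectorIV (s : ℝ) : Set ℂ :=
  {z | -Real.pi < (z + s).arg ∧ (z + s).arg < -(2 * Real.pi / 3)}

def sectorV (s : ℝ) : Set ℂ :=
  {z | -(2 * Real.pi / 3) < (z + s).arg ∧ (z + s).arg < 0}

/-! ### The Riemann-Hilbert problem -/

/-- On the arc `Γ`, with left side `P` and right side `N`, the function `M` has limiting values
`M₊` (from `P`) and `M₋` (from `N`), and `M₊ = M₋ J`. -/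
def HasJump (M : ℂ → Mat) (Γ P N : Set ℂ) (J : Mat) : Prop :=
  ∀ z ∈ Γ, ∃ Mp Mm : Mat,
    Tendsto M (𝓝[P] z) (𝓝 Mp) ∧ Tendsto M (𝓝[N] z) (𝓝 Mm) ∧ Mp = Mm * J

/-- `e^{(π i / 4) σ₃} z^{-σ₃ / 4} ((I + i σ₁) / √2) e^{l z^{1/2} σ₃}`. -/
def modelInfinity (l : ℝ) (z : ℂ) : Mat :=
  expSigma3 (Real.pi / 4 * Complex.I) * powSigma3 z (-(1 / 4)) *
    (((Real.sqrt 2 : ℂ)⁻¹) • (1 + Complex.I • sigma1)) * expSigma3 (l * z ^ (1 / 2 : ℂ))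

open Classical in
/-- The piecewise constant matrix `E^{(s)}(z)`; its value off the four sectors is irrelevant. -/
def piecewiseE (α s : ℝ) (z : ℂ) : Mat :=
  let e : ℂ := Complex.exp (α * Real.pi * Complex.I / 2)
  if z ∈ sectorII s then !![e, 0; 0, e⁻¹]
  else if z ∈ sectorIII s then !![e, 0; -e, e⁻¹]
  else if z ∈ sectorIV s then !![e⁻¹, 0; e⁻¹, e]
  else if z ∈ sectorV s then !![e⁻¹, 0; 0, e]
  else 1

/-- `M = M(z)` solves the Riemann-Hilbert problem with parameters `k, α, l, s` (`l` stands for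
`λ`), and `a` is the `(1,2)` entry of the coefficient `M_∞` in its expansion at infinity. -/
structure IsRHSolution (k : ℕ) (α l s : ℝ) (M : ℂ → Mat) (a : ℂ) : Prop where
  analytic : ∀ i j, DifferentiableOn ℂ (fun z => M z i j) (Omega s)
  jump1 : HasJump M (Gamma1 s) (sectorII s) (sectorV s)
    !![Complex.exp (α * Real.pi * Complex.I), 0; 0, Complex.exp (-(α * Real.pi * Complex.I))]
  jump2 : HasJump M (Gamma2 s) (sectorII s) (sectorIII s)
    !![1, 0; Complex.exp (α * Real.pi * Complex.I), 1]
  jump3 : HasJump M (Gamma3 s) (sectorIII s) (sectorIV s) !![0, 1; -1, 0]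
  jump4 : HasJump M (Gamma4 s) (sectorIV s) (sectorV s)
    !![1, 0; Complex.exp (-(α * Real.pi * Complex.I)), 1]
  infinity : ∃ (Minf : Mat) (Err : ℂ → Mat),
    Minf 0 1 = a ∧
    (∀ i j, (fun z => Err z i j) =O[Bornology.cobounded ℂ ⊓ 𝓟 (Omega s)]
      (fun z => (z ^ 2)⁻¹)) ∧
    ∀ z ∈ Omega s,
      M z = !![1, 0; a, 1] * (1 + z⁻¹ • Minf + Err z) * modelInfinity l z
  zero : ∃ M0 : ℂ → Mat, (∀ i j, AnalyticAt ℂ (fun z => M0 z i j) 0) ∧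
    ∀ᶠ z in 𝓝[Omega s] 0,
      M z = M0 z * expSigma3 ((-1) ^ (k + 1) / z ^ k) * powSigma3 z (α / 2)
  minus_s : ∃ Ms : ℂ → Mat, (∀ i j, AnalyticAt ℂ (fun z => Ms z i j) (-(s : ℂ))) ∧
    ∀ᶠ z in 𝓝[Omega s] (-(s : ℂ)),
      M z = Ms z *
        (1 + (Complex.log (z + s) / (2 * Real.pi * Complex.I)) • sigmaPlus) * piecewiseE α s z

/-! ### The coefficients of the Lax triple

Functions of `(λ, s)` are written `f l s`, and the prime is the derivative in the first
variable `l`. -/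

/-- `∂f/∂λ`. -/
def dl (f : ℝ → ℝ → ℂ) (l s : ℝ) : ℂ := deriv (fun x => f x s) l

/-- `∂²f/∂λ²`. -/
def ddl (f : ℝ → ℝ → ℂ) (l s : ℝ) : ℂ := deriv (fun x => dl f x s) l

/-- The matrix `A_j`, for `1 ≤ j ≤ k + 1`. -/
def coeffA (a : ℝ → ℝ → ℂ) (b : ℕ → ℝ → ℝ → ℂ) (j : ℕ) (l s : ℝ) : Mat :=
  !![-(dl (b j) l s / 2), b j l s;
     -(ddl (b j) l s / 2) + 2 * dl a l s * b j l s + b (j + 1) l s, dl (b j) l s / 2]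

/-- The matrix `A_0`. -/
def coeffA0 (a : ℝ → ℝ → ℂ) (b : ℕ → ℝ → ℝ → ℂ) (l s : ℝ) : Mat :=
  !![-(1 / 4) + dl (b 1) l s / 2, (l : ℂ) / 2 - b 1 l s;
     ddl (b 1) l s / 2 + (2 * dl a l s - s) * ((l : ℂ) / 2 - b 1 l s),
     1 / 4 - dl (b 1) l s / 2]

/-- The coefficient of the equation in `z`. -/
def laxZ (k : ℕ) (a : ℝ → ℝ → ℂ) (b : ℕ → ℝ → ℝ → ℂ) (z : ℂ) (l s : ℝ) : Mat :=
  (∑ j ∈ Finset.Icc 1 (k + 1), (z ^ j)⁻¹ • coeffA a b j l s) +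
    (z + s)⁻¹ • coeffA0 a b l s + ((l : ℂ) / 2) • sigmaMinus

/-- The coefficient of the equation in `λ`. -/
def laxL (a : ℝ → ℝ → ℂ) (z : ℂ) (l s : ℝ) : Mat :=
  !![0, 1; z + 2 * dl a l s, 0]

/-- The coefficient of the equation in `s`. -/
def laxS (a : ℝ → ℝ → ℂ) (b : ℕ → ℝ → ℝ → ℂ) (z : ℂ) (l s : ℝ) : Mat :=
  (deriv (fun t => a l t) s) • sigmaMinus + (z + s)⁻¹ • coeffA0 a b l s

/-- The constants on the right hand side of the coupled Painlevé III system. -/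
def constLambda (k : ℕ) (α : ℝ) (j : ℕ) : ℂ :=
  if j = 2 * k + 2 then 2 * (k : ℂ) ^ 2
  else if j = k + 2 then (-1) ^ k * 2 * α * k
  else 0

/-- The coupled Painlevé III system at the point `(l, s)`: an equation for `a, b₁`, and one
equation for each `j` with `k + 2 ≤ j ≤ 2 k + 2`. -/
def CoupledSystemAt (k : ℕ) (α : ℝ) (a : ℝ → ℝ → ℂ) (b : ℕ → ℝ → ℝ → ℂ) (l s : ℝ) : Prop :=
  ((l : ℂ) - 2 * b 1 l s) * ddl (b 1) l s + (dl (b 1) l s - 1 / 2) ^ 2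
      + (2 * dl a l s - s) * ((l : ℂ) - 2 * b 1 l s) ^ 2 = 0 ∧
  ∀ j ∈ Finset.Icc (k + 2) (2 * k + 2),
    ∑ m ∈ Finset.Icc (j - k - 1) (k + 1),
      (-(b (j - m) l s * ddl (b m) l s) + dl (b (j - m)) l s * dl (b m) l s / 2
        + 4 * dl a l s * b (j - m) l s * b m l s + 2 * b (j - m) l s * b (m + 1) l s)
      = constLambda k α j

end CoupledPIII

end

/-!
The proof is an isomonodromy argument. A solution `M` of the Riemann-Hilbert problem has determinant
one (`IsRHSolution.det_eq_one`), and its jumps, its behaviour at `0` and at `-s`, and its behaviour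
at infinity are those of explicit right factors. So `M' M⁻¹` is single-valued, with a pole of order
`k + 1` at `0`, a simple pole at `-s`, and polynomial growth, hence rational
(`IsRHSolution.exists_ratForm`). The local form at `-s` makes the residue there nilpotent
(`IsRHSolution.trace_det_residue`), the essential singularity at `0` fixes the polar part of the
trace of the square (`IsRHSolution.trace_convolution`), and the expansion at infinity gives linear
relations between the coefficients (`IsRHSolution.coeff_relations`). The nilpotency and the trace
identities become the coupled Painlevé III system.

Differentiability in `λ` and `s` is not assumed, so that the equations in these variables do not
follow from Liouville's theorem alone. Two solutions with nearby parameters `(λ, s)` and `(λ', s')`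
are compared after the affine change of variable `z ↦ g⁴ z + d` that carries `-s'` to `-s` and turns
the exponent `λ' z^{1/2}` into `λ z^{1/2}` to leading order, where `λ' = g² λ`. Outside a small disc
about the origin the contours are carried into each other and the quotient of the two solutions is
holomorphic (`exists_outer_factor`); inside a disc of radius less than `s` both solutions have a
holomorphic left factor (`IsRHSolution.exists_disc_factor`). On an annulus, the inner factor is the outer
one times a jump that is explicit and of the form `1 + t (Din - Dout) + o(t)`, with `Din`
holomorphic in the disc and `Dout` holomorphic outside and vanishing at infinity. By the Cauchy
integral the two factors are `1 + t Din + o(t)` and `1 + t Dout + o(t)`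
(`small_norm_factorization`, `IsDeformation.exists_factorization`).

The outer factor gives the derivatives of `a` (`IsDeformation.hasDerivAt_const`) and of `M` at every
point off the contour (`IsDeformation.hasDerivAt_solution`). The inner one is controlled uniformly in
a disc, so that the principal part of `M' M⁻¹` at the origin is differentiable too and obeys the zero
curvature equation (`hasDerivAt_coeff`). In the direction of `λ`, that equation expresses all entries
of the coefficients through `b_j = (A_j)₁₂` and its first two derivatives, which is the shape of
`A_j` and `A_0` in the Lax triple.
-/

namespace CoupledPIII

section

open scoped Matrix.Norms.Operator

/-! ### Gluing holomorphic functions -/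

section Gluing

variable {E : Type*} [NormedAddCommGroup E] [NormedSpace ℂ E] [CompleteSpace E]

open Complex Set Interval in
/-- Painlevé's theorem for the real line: by continuity, the integral over every rectangle vanishes. -/
theorem differentiableOn_of_continuousOn_off_real {f : ℂ → E} {U : Set ℂ} (hU : IsOpen U)
    (hc : ContinuousOn f U) (hd : DifferentiableOn ℂ f (U ∩ {z | z.im ≠ 0})) :
    DifferentiableOn ℂ f U := by
  refine (isConservativeOn_and_continuousOn_iff_isDifferentiableOn hU).1 ⟨?_, hc⟩
  intro z w hzw
  have hzw' : ([[z.re, w.re]] ×ℂ [[z.im, w.im]]) ⊆ U := hzw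
  rw [← add_eq_zero_iff_eq_neg, wedgeIntegral_add_wedgeIntegral_eq]
  by_cases h0 : (0 : ℝ) ∈ [[z.im, w.im]]
  · have key : ∀ z' w' : ℂ, [[z'.re, w'.re]] ⊆ [[z.re, w.re]] → [[z'.im, w'.im]] ⊆ [[z.im, w.im]] →
        (0 : ℝ) ∉ Ioo (min z'.im w'.im) (max z'.im w'.im) →
        (∫ x : ℝ in z'.re..w'.re, f (x + z'.im * I)) - (∫ x : ℝ in z'.re..w'.re, f (x + w'.im * I)) +
          I • (∫ y : ℝ in z'.im..w'.im, f (w'.re + y * I)) -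
          I • (∫ y : ℝ in z'.im..w'.im, f (z'.re + y * I)) = 0 := by
      intro z' w' h1 h2 h3
      apply integral_boundary_rect_eq_zero_of_continuousOn_of_differentiableOn
      · exact hc.mono (fun x hx => hzw' ⟨h1 hx.1, h2 hx.2⟩)
      · refine hd.mono (fun x hx => ⟨hzw' ⟨h1 ?_, h2 ?_⟩, ?_⟩)
        · exact Ioo_subset_Icc_self hx.1
        · exact Ioo_subset_Icc_self hx.2
        · intro hx0
          exact h3 (hx0 ▸ hx.2)
    have e1 := key z ⟨w.re, 0⟩ subset_rfl (uIcc_subset_uIcc_left h0) (by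
      simp only [mem_Ioo]; grind)
    have e2 := key ⟨z.re, 0⟩ w subset_rfl (uIcc_subset_uIcc_right h0) (by
      simp only [mem_Ioo]; grind)
    have hint : ∀ x ∈ [[z.re, w.re]], ∀ p ∈ [[z.im, w.im]], ∀ q ∈ [[z.im, w.im]],
        IntervalIntegrable (fun y : ℝ => f (x + y * I)) MeasureTheory.volume p q := by
      intro x hx p hp q hq
      apply ContinuousOn.intervalIntegrable
      refine hc.comp (by fun_prop) ?_
      intro y hy
      refine hzw' ⟨?_, ?_⟩
      · simpa using hx
      · simpa using uIcc_subset_uIcc hp hq hy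
    have a1 := intervalIntegral.integral_add_adjacent_intervals
      (hint w.re right_mem_uIcc _ left_mem_uIcc _ h0) (hint w.re right_mem_uIcc _ h0 _ right_mem_uIcc)
    have a2 := intervalIntegral.integral_add_adjacent_intervals
      (hint z.re left_mem_uIcc _ left_mem_uIcc _ h0) (hint z.re left_mem_uIcc _ h0 _ right_mem_uIcc)
    rw [← a1, ← a2]
    simp only at e1 e2
    have := congrArg₂ (· + ·) e1 e2
    simp only [add_zero] at this
    rw [← this]
    simp only [smul_add]
    abel
  · apply integral_boundary_rect_eq_zero_of_differentiableOn
    refine hd.mono (fun x hx => ⟨hzw' hx, ?_⟩)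
    intro hx0
    exact h0 (hx0 ▸ hx.2)

/-- A continuous function that is holomorphic off the line `p + ℝ u` is holomorphic. -/
theorem differentiableOn_of_continuousOn_off_line {f : ℂ → E} {U : Set ℂ} (hU : IsOpen U)
    (p : ℂ) {u : ℂ} (hu : u ≠ 0)
    (hc : ContinuousOn f U) (hd : DifferentiableOn ℂ f (U ∩ {z | ((z - p) / u).im ≠ 0})) :
    DifferentiableOn ℂ f U := by
  set A : ℂ → ℂ := fun w => p + u * w with hA
  have hAd : Differentiable ℂ A := by fun_prop
  have h1 : DifferentiableOn ℂ (f ∘ A) (A ⁻¹' U) := by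
    apply differentiableOn_of_continuousOn_off_real (hU.preimage hAd.continuous)
    · exact hc.comp hAd.continuous.continuousOn (fun _ h => h)
    · refine hd.comp hAd.differentiableOn (fun w hw => ⟨hw.1, ?_⟩)
      have : (A w - p) / u = w := by simp [hA]; field_simp
      simpa [this] using hw.2
  set B : ℂ → ℂ := fun z => (z - p) / u with hB
  have hBd : Differentiable ℂ B := by fun_prop
  have hAB : ∀ z, A (B z) = z := by intro z; simp [hA, hB]; field_simp; ring
  have h2 : DifferentiableOn ℂ ((f ∘ A) ∘ B) U :=
    h1.comp hBd.differentiableOn (fun z hz => by simpa [hAB] using hz)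
  refine h2.congr (fun z _ => by simp [hAB])

/-- Painlevé's principle: two holomorphic functions on the two sides of a line, with equal boundary
values, are parts of one holomorphic function. -/
theorem exists_extension_across_line {f : ℂ → E} {U : Set ℂ} (hU : IsOpen U)
    (p : ℂ) {u : ℂ} (hu : u ≠ 0)
    (hd : DifferentiableOn ℂ f (U ∩ {z | ((z - p) / u).im ≠ 0}))
    (hlim : ∀ z ∈ U, ((z - p) / u).im = 0 → ∃ v,
      Tendsto f (𝓝[{w | 0 < ((w - p) / u).im}] z) (𝓝 v) ∧
      Tendsto f (𝓝[{w | ((w - p) / u).im < 0}] z) (𝓝 v)) :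
    ∃ F, DifferentiableOn ℂ F U ∧ ∀ z ∈ U, ((z - p) / u).im ≠ 0 → F z = f z := by
  set S : Set ℂ := {z | ((z - p) / u).im ≠ 0} with hS
  have hcont : Continuous fun z : ℂ => ((z - p) / u).im := by fun_prop
  have hSo : IsOpen S := isOpen_ne.preimage hcont
  have hSd : Dense S := by
    intro z
    by_cases hz : z ∈ S
    · exact subset_closure hz
    have hz0 : ((z - p) / u).im = 0 := by simpa [hS] using hz
    refine mem_closure_of_tendsto (f := fun x : ℝ => z + u * (x * Complex.I))
      (b := 𝓝[>] (0 : ℝ)) ?_ ?_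
    · have : Tendsto (fun x : ℝ => z + u * (x * Complex.I)) (𝓝 0) (𝓝 (z + u * ((0 : ℝ) * Complex.I))) :=
        Continuous.tendsto (by fun_prop) _
      simpa using this.mono_left nhdsWithin_le_nhds
    · filter_upwards [self_mem_nhdsWithin] with x hx
      have : (z + u * (x * Complex.I) - p) / u = (z - p) / u + x * Complex.I := by field_simp; ring
      simp only [hS, Set.mem_ofPred_eq, this, Complex.add_im, hz0]
      simpa using (ne_of_gt hx : x ≠ 0)
  have hSeq : S = {w | 0 < ((w - p) / u).im} ∪ {w | ((w - p) / u).im < 0} := by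
    ext z; simp only [hS, Set.mem_ofPred_eq, Set.mem_union]; grind
  have hfS : ∀ z ∈ U, z ∈ S → ContinuousAt f z := fun z hz hzS =>
    (hd.differentiableAt ((hU.inter hSo).mem_nhds ⟨hz, hzS⟩)).continuousAt
  have hex : ∀ z ∈ U, ∃ v, Tendsto f (𝓝[S] z) (𝓝 v) := by
    intro z hz
    by_cases hzS : z ∈ S
    · exact ⟨f z, (hfS z hz hzS).tendsto.mono_left nhdsWithin_le_nhds⟩
    · obtain ⟨v, h1, h2⟩ := hlim z hz (by simpa [hS] using hzS)
      refine ⟨v, ?_⟩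
      rw [hSeq, nhdsWithin_union]
      exact h1.sup h2
  have heq : ∀ z ∈ U, z ∈ S → extendFrom S f z = f z := fun z hz hzS =>
    extendFrom_eq (hSd z) ((hfS z hz hzS).tendsto.mono_left nhdsWithin_le_nhds)
  refine ⟨extendFrom S f, ?_, heq⟩
  apply differentiableOn_of_continuousOn_off_line hU p hu
  · exact continuousOn_extendFrom (fun z _ => hSd z) hex
  · exact hd.congr (fun z hz => heq z hz.1 hz.2)

/-- A function that is holomorphic on a dense open set `W` and that, near each other point of `U`,
coincides on `W` with a function holomorphic at that point, extends holomorphically to `U`. -/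
theorem exists_extension_of_local {f : ℂ → E} {W U : Set ℂ} (hW : IsOpen W) (hWd : Dense W)
    (hU : IsOpen U) (hf : DifferentiableOn ℂ f (W ∩ U))
    (hloc : ∀ z ∈ U, z ∉ W → ∃ F : ℂ → E, AnalyticAt ℂ F z ∧ ∀ᶠ w in 𝓝[W] z, f w = F w) :
    ∃ g, DifferentiableOn ℂ g U ∧ ∀ z ∈ W ∩ U, g z = f z := by
  have hfW : ∀ z ∈ W ∩ U, ContinuousAt f z := fun z hz =>
    (hf.differentiableAt ((hW.inter hU).mem_nhds hz)).continuousAt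
  have heq : ∀ z ∈ W ∩ U, extendFrom W f z = f z := fun z hz =>
    extendFrom_eq (hWd z) ((hfW z hz).tendsto.mono_left nhdsWithin_le_nhds)
  refine ⟨extendFrom W f, ?_, heq⟩
  intro z hz
  apply DifferentiableAt.differentiableWithinAt
  by_cases hzW : z ∈ W
  · refine (hf.differentiableAt ((hW.inter hU).mem_nhds ⟨hzW, hz⟩)).congr_of_eventuallyEq ?_
    filter_upwards [(hW.inter hU).mem_nhds ⟨hzW, hz⟩] with w hw using heq w hw
  · obtain ⟨F, hF, hfF⟩ := hloc z hz hzW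
    refine hF.differentiableAt.congr_of_eventuallyEq ?_
    rw [eventually_nhdsWithin_iff] at hfF
    filter_upwards [hF.eventually_analyticAt, hfF.eventually_nhds] with w hw1 hw2
    refine extendFrom_eq (hWd w) ?_
    refine (hw1.continuousAt.tendsto.mono_left nhdsWithin_le_nhds).congr' ?_
    rw [EventuallyEq, eventually_nhdsWithin_iff]
    filter_upwards [hw2] with x hx hxW using (hx hxW).symm

end Gluing

/-! ### Two by two matrices -/

section MatrixTools

/-- The `(i, j)` entry, as a continuous linear form. -/
noncomputable def entryL (i j : Fin 2) : Mat →L[ℂ] ℂ :=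
  LinearMap.toContinuousLinearMap
    { toFun := fun M => M i j, map_add' := fun _ _ => rfl, map_smul' := fun _ _ => rfl }

/-- The adjugate, which is linear for two by two matrices. It replaces the inverse for matrices of
determinant one. -/
noncomputable def adjL : Mat →L[ℂ] Mat :=
  LinearMap.toContinuousLinearMap
    { toFun := fun M => M.adjugate
      map_add' := fun A B => by
        ext i j; fin_cases i <;> fin_cases j <;> simp [Matrix.adjugate_fin_two] <;> ring
      map_smul' := fun c A => by
        ext i j; fin_cases i <;> fin_cases j <;> simp [Matrix.adjugate_fin_two] }

theorem adjL_apply (M : Mat) : adjL M = !![M 1 1, -M 0 1; -M 1 0, M 0 0] := by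
  change M.adjugate = _
  rw [Matrix.adjugate_fin_two]

theorem adjL_mul (A B : Mat) : adjL (A * B) = adjL B * adjL A :=
  Matrix.adjugate_mul_distrib A B

theorem adjL_one : adjL 1 = 1 := by
  change (1 : Mat).adjugate = 1
  exact Matrix.adjugate_one

theorem adjL_adjL (A : Mat) : adjL (adjL A) = A := by
  ext i j; fin_cases i <;> fin_cases j <;> simp [adjL_apply]

theorem mul_adjL {A : Mat} (h : A.det = 1) : A * adjL A = 1 := by
  change A * A.adjugate = 1
  rw [Matrix.mul_adjugate, h, one_smul]

theorem adjL_mul_self {A : Mat} (h : A.det = 1) : adjL A * A = 1 := by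
  change A.adjugate * A = 1
  rw [Matrix.adjugate_mul, h, one_smul]

theorem det_adjL (A : Mat) : (adjL A).det = A.det := by
  rw [adjL_apply, Matrix.det_fin_two, Matrix.det_fin_two]; simp; ring

/-- A matrix is the combination of the four matrix units. -/
theorem mat_eq_sum (M : Mat) :
    M = M 0 0 • !![1, 0; 0, 0] + M 0 1 • !![0, 1; 0, 0] + M 1 0 • !![0, 0; 1, 0]
      + M 1 1 • !![0, 0; 0, 1] := by
  ext i j; fin_cases i <;> fin_cases j <;> simp

theorem hasDerivAt_mat {F : ℂ → Mat} {F' : Mat} {z : ℂ}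
    (h : ∀ i j, HasDerivAt (fun w => F w i j) (F' i j) z) : HasDerivAt F F' z := by
  have := ((((h 0 0).smul_const (!![1, 0; 0, 0] : Mat)).add
    ((h 0 1).smul_const (!![0, 1; 0, 0] : Mat))).add
    ((h 1 0).smul_const (!![0, 0; 1, 0] : Mat))).add ((h 1 1).smul_const (!![0, 0; 0, 1] : Mat))
  rw [mat_eq_sum F']
  refine this.congr_of_eventuallyEq (Eventually.of_forall fun w => mat_eq_sum (F w))

theorem hasDerivAt_mat_real {F : ℝ → Mat} {F' : Mat} {z : ℝ}
    (h : ∀ i j, HasDerivAt (fun w => F w i j) (F' i j) z) : HasDerivAt F F' z := by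
  have := ((((h 0 0).smul_const (!![1, 0; 0, 0] : Mat)).add
    ((h 0 1).smul_const (!![0, 1; 0, 0] : Mat))).add
    ((h 1 0).smul_const (!![0, 0; 1, 0] : Mat))).add ((h 1 1).smul_const (!![0, 0; 0, 1] : Mat))
  rw [mat_eq_sum F']
  refine this.congr_of_eventuallyEq (Eventually.of_forall fun w => mat_eq_sum (F w))

theorem HasDerivAt.entry {F : ℂ → Mat} {F' : Mat} {z : ℂ} (h : HasDerivAt F F' z) (i j : Fin 2) :
    HasDerivAt (fun w => F w i j) (F' i j) z :=
  (entryL i j).hasFDerivAt.comp_hasDerivAt z h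

theorem HasDerivAt.entryReal {F : ℝ → Mat} {F' : Mat} {z : ℝ} (h : HasDerivAt F F' z)
    (i j : Fin 2) : HasDerivAt (fun w => F w i j) (F' i j) z :=
  ((entryL i j).restrictScalars ℝ).hasFDerivAt.comp_hasDerivAt z h

theorem differentiableOn_mat {F : ℂ → Mat} {U : Set ℂ}
    (h : ∀ i j, DifferentiableOn ℂ (fun w => F w i j) U) : DifferentiableOn ℂ F U := by
  have := ((((h 0 0).smul_const (!![1, 0; 0, 0] : Mat)).add
    ((h 0 1).smul_const (!![0, 1; 0, 0] : Mat))).add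
    ((h 1 0).smul_const (!![0, 0; 1, 0] : Mat))).add ((h 1 1).smul_const (!![0, 0; 0, 1] : Mat))
  exact this.congr (fun w _ => mat_eq_sum (F w))

theorem analyticAt_mat {F : ℂ → Mat} {z : ℂ}
    (h : ∀ i j, AnalyticAt ℂ (fun w => F w i j) z) : AnalyticAt ℂ F z := by
  have := ((((h 0 0).smul (analyticAt_const (v := (!![1, 0; 0, 0] : Mat)))).add
    ((h 0 1).smul (analyticAt_const (v := (!![0, 1; 0, 0] : Mat))))).add
    ((h 1 0).smul (analyticAt_const (v := (!![0, 0; 1, 0] : Mat))))).add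
    ((h 1 1).smul (analyticAt_const (v := (!![0, 0; 0, 1] : Mat))))
  refine this.congr (Eventually.of_forall fun w => (mat_eq_sum (F w)).symm)

theorem tendsto_mat {ι : Type*} {l : Filter ι} {F : ι → Mat} {A : Mat}
    (h : ∀ i j, Tendsto (fun w => F w i j) l (𝓝 (A i j))) : Tendsto F l (𝓝 A) :=
  tendsto_pi_nhds.2 fun i => tendsto_pi_nhds.2 fun j => h i j

theorem Tendsto.entry {ι : Type*} {l : Filter ι} {F : ι → Mat} {A : Mat}
    (h : Tendsto F l (𝓝 A)) (i j : Fin 2) : Tendsto (fun w => F w i j) l (𝓝 (A i j)) :=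
  ((entryL i j).continuous.tendsto A).comp h

theorem entry_norm_le (M : Mat) (i j : Fin 2) : ‖M i j‖ ≤ ‖M‖ := by
  have := Matrix.linfty_opNorm_def M
  rw [this]
  have h1 : ‖M i j‖₊ ≤ ∑ j, ‖M i j‖₊ := Finset.single_le_sum (f := fun j => ‖M i j‖₊) (by simp) (Finset.mem_univ j)
  have h2 : ∑ j, ‖M i j‖₊ ≤ Finset.univ.sup fun i => ∑ j, ‖M i j‖₊ :=
    Finset.le_sup (f := fun i => ∑ j, ‖M i j‖₊) (Finset.mem_univ i)
  exact_mod_cast h1.trans h2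

theorem norm_le_of_entries {M : Mat} {C : ℝ} (h : ∀ i j, ‖M i j‖ ≤ C) : ‖M‖ ≤ 2 * C := by
  rw [Matrix.linfty_opNorm_def]
  have hC : 0 ≤ C := (norm_nonneg _).trans (h 0 0)
  lift C to NNReal using hC
  have : (Finset.univ.sup fun i => ∑ j, ‖M i j‖₊) ≤ 2 * C := by
    apply Finset.sup_le
    intro i _
    simp only [Fin.sum_univ_two, two_mul]
    exact add_le_add (by exact_mod_cast h i 0) (by exact_mod_cast h i 1)
  exact_mod_cast this

theorem DifferentiableOn.matDet {F : ℂ → Mat} {U : Set ℂ} (h : DifferentiableOn ℂ F U) :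
    DifferentiableOn ℂ (fun z => (F z).det) U := by
  simp only [Matrix.det_fin_two]
  have e : ∀ i j, DifferentiableOn ℂ (fun w => F w i j) U := fun i j =>
    (entryL i j).differentiable.comp_differentiableOn h
  exact ((e 0 0).mul (e 1 1)).sub ((e 0 1).mul (e 1 0))

theorem AnalyticAt.matDet {F : ℂ → Mat} {z : ℂ} (h : AnalyticAt ℂ F z) :
    AnalyticAt ℂ (fun z => (F z).det) z := by
  simp only [Matrix.det_fin_two]
  have e : ∀ i j, AnalyticAt ℂ (fun w => F w i j) z := fun i j =>
    (entryL i j).analyticAt _ |>.comp h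
  exact ((e 0 0).mul (e 1 1)).sub ((e 0 1).mul (e 1 0))

theorem AnalyticAt.adjL_comp {F : ℂ → Mat} {z : ℂ} (h : AnalyticAt ℂ F z) :
    AnalyticAt ℂ (fun z => adjL (F z)) z := (adjL.analyticAt _).comp h

theorem continuous_matDet : Continuous fun M : Mat => M.det := by
  simp only [Matrix.det_fin_two]
  have e : ∀ i j, Continuous (fun M : Mat => M i j) := fun i j => (entryL i j).continuous
  exact ((e 0 0).mul (e 1 1)).sub ((e 0 1).mul (e 1 0))

end MatrixTools

/-! ### The contour -/

section Contour

theorem sqrt3_pos : 0 < Real.sqrt 3 := by positivity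

theorem exp_neg_pi_third : Complex.exp (-(Real.pi / 3 * Complex.I)) = ⟨1 / 2, -(Real.sqrt 3 / 2)⟩ := by
  have : -((Real.pi : ℂ) / 3 * Complex.I) = ((-(Real.pi / 3) : ℝ) : ℂ) * Complex.I := by
    push_cast; ring
  rw [this]
  apply Complex.ext
  · rw [Complex.exp_ofReal_mul_I_re, Real.cos_neg, Real.cos_pi_div_three]
  · rw [Complex.exp_ofReal_mul_I_im, Real.sin_neg, Real.sin_pi_div_three]

theorem exp_pi_third : Complex.exp (Real.pi / 3 * Complex.I) = ⟨1 / 2, Real.sqrt 3 / 2⟩ := by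
  have : ((Real.pi : ℂ) / 3 * Complex.I) = (((Real.pi / 3) : ℝ) : ℂ) * Complex.I := by
    push_cast; ring
  rw [this]
  apply Complex.ext
  · rw [Complex.exp_ofReal_mul_I_re, Real.cos_pi_div_three]
  · rw [Complex.exp_ofReal_mul_I_im, Real.sin_pi_div_three]

theorem mem_Gamma1 {s : ℝ} {z : ℂ} : z ∈ Gamma1 s ↔ z.im = 0 ∧ 0 < z.re + s ∧ z.re < 0 := by
  constructor
  · rintro ⟨x, h1, h2, rfl⟩; simp; constructor <;> linarith
  · rintro ⟨h1, h2, h3⟩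
    exact ⟨z.re, by linarith, h3, Complex.ext (by simp) (by simp [h1])⟩

theorem mem_Gamma3 {s : ℝ} {z : ℂ} : z ∈ Gamma3 s ↔ z.im = 0 ∧ z.re + s < 0 := by
  constructor
  · rintro ⟨x, h1, rfl⟩; simp; linarith
  · rintro ⟨h1, h2⟩
    exact ⟨z.re, by linarith, Complex.ext (by simp) (by simp [h1])⟩

theorem mem_Gamma2 {s : ℝ} {z : ℂ} :
    z ∈ Gamma2 s ↔ 0 < z.im ∧ Real.sqrt 3 * (z.re + s) + z.im = 0 := by
  have h3 := sqrt3_pos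
  have h33 : Real.sqrt 3 * Real.sqrt 3 = 3 := Real.mul_self_sqrt (by norm_num)
  rw [Gamma2, Set.mem_ofPred_eq, exp_neg_pi_third]
  constructor
  · rintro ⟨x, h1, rfl⟩; simp; constructor
    · nlinarith
    · ring
  · rintro ⟨h1, h2⟩
    refine ⟨2 * (z.re + s), ?_, Complex.ext (by simp) ?_⟩
    · nlinarith
    · simp; linarith

theorem mem_Gamma4 {s : ℝ} {z : ℂ} :
    z ∈ Gamma4 s ↔ z.im < 0 ∧ Real.sqrt 3 * (z.re + s) - z.im = 0 := by
  have h3 := sqrt3_pos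
  have h33 : Real.sqrt 3 * Real.sqrt 3 = 3 := Real.mul_self_sqrt (by norm_num)
  rw [Gamma4, Set.mem_ofPred_eq, exp_pi_third]
  constructor
  · rintro ⟨x, h1, rfl⟩; simp; constructor
    · nlinarith
    · ring
  · rintro ⟨h1, h2⟩
    refine ⟨2 * (z.re + s), ?_, Complex.ext (by simp) ?_⟩
    · nlinarith
    · simp; linarith

theorem arg_lt_two_pi_div_three_iff {w : ℂ} (hw : 0 < w.im) :
    w.arg < 2 * Real.pi / 3 ↔ 0 < Real.sqrt 3 * w.re + w.im := by
  have hn : 0 < ‖w‖ := norm_pos_iff.2 (by rintro rfl; simp at hw)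
  have h0 : 0 ≤ w.arg := Complex.arg_nonneg_iff.2 hw.le
  have hpi := Real.pi_pos
  have hle := Complex.arg_le_pi w
  have key : Real.sqrt 3 * w.re + w.im = 2 * ‖w‖ * Real.sin (2 * Real.pi / 3 - w.arg) := by
    rw [Real.sin_sub, show 2 * Real.pi / 3 = Real.pi - Real.pi / 3 by ring, Real.sin_pi_sub,
      Real.cos_pi_sub, Real.sin_pi_div_three, Real.cos_pi_div_three]
    have h1 := Complex.norm_mul_cos_arg w
    have h2 := Complex.norm_mul_sin_arg w
    linear_combination (-Real.sqrt 3) * h1 - h2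
  rw [key]
  constructor
  · intro h
    have := Real.sin_pos_of_pos_of_lt_pi (x := 2 * Real.pi / 3 - w.arg) (by linarith) (by linarith)
    positivity
  · intro h
    by_contra hc
    push Not at hc
    have : Real.sin (2 * Real.pi / 3 - w.arg) ≤ 0 :=
      Real.sin_nonpos_of_nonpos_of_neg_pi_le (by linarith) (by linarith)
    nlinarith

theorem two_pi_div_three_lt_arg_iff {w : ℂ} (hw : 0 < w.im) :
    2 * Real.pi / 3 < w.arg ↔ Real.sqrt 3 * w.re + w.im < 0 := by
  have hn : 0 < ‖w‖ := norm_pos_iff.2 (by rintro rfl; simp at hw)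
  have h0 : 0 ≤ w.arg := Complex.arg_nonneg_iff.2 hw.le
  have hpi := Real.pi_pos
  have hle := Complex.arg_le_pi w
  have key : Real.sqrt 3 * w.re + w.im = 2 * ‖w‖ * Real.sin (2 * Real.pi / 3 - w.arg) := by
    rw [Real.sin_sub, show 2 * Real.pi / 3 = Real.pi - Real.pi / 3 by ring, Real.sin_pi_sub,
      Real.cos_pi_sub, Real.sin_pi_div_three, Real.cos_pi_div_three]
    have h1 := Complex.norm_mul_cos_arg w
    have h2 := Complex.norm_mul_sin_arg w
    linear_combination (-Real.sqrt 3) * h1 - h2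
  rw [key]
  constructor
  · intro h
    have := Real.sin_neg_of_neg_of_neg_pi_lt (x := 2 * Real.pi / 3 - w.arg) (by linarith) (by linarith)
    nlinarith
  · intro h
    by_contra hc
    push Not at hc
    have : 0 ≤ Real.sin (2 * Real.pi / 3 - w.arg) :=
      Real.sin_nonneg_of_nonneg_of_le_pi (by linarith) (by linarith)
    nlinarith

theorem arg_neg_of_im_neg {w : ℂ} (hw : w.im < 0) : w.arg = -((starRingEnd ℂ) w).arg := by
  rw [Complex.arg_conj, if_neg]
  · ring
  · intro h
    have := Complex.arg_neg_iff.2 hw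
    linarith [Real.pi_pos]

theorem im_pos_of_arg {w : ℂ} (h1 : 0 < w.arg) (h2 : w.arg < Real.pi) : 0 < w.im := by
  have hn : 0 < ‖w‖ := norm_pos_iff.2 (by rintro rfl; simp at h1)
  rw [← Complex.norm_mul_sin_arg w]
  exact mul_pos hn (Real.sin_pos_of_pos_of_lt_pi h1 h2)

theorem im_neg_of_arg {w : ℂ} (h1 : w.arg < 0) : w.im < 0 := Complex.arg_neg_iff.1 h1

theorem arg_pos_of_im_pos {w : ℂ} (h : 0 < w.im) : 0 < w.arg := by
  refine lt_of_le_of_ne (Complex.arg_nonneg_iff.2 h.le) (fun h0 => ?_)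
  rw [← Complex.norm_mul_sin_arg w, ← h0] at h
  simp at h

theorem arg_lt_pi_of_im_pos {w : ℂ} (h : 0 < w.im) : w.arg < Real.pi := by
  refine lt_of_le_of_ne (Complex.arg_le_pi w) (fun h0 => ?_)
  rw [← Complex.norm_mul_sin_arg w, h0] at h
  simp at h

theorem mem_sectorII {s : ℝ} {z : ℂ} :
    z ∈ sectorII s ↔ 0 < z.im ∧ 0 < Real.sqrt 3 * (z.re + s) + z.im := by
  have hpi := Real.pi_pos
  have him : (z + s).im = z.im := by simp
  have hre : (z + s).re = z.re + s := by simp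
  rw [sectorII, Set.mem_ofPred_eq]
  constructor
  · rintro ⟨h1, h2⟩
    have h3 := im_pos_of_arg h1 (by linarith)
    have := (arg_lt_two_pi_div_three_iff h3).1 h2
    rw [him] at h3 this; rw [hre] at this
    exact ⟨h3, this⟩
  · rintro ⟨h1, h2⟩
    rw [← him] at h1
    refine ⟨arg_pos_of_im_pos h1, (arg_lt_two_pi_div_three_iff h1).2 ?_⟩
    rwa [him, hre]

theorem mem_sectorIII {s : ℝ} {z : ℂ} :
    z ∈ sectorIII s ↔ 0 < z.im ∧ Real.sqrt 3 * (z.re + s) + z.im < 0 := by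
  have hpi := Real.pi_pos
  have him : (z + s).im = z.im := by simp
  have hre : (z + s).re = z.re + s := by simp
  rw [sectorIII, Set.mem_ofPred_eq]
  constructor
  · rintro ⟨h1, h2⟩
    have h3 := im_pos_of_arg (by linarith) h2
    have := (two_pi_div_three_lt_arg_iff h3).1 h1
    rw [him] at h3 this; rw [hre] at this
    exact ⟨h3, this⟩
  · rintro ⟨h1, h2⟩
    rw [← him] at h1
    refine ⟨(two_pi_div_three_lt_arg_iff h1).2 ?_, arg_lt_pi_of_im_pos h1⟩
    rwa [him, hre]

theorem mem_sectorIV_iff_conj {s : ℝ} {z : ℂ} :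
    z ∈ sectorIV s ↔ (starRingEnd ℂ) z ∈ sectorIII s := by
  have hpi := Real.pi_pos
  have hc : (starRingEnd ℂ) z + s = (starRingEnd ℂ) (z + s) := by simp
  rw [sectorIV, Set.mem_ofPred_eq, sectorIII, Set.mem_ofPred_eq, hc]
  constructor
  · rintro ⟨h1, h2⟩
    have h3 := arg_neg_of_im_neg (im_neg_of_arg (by linarith : (z + s).arg < 0))
    constructor <;> linarith
  · rintro ⟨h1, h2⟩
    have h4 : (z + s).im < 0 := by
      have := im_pos_of_arg (by linarith) h2
      simpa using this
    have h3 := arg_neg_of_im_neg h4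
    constructor <;> linarith

theorem mem_sectorV_iff_conj {s : ℝ} {z : ℂ} :
    z ∈ sectorV s ↔ (starRingEnd ℂ) z ∈ sectorII s := by
  have hpi := Real.pi_pos
  have hc : (starRingEnd ℂ) z + s = (starRingEnd ℂ) (z + s) := by simp
  rw [sectorV, Set.mem_ofPred_eq, sectorII, Set.mem_ofPred_eq, hc]
  constructor
  · rintro ⟨h1, h2⟩
    have h3 := arg_neg_of_im_neg (im_neg_of_arg h2)
    constructor <;> linarith
  · rintro ⟨h1, h2⟩
    have h4 : (z + s).im < 0 := by
      have := im_pos_of_arg h1 (by linarith)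
      simpa using this
    have h3 := arg_neg_of_im_neg h4
    constructor <;> linarith

theorem mem_sectorIV {s : ℝ} {z : ℂ} :
    z ∈ sectorIV s ↔ z.im < 0 ∧ Real.sqrt 3 * (z.re + s) - z.im < 0 := by
  rw [mem_sectorIV_iff_conj, mem_sectorIII]; simp [sub_eq_add_neg]

theorem mem_sectorV {s : ℝ} {z : ℂ} :
    z ∈ sectorV s ↔ z.im < 0 ∧ 0 < Real.sqrt 3 * (z.re + s) - z.im := by
  rw [mem_sectorV_iff_conj, mem_sectorII]; simp [sub_eq_add_neg]

theorem mem_Omega {s : ℝ} (hs : 0 < s) {z : ℂ} :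
    z ∈ Omega s ↔ ¬(z.im = 0 ∧ z.re ≤ 0) ∧ ¬(0 < z.im ∧ Real.sqrt 3 * (z.re + s) + z.im = 0) ∧
      ¬(z.im < 0 ∧ Real.sqrt 3 * (z.re + s) - z.im = 0) := by
  have e1 : z = -(s : ℂ) ↔ z.im = 0 ∧ z.re + s = 0 := by
    rw [Complex.ext_iff]; simp; constructor <;> (rintro ⟨h1, h2⟩; constructor <;> linarith)
  have e2 : z = 0 ↔ z.im = 0 ∧ z.re = 0 := by
    rw [Complex.ext_iff]; simp; tauto
  simp only [Omega, Set.mem_compl_iff, Set.mem_union, mem_Gamma1, mem_Gamma2, mem_Gamma3,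
    mem_Gamma4, Set.mem_insert_iff, Set.mem_singleton_iff, e1, e2]
  grind

theorem isOpen_Omega {s : ℝ} (hs : 0 < s) : IsOpen (Omega s) := by
  have : Omega s = ({z : ℂ | z.im = 0 ∧ z.re ≤ 0} ∪
      {z : ℂ | 0 ≤ z.im ∧ Real.sqrt 3 * (z.re + s) + z.im = 0} ∪
      {z : ℂ | z.im ≤ 0 ∧ Real.sqrt 3 * (z.re + s) - z.im = 0})ᶜ := by
    have h3 := sqrt3_pos
    have h0 : ∀ x : ℝ, Real.sqrt 3 * (x + s) = 0 → x ≤ 0 := by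
      intro x hx
      rcases mul_eq_zero.1 hx with h | h <;> linarith
    ext z
    rw [mem_Omega hs]
    simp only [Set.mem_compl_iff, Set.mem_union, Set.mem_ofPred_eq]
    have := h0 z.re
    grind
  rw [this, isOpen_compl_iff]
  refine IsClosed.union (IsClosed.union ?_ ?_) ?_
  · exact (isClosed_eq Complex.continuous_im continuous_const).inter
      (isClosed_le Complex.continuous_re continuous_const)
  · exact (isClosed_le continuous_const Complex.continuous_im).inter
      (isClosed_eq (by fun_prop) continuous_const)
  · exact (isClosed_le Complex.continuous_im continuous_const).inter
      (isClosed_eq (by fun_prop) continuous_const)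

theorem dense_Omega {s : ℝ} (hs : 0 < s) : Dense (Omega s) := by
  have h3 := sqrt3_pos
  intro z
  by_cases him : z.im = 0
  · refine mem_closure_of_tendsto (f := fun x : ℝ => z + x * Complex.I) (b := 𝓝[>] (0 : ℝ)) ?_ ?_
    · have : Tendsto (fun x : ℝ => z + x * Complex.I) (𝓝 0) (𝓝 (z + (0 : ℝ) * Complex.I)) :=
        Continuous.tendsto (by fun_prop) _
      simpa using this.mono_left nhdsWithin_le_nhds
    · have hev : ∀ᶠ x : ℝ in 𝓝[>] 0, Real.sqrt 3 * (z.re + s) + x ≠ 0 := by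
        by_cases hx : Real.sqrt 3 * (z.re + s) = 0
        · filter_upwards [self_mem_nhdsWithin] with x hx0
          rw [hx, zero_add]; exact ne_of_gt hx0
        · have hc : ContinuousAt (fun x : ℝ => Real.sqrt 3 * (z.re + s) + x) 0 := by fun_prop
          exact nhdsWithin_le_nhds (hc.eventually_ne (by simpa using hx))
      filter_upwards [self_mem_nhdsWithin, hev] with x hx0 hx
      have hx0' : 0 < x := hx0
      rw [mem_Omega hs]
      simp [him]
      grind
  · refine mem_closure_of_tendsto (f := fun x : ℝ => z + x) (b := 𝓝[>] (0 : ℝ)) ?_ ?_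
    · have : Tendsto (fun x : ℝ => z + x) (𝓝 0) (𝓝 (z + (0 : ℝ))) :=
        Continuous.tendsto (by fun_prop) _
      simpa using this.mono_left nhdsWithin_le_nhds
    · have hev : ∀ c : ℝ, ∀ᶠ x : ℝ in 𝓝[>] 0, Real.sqrt 3 * (z.re + x + s) + c ≠ 0 := by
        intro c
        by_cases hx : Real.sqrt 3 * (z.re + s) + c = 0
        · filter_upwards [self_mem_nhdsWithin] with x hx0
          have : Real.sqrt 3 * (z.re + x + s) + c = Real.sqrt 3 * x := by linear_combination hx
          rw [this]; exact ne_of_gt (mul_pos h3 hx0)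
        · have hc : ContinuousAt (fun x : ℝ => Real.sqrt 3 * (z.re + x + s) + c) 0 := by fun_prop
          exact nhdsWithin_le_nhds (hc.eventually_ne (by simpa using hx))
      filter_upwards [self_mem_nhdsWithin, hev z.im, hev (-z.im)] with x hx0 hx1 hx2
      rw [mem_Omega hs]
      simp [him]
      grind

end Contour

/-! ### Local structure of a solution on the contour -/

section LocalStructure

theorem sectorII_subset {s : ℝ} (hs : 0 < s) : sectorII s ⊆ Omega s := by
  intro z hz; rw [mem_sectorII] at hz; rw [mem_Omega hs]; grind

theorem sectorIII_subset {s : ℝ} (hs : 0 < s) : sectorIII s ⊆ Omega s := by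
  intro z hz; rw [mem_sectorIII] at hz; rw [mem_Omega hs]; grind

theorem sectorIV_subset {s : ℝ} (hs : 0 < s) : sectorIV s ⊆ Omega s := by
  intro z hz; rw [mem_sectorIV] at hz; rw [mem_Omega hs]; grind

theorem sectorV_subset {s : ℝ} (hs : 0 < s) : sectorV s ⊆ Omega s := by
  intro z hz; rw [mem_sectorV] at hz; rw [mem_Omega hs]; grind

/-- The value `e^{α π i / 2}` that occurs in `piecewiseE`. -/
noncomputable def unitE (α : ℝ) : ℂ := Complex.exp (α * Real.pi * Complex.I / 2)

theorem unitE_ne_zero (α : ℝ) : unitE α ≠ 0 := Complex.exp_ne_zero _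

theorem exp_alpha (α : ℝ) : Complex.exp (α * Real.pi * Complex.I) = unitE α ^ 2 := by
  rw [unitE, ← Complex.exp_nat_mul]; congr 1; push_cast; ring

theorem exp_neg_alpha (α : ℝ) : Complex.exp (-(α * Real.pi * Complex.I)) = (unitE α)⁻¹ ^ 2 := by
  rw [Complex.exp_neg, exp_alpha, inv_pow]

theorem piecewiseE_II {α s : ℝ} {z : ℂ} (hz : z ∈ sectorII s) :
    piecewiseE α s z = !![unitE α, 0; 0, (unitE α)⁻¹] := by
  simp only [piecewiseE, if_pos hz]; rfl

theorem piecewiseE_III {α s : ℝ} {z : ℂ} (hz : z ∈ sectorIII s) :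
    piecewiseE α s z = !![unitE α, 0; -unitE α, (unitE α)⁻¹] := by
  have h2 : z ∉ sectorII s := by rw [mem_sectorII]; rw [mem_sectorIII] at hz; grind
  simp only [piecewiseE, if_neg h2, if_pos hz]; rfl

theorem piecewiseE_IV {α s : ℝ} {z : ℂ} (hz : z ∈ sectorIV s) :
    piecewiseE α s z = !![(unitE α)⁻¹, 0; (unitE α)⁻¹, unitE α] := by
  have h2 : z ∉ sectorII s := by rw [mem_sectorII]; rw [mem_sectorIV] at hz; grind
  have h3 : z ∉ sectorIII s := by rw [mem_sectorIII]; rw [mem_sectorIV] at hz; grind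
  simp only [piecewiseE, if_neg h2, if_neg h3, if_pos hz]; rfl

theorem piecewiseE_V {α s : ℝ} {z : ℂ} (hz : z ∈ sectorV s) :
    piecewiseE α s z = !![(unitE α)⁻¹, 0; 0, unitE α] := by
  have h2 : z ∉ sectorII s := by rw [mem_sectorII]; rw [mem_sectorV] at hz; grind
  have h3 : z ∉ sectorIII s := by rw [mem_sectorIII]; rw [mem_sectorV] at hz; grind
  have h4 : z ∉ sectorIV s := by rw [mem_sectorIV]; rw [mem_sectorV] at hz; grind
  simp only [piecewiseE, if_neg h2, if_neg h3, if_neg h4, if_pos hz]; rfl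

theorem det_piecewiseE (α s : ℝ) (z : ℂ) : (piecewiseE α s z).det = 1 := by
  have h := unitE_ne_zero α
  have h' : Complex.exp (α * Real.pi * Complex.I / 2) ≠ 0 := h
  simp only [piecewiseE]
  split_ifs <;> simp [Matrix.det_fin_two]

/-- The unipotent matrix `I + c σ₊`. -/
noncomputable def upper (c : ℂ) : Mat := 1 + c • sigmaPlus

theorem upper_eq (c : ℂ) : upper c = !![1, c; 0, 1] := by
  ext i j; fin_cases i <;> fin_cases j <;> simp [upper, sigmaPlus]

theorem upper_mul (c d : ℂ) : upper c * upper d = upper (c + d) := by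
  simp only [upper_eq]; ext i j; fin_cases i <;> fin_cases j <;> simp [add_comm]

theorem det_upper (c : ℂ) : (upper c).det = 1 := by simp [upper_eq, Matrix.det_fin_two]

theorem adjL_upper (c : ℂ) : adjL (upper c) = upper (-c) := by
  simp [adjL_apply, upper_eq]

theorem differentiable_upper : Differentiable ℂ upper := by
  unfold upper; fun_prop

/-- The factor `log (z + s) / (2 π i)`. -/
noncomputable def logFactor (s : ℝ) (z : ℂ) : ℂ := Complex.log (z + s) / (2 * Real.pi * Complex.I)

/-- The explicit right factor that carries the jumps of a solution on all arcs, and its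
logarithmic singularity at `-s`. -/
noncomputable def jumpFactor (α s : ℝ) (z : ℂ) : Mat := upper (logFactor s z) * piecewiseE α s z

theorem det_jumpFactor (α s : ℝ) (z : ℂ) : (jumpFactor α s z).det = 1 := by
  rw [jumpFactor, Matrix.det_mul, det_upper, det_piecewiseE, one_mul]

theorem differentiableAt_logFactor {s : ℝ} {z : ℂ} (hz : z + s ∈ Complex.slitPlane) :
    DifferentiableAt ℂ (logFactor s) z := by
  unfold logFactor
  refine DifferentiableAt.div_const ?_ _
  exact DifferentiableAt.clog (by fun_prop) hz

theorem isOpen_sectorII (s : ℝ) : IsOpen (sectorII s) := by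
  have : sectorII s = {z : ℂ | 0 < z.im} ∩ {z : ℂ | 0 < Real.sqrt 3 * (z.re + s) + z.im} := by
    ext z; exact mem_sectorII
  rw [this]
  exact (isOpen_lt continuous_const (by fun_prop)).inter (isOpen_lt continuous_const (by fun_prop))

theorem isOpen_sectorIII (s : ℝ) : IsOpen (sectorIII s) := by
  have : sectorIII s = {z : ℂ | 0 < z.im} ∩ {z : ℂ | Real.sqrt 3 * (z.re + s) + z.im < 0} := by
    ext z; exact mem_sectorIII
  rw [this]
  exact (isOpen_lt continuous_const (by fun_prop)).inter (isOpen_lt (by fun_prop) continuous_const)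

theorem isOpen_sectorIV (s : ℝ) : IsOpen (sectorIV s) := by
  have : sectorIV s = {z : ℂ | z.im < 0} ∩ {z : ℂ | Real.sqrt 3 * (z.re + s) - z.im < 0} := by
    ext z; exact mem_sectorIV
  rw [this]
  exact (isOpen_lt (by fun_prop) continuous_const).inter (isOpen_lt (by fun_prop) continuous_const)

theorem isOpen_sectorV (s : ℝ) : IsOpen (sectorV s) := by
  have : sectorV s = {z : ℂ | z.im < 0} ∩ {z : ℂ | 0 < Real.sqrt 3 * (z.re + s) - z.im} := by
    ext z; exact mem_sectorV
  rw [this]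
  exact (isOpen_lt (by fun_prop) continuous_const).inter (isOpen_lt continuous_const (by fun_prop))

/-- On an open set where `piecewiseE` is constant and off the cut of the logarithm, the factor
`jumpFactor` is holomorphic. -/
theorem differentiableAt_jumpFactor {α s : ℝ} {z : ℂ} {S : Set ℂ} {A : Mat} (hS : IsOpen S)
    (hE : ∀ z ∈ S, piecewiseE α s z = A) (hz : z ∈ S) (hzs : z + s ∈ Complex.slitPlane) :
    DifferentiableAt ℂ (jumpFactor α s) z := by
  have h1 : DifferentiableAt ℂ (fun w => upper (logFactor s w) * A) z := by
    have : DifferentiableAt ℂ (fun w => upper (logFactor s w)) z :=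
      (differentiable_upper _).comp z (differentiableAt_logFactor hzs)
    exact this.mul_const A
  refine h1.congr_of_eventuallyEq ?_
  filter_upwards [hS.mem_nhds hz] with w hw
  rw [jumpFactor, hE w hw]

theorem tendsto_jumpFactor {α s : ℝ} {z : ℂ} {S : Set ℂ} {A : Mat} {c : ℂ}
    (hE : ∀ z ∈ S, piecewiseE α s z = A)
    (hl : Tendsto (logFactor s) (𝓝[S] z) (𝓝 c)) :
    Tendsto (jumpFactor α s) (𝓝[S] z) (𝓝 (upper c * A)) := by
  have h1 : Tendsto (fun w => upper (logFactor s w) * A) (𝓝[S] z) (𝓝 (upper c * A)) :=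
    ((differentiable_upper.continuous.tendsto c).comp hl).mul_const A
  refine h1.congr' ?_
  filter_upwards [self_mem_nhdsWithin] with w hw
  rw [jumpFactor, hE w hw]

theorem tendsto_logFactor {s : ℝ} {z : ℂ} {S : Set ℂ} (hz : z + s ∈ Complex.slitPlane) :
    Tendsto (logFactor s) (𝓝[S] z) (𝓝 (logFactor s z)) :=
  (differentiableAt_logFactor hz).continuousAt.tendsto.mono_left nhdsWithin_le_nhds

/-- Near each of its points, the arc `Γ` is a line in the direction `u`, with the set `P` on its
left and `N` on its right. -/
def IsLocalLine (Γ P N : Set ℂ) : Prop :=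
  ∀ z₀ ∈ Γ, ∃ u : ℂ, u ≠ 0 ∧ ∀ᶠ z in 𝓝 z₀, (0 < ((z - z₀) / u).im → z ∈ P) ∧
    (((z - z₀) / u).im < 0 → z ∈ N) ∧ (((z - z₀) / u).im = 0 → z ∈ Γ)

theorem isLocalLine_Gamma1 (s : ℝ) : IsLocalLine (Gamma1 s) (sectorII s) (sectorV s) := by
  intro z₀ hz
  rw [mem_Gamma1] at hz
  have h3 := sqrt3_pos
  have hx : 0 < Real.sqrt 3 * (z₀.re + s) := mul_pos h3 hz.2.1
  refine ⟨1, one_ne_zero, ?_⟩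
  have e1 : ∀ᶠ z : ℂ in 𝓝 z₀, 0 < Real.sqrt 3 * (z.re + s) + z.im :=
    ContinuousAt.eventually_lt (f := fun _ => (0 : ℝ)) (by fun_prop) (by fun_prop) (by simp [hz.1, hx])
  have e2 : ∀ᶠ z : ℂ in 𝓝 z₀, 0 < Real.sqrt 3 * (z.re + s) - z.im :=
    ContinuousAt.eventually_lt (f := fun _ => (0 : ℝ)) (by fun_prop) (by fun_prop) (by simp [hz.1, hx])
  have e3 : ∀ᶠ z : ℂ in 𝓝 z₀, 0 < z.re + s :=
    ContinuousAt.eventually_lt (f := fun _ => (0 : ℝ)) (by fun_prop) (by fun_prop) hz.2.1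
  have e4 : ∀ᶠ z : ℂ in 𝓝 z₀, z.re < 0 :=
    ContinuousAt.eventually_lt (g := fun _ => (0 : ℝ)) (by fun_prop) (by fun_prop) hz.2.2
  filter_upwards [e1, e2, e3, e4] with z h1 h2 h3 h4
  simp only [div_one, Complex.sub_im, hz.1, sub_zero, mem_sectorII, mem_sectorV, mem_Gamma1]
  grind

theorem isLocalLine_Gamma3 (s : ℝ) : IsLocalLine (Gamma3 s) (sectorIII s) (sectorIV s) := by
  intro z₀ hz
  rw [mem_Gamma3] at hz
  have h3 := sqrt3_pos
  have hx : Real.sqrt 3 * (z₀.re + s) < 0 := by nlinarith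
  refine ⟨1, one_ne_zero, ?_⟩
  have e1 : ∀ᶠ z : ℂ in 𝓝 z₀, Real.sqrt 3 * (z.re + s) + z.im < 0 :=
    ContinuousAt.eventually_lt (g := fun _ => (0 : ℝ)) (by fun_prop) (by fun_prop) (by simp [hz.1, hx])
  have e2 : ∀ᶠ z : ℂ in 𝓝 z₀, Real.sqrt 3 * (z.re + s) - z.im < 0 :=
    ContinuousAt.eventually_lt (g := fun _ => (0 : ℝ)) (by fun_prop) (by fun_prop) (by simp [hz.1, hx])
  have e3 : ∀ᶠ z : ℂ in 𝓝 z₀, z.re + s < 0 :=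
    ContinuousAt.eventually_lt (g := fun _ => (0 : ℝ)) (by fun_prop) (by fun_prop) hz.2
  filter_upwards [e1, e2, e3] with z h1 h2 h3
  simp only [div_one, Complex.sub_im, hz.1, sub_zero, mem_sectorIII, mem_sectorIV, mem_Gamma3]
  grind

theorem im_div_unit (w : ℂ) (b : ℝ) (hb : b ^ 2 = 3) :
    (w / ⟨1 / 2, b / 2⟩).im = (w.im - b * w.re) / 2 := by
  rw [Complex.div_im, Complex.normSq_mk]
  have : (1 / 2 : ℝ) * (1 / 2) + b / 2 * (b / 2) = 1 := by linear_combination hb / 4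
  rw [this]; ring

theorem isLocalLine_Gamma2 (s : ℝ) : IsLocalLine (Gamma2 s) (sectorII s) (sectorIII s) := by
  intro z₀ hz
  rw [mem_Gamma2] at hz
  have h3 := sqrt3_pos
  have h33 : (-Real.sqrt 3) ^ 2 = 3 := by simp
  refine ⟨⟨1 / 2, -Real.sqrt 3 / 2⟩, fun h => by simpa using congrArg Complex.re h, ?_⟩
  have e1 : ∀ᶠ z : ℂ in 𝓝 z₀, 0 < z.im :=
    ContinuousAt.eventually_lt (f := fun _ => (0 : ℝ)) (by fun_prop) (by fun_prop) hz.1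
  filter_upwards [e1] with z h1
  simp only [im_div_unit _ _ h33, Complex.sub_im, Complex.sub_re, mem_sectorII, mem_sectorIII,
    mem_Gamma2]
  grind

theorem isLocalLine_Gamma4 (s : ℝ) : IsLocalLine (Gamma4 s) (sectorIV s) (sectorV s) := by
  intro z₀ hz
  rw [mem_Gamma4] at hz
  have h3 := sqrt3_pos
  have h33 : (Real.sqrt 3) ^ 2 = 3 := by simp
  refine ⟨⟨1 / 2, Real.sqrt 3 / 2⟩, fun h => by simpa using congrArg Complex.re h, ?_⟩
  have e1 : ∀ᶠ z : ℂ in 𝓝 z₀, z.im < 0 :=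
    ContinuousAt.eventually_lt (g := fun _ => (0 : ℝ)) (by fun_prop) (by fun_prop) hz.1
  filter_upwards [e1] with z h1
  simp only [im_div_unit _ _ h33, Complex.sub_im, Complex.sub_re, mem_sectorIV, mem_sectorV,
    mem_Gamma4]
  grind

/-- If `N` has the same jump as `M` on an arc, then `M N⁻¹` is holomorphic across the arc. -/
theorem exists_factor_of_hasJump {M Nf : ℂ → Mat} {W Γ P N : Set ℂ} {J : Mat} (hJ : J.det = 1)
    (hP : IsOpen P) (hN : IsOpen N)
    (hM : DifferentiableOn ℂ M W) (hjump : HasJump M Γ P N J) (hline : IsLocalLine Γ P N)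
    (hPW : P ⊆ W) (hNW : N ⊆ W) (hΓW : Disjoint Γ W) (hNfP : DifferentiableOn ℂ Nf P)
    (hNfN : DifferentiableOn ℂ Nf N) (hdet : ∀ z, (Nf z).det = 1) (hNf : HasJump Nf Γ P N J)
    {z₀ : ℂ} (hz₀ : z₀ ∈ Γ) :
    ∃ F : ℂ → Mat, AnalyticAt ℂ F z₀ ∧ ∀ᶠ z in 𝓝[W] z₀, M z = F z * Nf z := by
  obtain ⟨u, hu, hev⟩ := hline z₀ hz₀
  obtain ⟨r, hr, hball⟩ := Metric.eventually_nhds_iff_ball.1 hev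
  have hdiff : ∀ S : Set ℂ, IsOpen S → S ⊆ W → DifferentiableOn ℂ Nf S →
      ∀ z ∈ S, DifferentiableAt ℂ (fun z => M z * adjL (Nf z)) z := by
    intro S hS hSW hNfS z hz
    have h1 : DifferentiableAt ℂ M z := (hM.mono hSW).differentiableAt (hS.mem_nhds hz)
    have h2 : DifferentiableAt ℂ (fun z => adjL (Nf z)) z :=
      adjL.differentiableAt.comp z (hNfS.differentiableAt (hS.mem_nhds hz))
    exact h1.mul h2
  have hext : ∃ F, DifferentiableOn ℂ F (Metric.ball z₀ r) ∧ ∀ z ∈ Metric.ball z₀ r,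
      ((z - z₀) / u).im ≠ 0 → F z = M z * adjL (Nf z) := by
    refine exists_extension_across_line Metric.isOpen_ball z₀ hu ?_ ?_
    · rintro z ⟨hzb, hz⟩
      apply DifferentiableAt.differentiableWithinAt
      rcases lt_or_gt_of_ne hz with h | h
      · exact hdiff N hN hNW hNfN z ((hball z hzb).2.1 h)
      · exact hdiff P hP hPW hNfP z ((hball z hzb).1 h)
    · intro z hzb hz
      have hzΓ := (hball z hzb).2.2 hz
      obtain ⟨Mp, Mm, hMp, hMm, hMJ⟩ := hjump z hzΓ
      obtain ⟨Np, Nm, hNp, hNm, hNJ⟩ := hNf z hzΓ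
      refine ⟨Mp * adjL Np, ?_, ?_⟩
      · have : Tendsto (fun z => M z * adjL (Nf z)) (𝓝[P] z) (𝓝 (Mp * adjL Np)) :=
          hMp.mul ((adjL.continuous.tendsto _).comp hNp)
        refine this.mono_left (nhdsWithin_le_of_mem ?_)
        filter_upwards [self_mem_nhdsWithin,
          nhdsWithin_le_nhds (Metric.isOpen_ball.mem_nhds hzb)] with w hw hwb
        exact (hball w hwb).1 hw
      · have : Tendsto (fun z => M z * adjL (Nf z)) (𝓝[N] z) (𝓝 (Mm * adjL Nm)) :=
          hMm.mul ((adjL.continuous.tendsto _).comp hNm)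
        have hval : Mp * adjL Np = Mm * adjL Nm := by
          rw [hMJ, hNJ, adjL_mul, mul_assoc, ← mul_assoc J, mul_adjL hJ, one_mul]
        rw [hval]
        refine this.mono_left (nhdsWithin_le_of_mem ?_)
        filter_upwards [self_mem_nhdsWithin,
          nhdsWithin_le_nhds (Metric.isOpen_ball.mem_nhds hzb)] with w hw hwb
        exact (hball w hwb).2.1 hw
  obtain ⟨F, hF, hFeq⟩ := hext
  refine ⟨F, hF.analyticAt (Metric.ball_mem_nhds z₀ hr), ?_⟩
  filter_upwards [self_mem_nhdsWithin, nhdsWithin_le_nhds (Metric.ball_mem_nhds z₀ hr)]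
    with z hzW hzb
  have hne : ((z - z₀) / u).im ≠ 0 := fun h =>
    Set.disjoint_left.1 hΓW ((hball z hzb).2.2 h) hzW
  rw [hFeq z hzb hne, mul_assoc, adjL_mul_self (hdet z), mul_one]

theorem slitPlane_of_im_ne {s : ℝ} {z : ℂ} (h : z.im ≠ 0) : z + s ∈ Complex.slitPlane :=
  Complex.mem_slitPlane_iff.2 (Or.inr (by simpa using h))

theorem jumpFactor_jump1 (α s : ℝ) : HasJump (jumpFactor α s) (Gamma1 s) (sectorII s) (sectorV s)
    !![Complex.exp (α * Real.pi * Complex.I), 0; 0, Complex.exp (-(α * Real.pi * Complex.I))] := by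
  intro z hz
  have hz' := mem_Gamma1.1 hz
  have hsl : z + s ∈ Complex.slitPlane := Complex.mem_slitPlane_iff.2 (Or.inl (by simpa using hz'.2.1))
  have h0 := unitE_ne_zero α
  refine ⟨_, _, tendsto_jumpFactor (fun z hz => piecewiseE_II hz) (tendsto_logFactor hsl),
    tendsto_jumpFactor (fun z hz => piecewiseE_V hz) (tendsto_logFactor hsl), ?_⟩
  rw [mul_assoc, exp_alpha, exp_neg_alpha]
  congr 1
  ext i j; fin_cases i <;> fin_cases j <;> simp <;> field_simp

theorem jumpFactor_jump2 (α s : ℝ) : HasJump (jumpFactor α s) (Gamma2 s) (sectorII s) (sectorIII s)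
    !![1, 0; Complex.exp (α * Real.pi * Complex.I), 1] := by
  intro z hz
  have hz' := mem_Gamma2.1 hz
  have hsl : z + s ∈ Complex.slitPlane := slitPlane_of_im_ne hz'.1.ne'
  have h0 := unitE_ne_zero α
  refine ⟨_, _, tendsto_jumpFactor (fun z hz => piecewiseE_II hz) (tendsto_logFactor hsl),
    tendsto_jumpFactor (fun z hz => piecewiseE_III hz) (tendsto_logFactor hsl), ?_⟩
  rw [mul_assoc, exp_alpha]
  congr 1
  ext i j; fin_cases i <;> fin_cases j <;> simp; field_simp; ring

theorem jumpFactor_jump4 (α s : ℝ) : HasJump (jumpFactor α s) (Gamma4 s) (sectorIV s) (sectorV s)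
    !![1, 0; Complex.exp (-(α * Real.pi * Complex.I)), 1] := by
  intro z hz
  have hz' := mem_Gamma4.1 hz
  have hsl : z + s ∈ Complex.slitPlane := slitPlane_of_im_ne hz'.1.ne
  have h0 := unitE_ne_zero α
  refine ⟨_, _, tendsto_jumpFactor (fun z hz => piecewiseE_IV hz) (tendsto_logFactor hsl),
    tendsto_jumpFactor (fun z hz => piecewiseE_V hz) (tendsto_logFactor hsl), ?_⟩
  rw [mul_assoc, exp_neg_alpha]
  congr 1
  ext i j; fin_cases i <;> fin_cases j <;> simp; field_simp

theorem jumpFactor_jump3 (α s : ℝ) : HasJump (jumpFactor α s) (Gamma3 s) (sectorIII s) (sectorIV s)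
    !![0, 1; -1, 0] := by
  intro z hz
  have hz' := mem_Gamma3.1 hz
  have h0 := unitE_ne_zero α
  have hpi : (2 * (Real.pi : ℂ) * Complex.I) ≠ 0 := Complex.two_pi_I_ne_zero
  have hre : (z + s).re < 0 := by simpa using hz'.2
  have him : (z + s).im = 0 := by simpa using hz'.1
  have hsh : ∀ S : Set ℂ, Tendsto (fun w : ℂ => w + s) (𝓝[S] z) (𝓝 (z + s)) := fun S =>
    (Continuous.tendsto (by fun_prop) z).mono_left nhdsWithin_le_nhds
  have t1 : Tendsto (logFactor s) (𝓝[sectorIII s] z)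
      (𝓝 ((Real.log ‖z + s‖ + Real.pi * Complex.I) / (2 * Real.pi * Complex.I))) := by
    refine Tendsto.div_const ?_ _
    refine (Complex.tendsto_log_nhdsWithin_im_nonneg_of_re_neg_of_im_zero hre him).comp
      (tendsto_nhdsWithin_iff.2 ⟨hsh _, ?_⟩)
    filter_upwards [self_mem_nhdsWithin] with w hw
    have := (mem_sectorIII.1 hw).1
    simpa using this.le
  have t2 : Tendsto (logFactor s) (𝓝[sectorIV s] z)
      (𝓝 ((Real.log ‖z + s‖ - Real.pi * Complex.I) / (2 * Real.pi * Complex.I))) := by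
    refine Tendsto.div_const ?_ _
    refine (Complex.tendsto_log_nhdsWithin_im_neg_of_re_neg_of_im_zero hre him).comp
      (tendsto_nhdsWithin_iff.2 ⟨hsh _, ?_⟩)
    filter_upwards [self_mem_nhdsWithin] with w hw
    have := (mem_sectorIV.1 hw).1
    simpa using this
  refine ⟨_, _, tendsto_jumpFactor (fun z hz => piecewiseE_III hz) t1,
    tendsto_jumpFactor (fun z hz => piecewiseE_IV hz) t2, ?_⟩
  have e1 : ((Real.log ‖z + s‖ : ℂ) + Real.pi * Complex.I) / (2 * Real.pi * Complex.I)
      = (Real.log ‖z + s‖ - Real.pi * Complex.I) / (2 * Real.pi * Complex.I) + 1 := by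
    field_simp; ring
  rw [e1, ← upper_mul]
  simp only [mul_assoc]
  congr 1
  rw [upper_eq]
  ext i j; fin_cases i <;> fin_cases j <;> simp

theorem differentiableOn_jumpFactor_sectors (α s : ℝ) :
    DifferentiableOn ℂ (jumpFactor α s) (sectorII s) ∧
    DifferentiableOn ℂ (jumpFactor α s) (sectorIII s) ∧
    DifferentiableOn ℂ (jumpFactor α s) (sectorIV s) ∧
    DifferentiableOn ℂ (jumpFactor α s) (sectorV s) := by
  refine ⟨fun z hz => ?_, fun z hz => ?_, fun z hz => ?_, fun z hz => ?_⟩ <;>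
    apply DifferentiableAt.differentiableWithinAt
  · exact differentiableAt_jumpFactor (isOpen_sectorII s) (fun z hz => piecewiseE_II hz) hz
      (slitPlane_of_im_ne (mem_sectorII.1 hz).1.ne')
  · exact differentiableAt_jumpFactor (isOpen_sectorIII s) (fun z hz => piecewiseE_III hz) hz
      (slitPlane_of_im_ne (mem_sectorIII.1 hz).1.ne')
  · exact differentiableAt_jumpFactor (isOpen_sectorIV s) (fun z hz => piecewiseE_IV hz) hz
      (slitPlane_of_im_ne (mem_sectorIV.1 hz).1.ne)
  · exact differentiableAt_jumpFactor (isOpen_sectorV s) (fun z hz => piecewiseE_V hz) hz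
      (slitPlane_of_im_ne (mem_sectorV.1 hz).1.ne)

variable {k : ℕ} {α l s : ℝ} {M : ℂ → Mat} {a : ℂ}

theorem IsRHSolution.diffOn (h : IsRHSolution k α l s M a) : DifferentiableOn ℂ M (Omega s) :=
  differentiableOn_mat h.analytic

/-- Near each point of the contour other than `0`, a solution is a holomorphic matrix times the
explicit factor `jumpFactor`. -/
theorem IsRHSolution.exists_factor (h : IsRHSolution k α l s M a) (hs : 0 < s) {z₀ : ℂ}
    (hz : z₀ ∉ Omega s) (hz0 : z₀ ≠ 0) :
    ∃ F : ℂ → Mat, AnalyticAt ℂ F z₀ ∧ ∀ᶠ z in 𝓝[Omega s] z₀, M z = F z * jumpFactor α s z := by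
  obtain ⟨d2, d3, d4, d5⟩ := differentiableOn_jumpFactor_sectors α s
  have hdisj : ∀ Γ, Γ ⊆ (Omega s)ᶜ → Disjoint Γ (Omega s) := fun Γ hΓ =>
    Set.disjoint_left.2 fun z hz => hΓ hz
  have hdet := det_jumpFactor α s
  simp only [Omega, Set.mem_compl_iff, not_not, Set.mem_union, Set.mem_insert_iff,
    Set.mem_singleton_iff] at hz
  rcases hz with (((hz | hz) | hz) | hz) | (hz | hz)
  · refine exists_factor_of_hasJump ?_ (isOpen_sectorII s) (isOpen_sectorV s)
      h.diffOn h.jump1 (isLocalLine_Gamma1 s) (sectorII_subset hs) (sectorV_subset hs) (hdisj _ ?_)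
      d2 d5 hdet (jumpFactor_jump1 α s) hz
    · simp [Matrix.det_fin_two, ← Complex.exp_add]
    · intro z hz; simp [Omega, hz]
  · refine exists_factor_of_hasJump ?_ (isOpen_sectorII s) (isOpen_sectorIII s)
      h.diffOn h.jump2 (isLocalLine_Gamma2 s) (sectorII_subset hs) (sectorIII_subset hs) (hdisj _ ?_)
      d2 d3 hdet (jumpFactor_jump2 α s) hz
    · simp [Matrix.det_fin_two]
    · intro z hz; simp [Omega, hz]
  · refine exists_factor_of_hasJump ?_ (isOpen_sectorIII s) (isOpen_sectorIV s)
      h.diffOn h.jump3 (isLocalLine_Gamma3 s) (sectorIII_subset hs) (sectorIV_subset hs) (hdisj _ ?_)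
      d3 d4 hdet (jumpFactor_jump3 α s) hz
    · simp [Matrix.det_fin_two]
    · intro z hz; simp [Omega, hz]
  · refine exists_factor_of_hasJump ?_ (isOpen_sectorIV s) (isOpen_sectorV s)
      h.diffOn h.jump4 (isLocalLine_Gamma4 s) (sectorIV_subset hs) (sectorV_subset hs) (hdisj _ ?_)
      d4 d5 hdet (jumpFactor_jump4 α s) hz
    · simp [Matrix.det_fin_two]
    · intro z hz; simp [Omega, hz]
  · obtain ⟨Ms, hMs, hev⟩ := h.minus_s
    refine ⟨Ms, ?_, ?_⟩
    · rw [hz]; exact analyticAt_mat hMs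
    · rw [hz]
      filter_upwards [hev] with z hz
      rw [hz, mul_assoc]
      rfl
  · exact absurd hz hz0

end LocalStructure

/-! ### The model at infinity -/

section Model

/-- The lower triangular matrix `[[1, 0], [a, 1]]`. -/
noncomputable def lower (a : ℂ) : Mat := !![1, 0; a, 1]

theorem det_lower (a : ℂ) : (lower a).det = 1 := by simp [lower, Matrix.det_fin_two]

theorem adjL_lower (a : ℂ) : adjL (lower a) = lower (-a) := by simp [adjL_apply, lower]

theorem adjL_expSigma3 (w : ℂ) : adjL (expSigma3 w) = expSigma3 (-w) := by
  simp [adjL_apply, expSigma3]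

theorem adjL_powSigma3 (z c : ℂ) : adjL (powSigma3 z c) = powSigma3 z (-c) := by
  simp [adjL_apply, powSigma3]

theorem expSigma3_mul (w v : ℂ) : expSigma3 w * expSigma3 v = expSigma3 (w + v) := by
  ext i j; fin_cases i <;> fin_cases j <;> simp [expSigma3, ← Complex.exp_add, add_comm]

theorem expSigma3_zero : expSigma3 0 = 1 := by
  ext i j; fin_cases i <;> fin_cases j <;> simp [expSigma3]

theorem det_expSigma3 (w : ℂ) : (expSigma3 w).det = 1 := by
  simp [expSigma3, Matrix.det_fin_two, ← Complex.exp_add]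

theorem det_powSigma3 {z : ℂ} (hz : z ≠ 0) (c : ℂ) : (powSigma3 z c).det = 1 := by
  simp [powSigma3, Matrix.det_fin_two, ← Complex.cpow_add _ _ hz]

theorem differentiable_expSigma3 : Differentiable ℂ expSigma3 := by
  intro z
  refine HasDerivAt.differentiableAt (f' := !![Complex.exp z, 0; 0, -Complex.exp (-z)])
    (hasDerivAt_mat fun i j => ?_)
  fin_cases i <;> fin_cases j
  · exact Complex.hasDerivAt_exp z
  · exact hasDerivAt_const _ _
  · exact hasDerivAt_const _ _
  · have := (Complex.hasDerivAt_exp (-z)).comp z (hasDerivAt_neg z)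
    simpa [Function.comp_def, expSigma3] using this

theorem differentiableAt_powSigma3 {z : ℂ} (hz : z ∈ Complex.slitPlane) (c : ℂ) :
    DifferentiableAt ℂ (fun w => powSigma3 w c) z := by
  refine HasDerivAt.differentiableAt
    (f' := !![c * z ^ (c - 1), 0; 0, (-c) * z ^ (-c - 1)]) (hasDerivAt_mat fun i j => ?_)
  fin_cases i <;> fin_cases j
  · simpa [powSigma3] using (hasDerivAt_id z).cpow_const (c := c) hz
  · exact hasDerivAt_const _ _
  · exact hasDerivAt_const _ _
  · simpa [powSigma3] using (hasDerivAt_id z).cpow_const (c := -c) hz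

/-- `e^{π i / 4}`. -/
noncomputable def e4 : ℂ := Complex.exp (Real.pi / 4 * Complex.I)

theorem e4_sq : e4 ^ 2 = Complex.I := by
  rw [e4, ← Complex.exp_nat_mul]
  rw [show ((2 : ℕ) : ℂ) * (Real.pi / 4 * Complex.I) = Real.pi / 2 * Complex.I by push_cast; ring]
  exact Complex.exp_pi_div_two_mul_I

theorem e4_ne : e4 ≠ 0 := Complex.exp_ne_zero _

/-- The `(1,1)` entry of `modelRoot`. -/
noncomputable def modelF (l : ℝ) (r : ℂ) : ℂ := e4 / (Real.sqrt 2 * r) * Complex.exp (l * r ^ 2)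

/-- The `(1,2)` entry of `modelRoot`. -/
noncomputable def modelG (l : ℝ) (r : ℂ) : ℂ :=
  Complex.I * e4 / (Real.sqrt 2 * r) * Complex.exp (-(l * r ^ 2))

/-- The model at infinity, as a function of the fourth root `r` of the variable. -/
noncomputable def modelRoot (l : ℝ) (r : ℂ) : Mat :=
  !![modelF l r, modelG l r; r ^ 2 * modelF l r, -(r ^ 2 * modelG l r)]

theorem sqrt2_sq : (Real.sqrt 2 : ℂ) ^ 2 = 2 := by
  rw [← Complex.ofReal_pow, Real.sq_sqrt (by norm_num)]; simp

theorem sqrt2_ne : (Real.sqrt 2 : ℂ) ≠ 0 := by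
  intro h; have := sqrt2_sq; rw [h] at this; norm_num at this

theorem two_mul_modelF_mul_modelG {l : ℝ} {r : ℂ} (hr : r ≠ 0) :
    -(2 * r ^ 2 * modelF l r * modelG l r) = 1 := by
  have h2 := sqrt2_ne
  have : modelF l r * modelG l r = e4 ^ 2 * Complex.I / ((Real.sqrt 2 : ℂ) ^ 2 * r ^ 2) *
      (Complex.exp (l * r ^ 2) * Complex.exp (-(l * r ^ 2))) := by
    rw [modelF, modelG]; field_simp
  have hE : Complex.exp (l * r ^ 2) * Complex.exp (-(l * r ^ 2)) = 1 := by
    rw [← Complex.exp_add]; simp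
  rw [hE, e4_sq, sqrt2_sq] at this
  rw [mul_assoc, this]
  have hI := Complex.I_mul_I
  field_simp
  rw [Complex.I_sq]; ring

theorem det_modelRoot {l : ℝ} {r : ℂ} (hr : r ≠ 0) : (modelRoot l r).det = 1 := by
  rw [modelRoot, Matrix.det_fin_two, ← two_mul_modelF_mul_modelG (l := l) hr]; simp; ring

theorem fourth_root_ne {z : ℂ} (hz : z ≠ 0) : z ^ (1 / 4 : ℂ) ≠ 0 := by simp [Complex.cpow_eq_zero_iff, hz]

theorem fourth_root_pow (z : ℂ) : (z ^ (1 / 4 : ℂ)) ^ 4 = z := by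
  have := Complex.cpow_nat_inv_pow z (n := 4) (by norm_num)
  simp at this ⊢

theorem fourth_root_sq (z : ℂ) : (z ^ (1 / 4 : ℂ)) ^ 2 = z ^ (1 / 2 : ℂ) := by
  rw [← Complex.cpow_nat_mul]; norm_num

theorem modelInfinity_eq (l : ℝ) {z : ℂ} (hz : z ≠ 0) :
    modelInfinity l z = modelRoot l (z ^ (1 / 4 : ℂ)) := by
  have hr := fourth_root_ne hz
  have h2 := sqrt2_ne
  have h4 := e4_ne
  have e4i : Complex.exp (-(Real.pi / 4 * Complex.I)) = e4⁻¹ := Complex.exp_neg _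
  have e4i' : Complex.exp (Real.pi / 4 * Complex.I) = e4 := rfl
  have hI : e4⁻¹ * Complex.I = e4 := by rw [← e4_sq]; field_simp
  have hI2 : e4⁻¹ = -(Complex.I * e4) := by
    have hI3 := Complex.I_mul_I
    linear_combination (-Complex.I) * hI + e4⁻¹ * hI3
  rw [modelInfinity, modelRoot, ← fourth_root_sq, expSigma3, expSigma3, powSigma3, e4i, e4i', neg_neg,
    Complex.cpow_neg, sigma1]
  have hU : (1 : Mat) + Complex.I • !![0, 1; 1, 0] = !![1, Complex.I; Complex.I, 1] := by
    ext i j; fin_cases i <;> fin_cases j <;> simp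
  rw [hU]
  unfold modelF modelG
  set r := z ^ (1 / 4 : ℂ)
  ext i j
  fin_cases i <;> fin_cases j <;> simp
  · field_simp
  · field_simp
  · field_simp
    rw [← e4_sq]
  · rw [hI2]; field_simp

theorem det_modelInfinity (l : ℝ) {z : ℂ} (hz : z ≠ 0) : (modelInfinity l z).det = 1 := by
  rw [modelInfinity_eq l hz, det_modelRoot (fourth_root_ne hz)]

/-- The logarithmic derivative of the model. -/
noncomputable def modelLog (l : ℝ) (z : ℂ) : Mat :=
  !![-(1 / (4 * z)), l / (2 * z); l / 2, 1 / (4 * z)]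

theorem hasDerivAt_modelRoot_comp (l : ℝ) {z : ℂ} (hz : z ≠ 0) {ρ : ℂ → ℂ}
    (hd : HasDerivAt ρ (ρ z / (4 * z)) z) (h4 : ρ z ^ 4 = z) :
    HasDerivAt (fun w => modelRoot l (ρ w)) (modelLog l z * modelRoot l (ρ z)) z := by
  have hr : ρ z ≠ 0 := by intro h; rw [h] at h4; simp at h4; exact hz h4.symm
  have h2 := sqrt2_ne
  have hI : HasDerivAt (fun w => (Real.sqrt 2 * ρ w)⁻¹) (-(Real.sqrt 2 * ρ z)⁻¹ / (4 * z)) z := by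
    refine HasDerivAt.congr_deriv ((hd.const_mul (Real.sqrt 2 : ℂ)).fun_inv (by simp [hr])) ?_
    field_simp
  have hE : HasDerivAt (fun w => l * ρ w ^ 2) (l * ρ z ^ 2 / (2 * z)) z := by
    refine HasDerivAt.congr_deriv ((hd.fun_pow 2).const_mul (l : ℂ)) ?_
    simp only [Nat.cast_ofNat]
    field_simp
    ring
  have hF : HasDerivAt (fun w => modelF l (ρ w))
      (modelF l (ρ z) * (-(1 / (4 * z)) + l / (2 * z) * ρ z ^ 2)) z := by
    simp only [modelF, div_eq_mul_inv e4]
    refine HasDerivAt.congr_deriv ((hI.const_mul e4).mul hE.cexp) ?_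
    field_simp
  have hG : HasDerivAt (fun w => modelG l (ρ w))
      (modelG l (ρ z) * (-(1 / (4 * z)) - l / (2 * z) * ρ z ^ 2)) z := by
    simp only [modelG, div_eq_mul_inv (Complex.I * e4)]
    refine HasDerivAt.congr_deriv ((hI.const_mul (Complex.I * e4)).mul hE.fun_neg.cexp) ?_
    field_simp
    ring
  have hR : HasDerivAt (fun w => ρ w ^ 2) (ρ z ^ 2 / (2 * z)) z := by
    refine HasDerivAt.congr_deriv (hd.fun_pow 2) ?_
    simp only [Nat.cast_ofNat]
    field_simp
    ring
  apply hasDerivAt_mat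
  intro i j
  simp only [modelRoot, modelLog]
  fin_cases i <;> fin_cases j <;> simp
  · refine hF.congr_deriv ?_; ring
  · refine hG.congr_deriv ?_; ring
  · refine HasDerivAt.congr_deriv (hR.mul hF) ?_
    field_simp
    linear_combination (4 * l * modelF l (ρ z)) * h4
  · refine HasDerivAt.congr_deriv ((hR.mul hG).neg) ?_
    field_simp
    linear_combination (4 * l * modelG l (ρ z)) * h4

theorem hasDerivAt_modelInfinity (l : ℝ) {z : ℂ} (hz : z ∈ Complex.slitPlane) :
    HasDerivAt (modelInfinity l) (modelLog l z * modelInfinity l z) z := by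
  have hz0 : z ≠ 0 := Complex.slitPlane_ne_zero hz
  have hd : HasDerivAt (fun w : ℂ => w ^ (1 / 4 : ℂ)) (z ^ (1 / 4 : ℂ) / (4 * z)) z := by
    have := (hasDerivAt_id z).cpow_const (c := 1 / 4) hz
    simp only [id, mul_one] at this
    refine this.congr_deriv ?_
    rw [Complex.cpow_sub _ _ hz0, Complex.cpow_one]; field_simp
  rw [modelInfinity_eq l hz0]
  refine (hasDerivAt_modelRoot_comp l hz0 hd (fourth_root_pow z)).congr_of_eventuallyEq ?_
  filter_upwards [isOpen_ne.mem_nhds hz0] with w hw using modelInfinity_eq l hw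

/-- The quotient of two models, in terms of the fourth roots of the variables. -/
theorem modelRoot_ratio (l₀ l : ℝ) {q p : ℂ} (hq : q ≠ 0) (hp : p ≠ 0) :
    modelRoot l₀ q * adjL (modelRoot l p) =
      !![p / q * Complex.cosh (l₀ * q ^ 2 - l * p ^ 2),
          Complex.sinh (l₀ * q ^ 2 - l * p ^ 2) / (p * q);
        p * q * Complex.sinh (l₀ * q ^ 2 - l * p ^ 2),
          q / p * Complex.cosh (l₀ * q ^ 2 - l * p ^ 2)] := by
  have h2 := sqrt2_sq
  have h4 := e4_sq
  have hI := Complex.I_mul_I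
  have h2n := sqrt2_ne
  have hFG : modelF l₀ q * modelG l p = -(Complex.exp (l₀ * q ^ 2 - l * p ^ 2) / (2 * (p * q))) := by
    rw [modelF, modelG, sub_eq_add_neg, Complex.exp_add]
    have : e4 * (Complex.I * e4) = -1 := by linear_combination Complex.I * h4 + hI
    field_simp
    rw [h2]
    linear_combination 2 * this
  have hGF : modelG l₀ q * modelF l p = -(Complex.exp (-(l₀ * q ^ 2 - l * p ^ 2)) / (2 * (p * q))) := by
    rw [modelF, modelG, show -(l₀ * q ^ 2 - l * p ^ 2) = -(l₀ * q ^ 2) + l * p ^ 2 by ring,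
      Complex.exp_add]
    have : e4 * (Complex.I * e4) = -1 := by linear_combination Complex.I * h4 + hI
    field_simp
    rw [h2]
    linear_combination 2 * this
  rw [Complex.cosh, Complex.sinh, adjL_apply]
  set E := Complex.exp (l₀ * q ^ 2 - l * p ^ 2)
  set E' := Complex.exp (-(l₀ * q ^ 2 - l * p ^ 2))
  simp only [modelRoot]
  ext i j
  fin_cases i <;> fin_cases j <;> simp
  · have : p / q * ((E + E') / 2) = p ^ 2 * (E / (2 * (p * q)) + E' / (2 * (p * q))) := by field_simp
    rw [this]; linear_combination (-p ^ 2) * hFG - p ^ 2 * hGF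
  · have : (E - E') / 2 / (p * q) = E / (2 * (p * q)) - E' / (2 * (p * q)) := by field_simp
    rw [this]; linear_combination (-1) * hFG + hGF
  · have : p * q * ((E - E') / 2) = p ^ 2 * q ^ 2 * (E / (2 * (p * q)) - E' / (2 * (p * q))) := by
      field_simp
    rw [this]; linear_combination (-p ^ 2 * q ^ 2) * hFG + p ^ 2 * q ^ 2 * hGF
  · have : q / p * ((E + E') / 2) = q ^ 2 * (E / (2 * (p * q)) + E' / (2 * (p * q))) := by field_simp
    rw [this]; linear_combination (-q ^ 2) * hFG - q ^ 2 * hGF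

end Model

/-! ### The normalized solution, its determinant, and the local form at the origin -/

section Determinant

theorem Omega_subset_slitPlane {s : ℝ} (hs : 0 < s) : Omega s ⊆ Complex.slitPlane := by
  intro z hz
  rw [mem_Omega hs] at hz
  rw [Complex.mem_slitPlane_iff]
  grind

theorem ne_zero_of_mem_Omega {s : ℝ} (hs : 0 < s) {z : ℂ} (hz : z ∈ Omega s) : z ≠ 0 :=
  Complex.slitPlane_ne_zero (Omega_subset_slitPlane hs hz)

/-- A limit at infinity along a dense set is a limit at infinity, for continuous functions. -/
theorem tendsto_cobounded_of_dense {E : Type*} [NormedAddCommGroup E] {g : ℂ → E} {W : Set ℂ}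
    (hWd : Dense W) {R : ℝ} (hg : ContinuousOn g {z | R < ‖z‖}) {v : E}
    (h : Tendsto g (Bornology.cobounded ℂ ⊓ 𝓟 W) (𝓝 v)) : Tendsto g (Bornology.cobounded ℂ) (𝓝 v) := by
  rw [Metric.tendsto_nhds] at h ⊢
  intro ε hε
  have h1 := h (ε / 2) (by linarith)
  rw [eventually_inf_principal, ← comap_norm_atTop, eventually_comap, eventually_atTop] at h1
  obtain ⟨S, hS⟩ := h1
  rw [← comap_norm_atTop, eventually_comap]
  filter_upwards [eventually_gt_atTop (max R S)] with b hb z hz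
  have hzR : R < ‖z‖ := by rw [hz]; exact (le_max_left _ _).trans_lt hb
  have hzS : S < ‖z‖ := by rw [hz]; exact (le_max_right _ _).trans_lt hb
  have hopen : IsOpen {w : ℂ | R < ‖w‖} := isOpen_lt continuous_const continuous_norm
  have hopen2 : IsOpen {w : ℂ | S < ‖w‖} := isOpen_lt continuous_const continuous_norm
  have hc : ContinuousAt g z := hg.continuousAt (hopen.mem_nhds hzR)
  have hne : (𝓝[W] z).NeBot := mem_closure_iff_nhdsWithin_neBot.1 (hWd z)
  have ht : Tendsto (fun w => dist (g w) v) (𝓝[W] z) (𝓝 (dist (g z) v)) :=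
    (hc.tendsto.mono_left nhdsWithin_le_nhds).dist tendsto_const_nhds
  have : dist (g z) v ≤ ε / 2 := by
    refine le_of_tendsto ht ?_
    filter_upwards [self_mem_nhdsWithin, nhdsWithin_le_nhds (hopen2.mem_nhds hzS)] with w hw hwS
    exact (hS _ (le_of_lt hwS) w rfl hw).le
  linarith

variable {k : ℕ} {α l s : ℝ} {M : ℂ → Mat} {a : ℂ}

/-- The solution with its prescribed factors at infinity removed. -/
noncomputable def normalized (l : ℝ) (a : ℂ) (M : ℂ → Mat) (z : ℂ) : Mat :=
  adjL (lower a) * M z * adjL (modelInfinity l z)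

theorem eq_normalized {z : ℂ} (hz : z ≠ 0) :
    M z = lower a * normalized l a M z * modelInfinity l z := by
  rw [normalized]
  calc M z = (lower a * adjL (lower a)) * M z * (adjL (modelInfinity l z) * modelInfinity l z) := by
        rw [mul_adjL (det_lower a), adjL_mul_self (det_modelInfinity l hz), one_mul, mul_one]
    _ = _ := by simp only [mul_assoc]

/-- The expansion at infinity, with the error term measured in norm. -/
theorem IsRHSolution.expansion (h : IsRHSolution k α l s M a) (hs : 0 < s) :
    ∃ Minf : Mat, Minf 0 1 = a ∧ ∃ C R : ℝ, 0 < C ∧ 0 < R ∧ ∀ z ∈ Omega s, R ≤ ‖z‖ →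
      ‖normalized l a M z - 1 - z⁻¹ • Minf‖ ≤ C / ‖z‖ ^ 2 := by
  obtain ⟨Minf, Err, hMinf, hErr, hM⟩ := h.infinity
  refine ⟨Minf, hMinf, ?_⟩
  have h1 : ∀ i j, ∃ c R : ℝ, ∀ z ∈ Omega s, R ≤ ‖z‖ → ‖Err z i j‖ ≤ c / ‖z‖ ^ 2 := by
    intro i j
    obtain ⟨c, hc⟩ := (hErr i j).bound
    rw [eventually_inf_principal, ← comap_norm_atTop, eventually_comap, eventually_atTop] at hc
    obtain ⟨R, hR⟩ := hc
    refine ⟨c, R, fun z hz hzR => (hR _ hzR z rfl hz).trans (le_of_eq ?_)⟩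
    rw [norm_inv, norm_pow]; rfl
  choose c R hcR using h1
  set c' : ℝ := 1 + ∑ i, ∑ j, |c i j| with hc'
  set R' : ℝ := 1 + ∑ i, ∑ j, |R i j| with hR'
  have hle : ∀ (f : Fin 2 → Fin 2 → ℝ) (i j), f i j ≤ 1 + ∑ i, ∑ j, |f i j| := by
    intro f i j
    have h2 : |f i j| ≤ ∑ j, |f i j| :=
      Finset.single_le_sum (f := fun j => |f i j|) (fun _ _ => abs_nonneg _) (Finset.mem_univ j)
    have h3 : ∑ j, |f i j| ≤ ∑ i, ∑ j, |f i j| :=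
      Finset.single_le_sum (f := fun i => ∑ j, |f i j|)
        (fun _ _ => Finset.sum_nonneg fun _ _ => abs_nonneg _) (Finset.mem_univ i)
    linarith [le_abs_self (f i j)]
  have hpos : ∀ (f : Fin 2 → Fin 2 → ℝ), 0 < 1 + ∑ i, ∑ j, |f i j| := fun f => by positivity
  refine ⟨2 * c', R', by have := hpos c; positivity, hpos R, fun z hz hzR => ?_⟩
  have hz0 := ne_zero_of_mem_Omega hs hz
  have hn : normalized l a M z = 1 + z⁻¹ • Minf + Err z := by
    have : M z = lower a * (1 + z⁻¹ • Minf + Err z) * modelInfinity l z := hM z hz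
    rw [normalized, this]
    simp only [mul_assoc]
    rw [mul_adjL (det_modelInfinity l hz0), mul_one, ← mul_assoc, adjL_mul_self (det_lower a), one_mul]
  have : normalized l a M z - 1 - z⁻¹ • Minf = Err z := by rw [hn]; abel
  rw [this, mul_div_assoc]
  refine norm_le_of_entries fun i j => (hcR i j z hz ((hle R i j).trans hzR)).trans ?_
  gcongr
  exact hle c i j

theorem IsRHSolution.tendsto_normalized (h : IsRHSolution k α l s M a) (hs : 0 < s) :
    Tendsto (normalized l a M) (Bornology.cobounded ℂ ⊓ 𝓟 (Omega s)) (𝓝 1) := by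
  obtain ⟨Minf, -, C, R, hC, hR, hb⟩ := h.expansion hs
  have hinv : Tendsto (fun z : ℂ => z⁻¹) (Bornology.cobounded ℂ ⊓ 𝓟 (Omega s)) (𝓝 0) :=
    tendsto_inv₀_cobounded.mono_left inf_le_left
  have hn : Tendsto (fun z : ℂ => ‖z‖⁻¹) (Bornology.cobounded ℂ ⊓ 𝓟 (Omega s)) (𝓝 0) := by
    simpa using hinv.norm
  have h1 : Tendsto (fun z => normalized l a M z - 1 - z⁻¹ • Minf)
      (Bornology.cobounded ℂ ⊓ 𝓟 (Omega s)) (𝓝 0) := by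
    refine squeeze_zero_norm' (a := fun z : ℂ => C * ‖z‖⁻¹ ^ 2) ?_ ?_
    · rw [eventually_inf_principal, ← comap_norm_atTop, eventually_comap]
      filter_upwards [eventually_ge_atTop R] with b hb' z hz hzΩ
      rw [inv_pow, ← div_eq_mul_inv]
      exact hb z hzΩ (by rw [hz]; exact hb')
    · simpa using (hn.pow 2).const_mul C
  have h2 := (h1.add (hinv.smul_const Minf)).add (tendsto_const_nhds (x := (1 : Mat)))
  rw [zero_smul, zero_add, zero_add] at h2
  refine h2.congr fun z => ?_
  abel

theorem IsRHSolution.exists_zero_factor (h : IsRHSolution k α l s M a) :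
    ∃ M0 : ℂ → Mat, AnalyticAt ℂ M0 0 ∧ ∀ᶠ z in 𝓝[Omega s] 0,
      M z = M0 z * expSigma3 ((-1) ^ (k + 1) / z ^ k) * powSigma3 z (α / 2) := by
  obtain ⟨M0, h0, hev⟩ := h.zero
  exact ⟨M0, analyticAt_mat h0, hev⟩

/-- A solution of the Riemann-Hilbert problem has determinant one: the determinant has no jumps and
no singularities, and it tends to one at infinity. -/
theorem IsRHSolution.det_eq_one (h : IsRHSolution k α l s M a) (hs : 0 < s) {z : ℂ}
    (hz : z ∈ Omega s) : (M z).det = 1 := by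
  obtain ⟨g, hg, hgM⟩ := exists_extension_of_local (f := fun z => (M z).det) (U := Set.univ)
    (isOpen_Omega hs) (dense_Omega hs) isOpen_univ
    ((DifferentiableOn.matDet h.diffOn).mono Set.inter_subset_left) (by
      intro z₀ _ hz₀
      by_cases h0 : z₀ = 0
      · obtain ⟨M0, hM0, hev⟩ := h.exists_zero_factor
        subst h0
        refine ⟨_, AnalyticAt.matDet hM0, ?_⟩
        filter_upwards [hev, self_mem_nhdsWithin] with w hw hwΩ
        rw [hw, Matrix.det_mul, Matrix.det_mul, det_expSigma3,
          det_powSigma3 (ne_zero_of_mem_Omega hs hwΩ), mul_one, mul_one]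
      · obtain ⟨F, hF, hev⟩ := h.exists_factor hs hz₀ h0
        refine ⟨_, AnalyticAt.matDet hF, ?_⟩
        filter_upwards [hev] with w hw
        rw [hw, Matrix.det_mul, det_jumpFactor, mul_one])
  have hgd : Differentiable ℂ g := differentiableOn_univ.1 hg
  have hlim : Tendsto g (Bornology.cobounded ℂ ⊓ 𝓟 (Omega s)) (𝓝 1) := by
    have h1 := (continuous_matDet.tendsto 1).comp (h.tendsto_normalized hs)
    rw [Matrix.det_one] at h1
    refine h1.congr' ?_
    filter_upwards [mem_inf_of_right (mem_principal_self _)] with w hw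
    have hw0 := ne_zero_of_mem_Omega hs hw
    rw [hgM w ⟨hw, trivial⟩, Function.comp, normalized, Matrix.det_mul, Matrix.det_mul, det_adjL,
      det_adjL, det_lower, det_modelInfinity l hw0, mul_one, one_mul]
  have hlim2 := tendsto_cobounded_of_dense (R := 0) (dense_Omega hs) hgd.continuous.continuousOn hlim
  rw [Metric.cobounded_eq_cocompact] at hlim2
  have := hgd.eq_const_of_tendsto_cocompact hlim2
  rw [← hgM z ⟨hz, trivial⟩, this]
  rfl

theorem det_normalized (h : IsRHSolution k α l s M a) (hs : 0 < s) {z : ℂ} (hz : z ∈ Omega s) :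
    (normalized l a M z).det = 1 := by
  rw [normalized, Matrix.det_mul, Matrix.det_mul, det_adjL, det_adjL, det_lower,
    det_modelInfinity l (ne_zero_of_mem_Omega hs hz), h.det_eq_one hs hz, mul_one, one_mul]

theorem mem_or_of_norm_lt {z : ℂ} (hs : 0 < s) (hz : ‖z‖ < s) (hzΩ : z ∉ Omega s) :
    z = 0 ∨ z ∈ Gamma1 s := by
  have h3 := sqrt3_pos
  have h33 : Real.sqrt 3 * Real.sqrt 3 = 3 := Real.mul_self_sqrt (by norm_num)
  have hn : z.re ^ 2 + z.im ^ 2 < s ^ 2 := by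
    have := Complex.sq_norm z
    rw [Complex.normSq_apply] at this
    nlinarith [norm_nonneg z]
  have hre := Complex.abs_re_le_norm z
  rw [abs_le] at hre
  have key : ∀ y : ℝ, 0 < y → Real.sqrt 3 * (z.re + s) + y = 0 → z.im ^ 2 = y ^ 2 → False := by
    intro y hy h1 h2
    nlinarith
  simp only [Omega, Set.mem_compl_iff, not_not, Set.mem_union, Set.mem_insert_iff,
    Set.mem_singleton_iff] at hzΩ
  rcases hzΩ with (((hz1 | hz1) | hz1) | hz1) | (hz1 | hz1)
  · exact Or.inr hz1
  · rw [mem_Gamma2] at hz1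
    exact (key z.im hz1.1 hz1.2 rfl).elim
  · rw [mem_Gamma3] at hz1; linarith
  · rw [mem_Gamma4] at hz1
    exact (key (-z.im) (by linarith) (by linarith) (by ring)).elim
  · rw [hz1] at hz; simp [abs_of_pos hs] at hz
  · exact Or.inl hz1

theorem powSigma3_im_pos {z : ℂ} (hz : 0 < z.im) (α : ℝ) :
    !![unitE α, 0; 0, (unitE α)⁻¹] * powSigma3 z (-(α / 2)) = powSigma3 (-z) (-(α / 2)) := by
  have hz0 : z ≠ 0 := by rintro rfl; simp at hz
  have hl : Complex.log z = Complex.log (-z) + Real.pi * Complex.I := by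
    rw [Complex.log, Complex.log, norm_neg, Complex.arg_neg_eq_arg_sub_pi_of_im_pos hz]; push_cast; ring
  have e : ∀ c : ℂ, z ^ c = (-z) ^ c * Complex.exp (Real.pi * Complex.I * c) := by
    intro c
    rw [Complex.cpow_def_of_ne_zero hz0, Complex.cpow_def_of_ne_zero (neg_ne_zero.2 hz0), hl,
      ← Complex.exp_add]; ring_nf
  have e1 : Complex.exp (Real.pi * Complex.I * (-(α / 2))) = (unitE α)⁻¹ := by
    rw [unitE, ← Complex.exp_neg]; ring_nf
  have e2 : Complex.exp (Real.pi * Complex.I * (- -(α / 2))) = unitE α := by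
    rw [unitE]; ring_nf
  have h0 := unitE_ne_zero α
  rw [powSigma3, powSigma3, e, e, e1, e2]
  ext i j; fin_cases i <;> fin_cases j <;> simp <;> field_simp

theorem powSigma3_im_neg {z : ℂ} (hz : z.im < 0) (α : ℝ) :
    !![(unitE α)⁻¹, 0; 0, unitE α] * powSigma3 z (-(α / 2)) = powSigma3 (-z) (-(α / 2)) := by
  have hz0 : z ≠ 0 := by rintro rfl; simp at hz
  have hl : Complex.log z = Complex.log (-z) - Real.pi * Complex.I := by
    rw [Complex.log, Complex.log, norm_neg, Complex.arg_neg_eq_arg_add_pi_of_im_neg hz]; push_cast; ring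
  have e : ∀ c : ℂ, z ^ c = (-z) ^ c * Complex.exp (-(Real.pi * Complex.I * c)) := by
    intro c
    rw [Complex.cpow_def_of_ne_zero hz0, Complex.cpow_def_of_ne_zero (neg_ne_zero.2 hz0), hl,
      ← Complex.exp_add]; ring_nf
  have e1 : Complex.exp (-(Real.pi * Complex.I * (-(α / 2)))) = unitE α := by
    rw [unitE]; ring_nf
  have e2 : Complex.exp (-(Real.pi * Complex.I * (- -(α / 2)))) = (unitE α)⁻¹ := by
    rw [unitE, ← Complex.exp_neg]; ring_nf
  have h0 := unitE_ne_zero α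
  rw [powSigma3, powSigma3, e, e, e1, e2]
  ext i j; fin_cases i <;> fin_cases j <;> simp <;> field_simp

/-- The exponent `(-1)^{k+1} / z^k` of the essential singularity at the origin. -/
noncomputable def theta (k : ℕ) (z : ℂ) : ℂ := (-1) ^ (k + 1) / z ^ k

theorem differentiableAt_theta (k : ℕ) {z : ℂ} (hz : z ≠ 0) : DifferentiableAt ℂ (theta k) z := by
  unfold theta
  exact (differentiableAt_const _).div (by fun_prop) (pow_ne_zero _ hz)

/-- The local form at the origin holds on the whole disc `|z| < s`. -/
theorem IsRHSolution.exists_disc_factor (h : IsRHSolution k α l s M a) (hs : 0 < s) :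
    ∃ P : ℂ → Mat, DifferentiableOn ℂ P (Metric.ball 0 s) ∧
      (∀ z ∈ Metric.ball (0 : ℂ) s, (P z).det = 1) ∧
      ∀ z ∈ Omega s ∩ Metric.ball 0 s,
        M z = P z * expSigma3 (theta k z) * powSigma3 z (α / 2) := by
  obtain ⟨P, hP, hPM⟩ := exists_extension_of_local
    (f := fun z => M z * powSigma3 z (-(α / 2)) * expSigma3 (-theta k z))
    (U := Metric.ball 0 s) (isOpen_Omega hs) (dense_Omega hs) Metric.isOpen_ball (by
      intro z hz
      have hz0 := ne_zero_of_mem_Omega hs hz.1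
      apply DifferentiableAt.differentiableWithinAt
      refine DifferentiableAt.mul (DifferentiableAt.mul ?_ ?_) ?_
      · exact h.diffOn.differentiableAt ((isOpen_Omega hs).mem_nhds hz.1)
      · exact differentiableAt_powSigma3 (Omega_subset_slitPlane hs hz.1) _
      · exact (differentiable_expSigma3 _).comp z (differentiableAt_theta k hz0).neg) (by
      intro z₀ hz₀ hzΩ
      rcases mem_or_of_norm_lt hs (by simpa using hz₀) hzΩ with h0 | h1
      · subst h0
        obtain ⟨M0, hM0, hev⟩ := h.exists_zero_factor
        refine ⟨M0, hM0, ?_⟩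
        filter_upwards [hev, self_mem_nhdsWithin] with w hw hwΩ
        have hw0 := ne_zero_of_mem_Omega hs hwΩ
        have hw' : M w = M0 w * expSigma3 (theta k w) * powSigma3 w (α / 2) := hw
        rw [hw', ← adjL_powSigma3, mul_assoc (M0 w * _), mul_adjL (det_powSigma3 hw0 _), mul_one,
          mul_assoc, ← adjL_expSigma3, mul_adjL (det_expSigma3 _), mul_one]
      · have h1' := mem_Gamma1.1 h1
        have hz00 : z₀ ≠ 0 := by rintro rfl; simp at h1'
        obtain ⟨F, hF, hev⟩ := h.exists_factor hs hzΩ hz00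
        refine ⟨fun z => F z * upper (logFactor s z) * powSigma3 (-z) (-(α / 2)) *
          expSigma3 (-theta k z), ?_, ?_⟩
        · have hsl : z₀ + s ∈ Complex.slitPlane :=
            Complex.mem_slitPlane_iff.2 (Or.inl (by simpa using h1'.2.1))
          have hsl2 : -z₀ ∈ Complex.slitPlane :=
            Complex.mem_slitPlane_iff.2 (Or.inl (by simpa using h1'.2.2))
          have e1 : ∀ᶠ z : ℂ in 𝓝 z₀, z + (s : ℂ) ∈ Complex.slitPlane :=
            (Continuous.continuousAt (by fun_prop)).eventually_mem
              (Complex.isOpen_slitPlane.mem_nhds hsl)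
          have e2 : ∀ᶠ z in 𝓝 z₀, -z ∈ Complex.slitPlane :=
            (Continuous.continuousAt (by fun_prop)).eventually_mem
              (Complex.isOpen_slitPlane.mem_nhds hsl2)
          have e3 : ∀ᶠ z in 𝓝 z₀, z ≠ 0 := isOpen_ne.mem_nhds hz00
          rw [Complex.analyticAt_iff_eventually_differentiableAt]
          filter_upwards [hF.eventually_analyticAt, e1, e2, e3] with w g1 h2 h3 h4
          refine ((g1.differentiableAt.mul ?_).mul ?_).mul ?_
          · exact (differentiable_upper _).comp w (differentiableAt_logFactor h2)
          · exact (differentiableAt_powSigma3 h3 (-(α / 2))).comp w (differentiable_neg _)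
          · exact (differentiable_expSigma3 _).comp w (differentiableAt_theta k h4).neg
        · have hII : ∀ᶠ z : ℂ in 𝓝 z₀, 0 < Real.sqrt 3 * (z.re + s) + z.im :=
            ContinuousAt.eventually_lt (f := fun _ => (0 : ℝ)) (by fun_prop) (by fun_prop)
              (by rw [h1'.1, add_zero]; exact mul_pos sqrt3_pos h1'.2.1)
          have hV : ∀ᶠ z : ℂ in 𝓝 z₀, 0 < Real.sqrt 3 * (z.re + s) - z.im :=
            ContinuousAt.eventually_lt (f := fun _ => (0 : ℝ)) (by fun_prop) (by fun_prop)
              (by rw [h1'.1, sub_zero]; exact mul_pos sqrt3_pos h1'.2.1)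
          have hre : ∀ᶠ z : ℂ in 𝓝 z₀, z.re < 0 :=
            ContinuousAt.eventually_lt (g := fun _ => (0 : ℝ)) (by fun_prop) (by fun_prop) h1'.2.2
          filter_upwards [hev, self_mem_nhdsWithin, nhdsWithin_le_nhds hII, nhdsWithin_le_nhds hV,
            nhdsWithin_le_nhds hre] with w hw hwΩ hwII hwV hwre
          have him : w.im ≠ 0 := by
            have := ((mem_Omega hs).1 hwΩ).1
            grind
          rw [hw, jumpFactor]
          congr 1
          simp only [mul_assoc]
          congr 2
          rcases lt_or_gt_of_ne him with him | him
          · rw [piecewiseE_V (mem_sectorV.2 ⟨him, hwV⟩), powSigma3_im_neg him]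
          · rw [piecewiseE_II (mem_sectorII.2 ⟨him, hwII⟩), powSigma3_im_pos him])
  have hPM' : ∀ z ∈ Omega s ∩ Metric.ball 0 s,
        M z = P z * expSigma3 (theta k z) * powSigma3 z (α / 2) := by
    intro z hz
    have hz0 := ne_zero_of_mem_Omega hs hz.1
    rw [hPM z hz, ← adjL_expSigma3, mul_assoc _ (adjL _), adjL_mul_self (det_expSigma3 _), mul_one,
      ← adjL_powSigma3, mul_assoc, adjL_mul_self (det_powSigma3 hz0 _), mul_one]
  refine ⟨P, hP, fun z hz => ?_, hPM'⟩
  have hc : ContinuousAt (fun z => (P z).det) z :=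
    continuous_matDet.continuousAt.comp
      (hP.differentiableAt (Metric.isOpen_ball.mem_nhds hz)).continuousAt
  have hne : (𝓝[Omega s] z).NeBot := mem_closure_iff_nhdsWithin_neBot.1 (dense_Omega hs z)
  refine tendsto_nhds_unique (hc.tendsto.mono_left nhdsWithin_le_nhds)
    (tendsto_const_nhds.congr' ?_ : Tendsto _ (𝓝[Omega s] z) _)
  filter_upwards [self_mem_nhdsWithin, nhdsWithin_le_nhds (Metric.isOpen_ball.mem_nhds hz)]
    with w hw hwb
  have h1 := h.det_eq_one hs hw
  rw [hPM' w ⟨hw, hwb⟩, Matrix.det_mul, Matrix.det_mul, det_expSigma3,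
    det_powSigma3 (ne_zero_of_mem_Omega hs hw), mul_one, mul_one] at h1
  exact h1.symm

end Determinant

/-! ### Splitting into inner and outer parts with small jump -/

section Splitting

variable {E : Type*} [NormedAddCommGroup E] [NormedSpace ℂ E] [CompleteSpace E]

theorem isOpen_exterior (r : ℝ) : IsOpen {z : ℂ | r < ‖z‖} := isOpen_lt continuous_const continuous_norm

/-- The Cauchy integral, at an inner point, of a function holomorphic near infinity. -/
theorem circleIntegral_exterior_of_norm_lt {g : ℂ → E} {r₀ r : ℝ} {v : E} (h0 : 0 < r) (hr : r₀ < r)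
    (hg : DifferentiableOn ℂ g {z | r₀ < ‖z‖}) (hv : Tendsto g (Bornology.cobounded ℂ) (𝓝 v))
    {z : ℂ} (hz : ‖z‖ < r) :
    (∮ ζ in C(0, r), (ζ - z)⁻¹ • g ζ) = (2 * Real.pi * Complex.I : ℂ) • v := by
  have hne : ∀ R, r ≤ R → ∀ ζ ∈ Metric.sphere (0 : ℂ) R, ζ - z ≠ 0 := by
    intro R hR ζ hζ h
    rw [sub_eq_zero.1 h] at hζ
    simp at hζ; linarith
  have hgc : ∀ R, r ≤ R → ContinuousOn g (Metric.sphere (0 : ℂ) R) := by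
    intro R hR
    refine hg.continuousOn.mono fun ζ hζ => ?_
    simp at hζ ⊢; linarith
  have hkc : ∀ R, r ≤ R → ContinuousOn (fun ζ => (ζ - z)⁻¹) (Metric.sphere (0 : ℂ) R) := fun R hR =>
    ContinuousOn.inv₀ (by fun_prop) (hne R hR)
  have hconst : ∀ R, r ≤ R → (∮ ζ in C(0, R), (ζ - z)⁻¹ • g ζ) = ∮ ζ in C(0, r), (ζ - z)⁻¹ • g ζ := by
    intro R hR
    have hd : ∀ ζ : ℂ, r ≤ ‖ζ‖ → DifferentiableAt ℂ (fun ζ => (ζ - z)⁻¹ • g ζ) ζ := by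
      intro ζ hζ
      refine DifferentiableAt.smul ?_ (hg.differentiableAt ((isOpen_exterior r₀).mem_nhds ?_))
      · refine DifferentiableAt.inv (by fun_prop) ?_
        intro h; rw [sub_eq_zero.1 h] at hζ; linarith
      · change r₀ < ‖ζ‖; linarith
    refine Complex.circleIntegral_eq_of_differentiable_on_annulus_off_countable h0 hR
      Set.countable_empty ?_ ?_
    · intro ζ hζ
      refine (hd ζ ?_).continuousAt.continuousWithinAt
      have := hζ.2
      simpa using this
    · intro ζ hζ
      refine hd ζ ?_
      have := hζ.1.2
      simp at this
      exact this.le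
  rw [← sub_eq_zero, ← norm_le_zero_iff]
  refine le_of_forall_pos_le_add fun ε hε => ?_
  rw [zero_add]
  have h1 : ∀ᶠ b : ℝ in atTop, ∀ ζ : ℂ, ‖ζ‖ = b → ‖g ζ - v‖ < ε / (4 * Real.pi) := by
    have := (Metric.tendsto_nhds.1 hv) (ε / (4 * Real.pi)) (by positivity)
    rw [← comap_norm_atTop, eventually_comap] at this
    simpa only [dist_eq_norm] using this
  obtain ⟨R, hR1, hR2⟩ := (h1.and (eventually_ge_atTop (2 * r))).exists
  have hrR : r ≤ R := by linarith
  have hR0 : 0 < R := by linarith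
  rw [← hconst R hrR]
  have e1 : (∮ ζ in C(0, R), (ζ - z)⁻¹ • v) = (2 * Real.pi * Complex.I : ℂ) • v := by
    rw [circleIntegral.integral_smul_const, circleIntegral.integral_sub_inv_of_mem_ball]
    simp; linarith
  have e2 : (∮ ζ in C(0, R), (ζ - z)⁻¹ • g ζ) - (∮ ζ in C(0, R), (ζ - z)⁻¹ • v)
      = ∮ ζ in C(0, R), (ζ - z)⁻¹ • (g ζ - v) := by
    rw [← circleIntegral.integral_sub]
    · simp only [smul_sub]
    · exact ((hkc R hrR).smul (hgc R hrR)).circleIntegrable hR0.le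
    · exact ((hkc R hrR).smul continuousOn_const).circleIntegrable hR0.le
  rw [← e1, e2]
  have hpi := Real.pi_pos
  refine (circleIntegral.norm_integral_le_of_norm_le_const (C := (R / 2)⁻¹ * (ε / (4 * Real.pi)))
    hR0.le ?_).trans (le_of_eq ?_)
  · intro ζ hζ
    have hζn : ‖ζ‖ = R := by simpa using hζ
    rw [norm_smul, norm_inv]
    have h2 : R / 2 ≤ ‖ζ - z‖ := by
      have := norm_sub_norm_le ζ z
      linarith
    gcongr
    exact (hR1 ζ hζn).le
  · field_simp; ring

/-- The Cauchy integral, at an outer point, of a function holomorphic near infinity. -/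
theorem circleIntegral_exterior_of_lt_norm {g : ℂ → E} {r₀ r : ℝ} {v : E} (h0 : 0 < r) (hr : r₀ < r)
    (hg : DifferentiableOn ℂ g {z | r₀ < ‖z‖}) (hv : Tendsto g (Bornology.cobounded ℂ) (𝓝 v))
    {z : ℂ} (hz : r < ‖z‖) :
    (∮ ζ in C(0, r), (ζ - z)⁻¹ • g ζ) = (2 * Real.pi * Complex.I : ℂ) • (v - g z) := by
  have hzn : {w : ℂ | r₀ < ‖w‖} ∈ 𝓝 z := (isOpen_exterior r₀).mem_nhds (hr.trans hz)
  have hds : DifferentiableOn ℂ (dslope g z) {w | r₀ < ‖w‖} :=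
    (Complex.differentiableOn_dslope hzn).2 hg
  have hdd : ∀ w : ℂ, r₀ < ‖w‖ → DifferentiableAt ℂ (dslope g z) w := fun w hw =>
    hds.differentiableAt ((isOpen_exterior r₀).mem_nhds hw)
  set R := ‖z‖ + 1 with hR
  have hrR : r ≤ R := by linarith
  have hR0 : 0 < R := by linarith
  have hann : (∮ ζ in C(0, R), dslope g z ζ) = ∮ ζ in C(0, r), dslope g z ζ := by
    refine Complex.circleIntegral_eq_of_differentiable_on_annulus_off_countable h0 hrR
      Set.countable_empty ?_ ?_
    · intro ζ hζ
      refine (hdd ζ ?_).continuousAt.continuousWithinAt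
      have := hζ.2
      simp at this; linarith
    · intro ζ hζ
      refine hdd ζ ?_
      have := hζ.1.2
      simp at this; linarith
  have key : ∀ ρ, r ≤ ρ → ρ ≠ ‖z‖ → (∮ ζ in C(0, ρ), dslope g z ζ) =
      (∮ ζ in C(0, ρ), (ζ - z)⁻¹ • g ζ) - (∮ ζ in C(0, ρ), (ζ - z)⁻¹) • g z := by
    intro ρ hρ hρz
    have hρ0 : 0 < ρ := by linarith
    have hne : ∀ ζ ∈ Metric.sphere (0 : ℂ) ρ, ζ - z ≠ 0 := by
      intro ζ hζ h
      rw [sub_eq_zero.1 h] at hζ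
      simp at hζ; exact hρz hζ.symm
    have hgc : ContinuousOn g (Metric.sphere (0 : ℂ) ρ) := by
      refine hg.continuousOn.mono fun ζ hζ => ?_
      simp at hζ ⊢; linarith
    have hkc : ContinuousOn (fun ζ => (ζ - z)⁻¹) (Metric.sphere (0 : ℂ) ρ) :=
      ContinuousOn.inv₀ (by fun_prop) hne
    rw [← circleIntegral.integral_smul_const, ← circleIntegral.integral_sub]
    · refine circleIntegral.integral_congr hρ0.le fun ζ hζ => ?_
      rw [dslope_of_ne _ (sub_ne_zero.1 (hne ζ hζ)), slope_def_module, smul_sub]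
    · exact (hkc.smul hgc).circleIntegrable hρ0.le
    · exact (hkc.smul continuousOn_const).circleIntegrable hρ0.le
  have k1 := key R hrR (by rw [hR]; linarith)
  have k2 := key r le_rfl hz.ne
  have e1 : (∮ ζ in C(0, R), (ζ - z)⁻¹) = 2 * Real.pi * Complex.I :=
    circleIntegral.integral_sub_inv_of_mem_ball (by simp [hR])
  have e2 : (∮ ζ in C(0, r), (ζ - z)⁻¹) = 0 := by
    refine DiffContOnCl.circleIntegral_eq_zero h0.le ?_
    refine DifferentiableOn.diffContOnCl ?_
    rw [closure_ball _ h0.ne']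
    intro ζ hζ
    refine (DifferentiableAt.inv (by fun_prop) ?_).differentiableWithinAt
    intro h
    rw [sub_eq_zero.1 h] at hζ
    simp at hζ; linarith
  have e3 := circleIntegral_exterior_of_norm_lt hR0 (by linarith) hg hv (z := z) (by rw [hR]; linarith)
  rw [e2, zero_smul, sub_zero] at k2
  rw [← k2, ← hann, k1, e1, e3, smul_sub]

/-- If `u` is holomorphic outside a disc and vanishes at infinity, `v` is holomorphic in a larger
disc, and `v - u` is small on a circle, then `u` is small outside the circle. -/
theorem norm_outer_le {u v : ℂ → E} {r₀ r R : ℝ} {ε : ℝ} (h0 : 0 < r) (hr : r₀ < r) (hR : r < R)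
    (hu : DifferentiableOn ℂ u {z | r₀ < ‖z‖}) (hu0 : Tendsto u (Bornology.cobounded ℂ) (𝓝 0))
    (hv : DifferentiableOn ℂ v (Metric.ball 0 R))
    (hε : ∀ z : ℂ, ‖z‖ = r → ‖v z - u z‖ ≤ ε) {z : ℂ} (hz : r < ‖z‖) :
    ‖u z‖ ≤ r / (‖z‖ - r) * ε := by
  have h1 := circleIntegral_exterior_of_lt_norm h0 hr hu hu0 hz
  have hne : ∀ ζ ∈ Metric.closedBall (0 : ℂ) r, ζ - z ≠ 0 := by
    intro ζ hζ h
    rw [sub_eq_zero.1 h] at hζ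
    simp at hζ; linarith
  have h2 : (∮ ζ in C(0, r), (ζ - z)⁻¹ • v ζ) = 0 := by
    refine DiffContOnCl.circleIntegral_eq_zero h0.le (DifferentiableOn.diffContOnCl ?_)
    rw [closure_ball _ h0.ne']
    refine DifferentiableOn.smul (DifferentiableOn.inv (by fun_prop) hne) (hv.mono ?_)
    exact Metric.closedBall_subset_ball hR
  have hkc : ContinuousOn (fun ζ => (ζ - z)⁻¹) (Metric.sphere (0 : ℂ) r) :=
    ContinuousOn.inv₀ (by fun_prop) fun ζ hζ => hne ζ (Metric.sphere_subset_closedBall hζ)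
  have h3 : (∮ ζ in C(0, r), (ζ - z)⁻¹ • (v ζ - u ζ)) = (2 * Real.pi * Complex.I : ℂ) • u z := by
    simp only [smul_sub]
    rw [circleIntegral.integral_sub, h1, h2]
    · simp
    · refine ContinuousOn.circleIntegrable h0.le (hkc.smul (hv.continuousOn.mono ?_))
      exact Metric.sphere_subset_closedBall.trans (Metric.closedBall_subset_ball hR)
    · refine ContinuousOn.circleIntegrable h0.le (hkc.smul (hu.continuousOn.mono ?_))
      intro ζ hζ; simp at hζ ⊢; linarith
  have hpi := Real.pi_pos
  have hd : 0 < ‖z‖ - r := by linarith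
  have h4 := circleIntegral.norm_integral_le_of_norm_le_const (c := 0) (R := r)
    (f := fun ζ => (ζ - z)⁻¹ • (v ζ - u ζ)) (C := (‖z‖ - r)⁻¹ * ε) h0.le (by
      intro ζ hζ
      have hζn : ‖ζ‖ = r := by simpa using hζ
      rw [norm_smul, norm_inv]
      have : ‖z‖ - r ≤ ‖ζ - z‖ := by
        have := norm_sub_norm_le z ζ
        rw [norm_sub_rev] at this; linarith
      gcongr
      exact hε ζ hζn)
  rw [h3, norm_smul] at h4
  have : ‖(2 * Real.pi * Complex.I : ℂ)‖ = 2 * Real.pi := by simp [abs_of_pos hpi]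
  rw [this] at h4
  rw [div_mul_eq_mul_div, le_div_iff₀ hd]
  have h5 : ‖u z‖ ≤ r * ((‖z‖ - r)⁻¹ * ε) := by
    refine le_of_mul_le_mul_left (a := 2 * Real.pi) ?_ (by positivity)
    linarith
  calc ‖u z‖ * (‖z‖ - r) ≤ r * ((‖z‖ - r)⁻¹ * ε) * (‖z‖ - r) := by gcongr
    _ = r * ε := by field_simp

/-- The companion of `norm_outer_le` for the function in the disc. -/
theorem norm_inner_le {u v : ℂ → E} {r₀ r R : ℝ} {ε : ℝ} (h0 : 0 < r) (hr : r₀ < r) (hR : r < R)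
    (hu : DifferentiableOn ℂ u {z | r₀ < ‖z‖}) (hu0 : Tendsto u (Bornology.cobounded ℂ) (𝓝 0))
    (hv : DifferentiableOn ℂ v (Metric.ball 0 R))
    (hε : ∀ z : ℂ, ‖z‖ = r → ‖v z - u z‖ ≤ ε) {z : ℂ} (hz : ‖z‖ < r) :
    ‖v z‖ ≤ r / (r - ‖z‖) * ε := by
  have h1 := circleIntegral_exterior_of_norm_lt h0 hr hu hu0 hz
  have hne : ∀ ζ ∈ Metric.sphere (0 : ℂ) r, ζ - z ≠ 0 := by
    intro ζ hζ h
    rw [sub_eq_zero.1 h] at hζ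
    simp at hζ; linarith
  have h2 : (∮ ζ in C(0, r), (ζ - z)⁻¹ • v ζ) = (2 * Real.pi * Complex.I : ℂ) • v z :=
    DifferentiableOn.circleIntegral_sub_inv_smul
      (hv.mono (Metric.closedBall_subset_ball hR)) (by simpa using hz)
  have hkc : ContinuousOn (fun ζ => (ζ - z)⁻¹) (Metric.sphere (0 : ℂ) r) :=
    ContinuousOn.inv₀ (by fun_prop) hne
  have h3 : (∮ ζ in C(0, r), (ζ - z)⁻¹ • (v ζ - u ζ)) = (2 * Real.pi * Complex.I : ℂ) • v z := by
    simp only [smul_sub]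
    rw [circleIntegral.integral_sub, h1, h2]
    · simp
    · refine ContinuousOn.circleIntegrable h0.le (hkc.smul (hv.continuousOn.mono ?_))
      exact Metric.sphere_subset_closedBall.trans (Metric.closedBall_subset_ball hR)
    · refine ContinuousOn.circleIntegrable h0.le (hkc.smul (hu.continuousOn.mono ?_))
      intro ζ hζ; simp at hζ ⊢; linarith
  have hpi := Real.pi_pos
  have hd : 0 < r - ‖z‖ := by linarith
  have h4 := circleIntegral.norm_integral_le_of_norm_le_const (c := 0) (R := r)
    (f := fun ζ => (ζ - z)⁻¹ • (v ζ - u ζ)) (C := (r - ‖z‖)⁻¹ * ε) h0.le (by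
      intro ζ hζ
      have hζn : ‖ζ‖ = r := by simpa using hζ
      rw [norm_smul, norm_inv]
      have : r - ‖z‖ ≤ ‖ζ - z‖ := by
        have := norm_sub_norm_le ζ z
        linarith
      gcongr
      exact hε ζ hζn)
  rw [h3, norm_smul] at h4
  have : ‖(2 * Real.pi * Complex.I : ℂ)‖ = 2 * Real.pi := by simp [abs_of_pos hpi]
  rw [this] at h4
  rw [div_mul_eq_mul_div, le_div_iff₀ hd]
  have h5 : ‖v z‖ ≤ r * ((r - ‖z‖)⁻¹ * ε) := by
    refine le_of_mul_le_mul_left (a := 2 * Real.pi) ?_ (by positivity)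
    linarith
  calc ‖v z‖ * (r - ‖z‖) ≤ r * ((r - ‖z‖)⁻¹ * ε) * (r - ‖z‖) := by gcongr
    _ = r * ε := by field_simp

end Splitting

section SmallNorm

variable {𝔸 : Type*} [NormedRing 𝔸] [NormedAlgebra ℂ 𝔸] [CompleteSpace 𝔸]

/-- First order perturbation of a factorization `zin = zout H` across an annulus, when the jump `H`
differs from one by `t (Din - Dout) + o(t)` on two circles. Two circles are used because the Cauchy
integral over one of them is only estimated away from it. -/
theorem small_norm_factorization {r₀ r₁ r₂ R : ℝ} (h0 : 0 < r₁) (h01 : r₀ < r₁) (h12 : r₁ < r₂)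
    (h2R : r₂ < R) {zin zout H : ℝ → ℂ → 𝔸} {Din Dout : ℂ → 𝔸} {ε : ℝ → ℝ}
    (hin : ∀ᶠ t in 𝓝 0, DifferentiableOn ℂ (zin t) (Metric.ball 0 R))
    (hout : ∀ᶠ t in 𝓝 0, DifferentiableOn ℂ (zout t) {z | r₀ < ‖z‖})
    (hlim : ∀ᶠ t in 𝓝 0, Tendsto (zout t) (Bornology.cobounded ℂ) (𝓝 1))
    (heq : ∀ᶠ t in 𝓝 0, ∀ z : ℂ, ‖z‖ = r₁ ∨ ‖z‖ = r₂ → zin t z = zout t z * H t z)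
    (hDin : DifferentiableOn ℂ Din (Metric.ball 0 R))
    (hDout : DifferentiableOn ℂ Dout {z | r₀ < ‖z‖})
    (hD0 : Tendsto Dout (Bornology.cobounded ℂ) (𝓝 0))
    (hε : ε =o[𝓝 0] (fun t : ℝ => t))
    (hH : ∀ᶠ t in 𝓝 0, ∀ z : ℂ, ‖z‖ = r₁ ∨ ‖z‖ = r₂ →
      ‖H t z - 1 - (t : ℂ) • (Din z - Dout z)‖ ≤ ε t) :
    ∃ δ : ℝ → ℝ, δ =o[𝓝 0] (fun t : ℝ => t) ∧ ∀ᶠ t in 𝓝 0,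
      (∀ z : ℂ, r₁ < ‖z‖ → ‖zout t z - 1 - (t : ℂ) • Dout z‖ ≤ r₁ / (‖z‖ - r₁) * δ t) ∧
      (∀ z : ℂ, ‖z‖ < r₂ → ‖zin t z - 1 - (t : ℂ) • Din z‖ ≤ r₂ / (r₂ - ‖z‖) * δ t) := by
  set S : Set ℂ := Metric.sphere 0 r₁ ∪ Metric.sphere 0 r₂ with hS
  have hSmem : ∀ z : ℂ, z ∈ S ↔ ‖z‖ = r₁ ∨ ‖z‖ = r₂ := by intro z; simp [hS]
  have hScomp : IsCompact S := (isCompact_sphere _ _).union (isCompact_sphere _ _)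
  have hSne : S.Nonempty := ⟨(r₁ : ℂ), (hSmem _).2 (Or.inl (by simp [abs_of_pos h0]))⟩
  have hSout : S ⊆ {z | r₀ < ‖z‖} := by
    intro z hz; change r₀ < ‖z‖; rcases (hSmem z).1 hz with h | h <;> linarith
  have hSin : S ⊆ Metric.ball 0 R := by
    intro z hz; rw [mem_ball_zero_iff]; rcases (hSmem z).1 hz with h | h <;> linarith
  obtain ⟨C, hC⟩ := hScomp.exists_bound_of_continuousOn
    ((hDin.continuousOn.mono hSin).sub (hDout.continuousOn.mono hSout))
  set κ : ℝ := r₂ / (r₂ - r₁) with hκ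
  have hκ0 : 0 < κ := by have : 0 < r₂ - r₁ := by linarith
                         have : 0 < r₂ := by linarith
                         positivity
  set η : ℝ → ℝ := fun t => |t| * |C| + |ε t| with hη
  have hεO : (fun t => |ε t|) =O[𝓝 0] (fun t : ℝ => t) := (hε.isBigO).abs_left
  have hηO : η =O[𝓝 0] (fun t : ℝ => t) := by
    refine IsBigO.add ?_ hεO
    have : (fun t : ℝ => |t|) =O[𝓝 0] (fun t : ℝ => t) := (isBigO_refl _ _).abs_left
    simpa [mul_comm] using this.const_mul_left |C|
  have hη0 : Tendsto η (𝓝 0) (𝓝 0) := hηO.trans_tendsto tendsto_id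
  refine ⟨fun t => 2 * (κ + 1) * η t ^ 2 + |ε t|, ?_, ?_⟩
  · refine IsLittleO.add ?_ hε.abs_left
    refine IsLittleO.const_mul_left ?_ _
    have h1 : (fun t => η t ^ 2) =O[𝓝 0] (fun t : ℝ => t ^ 2) := hηO.pow 2
    exact h1.trans_isLittleO (isLittleO_pow_id one_lt_two)
  have hsmall : ∀ᶠ t in 𝓝 0, (κ + 1) * η t < 1 / 2 := by
    have : Tendsto (fun t => (κ + 1) * η t) (𝓝 0) (𝓝 0) := by simpa using hη0.const_mul (κ + 1)
    exact this.eventually_lt_const (by norm_num)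
  filter_upwards [hin, hout, hlim, heq, hH, hsmall] with t hin hout hlim heq hH hsmall
  have hη_nonneg : 0 ≤ η t := by positivity
  have hH1 : ∀ z ∈ S, ‖H t z - 1‖ ≤ η t := by
    intro z hz
    have e1 : H t z - 1 = (t : ℂ) • (Din z - Dout z) + (H t z - 1 - (t : ℂ) • (Din z - Dout z)) := by
      abel
    rw [e1]
    refine (norm_add_le _ _).trans (add_le_add ?_ ?_)
    · rw [norm_smul, Complex.norm_real, Real.norm_eq_abs]
      gcongr
      exact (hC z hz).trans (le_abs_self C)
    · exact (hH z ((hSmem z).1 hz)).trans (le_abs_self _)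
  have hcont : ContinuousOn (fun z => ‖zout t z - 1‖) S :=
    ((hout.continuousOn.mono hSout).sub continuousOn_const).norm
  obtain ⟨z₁, hz₁S, hz₁⟩ := hScomp.exists_isMaxOn hSne hcont
  set m : ℝ := ‖zout t z₁ - 1‖ with hm
  have hm0 : 0 ≤ m := norm_nonneg _
  have hmle : ∀ z ∈ S, ‖zout t z - 1‖ ≤ m := fun z hz => hz₁ hz
  have hbd : ∀ z ∈ S, ‖(zin t z - 1) - (zout t z - 1)‖ ≤ (m + 1) * η t := by
    intro z hz
    have e1 : (zin t z - 1) - (zout t z - 1) = (zout t z - 1) * (H t z - 1) + (H t z - 1) := by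
      rw [heq z ((hSmem z).1 hz)]; noncomm_ring
    rw [e1]
    refine (norm_add_le _ _).trans ?_
    have h3 := (norm_mul_le (zout t z - 1) (H t z - 1)).trans
      (mul_le_mul (hmle z hz) (hH1 z hz) (norm_nonneg _) hm0)
    have h4 := hH1 z hz
    linarith
  have hbd1 : ∀ z : ℂ, ‖z‖ = r₁ → ‖(zin t z - 1) - (zout t z - 1)‖ ≤ (m + 1) * η t :=
    fun z hz => hbd z ((hSmem z).2 (Or.inl hz))
  have hbd2 : ∀ z : ℂ, ‖z‖ = r₂ → ‖(zin t z - 1) - (zout t z - 1)‖ ≤ (m + 1) * η t :=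
    fun z hz => hbd z ((hSmem z).2 (Or.inr hz))
  have hu : DifferentiableOn ℂ (fun z => zout t z - 1) {z | r₀ < ‖z‖} := hout.sub_const 1
  have hv : DifferentiableOn ℂ (fun z => zin t z - 1) (Metric.ball 0 R) := hin.sub_const 1
  have hu0 : Tendsto (fun z => zout t z - 1) (Bornology.cobounded ℂ) (𝓝 0) := by
    simpa using hlim.sub_const 1
  have hr21 : 0 < r₂ - r₁ := by linarith
  have hmbd : m ≤ (κ + 1) * ((m + 1) * η t) := by
    have hpos : 0 ≤ (m + 1) * η t := by positivity
    rcases (hSmem z₁).1 hz₁S with h | h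
    · have h5 := norm_inner_le (z := z₁) (h0.trans h12) (h01.trans h12) h2R hu hu0 hv hbd2
        (by linarith)
      rw [h] at h5
      have h6 := hbd1 z₁ h
      have e2 : zout t z₁ - 1 = (zin t z₁ - 1) - ((zin t z₁ - 1) - (zout t z₁ - 1)) := by abel
      calc m = ‖(zin t z₁ - 1) - ((zin t z₁ - 1) - (zout t z₁ - 1))‖ := by rw [hm, ← e2]
        _ ≤ _ := norm_sub_le _ _
        _ ≤ κ * ((m + 1) * η t) + (m + 1) * η t := add_le_add h5 h6
        _ = _ := by ring
    · have h5 := norm_outer_le (z := z₁) h0 h01 (h12.trans h2R) hu hu0 hv hbd1 (by linarith)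
      rw [h] at h5
      refine h5.trans ?_
      gcongr
      have : r₁ / (r₂ - r₁) ≤ κ := by rw [hκ]; gcongr
      linarith
  have hm2 : m ≤ 2 * (κ + 1) * η t := by nlinarith
  have hbd' : ∀ z ∈ S, ‖(zin t z - 1 - (t : ℂ) • Din z) - (zout t z - 1 - (t : ℂ) • Dout z)‖ ≤
      2 * (κ + 1) * η t ^ 2 + |ε t| := by
    intro z hz
    have e1 : (zin t z - 1 - (t : ℂ) • Din z) - (zout t z - 1 - (t : ℂ) • Dout z) =
        (zout t z - 1) * (H t z - 1) + (H t z - 1 - (t : ℂ) • (Din z - Dout z)) := by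
      rw [heq z ((hSmem z).1 hz), smul_sub]; noncomm_ring
    rw [e1]
    refine (norm_add_le _ _).trans (add_le_add ?_ ((hH z ((hSmem z).1 hz)).trans (le_abs_self _)))
    refine (norm_mul_le _ _).trans ?_
    calc ‖zout t z - 1‖ * ‖H t z - 1‖ ≤ (2 * (κ + 1) * η t) * η t :=
          mul_le_mul ((hmle z hz).trans hm2) (hH1 z hz) (norm_nonneg _) (by positivity)
      _ = _ := by ring
  have hu' : DifferentiableOn ℂ (fun z => zout t z - 1 - (t : ℂ) • Dout z) {z | r₀ < ‖z‖} :=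
    hu.sub (hDout.fun_const_smul _)
  have hv' : DifferentiableOn ℂ (fun z => zin t z - 1 - (t : ℂ) • Din z) (Metric.ball 0 R) :=
    hv.sub (hDin.fun_const_smul _)
  have hu0' : Tendsto (fun z => zout t z - 1 - (t : ℂ) • Dout z) (Bornology.cobounded ℂ) (𝓝 0) := by
    simpa using hu0.sub (hD0.const_smul (t : ℂ))
  exact ⟨fun z hz => norm_outer_le h0 h01 (h12.trans h2R) hu' hu0' hv'
      (fun z hz => hbd' z ((hSmem z).2 (Or.inl hz))) hz,
    fun z hz => norm_inner_le (h0.trans h12) (h01.trans h12) h2R hu' hu0' hv'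
      (fun z hz => hbd' z ((hSmem z).2 (Or.inr hz))) hz⟩

end SmallNorm

/-! ### The logarithmic derivative in `z` -/

section LogDerivative

variable {k : ℕ} {α l s : ℝ} {M : ℂ → Mat} {a : ℂ}

/-- The Pauli matrix `σ₃`. -/
noncomputable def sigma3 : Mat := !![1, 0; 0, -1]

/-- The logarithmic derivative `M' M⁻¹`, for `M` of determinant one. -/
noncomputable def logD (M : ℂ → Mat) (z : ℂ) : Mat := deriv M z * adjL (M z)

theorem IsRHSolution.differentiableAt (h : IsRHSolution k α l s M a) (hs : 0 < s) {z : ℂ}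
    (hz : z ∈ Omega s) : DifferentiableAt ℂ M z :=
  h.diffOn.differentiableAt ((isOpen_Omega hs).mem_nhds hz)

theorem IsRHSolution.hasDerivAt (h : IsRHSolution k α l s M a) (hs : 0 < s) {z : ℂ}
    (hz : z ∈ Omega s) : HasDerivAt M (logD M z * M z) z := by
  rw [logD, mul_assoc, adjL_mul_self (h.det_eq_one hs hz), mul_one]
  exact (h.differentiableAt hs hz).hasDerivAt

/-- Off the real axis, `Omega` is covered by open sets on which `piecewiseE` is constant. -/
theorem exists_piecewiseE_const (hs : 0 < s) {z : ℂ} (hz : z ∈ Omega s) (him : z.im ≠ 0) :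
    ∃ S : Set ℂ, IsOpen S ∧ z ∈ S ∧ ∃ A : Mat, ∀ w ∈ S, piecewiseE α s w = A := by
  have h := (mem_Omega hs).1 hz
  rcases lt_or_gt_of_ne him with h1 | h1
  · rcases lt_trichotomy (Real.sqrt 3 * (z.re + s) - z.im) 0 with h2 | h2 | h2
    · exact ⟨_, isOpen_sectorIV s, mem_sectorIV.2 ⟨h1, h2⟩, _, fun w hw => piecewiseE_IV hw⟩
    · exact absurd ⟨h1, h2⟩ h.2.2
    · exact ⟨_, isOpen_sectorV s, mem_sectorV.2 ⟨h1, h2⟩, _, fun w hw => piecewiseE_V hw⟩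
  · rcases lt_trichotomy (Real.sqrt 3 * (z.re + s) + z.im) 0 with h2 | h2 | h2
    · exact ⟨_, isOpen_sectorIII s, mem_sectorIII.2 ⟨h1, h2⟩, _, fun w hw => piecewiseE_III hw⟩
    · exact absurd ⟨h1, h2⟩ h.2.1
    · exact ⟨_, isOpen_sectorII s, mem_sectorII.2 ⟨h1, h2⟩, _, fun w hw => piecewiseE_II hw⟩

theorem hasDerivAt_jumpFactor (hs : 0 < s) {z : ℂ} (hz : z ∈ Omega s) (him : z.im ≠ 0) :
    HasDerivAt (jumpFactor α s)
      (((2 * Real.pi * Complex.I * (z + s))⁻¹ • sigmaPlus) * jumpFactor α s z) z := by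
  obtain ⟨S, hS, hzS, A, hA⟩ := exists_piecewiseE_const (α := α) hs hz him
  have hsl : z + s ∈ Complex.slitPlane := slitPlane_of_im_ne him
  have h1 : HasDerivAt (logFactor s) ((2 * Real.pi * Complex.I * (z + s))⁻¹) z := by
    have := (((hasDerivAt_id z).add_const (s : ℂ)).clog hsl).div_const (2 * Real.pi * Complex.I)
    refine this.congr_deriv ?_
    rw [div_div, one_div, mul_comm]; rfl
  have h2 : HasDerivAt (fun w => upper (logFactor s w) * A)
      ((((2 * Real.pi * Complex.I * (z + s))⁻¹) • sigmaPlus) * A) z := by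
    unfold upper
    exact ((h1.smul_const sigmaPlus).const_add 1).mul_const A
  have h3 : ((2 * Real.pi * Complex.I * (z + s))⁻¹ • sigmaPlus) * jumpFactor α s z =
      (((2 * Real.pi * Complex.I * (z + s))⁻¹) • sigmaPlus) * A := by
    rw [jumpFactor, hA z hzS, ← mul_assoc]
    congr 1
    rw [upper_eq, sigmaPlus]
    ext i j; fin_cases i <;> fin_cases j <;> simp
  rw [h3]
  refine h2.congr_of_eventuallyEq ?_
  filter_upwards [hS.mem_nhds hzS] with w hw
  rw [jumpFactor, hA w hw]

/-- The logarithmic derivative of a product `F J`, when `J' J⁻¹` is known. -/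
theorem logD_of_eventuallyEq {F J : ℂ → Mat} {F' J' : Mat} {z : ℂ} (hM : M =ᶠ[𝓝 z] fun w => F w * J w)
    (hF : HasDerivAt F F' z) (hJ : HasDerivAt J (J' * J z) z) (hJ1 : (J z).det = 1)
    : logD M z = F' * adjL (F z) + F z * J' * adjL (F z) := by
  have h1 : HasDerivAt M (F' * J z + F z * (J' * J z)) z := (hF.mul hJ).congr_of_eventuallyEq hM
  have h1' : deriv M z = F' * J z + F z * (J' * J z) := h1.deriv
  rw [logD, h1', hM.eq_of_nhds, adjL_mul]
  have : (F' * J z + F z * (J' * J z)) * (adjL (J z) * adjL (F z)) =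
      F' * (J z * adjL (J z)) * adjL (F z) + F z * J' * (J z * adjL (J z)) * adjL (F z) := by
    noncomm_ring
  rw [this, mul_adjL hJ1]
  simp

theorem eventually_eq_of_mem {f g : ℂ → Mat} {W : Set ℂ} (hW : IsOpen W) {z₀ : ℂ}
    (h : ∀ᶠ z in 𝓝[W] z₀, f z = g z) : ∀ᶠ z in 𝓝[W] z₀, f =ᶠ[𝓝 z] g := by
  rw [eventually_nhdsWithin_iff] at h ⊢
  filter_upwards [h.eventually_nhds] with z hz hzW
  filter_upwards [hz, hW.mem_nhds hzW] with w hw hwW using hw hwW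

/-- Near a point of the contour other than the origin, the logarithmic derivative is meromorphic,
with a simple pole with nilpotent residue at `-s`. -/
theorem IsRHSolution.logD_eq_near_contour (h : IsRHSolution k α l s M a) (hs : 0 < s) {z₀ : ℂ}
    (hz : z₀ ∉ Omega s) (hz0 : z₀ ≠ 0) :
    ∃ F : ℂ → Mat, AnalyticAt ℂ F z₀ ∧ ∀ᶠ z in 𝓝[Omega s] z₀, (F z).det = 1 ∧
      logD M z = deriv F z * adjL (F z) +
        (2 * Real.pi * Complex.I * (z + s))⁻¹ • (F z * sigmaPlus * adjL (F z)) := by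
  obtain ⟨F, hF, hev⟩ := h.exists_factor hs hz hz0
  refine ⟨F, hF, ?_⟩
  have him : ∀ᶠ z in 𝓝[Omega s] z₀, z.im ≠ 0 := by
    by_cases hi : z₀.im = 0
    · have hre : z₀.re < 0 := by
        rw [mem_Omega hs] at hz
        have hr0 : z₀.re ≤ 0 := by grind
        refine lt_of_le_of_ne hr0 fun h0 => hz0 (Complex.ext h0 hi)
      have e : ∀ᶠ z : ℂ in 𝓝 z₀, z.re < 0 :=
        ContinuousAt.eventually_lt (g := fun _ => (0 : ℝ)) (by fun_prop) (by fun_prop) hre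
      filter_upwards [nhdsWithin_le_nhds e, self_mem_nhdsWithin] with z h1 h2 h3
      exact ((mem_Omega hs).1 h2).1 ⟨h3, h1.le⟩
    · exact nhdsWithin_le_nhds ((Complex.continuous_im.continuousAt).eventually_ne hi)
  filter_upwards [eventually_eq_of_mem (isOpen_Omega hs) hev, him, self_mem_nhdsWithin,
    nhdsWithin_le_nhds hF.eventually_analyticAt] with z h1 h2 h3 h4
  have hdet : (F z).det = 1 := by
    have := h.det_eq_one hs h3
    rwa [h1.eq_of_nhds, Matrix.det_mul, det_jumpFactor, mul_one] at this
  refine ⟨hdet, ?_⟩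
  rw [logD_of_eventuallyEq h1 h4.differentiableAt.hasDerivAt (hasDerivAt_jumpFactor hs h3 h2)
    (det_jumpFactor _ _ _)]
  simp only [mul_smul_comm, smul_mul_assoc]
  rfl

/-- The derivative of the exponent of the local form at the origin. -/
noncomputable def zeroExponent (k : ℕ) (α : ℝ) (z : ℂ) : ℂ :=
  (-1) ^ k * k / z ^ (k + 1) + α / (2 * z)

theorem hasDerivAt_zeroFactor {k : ℕ} {α : ℝ} {z : ℂ} (hz : z ∈ Complex.slitPlane) :
    HasDerivAt (fun w => expSigma3 (theta k w) * powSigma3 w (α / 2))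
      ((zeroExponent k α z • sigma3) * (expSigma3 (theta k z) * powSigma3 z (α / 2))) z := by
  have hz0 := Complex.slitPlane_ne_zero hz
  have ht : HasDerivAt (theta k) ((-1) ^ k * k / z ^ (k + 1)) z := by
    have := ((hasDerivAt_pow k z).fun_inv (pow_ne_zero k hz0)).const_mul ((-1 : ℂ) ^ (k + 1))
    simp only [← div_eq_mul_inv] at this
    refine this.congr_deriv ?_
    rcases k with _ | k
    · simp
    · simp only [Nat.add_sub_cancel]; push_cast; field_simp; ring
  have hp : ∀ c : ℂ, HasDerivAt (fun w : ℂ => w ^ c) (c / z * z ^ c) z := by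
    intro c
    refine ((hasDerivAt_id z).cpow_const (c := c) hz).congr_deriv ?_
    simp only [id]
    rw [Complex.cpow_sub _ _ hz0, Complex.cpow_one]; field_simp
  have e : ∀ w, expSigma3 (theta k w) * powSigma3 w (α / 2) =
      !![Complex.exp (theta k w) * w ^ (α / 2 : ℂ), 0;
        0, Complex.exp (-theta k w) * w ^ (-(α / 2) : ℂ)] := by
    intro w
    ext i j; fin_cases i <;> fin_cases j <;> simp [expSigma3, powSigma3]
  simp only [e]
  apply hasDerivAt_mat
  intro i j
  fin_cases i <;> fin_cases j <;> simp [sigma3, zeroExponent]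
  · refine (ht.cexp.mul (hp (α / 2))).congr_deriv ?_
    field_simp
  · exact hasDerivAt_const _ _
  · exact hasDerivAt_const _ _
  · refine (ht.neg.cexp.mul (hp (-(α / 2)))).congr_deriv ?_
    simp only [Pi.neg_apply]
    field_simp
    ring

/-- The local form at the origin, with its consequence for the logarithmic derivative. -/
theorem IsRHSolution.logD_eq_near_zero (h : IsRHSolution k α l s M a) (hs : 0 < s) :
    ∃ P : ℂ → Mat, DifferentiableOn ℂ P (Metric.ball 0 s) ∧
      (∀ z ∈ Metric.ball (0 : ℂ) s, (P z).det = 1) ∧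
      (∀ z ∈ Omega s ∩ Metric.ball 0 s,
        M z = P z * expSigma3 (theta k z) * powSigma3 z (α / 2)) ∧
      ∀ z ∈ Omega s ∩ Metric.ball 0 s, logD M z = deriv P z * adjL (P z) +
        zeroExponent k α z • (P z * sigma3 * adjL (P z)) := by
  obtain ⟨P, hP, hP1, hPM⟩ := h.exists_disc_factor hs
  refine ⟨P, hP, hP1, hPM, fun z hz => ?_⟩
  have hz0 := ne_zero_of_mem_Omega hs hz.1
  have hev : M =ᶠ[𝓝 z] fun w => P w * (expSigma3 (theta k w) * powSigma3 w (α / 2)) := by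
    filter_upwards [((isOpen_Omega hs).inter Metric.isOpen_ball).mem_nhds hz] with w hw
    rw [hPM w hw, mul_assoc]
  rw [logD_of_eventuallyEq hev (hP.differentiableAt (Metric.isOpen_ball.mem_nhds hz.2)).hasDerivAt
    (hasDerivAt_zeroFactor (Omega_subset_slitPlane hs hz.1)) ?_]
  · simp only [mul_smul_comm, smul_mul_assoc]
    rfl
  · rw [Matrix.det_mul, det_expSigma3, det_powSigma3 hz0, one_mul]

theorem differentiableOn_logD (h : IsRHSolution k α l s M a) (hs : 0 < s) :
    DifferentiableOn ℂ (logD M) (Omega s) :=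
  (h.diffOn.deriv (isOpen_Omega hs)).mul (adjL.differentiable.comp_differentiableOn h.diffOn)

/-- The logarithmic derivative is the quotient of an entire function by `z^{k+1} (z + s)`. -/
theorem IsRHSolution.exists_entire (h : IsRHSolution k α l s M a) (hs : 0 < s) :
    ∃ Q : ℂ → Mat, Differentiable ℂ Q ∧
      ∀ z ∈ Omega s, Q z = (z ^ (k + 1) * (z + s)) • logD M z := by
  obtain ⟨Q, hQ, hQM⟩ := exists_extension_of_local
    (f := fun z => (z ^ (k + 1) * (z + s)) • logD M z) (U := Set.univ)
    (isOpen_Omega hs) (dense_Omega hs) isOpen_univ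
    ((Differentiable.differentiableOn (𝕜 := ℂ) (f := fun z : ℂ => z ^ (k + 1) * (z + s))
      (by fun_prop)).fun_smul ((differentiableOn_logD h hs).mono Set.inter_subset_left)) (by
      intro z₀ _ hz₀
      by_cases h0 : z₀ = 0
      · subst h0
        obtain ⟨P, hP, hP1, -, hPM⟩ := h.logD_eq_near_zero hs
        have hPa : AnalyticAt ℂ P 0 := hP.analyticAt (Metric.ball_mem_nhds _ hs)
        refine ⟨fun z => (z ^ (k + 1) * (z + s)) • (deriv P z * adjL (P z)) +
          (((-1) ^ k * k + α / 2 * z ^ k) * (z + s)) • (P z * sigma3 * adjL (P z)), ?_, ?_⟩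
        · refine AnalyticAt.add
            (AnalyticAt.smul (f := fun z : ℂ => z ^ (k + 1) * (z + s)) (by fun_prop) ?_)
            (AnalyticAt.smul (f := fun z : ℂ => ((-1) ^ k * k + α / 2 * z ^ k) * (z + s))
              (by fun_prop) ?_)
          · exact hPa.deriv.mul (AnalyticAt.adjL_comp hPa)
          · exact (hPa.mul analyticAt_const).mul (AnalyticAt.adjL_comp hPa)
        · filter_upwards [self_mem_nhdsWithin,
            nhdsWithin_le_nhds (Metric.ball_mem_nhds (0 : ℂ) hs)] with z hz hzb
          have hz0 := ne_zero_of_mem_Omega hs hz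
          rw [hPM z ⟨hz, hzb⟩, smul_add, smul_smul]
          congr 2
          rw [zeroExponent]; field_simp; ring
      · obtain ⟨F, hF, hev⟩ := h.logD_eq_near_contour hs hz₀ h0
        refine ⟨fun z => (z ^ (k + 1) * (z + s)) • (deriv F z * adjL (F z)) +
          (z ^ (k + 1) * (2 * Real.pi * Complex.I)⁻¹) • (F z * sigmaPlus * adjL (F z)), ?_, ?_⟩
        · refine AnalyticAt.add
            (AnalyticAt.smul (f := fun z : ℂ => z ^ (k + 1) * (z + s)) (by fun_prop) ?_)
            (AnalyticAt.smul (f := fun z : ℂ => z ^ (k + 1) * (2 * Real.pi * Complex.I)⁻¹)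
              (by fun_prop) ?_)
          · exact hF.deriv.mul (AnalyticAt.adjL_comp hF)
          · exact (hF.mul analyticAt_const).mul (AnalyticAt.adjL_comp hF)
        · filter_upwards [hev, self_mem_nhdsWithin] with z hz hzΩ
          have hzs : z + s ≠ 0 := by
            intro hc
            rw [mem_Omega hs] at hzΩ
            have : z = -(s : ℂ) := by linear_combination hc
            exact hzΩ.1 (by rw [this]; simp [hs.le])
          have hpi : (2 * (Real.pi : ℂ) * Complex.I) ≠ 0 := Complex.two_pi_I_ne_zero
          rw [hz.2, smul_add, smul_smul]
          congr 2
          rw [mul_inv]; field_simp)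
  exact ⟨Q, differentiableOn_univ.1 hQ, fun z hz => hQM z ⟨hz, trivial⟩⟩

theorem add_ne_zero_of_mem_Omega (hs : 0 < s) {z : ℂ} (hz : z ∈ Omega s) : z + s ≠ 0 := by
  intro hc
  rw [mem_Omega hs] at hz
  have : z = -(s : ℂ) := by linear_combination hc
  exact hz.1 (by rw [this]; simp [hs.le])

theorem differentiableOn_normalized (h : IsRHSolution k α l s M a) (hs : 0 < s) :
    DifferentiableOn ℂ (normalized l a M) (Omega s) := by
  intro z hz
  apply DifferentiableAt.differentiableWithinAt
  refine ((h.differentiableAt hs hz).const_mul _).mul (adjL.differentiableAt.comp z ?_)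
  exact (hasDerivAt_modelInfinity l (Omega_subset_slitPlane hs hz)).differentiableAt

/-- The logarithmic derivative in terms of the normalized solution. -/
theorem IsRHSolution.logD_eq_normalized (h : IsRHSolution k α l s M a) (hs : 0 < s) {z : ℂ}
    (hz : z ∈ Omega s) :
    logD M z = lower a * (deriv (normalized l a M) z * adjL (normalized l a M z) +
      normalized l a M z * modelLog l z * adjL (normalized l a M z)) * adjL (lower a) := by
  have hz0 := ne_zero_of_mem_Omega hs hz
  have hev : M =ᶠ[𝓝 z] fun w => (lower a * normalized l a M w) * modelInfinity l w := by
    filter_upwards [isOpen_ne.mem_nhds hz0] with w hw using eq_normalized hw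
  have hY := ((differentiableOn_normalized h hs).differentiableAt
    ((isOpen_Omega hs).mem_nhds hz)).hasDerivAt
  rw [logD_of_eventuallyEq hev (hY.const_mul (lower a))
    (hasDerivAt_modelInfinity l (Omega_subset_slitPlane hs hz)) (det_modelInfinity l hz0),
    adjL_mul]
  simp only [mul_add, add_mul, mul_assoc]
  rfl

end LogDerivative

/-! ### Growth of the logarithmic derivative -/

section Growth

variable {k : ℕ} {α l s : ℝ} {M : ℂ → Mat} {a : ℂ}

theorem norm_modelLog_le (l : ℝ) {z : ℂ} (hz : 1 ≤ ‖z‖) : ‖modelLog l z‖ ≤ 2 * (1 + |l|) := by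
  have hinv : ‖z‖⁻¹ ≤ 1 := inv_le_one_of_one_le₀ hz
  have hl := abs_nonneg l
  have hp : 0 ≤ ‖z‖⁻¹ := by positivity
  apply norm_le_of_entries
  intro i j
  fin_cases i <;> fin_cases j <;> simp [modelLog, div_eq_mul_inv] <;> nlinarith

theorem norm_adjL_le (A : Mat) : ‖adjL A‖ ≤ 2 * ‖A‖ := by
  apply norm_le_of_entries
  intro i j
  rw [adjL_apply]
  fin_cases i <;> fin_cases j <;> simp <;> exact entry_norm_le _ _ _

/-- At a distance `δ` of the contour, far from the origin, the logarithmic derivative is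
`O(1 / δ)`, by the Cauchy estimate. -/
theorem IsRHSolution.norm_logD_le (h : IsRHSolution k α l s M a) (hs : 0 < s) :
    ∃ C R : ℝ, 0 < C ∧ 0 < R ∧ ∀ (z : ℂ) (δ : ℝ), 0 < δ → δ ≤ 1 → Metric.ball z δ ⊆ Omega s →
      R ≤ ‖z‖ → ‖logD M z‖ ≤ C / δ := by
  obtain ⟨R, hR⟩ : ∃ R : ℝ, ∀ w ∈ Omega s, R ≤ ‖w‖ → ‖normalized l a M w‖ ≤ ‖(1 : Mat)‖ + 1 := by
    have h1 : ∀ᶠ w in Bornology.cobounded ℂ ⊓ 𝓟 (Omega s),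
        ‖normalized l a M w‖ < ‖(1 : Mat)‖ + 1 :=
      (h.tendsto_normalized hs).norm.eventually_lt_const (by linarith)
    rw [eventually_inf_principal, ← comap_norm_atTop, eventually_comap, eventually_atTop] at h1
    obtain ⟨R, hR⟩ := h1
    exact ⟨R, fun w hw hRw => (hR _ hRw w rfl hw).le⟩
  set K : ℝ := ‖(1 : Mat)‖ + 1 with hK
  have hK0 : 0 < K := by positivity
  refine ⟨‖lower a‖ * (2 * K * (2 * K) + K * (2 * (1 + |l|)) * (2 * K)) * ‖adjL (lower a)‖ + 1,
    |R| + 2, by positivity, by positivity, fun z δ hδ hδ1 hball hRz => ?_⟩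
  have hzΩ : z ∈ Omega s := hball (Metric.mem_ball_self hδ)
  have hbd : ∀ w ∈ Metric.ball z δ, ‖normalized l a M w‖ ≤ K := by
    intro w hw
    refine hR w (hball hw) ?_
    have h1 := norm_sub_norm_le z w
    rw [Metric.mem_ball, dist_comm, dist_eq_norm] at hw
    have := le_abs_self R
    linarith
  have hY : ‖normalized l a M z‖ ≤ K := hbd z (Metric.mem_ball_self hδ)
  have hsub : Metric.closedBall z (δ / 2) ⊆ Metric.ball z δ :=
    Metric.closedBall_subset_ball (by linarith)
  have hdiff : DiffContOnCl ℂ (normalized l a M) (Metric.ball z (δ / 2)) :=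
    ((differentiableOn_normalized h hs).mono (hsub.trans hball)).diffContOnCl_ball subset_rfl
  have hY' : ‖deriv (normalized l a M) z‖ ≤ K / (δ / 2) :=
    Complex.norm_deriv_le_of_forall_mem_sphere_norm_le (by linarith) hdiff
      fun w hw => hbd w (hsub (Metric.sphere_subset_closedBall hw))
  have hadj : ‖adjL (normalized l a M z)‖ ≤ 2 * K :=
    (norm_adjL_le _).trans (mul_le_mul_of_nonneg_left hY two_pos.le)
  have hlog := norm_modelLog_le l (z := z) (by have := abs_nonneg R; linarith)
  rw [h.logD_eq_normalized hs hzΩ]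
  have e1 : ‖deriv (normalized l a M) z * adjL (normalized l a M z)‖ ≤ 2 * K * (2 * K) / δ := by
    calc _ ≤ K / (δ / 2) * (2 * K) := (norm_mul_le _ _).trans (by gcongr)
      _ = _ := by field_simp
  have e2 : ‖normalized l a M z * modelLog l z * adjL (normalized l a M z)‖ ≤
      K * (2 * (1 + |l|)) * (2 * K) / δ := by
    calc _ ≤ K * (2 * (1 + |l|)) * (2 * K) :=
          (norm_mul_le _ _).trans (by
            refine mul_le_mul ((norm_mul_le _ _).trans (by gcongr)) hadj (norm_nonneg _)
              (by positivity))
      _ ≤ _ := le_div_self (by positivity) hδ hδ1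
  calc _ ≤ ‖lower a‖ * (2 * K * (2 * K) / δ + K * (2 * (1 + |l|)) * (2 * K) / δ) *
        ‖adjL (lower a)‖ := by
        refine (norm_mul_le _ _).trans ?_
        refine mul_le_mul_of_nonneg_right ((norm_mul_le _ _).trans ?_) (norm_nonneg _)
        exact mul_le_mul_of_nonneg_left ((norm_add_le _ _).trans (add_le_add e1 e2)) (norm_nonneg _)
    _ = (‖lower a‖ * (2 * K * (2 * K) + K * (2 * (1 + |l|)) * (2 * K)) * ‖adjL (lower a)‖) / δ := by
        ring
    _ ≤ _ := by gcongr; linarith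

/-- If `‖w‖ = r` and `‖u‖ = 1`, the distance of `w` to the ray through `u` is comparable to its
distance to the point of modulus `r` on that ray. -/
theorem norm_sub_le_two_mul_of_ray {w u : ℂ} {t : ℝ} (ht : 0 ≤ t) (hu : ‖u‖ = 1) :
    ‖w - ‖w‖ * u‖ ≤ 2 * ‖w - t * u‖ := by
  have h1 : ‖((t : ℂ) - ‖w‖) * u‖ ≤ ‖w - t * u‖ := by
    rw [norm_mul, hu, mul_one, ← Complex.ofReal_sub, Complex.norm_real, Real.norm_eq_abs]
    have := abs_norm_sub_norm_le w (t * u)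
    rw [norm_mul, hu, mul_one, Complex.norm_real, Real.norm_eq_abs, abs_of_nonneg ht] at this
    rwa [abs_sub_comm]
  calc ‖w - ‖w‖ * u‖ = ‖(w - t * u) + ((t : ℂ) - ‖w‖) * u‖ := by congr 1; ring
    _ ≤ _ := (norm_add_le _ _).trans (by linarith)

/-- The unit vectors along the unbounded rays of the contour. -/
noncomputable def rayDir : Fin 3 → ℂ := ![-1, ⟨-1 / 2, Real.sqrt 3 / 2⟩, ⟨-1 / 2, -(Real.sqrt 3 / 2)⟩]

theorem norm_rayDir (i : Fin 3) : ‖rayDir i‖ = 1 := by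
  have h33 : Real.sqrt 3 * Real.sqrt 3 = 3 := Real.mul_self_sqrt (by norm_num)
  rw [← sq_eq_sq₀ (norm_nonneg _) (by norm_num), Complex.sq_norm]
  fin_cases i <;> simp [rayDir, Complex.normSq_apply] <;> nlinarith

/-- The bounded part of the contour lies in a disc about `-s`, the rest on three rays from `-s`. -/
theorem exists_ray_of_notMem (hs : 0 < s) {z : ℂ} (hz : z ∉ Omega s) :
    ‖z + s‖ ≤ s ∨ ∃ i, ∃ t : ℝ, 0 ≤ t ∧ z + s = t * rayDir i := by
  have h33 : Real.sqrt 3 * Real.sqrt 3 = 3 := Real.mul_self_sqrt (by norm_num)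
  have h3 := sqrt3_pos
  rw [mem_Omega hs] at hz
  by_cases h1 : z.im = 0 ∧ z.re ≤ 0
  · have e : z + s = ((z.re + s : ℝ) : ℂ) := by
      apply Complex.ext <;> simp [h1.1]
    by_cases h2 : 0 ≤ z.re + s
    · left
      rw [e, Complex.norm_real, Real.norm_eq_abs, abs_of_nonneg h2]; linarith [h1.2]
    · exact Or.inr ⟨0, -(z.re + s), by linarith, by rw [e]; simp [rayDir]⟩
  · by_cases h2 : 0 < z.im
    · refine Or.inr ⟨1, -2 * (z.re + s), ?_, ?_⟩
      · have : Real.sqrt 3 * (z.re + s) + z.im = 0 := by grind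
        nlinarith
      · have : Real.sqrt 3 * (z.re + s) + z.im = 0 := by grind
        apply Complex.ext <;> simp [rayDir] <;> linarith
    · have h4 : z.im < 0 ∧ Real.sqrt 3 * (z.re + s) - z.im = 0 := by grind
      refine Or.inr ⟨2, -2 * (z.re + s), ?_, ?_⟩
      · nlinarith
      · apply Complex.ext <;> simp [rayDir] <;> linarith

/-- `∏ᵢ (w - r uᵢ)`, vanishing where the unbounded rays meet the circle of radius `r`. -/
noncomputable def rayProd (r : ℝ) (w : ℂ) : ℂ := ∏ i, (w - r * rayDir i)

theorem norm_sub_rayDir_le {r : ℝ} {w : ℂ} (hr : 0 ≤ r) (hw : ‖w‖ ≤ r) (i : Fin 3) :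
    ‖w - r * rayDir i‖ ≤ 2 * r := by
  refine (norm_sub_le _ _).trans ?_
  rw [norm_mul, norm_rayDir, Complex.norm_real, Real.norm_eq_abs, abs_of_nonneg hr]
  linarith

theorem norm_rayProd_le {r : ℝ} {w : ℂ} (hr : 0 ≤ r) (hw : ‖w‖ ≤ r) (i : Fin 3) :
    ‖rayProd r w‖ ≤ 4 * r ^ 2 * ‖w - r * rayDir i‖ := by
  rw [rayProd, norm_prod, ← Finset.mul_prod_erase _ _ (Finset.mem_univ i), mul_comm]
  refine mul_le_mul_of_nonneg_right ?_ (norm_nonneg _)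
  refine (Finset.prod_le_prod (g := fun _ => 2 * r) (fun _ _ => norm_nonneg _)
    fun j _ => norm_sub_rayDir_le hr hw j).trans ?_
  rw [Finset.prod_const, Finset.card_erase_of_mem (Finset.mem_univ i)]
  simp only [Finset.card_univ, Fintype.card_fin]
  apply le_of_eq; norm_num; ring

theorem le_norm_rayProd {r : ℝ} {w : ℂ} (hr : 0 ≤ r) (hw : ‖w‖ ≤ r / 2) :
    (r / 2) ^ 3 ≤ ‖rayProd r w‖ := by
  rw [rayProd, norm_prod]
  have : ∀ i, r / 2 ≤ ‖w - r * rayDir i‖ := by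
    intro i
    have h1 := norm_sub_norm_le (r * rayDir i) w
    rw [norm_mul, norm_rayDir, Complex.norm_real, Real.norm_eq_abs, abs_of_nonneg hr, norm_sub_rev]
      at h1
    linarith
  have h2 := Finset.prod_le_prod (s := Finset.univ) (f := fun _ : Fin 3 => r / 2)
    (g := fun i => ‖w - r * rayDir i‖) (fun _ _ => by positivity) fun i _ => this i
  rwa [Finset.prod_const, Finset.card_univ, Fintype.card_fin] at h2

/-- On the circle of radius `r` about `-s`, the distance to the contour is bounded below by a multiple
of `rayProd`. -/
theorem ball_subset_Omega (hs : 0 < s) {z : ℂ} {r : ℝ} (hr : s + 1 ≤ r) (hz : ‖z + s‖ = r) :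
    Metric.ball z (‖rayProd r (z + s)‖ / (8 * r ^ 3)) ⊆ Omega s := by
  intro y hy
  by_contra hyΩ
  have hr0 : 0 < r := by linarith
  have hr1 : 1 ≤ r := by linarith
  rw [Metric.mem_ball, dist_comm, dist_eq_norm, lt_div_iff₀ (by positivity)] at hy
  rcases exists_ray_of_notMem hs hyΩ with h1 | ⟨i, t, ht, h1⟩
  · have h2 := norm_rayProd_le hr0.le hz.le 0
    have h3 := norm_sub_rayDir_le hr0.le hz.le 0
    have h4 : 1 ≤ ‖z - y‖ := by
      have := norm_sub_norm_le (z + s) (y + s)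
      rw [add_sub_add_right_eq_sub] at this
      linarith
    nlinarith [pow_pos hr0 3, pow_pos hr0 2]
  · have h2 := norm_rayProd_le hr0.le hz.le i
    have h3 := norm_sub_le_two_mul_of_ray (w := z + s) ht (norm_rayDir i)
    rw [hz, ← h1, add_sub_add_right_eq_sub] at h3
    have h5 : r ^ 2 ≤ r ^ 3 := pow_le_pow_right₀ hr1 (by norm_num)
    have h6 := norm_nonneg (z - y)
    nlinarith [pow_pos hr0 2]

/-- The entire numerator of the logarithmic derivative has polynomial growth. The expansion at infinity
is not assumed to be differentiable up to the contour, so that the logarithmic derivative is only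
bounded by the inverse of the distance to the contour. Multiplication by `rayProd` compensates for
this on a large circle, and the maximum principle carries the bound inside. -/
theorem IsRHSolution.growth (h : IsRHSolution k α l s M a) (hs : 0 < s) {Q : ℂ → Mat}
    (hQ : Differentiable ℂ Q) (hQM : ∀ z ∈ Omega s, Q z = (z ^ (k + 1) * (z + s)) • logD M z) :
    ∃ C : ℝ, ∀ z, ‖Q z‖ ≤ C * (1 + ‖z‖) ^ (k + 2) := by
  obtain ⟨C, R, hC, hR, hb⟩ := h.norm_logD_le hs
  have key : ∀ (r : ℝ), R + s + 1 ≤ r → ∀ z : ℂ, ‖z + s‖ ≤ r / 2 →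
      ‖Q z‖ ≤ 64 * C * (2 * r) ^ (k + 1) * r := by
    intro r hr z hz
    have hr0 : 0 < r := by linarith
    have hdiff : DiffContOnCl ℂ (fun w => rayProd r (w + s) • Q w) (Metric.ball (-(s : ℂ)) r) := by
      apply Differentiable.diffContOnCl
      refine Differentiable.fun_smul ?_ hQ
      unfold rayProd
      fun_prop
    have hmax := Complex.norm_le_of_forall_mem_frontier_norm_le
      (C := 8 * r ^ 3 * (C * (2 * r) ^ (k + 1) * r)) Metric.isBounded_ball hdiff (fun w hw => ?_)
      (z := z) (subset_closure (by
        rw [Metric.mem_ball, dist_eq_norm, sub_neg_eq_add]; linarith))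
    · rw [norm_smul] at hmax
      have h1 := le_norm_rayProd hr0.le hz
      have h2 := (mul_le_mul_of_nonneg_right h1 (norm_nonneg (Q z))).trans hmax
      have h3 : 0 < (r / 2) ^ 3 := by positivity
      refine le_of_mul_le_mul_left (h2.trans (le_of_eq ?_)) h3
      ring
    · rw [frontier_ball _ hr0.ne', Metric.mem_sphere, dist_eq_norm, sub_neg_eq_add] at hw
      rw [norm_smul]
      by_cases h0 : rayProd r (w + s) = 0
      · rw [h0, norm_zero, zero_mul]; positivity
      · have hp : 0 < ‖rayProd r (w + s)‖ := norm_pos_iff.2 h0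
        have hball := ball_subset_Omega hs (by linarith) hw
        have hδ : 0 < ‖rayProd r (w + s)‖ / (8 * r ^ 3) := by positivity
        have hwΩ := hball (Metric.mem_ball_self hδ)
        have hδ1 : ‖rayProd r (w + s)‖ / (8 * r ^ 3) ≤ 1 := by
          rw [div_le_one (by positivity)]
          have e1 := norm_rayProd_le hr0.le hw.le 0
          have e2 := norm_sub_rayDir_le hr0.le hw.le 0
          nlinarith [pow_pos hr0 2]
        have hwR : R ≤ ‖w‖ := by
          have := norm_add_le w (s : ℂ)
          rw [hw, Complex.norm_real, Real.norm_eq_abs, abs_of_pos hs] at this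
          linarith
        have hw2 : ‖w‖ ≤ 2 * r := by
          have := norm_sub_le (w + s) (s : ℂ)
          rw [hw, Complex.norm_real, Real.norm_eq_abs, abs_of_pos hs, add_sub_cancel_right] at this
          linarith
        have h1 := hb w _ hδ hδ1 hball hwR
        rw [hQM w hwΩ, norm_smul, norm_mul, norm_pow, hw]
        calc ‖rayProd r (w + s)‖ * (‖w‖ ^ (k + 1) * r * ‖logD M w‖)
            ≤ ‖rayProd r (w + s)‖ * ((2 * r) ^ (k + 1) * r *
              (C / (‖rayProd r (w + s)‖ / (8 * r ^ 3)))) := by gcongr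
          _ = _ := by field_simp
  refine ⟨64 * C * (2 * (R + 3 * s + 3)) ^ (k + 1) * (R + 3 * s + 3), fun z => ?_⟩
  have hz : ‖z + s‖ ≤ ‖z‖ + s := by
    refine (norm_add_le _ _).trans ?_
    rw [Complex.norm_real, Real.norm_eq_abs, abs_of_pos hs]
  have hz0 := norm_nonneg z
  refine (key (R + s + 1 + 2 * (‖z‖ + s)) (by linarith) z (by linarith)).trans ?_
  have e : R + s + 1 + 2 * (‖z‖ + s) ≤ (R + 3 * s + 3) * (1 + ‖z‖) := by nlinarith
  calc _ ≤ 64 * C * (2 * ((R + 3 * s + 3) * (1 + ‖z‖))) ^ (k + 1) *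
      ((R + 3 * s + 3) * (1 + ‖z‖)) := by gcongr
    _ = _ := by
      simp only [mul_pow]
      ring

end Growth

/-! ### Entire functions of polynomial growth, divided by a polynomial -/

section Rational

variable {E : Type*} [NormedAddCommGroup E] [NormedSpace ℂ E]

theorem differentiable_dslope [CompleteSpace E] {Q : ℂ → E} (hQ : Differentiable ℂ Q) (c : ℂ) :
    Differentiable ℂ (dslope Q c) := by
  rw [← differentiableOn_univ]
  exact (Complex.differentiableOn_dslope univ_mem).2 hQ.differentiableOn

/-- Division by `z - c` lowers the order of growth by one. -/
theorem growth_dslope [CompleteSpace E] {Q : ℂ → E} (hQ : Differentiable ℂ Q) (c : ℂ) {n : ℕ}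
    (hb : ∃ C : ℝ, ∀ z, ‖Q z‖ ≤ C * (1 + ‖z‖) ^ (n + 1)) :
    ∃ C : ℝ, ∀ z, ‖dslope Q c z‖ ≤ C * (1 + ‖z‖) ^ n := by
  obtain ⟨C, hC⟩ := hb
  obtain ⟨K, hK⟩ := (isCompact_closedBall c 1).exists_bound_of_continuousOn
    (differentiable_dslope hQ c).continuous.continuousOn
  have hC0 : 0 ≤ C := by
    have := (norm_nonneg _).trans (hC 0)
    simpa using this
  refine ⟨|K| + (C + ‖Q c‖) * (2 + ‖c‖), fun z => ?_⟩
  have h1 : 1 ≤ (1 + ‖z‖) ^ n := one_le_pow₀ (by linarith [norm_nonneg z])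
  by_cases hz : z ∈ Metric.closedBall c 1
  · refine (hK z hz).trans ((le_abs_self K).trans ?_)
    have : 0 ≤ (C + ‖Q c‖) * (2 + ‖c‖) := by positivity
    nlinarith [abs_nonneg K]
  · rw [Metric.mem_closedBall, dist_eq_norm, not_le] at hz
    have hne : z ≠ c := by rintro rfl; simp at hz; linarith
    rw [dslope_of_ne _ hne, slope_def_module, norm_smul, norm_inv]
    have h2 : 1 + ‖z‖ ≤ (2 + ‖c‖) * ‖z - c‖ := by
      have := norm_add_le (z - c) c
      rw [sub_add_cancel] at this
      nlinarith [norm_nonneg c]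
    have h3 : ‖Q z - Q c‖ ≤ (C + ‖Q c‖) * (1 + ‖z‖) ^ (n + 1) := by
      refine (norm_sub_le _ _).trans ?_
      have : 1 ≤ (1 + ‖z‖) ^ (n + 1) := one_le_pow₀ (by linarith [norm_nonneg z])
      have h4 := hC z
      nlinarith [norm_nonneg (Q c)]
    have hp : 0 < ‖z - c‖ := by linarith
    rw [inv_mul_le_iff₀ hp]
    refine h3.trans ?_
    rw [pow_succ]
    have h5 : 0 ≤ (C + ‖Q c‖) * (1 + ‖z‖) ^ n := by positivity
    calc (C + ‖Q c‖) * ((1 + ‖z‖) ^ n * (1 + ‖z‖)) = (C + ‖Q c‖) * (1 + ‖z‖) ^ n * (1 + ‖z‖) := by ring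
      _ ≤ (C + ‖Q c‖) * (1 + ‖z‖) ^ n * ((2 + ‖c‖) * ‖z - c‖) := by gcongr
      _ ≤ _ := by
        have : 0 ≤ |K| * (‖z - c‖ * (1 + ‖z‖) ^ n) := by positivity
        nlinarith

/-- Partial fractions for the quotient of an entire function of growth `O(|z|^{n+1})` by
`z^n (z + s)`. -/
theorem exists_partial_fractions [CompleteSpace E] {s : ℂ} (hs : s ≠ 0) (n : ℕ) {Q : ℂ → E}
    (hQ : Differentiable ℂ Q) (hb : ∃ C : ℝ, ∀ z, ‖Q z‖ ≤ C * (1 + ‖z‖) ^ (n + 1)) :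
    ∃ (c : ℕ → E) (c₀ c₁ : E), ∀ z, z ≠ 0 → z + s ≠ 0 →
      (z ^ n * (z + s))⁻¹ • Q z =
        ∑ j ∈ Finset.Icc 1 n, (z ^ j)⁻¹ • c j + (z + s)⁻¹ • c₀ + c₁ := by
  induction n generalizing Q with
  | zero =>
    obtain ⟨C, hC⟩ := growth_dslope hQ (-s) hb
    have hconst : ∀ z, dslope Q (-s) z = dslope Q (-s) 0 := fun z =>
      (differentiable_dslope hQ (-s)).apply_eq_apply_of_bounded
        (isBounded_iff_forall_norm_le.2 ⟨C, by rintro _ ⟨w, rfl⟩; simpa using hC w⟩) z 0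
    refine ⟨fun _ => 0, Q (-s), dslope Q (-s) 0, fun z _ hz => ?_⟩
    have h1 : Q z = (z + s) • dslope Q (-s) z + Q (-s) := by
      have := sub_smul_dslope Q (-s) z
      rw [sub_neg_eq_add] at this
      rw [this]; abel
    rw [h1, hconst z]
    simp only [pow_zero, one_mul, smul_add, smul_smul, inv_mul_cancel₀ hz, one_smul]
    simp [add_comm]
  | succ n ih =>
    have hd : Differentiable ℂ (fun z => dslope Q 0 z - s⁻¹ • Q 0) :=
      (differentiable_dslope hQ 0).sub_const _
    have hg : ∃ C : ℝ, ∀ z, ‖dslope Q 0 z - s⁻¹ • Q 0‖ ≤ C * (1 + ‖z‖) ^ (n + 1) := by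
      obtain ⟨C, hC⟩ := growth_dslope hQ 0 hb
      refine ⟨C + ‖s⁻¹ • Q 0‖, fun z => (norm_sub_le _ _).trans ?_⟩
      have : 1 ≤ (1 + ‖z‖) ^ (n + 1) := one_le_pow₀ (by linarith [norm_nonneg z])
      have h4 := hC z
      nlinarith [norm_nonneg (s⁻¹ • Q 0)]
    obtain ⟨c, c₀, c₁, h⟩ := ih hd hg
    refine ⟨fun j => if j = n + 1 then s⁻¹ • Q 0 else c j, c₀, c₁, fun z hz hzs => ?_⟩
    have h1 : Q z = z • dslope Q 0 z + Q 0 := by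
      have := sub_smul_dslope Q 0 z
      rw [sub_zero] at this
      rw [this]; abel
    have h2 : (z ^ (n + 1) * (z + s))⁻¹ • Q z =
        (z ^ n * (z + s))⁻¹ • (dslope Q 0 z - s⁻¹ • Q 0) + (z ^ (n + 1))⁻¹ • (s⁻¹ • Q 0) := by
      rw [h1, smul_add, smul_smul, smul_sub, smul_smul, smul_smul, sub_add_eq_add_sub,
        add_sub_assoc, ← sub_smul]
      congr 2
      · field_simp
        ring
      · field_simp; ring
    rw [h2, h z hz hzs, Finset.sum_Icc_succ_top (by omega)]
    simp only [if_true]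
    have h3 : ∑ j ∈ Finset.Icc 1 n, (z ^ j)⁻¹ • (if j = n + 1 then s⁻¹ • Q 0 else c j) =
        ∑ j ∈ Finset.Icc 1 n, (z ^ j)⁻¹ • c j := by
      refine Finset.sum_congr rfl fun j hj => ?_
      rw [if_neg]
      rw [Finset.mem_Icc] at hj; omega
    rw [h3]
    abel

end Rational

/-! ### The rational form of the logarithmic derivative -/

section RationalForm

variable {k : ℕ} {α l s : ℝ} {M : ℂ → Mat} {a : ℂ}

/-- The matrix-valued rational function with principal part `∑ z^{-j} c_j` at the origin, residue
`c₀` at `-s`, and value `c₁` at infinity. -/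
noncomputable def ratForm (k : ℕ) (s : ℂ) (c : ℕ → Mat) (c₀ c₁ : Mat) (z : ℂ) : Mat :=
  ∑ j ∈ Finset.Icc 1 (k + 1), (z ^ j)⁻¹ • c j + (z + s)⁻¹ • c₀ + c₁

/-- The logarithmic derivative of a solution is rational. -/
theorem IsRHSolution.exists_ratForm (h : IsRHSolution k α l s M a) (hs : 0 < s) :
    ∃ (c : ℕ → Mat) (c₀ c₁ : Mat), ∀ z ∈ Omega s, logD M z = ratForm k s c c₀ c₁ z := by
  obtain ⟨Q, hQ, hQM⟩ := h.exists_entire hs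
  obtain ⟨c, c₀, c₁, hc⟩ := exists_partial_fractions
    (Complex.ofReal_ne_zero.2 hs.ne') (k + 1) hQ (h.growth hs hQ hQM)
  refine ⟨c, c₀, c₁, fun z hz => ?_⟩
  have hz0 := ne_zero_of_mem_Omega hs hz
  have hzs := add_ne_zero_of_mem_Omega hs hz
  rw [ratForm, ← hc z hz0 hzs, hQM z hz, smul_smul, inv_mul_cancel₀, one_smul]
  exact mul_ne_zero (pow_ne_zero _ hz0) hzs

theorem IsRHSolution.trace_logD (h : IsRHSolution k α l s M a) (hs : 0 < s) {z : ℂ}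
    (hz : z ∈ Omega s) : (logD M z).trace = 0 := by
  have hM := (h.differentiableAt hs hz).hasDerivAt
  have h1 : HasDerivAt (fun w => M w 0 0 * M w 1 1 - M w 0 1 * M w 1 0) 0 z := by
    refine (hasDerivAt_const z (1 : ℂ)).congr_of_eventuallyEq ?_
    filter_upwards [(isOpen_Omega hs).mem_nhds hz] with w hw
    rw [← Matrix.det_fin_two, h.det_eq_one hs hw]
  have h2 := ((HasDerivAt.entry hM 0 0).mul (HasDerivAt.entry hM 1 1)).sub
    ((HasDerivAt.entry hM 0 1).mul (HasDerivAt.entry hM 1 0))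
  have h3 := h2.unique h1
  rw [logD, adjL_apply, Matrix.trace_fin_two]
  simp only [Matrix.mul_apply, Fin.sum_univ_two, Matrix.of_apply, Matrix.cons_val', Matrix.cons_val_zero,
    Matrix.cons_val_one, Matrix.cons_val_fin_one]
  rw [← h3]
  change _ = _ - _
  change deriv M z 0 0 * M z 1 1 + deriv M z 0 1 * -(M z 1 0) +
    (deriv M z 1 0 * -(M z 0 1) + deriv M z 1 1 * M z 0 0) =
    deriv M z 0 0 * M z 1 1 + M z 0 0 * deriv M z 1 1 -
      (deriv M z 0 1 * M z 1 0 + M z 0 1 * deriv M z 1 0)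
  ring

/-- A polynomial that agrees with `zⁿ g`, with `g` bounded near `0`, along a set accumulating at `0` has no
coefficient below degree `n`. -/
theorem coeff_eq_zero_of_eval {W : Set ℂ} (hW : (𝓝[W] (0 : ℂ)).NeBot) (hW0 : ∀ z ∈ W, z ≠ 0) (n : ℕ)
    (p : Polynomial ℂ) (g : ℂ → ℂ) (hg : ∃ c, Tendsto g (𝓝[W] 0) (𝓝 c))
    (hp : ∀ᶠ z in 𝓝[W] 0, p.eval z = z ^ n * g z) : ∀ i < n, p.coeff i = 0 := by
  induction n generalizing p with
  | zero => intro i hi; omega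
  | succ n ih =>
    obtain ⟨c, hc⟩ := hg
    have hid : Tendsto (fun z : ℂ => z) (𝓝[W] 0) (𝓝 0) := tendsto_id.mono_left nhdsWithin_le_nhds
    have h0 : p.coeff 0 = 0 := by
      rw [Polynomial.coeff_zero_eq_eval_zero]
      refine tendsto_nhds_unique (p.continuous.continuousAt.tendsto.comp hid) ?_
      have : Tendsto (fun z : ℂ => z ^ (n + 1) * g z) (𝓝[W] 0) (𝓝 (0 ^ (n + 1) * c)) :=
        (hid.pow _).mul hc
      rw [zero_pow (by omega), zero_mul] at this
      exact this.congr' (hp.mono fun z hz => hz.symm)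
    have h1 : p.divX * Polynomial.X = p := by
      have := p.divX_mul_X_add
      rwa [h0, map_zero, add_zero] at this
    have h2 := ih p.divX (by
      filter_upwards [hp, self_mem_nhdsWithin] with z hz hzW
      rw [← h1, Polynomial.eval_mul, Polynomial.eval_X, pow_succ] at hz
      refine mul_right_cancel₀ (hW0 z hzW) ?_
      rw [hz]; ring)
    intro i hi
    rcases i with _ | i
    · exact h0
    · rw [← Polynomial.coeff_divX]
      exact h2 i (by omega)

/-- The polynomial `∑ f_j X^{k+1-j}`, which is `X^{k+1} ∑ f_j X^{-j}`. -/
noncomputable def principalPoly (k : ℕ) (f : ℕ → ℂ) : Polynomial ℂ :=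
  ∑ j ∈ Finset.Icc 1 (k + 1), Polynomial.C (f j) * Polynomial.X ^ (k + 1 - j)

theorem eval_principalPoly (k : ℕ) (f : ℕ → ℂ) (z : ℂ) :
    (principalPoly k f).eval z = ∑ j ∈ Finset.Icc 1 (k + 1), f j * z ^ (k + 1 - j) := by
  simp [principalPoly, Polynomial.eval_finsetSum]

theorem coeff_principalPoly {k : ℕ} (f : ℕ → ℂ) {i : ℕ} (hi : i ≤ k) :
    (principalPoly k f).coeff i = f (k + 1 - i) := by
  simp only [principalPoly, Polynomial.finsetSum_coeff, Polynomial.coeff_C_mul,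
    Polynomial.coeff_X_pow]
  rw [Finset.sum_eq_single (k + 1 - i)]
  · rw [if_pos (by omega), mul_one]
  · intro j hj hne
    rw [Finset.mem_Icc] at hj
    rw [if_neg (by omega), mul_zero]
  · intro hn
    rw [Finset.mem_Icc] at hn
    omega

theorem neBot_nhdsWithin_Omega (hs : 0 < s) (z : ℂ) : (𝓝[Omega s] z).NeBot :=
  mem_closure_iff_nhdsWithin_neBot.1 (dense_Omega hs z)

theorem pow_smul_ratForm {s : ℂ} (c : ℕ → Mat) (c₀ c₁ : Mat) {z : ℂ} (hz : z ≠ 0) :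
    z ^ (k + 1) • ratForm k s c c₀ c₁ z =
      ∑ j ∈ Finset.Icc 1 (k + 1), z ^ (k + 1 - j) • c j + z ^ (k + 1) • ((z + s)⁻¹ • c₀ + c₁) := by
  rw [ratForm, add_assoc, smul_add, Finset.smul_sum]
  congr 1
  refine Finset.sum_congr rfl fun j hj => ?_
  rw [Finset.mem_Icc] at hj
  rw [smul_smul, pow_sub₀ z hz hj.2]

theorem sum_pow_smul_apply (c : ℕ → Mat) (z : ℂ) (i j : Fin 2) :
    (∑ m ∈ Finset.Icc 1 (k + 1), z ^ (k + 1 - m) • c m) i j =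
      (principalPoly k fun m => c m i j).eval z := by
  rw [eval_principalPoly, Matrix.sum_apply]
  exact Finset.sum_congr rfl fun m _ => by simp [mul_comm]

theorem tendsto_holomorphic_part {s : ℝ} (hs : 0 < s) (c₀ c₁ : Mat) :
    Tendsto (fun z : ℂ => (z + s)⁻¹ • c₀ + c₁) (𝓝[Omega s] 0) (𝓝 ((0 + (s : ℂ))⁻¹ • c₀ + c₁)) := by
  have : Tendsto (fun z : ℂ => (z + s)⁻¹) (𝓝 0) (𝓝 (0 + (s : ℂ))⁻¹) :=
    (tendsto_id.add_const _).inv₀ (by simpa using hs.ne')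
  exact ((this.smul_const c₀).add_const c₁).mono_left nhdsWithin_le_nhds

theorem IsRHSolution.trace_coeff (h : IsRHSolution k α l s M a) (hs : 0 < s) {c : ℕ → Mat}
    {c₀ c₁ : Mat} (hc : ∀ z ∈ Omega s, logD M z = ratForm k s c c₀ c₁ z) {j : ℕ}
    (hj : j ∈ Finset.Icc 1 (k + 1)) : (c j).trace = 0 := by
  rw [Finset.mem_Icc] at hj
  have hH := tendsto_holomorphic_part hs c₀ c₁
  have h1 := coeff_eq_zero_of_eval (neBot_nhdsWithin_Omega hs 0)
    (fun z hz => ne_zero_of_mem_Omega hs hz) (k + 1)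
    (principalPoly k (fun m => c m 0 0) + principalPoly k (fun m => c m 1 1))
    (fun z => -(((z + s)⁻¹ • c₀ + c₁) 0 0 + ((z + s)⁻¹ • c₀ + c₁) 1 1))
    ⟨_, ((Tendsto.entry hH 0 0).add (Tendsto.entry hH 1 1)).neg⟩ (by
      filter_upwards [self_mem_nhdsWithin] with z hz
      have h2 := pow_smul_ratForm (k := k) (s := s) c c₀ c₁ (ne_zero_of_mem_Omega hs hz)
      have h3 := h.trace_logD hs hz
      rw [hc z hz] at h3
      have h4 := congrArg Matrix.trace h2
      rw [Matrix.trace_smul, h3, smul_zero, Matrix.trace_add, Matrix.trace_smul,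
        Matrix.trace_fin_two, Matrix.trace_fin_two, sum_pow_smul_apply, sum_pow_smul_apply] at h4
      rw [Polynomial.eval_add]
      simp only [smul_eq_mul] at h4
      linear_combination -h4)
    (k + 1 - j) (by omega)
  rw [Polynomial.coeff_add, coeff_principalPoly _ (by omega), coeff_principalPoly _ (by omega)] at h1
  rw [Matrix.trace_fin_two]
  rwa [show k + 1 - (k + 1 - j) = j by omega] at h1

/-- The logarithm in the local form at `-s` makes the residue there conjugate to a multiple of `σ₊`. -/
theorem IsRHSolution.residue_at_minus_s (h : IsRHSolution k α l s M a) (hs : 0 < s) {c : ℕ → Mat}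
    {c₀ c₁ : Mat} (hc : ∀ z ∈ Omega s, logD M z = ratForm k s c c₀ c₁ z) :
    ∃ F : Mat, c₀ = (2 * Real.pi * Complex.I)⁻¹ • (F * sigmaPlus * adjL F) := by
  have hsΩ : -(s : ℂ) ∉ Omega s := fun hc => add_ne_zero_of_mem_Omega hs hc (by ring)
  have hs0 : -(s : ℂ) ≠ 0 := neg_ne_zero.2 (Complex.ofReal_ne_zero.2 hs.ne')
  obtain ⟨F, hF, hev⟩ := h.logD_eq_near_contour hs hsΩ hs0
  have := neBot_nhdsWithin_Omega hs (-(s : ℂ))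
  refine ⟨F (-(s : ℂ)), tendsto_nhds_unique (f := fun z : ℂ => (z + s) • logD M z)
    (l := 𝓝[Omega s] (-(s : ℂ))) ?_ ?_⟩
  · have h1 : ContinuousAt (fun z : ℂ => (z + s) •
        (∑ j ∈ Finset.Icc 1 (k + 1), (z ^ j)⁻¹ • c j + c₁) + c₀) (-(s : ℂ)) := by
      refine ContinuousAt.add
        (ContinuousAt.smul (f := fun z : ℂ => z + s) (by fun_prop) (ContinuousAt.add ?_
        continuousAt_const)) continuousAt_const
      refine tendsto_finsetSum _ fun j _ => ?_
      exact ((((continuous_pow j).continuousAt).inv₀ (pow_ne_zero _ hs0)).smul_const _)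
    have h2 := h1.tendsto
    simp only [neg_add_cancel, zero_smul, zero_add] at h2
    refine (h2.mono_left nhdsWithin_le_nhds).congr' ?_
    filter_upwards [self_mem_nhdsWithin] with z hz
    rw [hc z hz, ratForm, add_right_comm, smul_add _ _ ((z + (s : ℂ))⁻¹ • c₀), smul_smul,
      mul_inv_cancel₀ (add_ne_zero_of_mem_Omega hs hz), one_smul]
  · have h1 : ContinuousAt (fun z : ℂ => (z + s) • (deriv F z * adjL (F z)) +
        (2 * Real.pi * Complex.I)⁻¹ • (F z * sigmaPlus * adjL (F z))) (-(s : ℂ)) := by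
      have hd := hF.deriv.continuousAt
      have hf := hF.continuousAt
      have ha := (AnalyticAt.adjL_comp hF).continuousAt
      have hn : ContinuousAt (fun z : ℂ => F z * sigmaPlus * adjL (F z)) (-(s : ℂ)) :=
        (hf.mul continuousAt_const).mul ha
      exact ((by fun_prop : ContinuousAt (fun z : ℂ => z + s) _).smul (hd.mul ha)).add
        (hn.tendsto.const_smul _)
    have h2 := h1.tendsto
    simp only [neg_add_cancel, zero_smul, zero_add] at h2
    refine (h2.mono_left nhdsWithin_le_nhds).congr' ?_
    filter_upwards [self_mem_nhdsWithin, hev] with z hz hz2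
    have hzs := add_ne_zero_of_mem_Omega hs hz
    have hpi := Complex.two_pi_I_ne_zero
    rw [hz2.2, smul_add, smul_smul]
    congr 2
    field_simp

/-- The residue at `-s` is nilpotent. -/
theorem IsRHSolution.trace_det_residue (h : IsRHSolution k α l s M a) (hs : 0 < s) {c : ℕ → Mat}
    {c₀ c₁ : Mat} (hc : ∀ z ∈ Omega s, logD M z = ratForm k s c c₀ c₁ z) :
    c₀ 0 0 + c₀ 1 1 = 0 ∧ c₀ 0 0 * c₀ 1 1 - c₀ 0 1 * c₀ 1 0 = 0 := by
  obtain ⟨F, hF⟩ := h.residue_at_minus_s hs hc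
  constructor <;> rw [hF] <;>
    simp [adjL_apply, Matrix.mul_apply, Fin.sum_univ_two, sigmaPlus] <;> ring

theorem trace_mul_fin_two (A B : Mat) :
    (A * B).trace = A 0 0 * B 0 0 + A 0 1 * B 1 0 + (A 1 0 * B 0 1 + A 1 1 * B 1 1) := by
  simp [Matrix.trace_fin_two, Matrix.mul_apply, Fin.sum_univ_two]

/-- The singular part of `tr A²` at the origin is determined by the exponents of the local form. -/
theorem IsRHSolution.trace_convolution (h : IsRHSolution k α l s M a) (hk : 1 ≤ k) (hs : 0 < s)
    {c : ℕ → Mat} {c₀ c₁ : Mat} (hc : ∀ z ∈ Omega s, logD M z = ratForm k s c c₀ c₁ z) {J : ℕ}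
    (hJ : J ∈ Finset.Icc (k + 2) (2 * k + 2)) :
    ∑ m ∈ Finset.Icc (J - k - 1) (k + 1), (c (J - m) * c m).trace = constLambda k α J := by
  rw [Finset.mem_Icc] at hJ
  obtain ⟨P, hP, hP1, -, hPM⟩ := h.logD_eq_near_zero hs
  have hPa : AnalyticAt ℂ P 0 := hP.analyticAt (Metric.ball_mem_nhds _ hs)
  -- `S = z^{k+1} A` up to `O(z^{k+1})`, and `S = e N + O(z^{k+1})` with `N² = 1`
  set S : ℂ → Mat := fun z => ∑ m ∈ Finset.Icc 1 (k + 1), z ^ (k + 1 - m) • c m with hS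
  set N : ℂ → Mat := fun z => P z * sigma3 * adjL (P z) with hN
  set G : ℂ → Mat := fun z => deriv P z * adjL (P z) - ((z + s)⁻¹ • c₀ + c₁) with hG
  set e : ℂ → ℂ := fun z => (-1) ^ k * k + α / 2 * z ^ k with he
  have hSN : ∀ z ∈ Omega s ∩ Metric.ball 0 s, S z = e z • N z + z ^ (k + 1) • G z := by
    intro z hz
    have hz0 := ne_zero_of_mem_Omega hs hz.1
    have h1 := pow_smul_ratForm (k := k) (s := s) c c₀ c₁ hz0
    rw [← hc z hz.1, hPM z hz] at h1
    rw [hS, hG]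
    simp only
    rw [eq_sub_of_add_eq h1.symm, smul_sub, smul_add, smul_smul, he, hN]
    have : z ^ (k + 1) * zeroExponent k α z = (-1) ^ k * k + α / 2 * z ^ k := by
      rw [zeroExponent]; field_simp; ring
    rw [this]; abel
  have hN1 : ∀ z ∈ Omega s ∩ Metric.ball 0 s, (N z * N z).trace = 2 := by
    intro z hz
    have h1 : adjL (P z) * P z = 1 := adjL_mul_self (hP1 z hz.2)
    have h2 : N z * N z = P z * sigma3 * (adjL (P z) * P z) * sigma3 * adjL (P z) := by
      simp only [hN]; noncomm_ring
    have h3 : sigma3 * sigma3 = 1 := by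
      ext i j; fin_cases i <;> fin_cases j <;> simp [sigma3]
    rw [h2, h1, mul_one, mul_assoc (P z), h3, mul_one, mul_adjL (hP1 z hz.2)]
    simp
  have hNt : Tendsto N (𝓝[Omega s] 0) (𝓝 (N 0)) :=
    ((hPa.continuousAt.mul continuousAt_const).mul
      (AnalyticAt.adjL_comp hPa).continuousAt).tendsto.mono_left nhdsWithin_le_nhds
  have hGt : ∃ G0, Tendsto G (𝓝[Omega s] 0) (𝓝 G0) :=
    ⟨_, ((hPa.deriv.continuousAt.mul (AnalyticAt.adjL_comp hPa).continuousAt).tendsto.mono_left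
      nhdsWithin_le_nhds).sub (tendsto_holomorphic_part hs c₀ c₁)⟩
  obtain ⟨G0, hGt⟩ := hGt
  have htr : ∀ {A B : ℂ → Mat} {A0 B0 : Mat}, Tendsto A (𝓝[Omega s] 0) (𝓝 A0) →
      Tendsto B (𝓝[Omega s] 0) (𝓝 B0) →
      Tendsto (fun z => (A z * B z).trace) (𝓝[Omega s] 0) (𝓝 (A0 * B0).trace) := by
    intro A B A0 B0 hA hB
    simp only [trace_mul_fin_two]
    exact (((Tendsto.entry hA 0 0).mul (Tendsto.entry hB 0 0)).add
      ((Tendsto.entry hA 0 1).mul (Tendsto.entry hB 1 0))).add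
      (((Tendsto.entry hA 1 0).mul (Tendsto.entry hB 0 1)).add
      ((Tendsto.entry hA 1 1).mul (Tendsto.entry hB 1 1)))
  have het : Tendsto e (𝓝[Omega s] 0) (𝓝 (e 0)) :=
    (by fun_prop : Continuous e).continuousAt.tendsto.mono_left nhdsWithin_le_nhds
  have hpow : ∀ n : ℕ, Tendsto (fun z : ℂ => z ^ n) (𝓝[Omega s] 0) (𝓝 (0 ^ n)) := fun n =>
    (continuous_pow n).continuousAt.tendsto.mono_left nhdsWithin_le_nhds
  let p : Fin 2 → Fin 2 → Polynomial ℂ := fun i j => principalPoly k fun m => c m i j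
  -- hence `tr S² = 2 e² + O(z^{k+1})`, where `e² = k² + (-1)^k α k z^k + O(z^{2k})`
  have key := coeff_eq_zero_of_eval (neBot_nhdsWithin_Omega hs 0)
    (fun z hz => ne_zero_of_mem_Omega hs hz) (k + 1)
    (p 0 0 * p 0 0 + p 0 1 * p 1 0 + (p 1 0 * p 0 1 + p 1 1 * p 1 1)
      - Polynomial.C (2 * (k : ℂ) ^ 2) - Polynomial.C ((-1) ^ k * 2 * (α : ℂ) * k) * Polynomial.X ^ k)
    (fun z => (α : ℂ) ^ 2 / 2 * z ^ (k - 1) + 2 * (e z * (N z * G z).trace) +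
      z ^ (k + 1) * (G z * G z).trace)
    ⟨_, ((((hpow (k - 1)).const_mul _).add ((het.mul (htr hNt hGt)).const_mul 2)).add
      ((hpow (k + 1)).mul (htr hGt hGt)))⟩ (by
      filter_upwards [self_mem_nhdsWithin, nhdsWithin_le_nhds (Metric.ball_mem_nhds (0 : ℂ) hs)]
        with z hz hzb
      have h1 := hSN z ⟨hz, hzb⟩
      have h2 := hN1 z ⟨hz, hzb⟩
      have h3 : (S z * S z).trace = e z ^ 2 * (N z * N z).trace +
          z ^ (k + 1) * (2 * (e z * (N z * G z).trace) + z ^ (k + 1) * (G z * G z).trace) := by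
        rw [h1]
        simp only [trace_mul_fin_two, Matrix.add_apply, Matrix.smul_apply, smul_eq_mul]
        ring
      rw [h2, trace_mul_fin_two] at h3
      simp only [hS, sum_pow_smul_apply] at h3
      simp only [Polynomial.eval_sub, Polynomial.eval_add, Polynomial.eval_mul, Polynomial.eval_C,
        Polynomial.eval_pow, Polynomial.eval_X, p]
      rw [h3]
      have h4 : z ^ (k + 1) * z ^ (k - 1) = z ^ k * z ^ k := by
        rw [← pow_add, ← pow_add]; congr 1; omega
      have h5 : ((-1 : ℂ) ^ k) ^ 2 = 1 := by rw [← pow_mul, mul_comm, pow_mul]; simp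
      simp only [he]
      linear_combination (2 * (k : ℂ) ^ 2) * h5 - (α ^ 2 / 2 : ℂ) * h4)
    (2 * k + 2 - J) (by omega)
  have hcoeff : ∀ i j i' j', (p i j * p i' j').coeff (2 * k + 2 - J) =
      ∑ m ∈ Finset.Icc (J - k - 1) (k + 1), c (J - m) i j * c m i' j' := by
    intro i j i' j'
    rw [Polynomial.coeff_mul]
    refine Finset.sum_bij' (fun x _ => k + 1 - x.2) (fun m _ => (m - (J - k - 1), k + 1 - m))
      ?_ ?_ ?_ ?_ ?_
    · rintro ⟨x, y⟩ hx
      rw [Finset.HasAntidiagonal.mem_antidiagonal] at hx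
      simp only at hx ⊢
      rw [Finset.mem_Icc]; omega
    · intro m hm
      rw [Finset.mem_Icc] at hm
      rw [Finset.HasAntidiagonal.mem_antidiagonal]; omega
    · rintro ⟨x, y⟩ hx
      rw [Finset.HasAntidiagonal.mem_antidiagonal] at hx
      simp only at hx
      ext <;> simp only <;> omega
    · intro m hm
      rw [Finset.mem_Icc] at hm
      simp only; omega
    · rintro ⟨x, y⟩ hx
      rw [Finset.HasAntidiagonal.mem_antidiagonal] at hx
      simp only at hx
      simp only [p]
      rw [coeff_principalPoly _ (by omega), coeff_principalPoly _ (by omega),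
        show k + 1 - x = J - (k + 1 - y) by omega]
  simp only [Polynomial.coeff_sub, Polynomial.coeff_add, hcoeff, Polynomial.coeff_C,
    Polynomial.coeff_C_mul, Polynomial.coeff_X_pow, ← Finset.sum_add_distrib] at key
  simp only [trace_mul_fin_two]
  rw [sub_sub, sub_eq_zero] at key
  rw [key, constLambda]
  by_cases hJ1 : J = 2 * k + 2
  · rw [if_pos (by omega), if_neg (by omega), if_pos hJ1]; ring
  · rw [if_neg (by omega), if_neg hJ1]
    by_cases hJ2 : J = k + 2
    · rw [if_pos (by omega), if_pos hJ2]; ring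
    · rw [if_neg (by omega), if_neg hJ2]; ring

end RationalForm

/-! ### Asymptotics along the positive half line -/

section PositiveRay

variable {k : ℕ} {α l s : ℝ} {M : ℂ → Mat} {a : ℂ}

theorem mem_Omega_of_re_pos (hs : 0 < s) {z : ℂ} (hz : 0 < z.re) : z ∈ Omega s := by
  have h3 := sqrt3_pos
  rw [mem_Omega hs]
  refine ⟨fun h => by linarith [h.2], fun h => ?_, fun h => ?_⟩
  · nlinarith [h.1, h.2]
  · nlinarith [h.1, h.2]

/-- The expansion of the normalized solution at infinity may be differentiated on the positive
half line, by the Cauchy estimate on the discs `|z - x| ≤ x / 2`. -/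
theorem IsRHSolution.expansion_on_ray (h : IsRHSolution k α l s M a) (hs : 0 < s) :
    ∃ m : Mat, m 0 1 = a ∧
      Tendsto (fun x : ℝ => (x : ℂ) • (normalized l a M x - 1)) atTop (𝓝 m) ∧
      Tendsto (fun x : ℝ => (x : ℂ) ^ 2 • deriv (normalized l a M) x) atTop (𝓝 (-m)) := by
  obtain ⟨m, hm, C, R, hC, hR, hb⟩ := h.expansion hs
  have hlim : ∀ D : ℝ, Tendsto (fun x : ℝ => D / x) atTop (𝓝 0) := fun D =>
    tendsto_const_nhds.div_atTop tendsto_id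
  refine ⟨m, hm, ?_, ?_⟩
  · refine tendsto_iff_norm_sub_tendsto_zero.2 ?_
    refine squeeze_zero' (Eventually.of_forall fun _ => norm_nonneg _) ?_ (hlim C)
    filter_upwards [eventually_ge_atTop R, eventually_gt_atTop 0] with x hx hx0
    have hxc : (x : ℂ) ≠ 0 := Complex.ofReal_ne_zero.2 hx0.ne'
    have hn : ‖(x : ℂ)‖ = x := by rw [Complex.norm_real, Real.norm_eq_abs, abs_of_pos hx0]
    have h1 := hb x (mem_Omega_of_re_pos hs (by simpa using hx0)) (by rw [hn]; exact hx)
    have h2 : (x : ℂ) • (normalized l a M x - 1) - m =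
        (x : ℂ) • (normalized l a M x - 1 - (x : ℂ)⁻¹ • m) := by
      rw [smul_sub _ _ ((x : ℂ)⁻¹ • m), smul_smul, mul_inv_cancel₀ hxc, one_smul]
    rw [h2, norm_smul, hn]
    rw [hn] at h1
    calc x * _ ≤ x * (C / x ^ 2) := by gcongr
      _ = _ := by field_simp
  · refine tendsto_iff_norm_sub_tendsto_zero.2 ?_
    refine squeeze_zero' (Eventually.of_forall fun _ => norm_nonneg _) ?_ (hlim (8 * C))
    filter_upwards [eventually_ge_atTop (2 * R), eventually_gt_atTop 0] with x hx hx0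
    have hxc : (x : ℂ) ≠ 0 := Complex.ofReal_ne_zero.2 hx0.ne'
    have hn : ‖(x : ℂ)‖ = x := by rw [Complex.norm_real, Real.norm_eq_abs, abs_of_pos hx0]
    have hball : ∀ w ∈ Metric.closedBall (x : ℂ) (x / 2), w ∈ Omega s ∧ x / 2 ≤ ‖w‖ := by
      intro w hw
      rw [Metric.mem_closedBall, dist_comm, dist_eq_norm] at hw
      have e1 := (Complex.abs_re_le_norm ((x : ℂ) - w)).trans hw
      rw [Complex.sub_re, Complex.ofReal_re, abs_le] at e1
      have e2 := norm_sub_norm_le (x : ℂ) w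
      rw [hn] at e2
      exact ⟨mem_Omega_of_re_pos hs (by linarith [e1.2]), by linarith⟩
    have hdY : ∀ w ∈ Metric.closedBall (x : ℂ) (x / 2), DifferentiableAt ℂ (normalized l a M) w :=
      fun w hw => (differentiableOn_normalized h hs).differentiableAt
        ((isOpen_Omega hs).mem_nhds (hball w hw).1)
    have hinv : ∀ w ∈ Metric.closedBall (x : ℂ) (x / 2), w ≠ 0 := fun w hw =>
      ne_zero_of_mem_Omega hs (hball w hw).1
    have hd : DiffContOnCl ℂ (fun w => normalized l a M w - 1 - w⁻¹ • m)
        (Metric.ball (x : ℂ) (x / 2)) := by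
      refine DifferentiableOn.diffContOnCl_ball (U := Metric.closedBall (x : ℂ) (x / 2))
        (fun w hw => ?_) subset_rfl
      exact (((hdY w hw).sub_const 1).sub
        ((differentiableAt_inv (hinv w hw)).smul_const m)).differentiableWithinAt
    have h1 := Complex.norm_deriv_le_of_forall_mem_sphere_norm_le (C := C / (x / 2) ^ 2)
      (by linarith : 0 < x / 2) hd (fun w hw => by
        obtain ⟨e1, e2⟩ := hball w (Metric.sphere_subset_closedBall hw)
        refine (hb w e1 (by linarith)).trans ?_
        gcongr)
    have hx_mem : (x : ℂ) ∈ Metric.closedBall (x : ℂ) (x / 2) :=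
      Metric.mem_closedBall_self (by linarith)
    have h2 : deriv (fun w => normalized l a M w - 1 - w⁻¹ • m) (x : ℂ) =
        deriv (normalized l a M) x - (-((x : ℂ) ^ 2)⁻¹) • m :=
      (((hdY x hx_mem).hasDerivAt.sub_const 1).sub
        ((hasDerivAt_inv hxc).smul_const m)).deriv
    have h1 := (congrArg norm h2).symm.le.trans h1
    have h3 : (x : ℂ) ^ 2 • deriv (normalized l a M) x - -m =
        (x : ℂ) ^ 2 • (deriv (normalized l a M) x - (-((x : ℂ) ^ 2)⁻¹) • m) := by
      rw [smul_sub, smul_smul, mul_neg, mul_inv_cancel₀ (pow_ne_zero 2 hxc), neg_smul, one_smul]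
    rw [h3, norm_smul, norm_pow, hn]
    calc x ^ 2 * _ ≤ x ^ 2 * (C / (x / 2) ^ 2 / (x / 2)) := by gcongr
      _ = _ := by field_simp; norm_num

theorem tendsto_ofReal_inv : Tendsto (fun x : ℝ => (x : ℂ)⁻¹) atTop (𝓝 0) := by
  have := Complex.continuous_ofReal.continuousAt.tendsto.comp tendsto_inv_atTop_zero
  simpa [Function.comp_def] using this

/-- The `z`-independent part of `z (modelLog l z - (l / 2) σ₋)`. -/
noncomputable def modelLogOne (l : ℝ) : Mat := !![-(1 / 4), l / 2; 0, 1 / 4]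

theorem modelLog_eq (l : ℝ) (z : ℂ) :
    modelLog l z = ((l : ℂ) / 2) • sigmaMinus + z⁻¹ • modelLogOne l := by
  ext i j
  fin_cases i <;> fin_cases j <;> simp [modelLog, modelLogOne, sigmaMinus, div_eq_mul_inv]; ring

/-- The first two terms of the expansion of the rational function at infinity. -/
theorem smul_ratForm_sub {s : ℂ} (hk : 1 ≤ k) (c : ℕ → Mat) (c₀ c₁ : Mat) :
    Tendsto (fun x : ℝ => (x : ℂ) • (ratForm k s c c₀ c₁ x - c₁)) atTop (𝓝 (c 1 + c₀)) ∧
    Tendsto (fun x : ℝ => (x : ℂ) ^ 2 • (ratForm k s c c₀ c₁ x - c₁ - (x : ℂ)⁻¹ • (c 1 + c₀)))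
      atTop (𝓝 (c 2 - s • c₀)) := by
  have hu := tendsto_ofReal_inv
  have hw : Tendsto (fun x : ℝ => (1 + s * (x : ℂ)⁻¹)⁻¹) atTop (𝓝 1) := by
    simpa using ((hu.const_mul s).const_add 1).inv₀ (by simp)
  have hx0 : ∀ᶠ x : ℝ in atTop, (x : ℂ) ≠ 0 := by
    filter_upwards [eventually_gt_atTop 0] with x hx using Complex.ofReal_ne_zero.2 hx.ne'
  have hne : ∀ᶠ x : ℝ in atTop, 1 + s * (x : ℂ)⁻¹ ≠ 0 := by
    have := (hu.const_mul s).const_add 1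
    rw [mul_zero, add_zero] at this
    exact this.eventually_ne one_ne_zero
  have hsum : Tendsto (fun x : ℝ => ∑ j ∈ Finset.Icc 2 (k + 1), ((x : ℂ)⁻¹ ^ (j - 2)) • c j) atTop
      (𝓝 (c 2)) := by
    have h1 : Tendsto (fun x : ℝ => ∑ j ∈ Finset.Icc 2 (k + 1), ((x : ℂ)⁻¹ ^ (j - 2)) • c j) atTop
        (𝓝 (∑ j ∈ Finset.Icc 2 (k + 1), ((0 : ℂ) ^ (j - 2)) • c j)) :=
      tendsto_finsetSum _ fun j _ => (hu.pow _).smul_const _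
    rwa [Finset.sum_eq_single 2, Nat.sub_self, pow_zero, one_smul] at h1
    · intro j hj hne
      rw [Finset.mem_Icc] at hj
      rw [zero_pow (by omega), zero_smul]
    · intro hn
      rw [Finset.mem_Icc] at hn; omega
  have hform : ∀ᶠ x : ℝ in atTop, ratForm k s c c₀ c₁ x - c₁ =
      (x : ℂ)⁻¹ • (c 1 + c₀) + ((x : ℂ)⁻¹ ^ 2) •
        (∑ j ∈ Finset.Icc 2 (k + 1), ((x : ℂ)⁻¹ ^ (j - 2)) • c j -
          s • (1 + s * (x : ℂ)⁻¹)⁻¹ • c₀) := by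
    filter_upwards [hx0, hne] with x hx hn
    rw [ratForm, add_sub_cancel_right, ← Finset.add_sum_Ioc_eq_sum_Icc (by omega : 1 ≤ k + 1)]
    have e1 : ∑ j ∈ Finset.Ioc 1 (k + 1), ((x : ℂ) ^ j)⁻¹ • c j =
        ((x : ℂ)⁻¹ ^ 2) • ∑ j ∈ Finset.Icc 2 (k + 1), ((x : ℂ)⁻¹ ^ (j - 2)) • c j := by
      rw [Finset.smul_sum]
      refine Finset.sum_congr rfl fun j hj => ?_
      have hj' := Finset.mem_Icc.1 (show j ∈ Finset.Icc 2 (k + 1) from hj)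
      rw [smul_smul, ← pow_add, inv_pow, Nat.add_sub_cancel' hj'.1]
    have e2 : ((x : ℂ) + s)⁻¹ = (x : ℂ)⁻¹ - (x : ℂ)⁻¹ ^ 2 * (s * (1 + s * (x : ℂ)⁻¹)⁻¹) := by
      have h1 : (x : ℂ) + s ≠ 0 := by
        intro h0
        apply hn
        rw [show s = -(x : ℂ) by linear_combination h0]
        field_simp; ring
      have h2 : 1 + s * (x : ℂ)⁻¹ = ((x : ℂ) + s) / x := by field_simp
      rw [h2, inv_div]
      field_simp
      ring
    rw [e1, e2, pow_one, sub_smul, smul_sub, smul_smul s, smul_smul _ _ c₀, smul_add]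
    abel
  have hmain := hsum.sub ((hw.smul_const c₀).const_smul s)
  rw [one_smul] at hmain
  constructor
  · have h1 := (hu.smul hmain).const_add (c 1 + c₀)
    rw [zero_smul, add_zero] at h1
    refine h1.congr' ?_
    filter_upwards [hform, hx0] with x hx hx0
    rw [hx, smul_add, smul_smul (x : ℂ) (x : ℂ)⁻¹, smul_smul (x : ℂ) ((x : ℂ)⁻¹ ^ 2),
      mul_inv_cancel₀ hx0, one_smul, show (x : ℂ) * (x : ℂ)⁻¹ ^ 2 = (x : ℂ)⁻¹ by field_simp]
  · refine hmain.congr' ?_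
    filter_upwards [hform, hx0] with x hx hx0
    rw [hx, add_sub_cancel_left, smul_smul ((x : ℂ) ^ 2)]
    rw [show (x : ℂ) ^ 2 * (x : ℂ)⁻¹ ^ 2 = 1 by field_simp, one_smul]

/-- The constraints on the rational form of the logarithmic derivative imposed by the expansion
at infinity up to the order `z^{-2}`. -/
theorem IsRHSolution.coeff_relations (h : IsRHSolution k α l s M a) (hk : 1 ≤ k) (hs : 0 < s)
    {c : ℕ → Mat} {c₀ c₁ : Mat} (hc : ∀ z ∈ Omega s, logD M z = ratForm k s c c₀ c₁ z) :
    c₁ = ((l : ℂ) / 2) • sigmaMinus ∧ (c 1 + c₀) 0 1 = l / 2 ∧ (c 1 + c₀) 0 0 = -(1 / 4) ∧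
      (c 1 + c₀) 1 0 + (c 2 - (s : ℂ) • c₀) 0 1 = -a := by
  obtain ⟨m, hm, hW, hV⟩ := h.expansion_on_ray hs
  set W : ℝ → Mat := fun x => (x : ℂ) • (normalized l a M x - 1) with hWdef
  set V : ℝ → Mat := fun x => (x : ℂ) ^ 2 • deriv (normalized l a M) x with hVdef
  have hu := tendsto_ofReal_inv
  obtain ⟨hr1, hr2⟩ := smul_ratForm_sub (s := (s : ℂ)) hk c c₀ c₁
  have hx0 : ∀ᶠ x : ℝ in atTop, (x : ℂ) ≠ 0 := by
    filter_upwards [eventually_gt_atTop 0] with x hx using Complex.ofReal_ne_zero.2 hx.ne'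
  have hΩ : ∀ᶠ x : ℝ in atTop, (x : ℂ) ∈ Omega s := by
    filter_upwards [eventually_gt_atTop 0] with x hx
    exact mem_Omega_of_re_pos hs (by simpa using hx)
  have hY : ∀ᶠ x : ℝ in atTop, normalized l a M x = 1 + (x : ℂ)⁻¹ • W x := by
    filter_upwards [hx0] with x hx
    rw [hWdef, smul_smul, inv_mul_cancel₀ hx, one_smul]; abel
  have hY' : ∀ᶠ x : ℝ in atTop, deriv (normalized l a M) x = ((x : ℂ)⁻¹ ^ 2) • V x := by
    filter_upwards [hx0] with x hx
    rw [hVdef, smul_smul, inv_pow, inv_mul_cancel₀ (pow_ne_zero 2 hx), one_smul]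
  clear_value W V
  have htr : m 1 1 = -m 0 0 := by
    have h1 : Tendsto (fun x => W x 0 0 + W x 1 1 + (x : ℂ)⁻¹ * (W x 0 0 * W x 1 1 - W x 0 1 * W x 1 0))
        atTop (𝓝 (m 0 0 + m 1 1 + 0 * (m 0 0 * m 1 1 - m 0 1 * m 1 0))) :=
      ((Tendsto.entry hW 0 0).add (Tendsto.entry hW 1 1)).add (hu.mul
        (((Tendsto.entry hW 0 0).mul (Tendsto.entry hW 1 1)).sub
          ((Tendsto.entry hW 0 1).mul (Tendsto.entry hW 1 0))))
    have h2 : ∀ᶠ x : ℝ in atTop,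
        W x 0 0 + W x 1 1 + (x : ℂ)⁻¹ * (W x 0 0 * W x 1 1 - W x 0 1 * W x 1 0) = 0 := by
      filter_upwards [hx0, hΩ, hY] with x hx hxΩ hYx
      have h3 := det_normalized h hs hxΩ
      rw [hYx, Matrix.det_fin_two] at h3
      simp at h3
      refine mul_left_cancel₀ (inv_ne_zero hx) ?_
      linear_combination h3
    have h3 := tendsto_nhds_unique h1 (tendsto_const_nhds.congr' (h2.mono fun x hx => hx.symm))
    linear_combination h3
  -- the logarithmic derivative in terms of `u = 1 / x`, `W` and `V`
  have hA : ∀ᶠ x : ℝ in atTop, ratForm k s c c₀ c₁ x = lower a *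
      (((x : ℂ)⁻¹ ^ 2) • V x * adjL (1 + (x : ℂ)⁻¹ • W x) + (1 + (x : ℂ)⁻¹ • W x) *
        (((l : ℂ) / 2) • sigmaMinus + (x : ℂ)⁻¹ • modelLogOne l) * adjL (1 + (x : ℂ)⁻¹ • W x)) *
      adjL (lower a) := by
    filter_upwards [hΩ, hY, hY'] with x hxΩ hYx hYx'
    rw [← hc x hxΩ, h.logD_eq_normalized hs hxΩ, modelLog_eq, hYx]
    congr 3
    rw [← hYx']
  have hadj : ∀ x : ℝ, adjL (1 + (x : ℂ)⁻¹ • W x) = 1 + (x : ℂ)⁻¹ • adjL (W x) := fun x => by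
    rw [map_add, map_smul, adjL_one]
  have hWa : Tendsto (fun x => adjL (W x)) atTop (𝓝 (adjL m)) :=
    (adjL.continuous.tendsto m).comp hW
  have hσ : lower a * sigmaMinus * adjL (lower a) = sigmaMinus := by
    rw [adjL_lower]
    ext i j; fin_cases i <;> fin_cases j <;> simp [lower, sigmaMinus]
  have h1W : Tendsto (fun x : ℝ => 1 + (x : ℂ)⁻¹ • W x) atTop (𝓝 1) := by
    simpa using (hu.smul hW).const_add 1
  have h1Wa : Tendsto (fun x : ℝ => 1 + (x : ℂ)⁻¹ • adjL (W x)) atTop (𝓝 1) := by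
    simpa using (hu.smul hWa).const_add 1
  have hinner : Tendsto (fun x : ℝ => lower a * ((x : ℂ)⁻¹ • V x * (1 + (x : ℂ)⁻¹ • adjL (W x)) +
      (1 + (x : ℂ)⁻¹ • W x) * modelLogOne l * (1 + (x : ℂ)⁻¹ • adjL (W x)) +
      ((l : ℂ) / 2) • (W x * sigmaMinus + sigmaMinus * adjL (W x) +
        (x : ℂ)⁻¹ • (W x * sigmaMinus * adjL (W x)))) * adjL (lower a)) atTop
      (𝓝 (lower a * ((0 : ℂ) • (-m) * 1 + 1 * modelLogOne l * 1 +
        ((l : ℂ) / 2) • (m * sigmaMinus + sigmaMinus * adjL m +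
          (0 : ℂ) • (m * sigmaMinus * adjL m))) * adjL (lower a))) := by
    refine (Tendsto.const_mul _ ?_).mul_const _
    refine ((((hu.smul hV).mul h1Wa).add ((h1W.mul_const _).mul h1Wa)).add
      (Tendsto.const_smul ?_ _))
    exact ((hW.mul_const _).add (hWa.const_mul _)).add (hu.smul ((hW.mul_const _).mul hWa))
  have hstep : ∀ᶠ x : ℝ in atTop, ratForm k s c c₀ c₁ x = ((l : ℂ) / 2) • sigmaMinus +
      (x : ℂ)⁻¹ • (lower a * ((x : ℂ)⁻¹ • V x * (1 + (x : ℂ)⁻¹ • adjL (W x)) +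
      (1 + (x : ℂ)⁻¹ • W x) * modelLogOne l * (1 + (x : ℂ)⁻¹ • adjL (W x)) +
      ((l : ℂ) / 2) • (W x * sigmaMinus + sigmaMinus * adjL (W x) +
        (x : ℂ)⁻¹ • (W x * sigmaMinus * adjL (W x)))) * adjL (lower a)) := by
    filter_upwards [hA] with x hx
    rw [hx, hadj]
    set Z : Mat := (x : ℂ)⁻¹ • V x * (1 + (x : ℂ)⁻¹ • adjL (W x)) +
      (1 + (x : ℂ)⁻¹ • W x) * modelLogOne l * (1 + (x : ℂ)⁻¹ • adjL (W x)) +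
      ((l : ℂ) / 2) • (W x * sigmaMinus + sigmaMinus * adjL (W x) +
        (x : ℂ)⁻¹ • (W x * sigmaMinus * adjL (W x))) with hZ
    have e : ((x : ℂ)⁻¹ ^ 2) • V x * (1 + (x : ℂ)⁻¹ • adjL (W x)) + (1 + (x : ℂ)⁻¹ • W x) *
        (((l : ℂ) / 2) • sigmaMinus + (x : ℂ)⁻¹ • modelLogOne l) * (1 + (x : ℂ)⁻¹ • adjL (W x)) =
        ((l : ℂ) / 2) • sigmaMinus + (x : ℂ)⁻¹ • Z := by
      rw [hZ]
      simp only [mul_add, add_mul, smul_add, smul_mul_assoc, mul_smul_comm, mul_one, one_mul,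
        smul_smul, pow_two]
      module
    rw [e, mul_add, add_mul, mul_smul_comm, smul_mul_assoc, hσ, mul_smul_comm, smul_mul_assoc]
  have hc₁ : c₁ = ((l : ℂ) / 2) • sigmaMinus := by
    have h1 := (hu.smul hr1).add_const c₁
    have h2 := (hu.smul hinner).const_add (((l : ℂ) / 2) • sigmaMinus)
    rw [zero_smul, zero_add] at h1
    rw [zero_smul, add_zero] at h2
    refine tendsto_nhds_unique h1 (h2.congr' ?_)
    filter_upwards [hstep, hx0] with x hx hx0
    rw [← hx, smul_smul, inv_mul_cancel₀ hx0, one_smul, sub_add_cancel]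
  have hsum : c 1 + c₀ = lower a * (modelLogOne l +
      ((l : ℂ) / 2) • (m * sigmaMinus + sigmaMinus * adjL m)) * adjL (lower a) := by
    simp only [zero_smul, mul_one, one_mul, add_zero, zero_add] at hinner
    refine tendsto_nhds_unique hr1 (hinner.congr' ?_)
    filter_upwards [hstep, hx0] with x hx hx0
    rw [hx, hc₁, add_sub_cancel_left, smul_smul (x : ℂ) (x : ℂ)⁻¹, mul_inv_cancel₀ hx0, one_smul]
  have e01 : (c 1 + c₀) 0 1 = l / 2 := by
    rw [hsum, adjL_lower, adjL_apply, Matrix.eta_fin_two m]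
    simp [lower, sigmaMinus, modelLogOne, Matrix.mul_apply, Fin.sum_univ_two]
  have e00 : (c 1 + c₀) 0 0 = -(1 / 4) := by
    rw [hsum, adjL_lower, adjL_apply, Matrix.eta_fin_two m]
    simp [lower, sigmaMinus, modelLogOne, Matrix.mul_apply, Fin.sum_univ_two, hm]
  have e10 : (c 1 + c₀) 1 0 = -(l * m 0 0) + l * a ^ 2 / 2 - a / 2 := by
    rw [hsum, adjL_lower, adjL_apply, Matrix.eta_fin_two m]
    simp [lower, sigmaMinus, modelLogOne, Matrix.mul_apply, Fin.sum_univ_two, hm, htr]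
    ring
  have hsecond : (c 2 - (s : ℂ) • c₀) 0 1 = -a / 2 - l / 2 * a ^ 2 + l * m 0 0 := by
    have h1 := Tendsto.entry hr2 0 1
    have h2 : Tendsto (fun x : ℝ => (V x 0 0 * (-((x : ℂ)⁻¹ * W x 0 1)) +
        V x 0 1 * (1 + (x : ℂ)⁻¹ * W x 0 0)) - l / 2 * W x 0 1 ^ 2 +
        l / 2 * (2 * W x 0 0 + (x : ℂ)⁻¹ * W x 0 0 ^ 2) +
        (1 + (x : ℂ)⁻¹ * W x 0 0) * W x 0 1 / 2) atTop
        (𝓝 (((-m) 0 0 * (-(0 * m 0 1)) + (-m) 0 1 * (1 + 0 * m 0 0)) - l / 2 * m 0 1 ^ 2 +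
          l / 2 * (2 * m 0 0 + 0 * m 0 0 ^ 2) + (1 + 0 * m 0 0) * m 0 1 / 2)) := by
      have w00 := Tendsto.entry hW 0 0
      have w01 := Tendsto.entry hW 0 1
      have v00 := Tendsto.entry hV 0 0
      have v01 := Tendsto.entry hV 0 1
      have hp := (hu.mul w00).const_add 1
      exact ((((v00.mul (hu.mul w01).neg).add (v01.mul hp)).sub ((w01.pow 2).const_mul _)).add
        (((w00.const_mul 2).add (hu.mul (w00.pow 2))).const_mul _)).add ((hp.mul w01).div_const 2)
    have h3 := tendsto_nhds_unique h1 (h2.congr' (by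
      filter_upwards [hA, hx0] with x hx hx0
      rw [hx, hc₁]
      simp only [Matrix.smul_apply, Matrix.sub_apply, e01]
      rw [adjL_lower, adjL_apply, Matrix.eta_fin_two (W x), Matrix.eta_fin_two (V x), Matrix.one_fin_two]
      simp [lower, sigmaMinus, modelLogOne, Matrix.mul_apply, Fin.sum_univ_two]
      field_simp
      ring))
    rw [h3, hm]
    simp [hm]
    ring
  refine ⟨hc₁, e01, e00, ?_⟩
  rw [e10, hsecond]
  ring

end PositiveRay

/-! ### Comparison of two solutions near infinity -/

section Comparison

variable {k : ℕ} {α l l' s s' : ℝ} {M M' : ℂ → Mat} {a a' : ℂ}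

/-- Outside a disc, the affine map `z ↦ c z + d` with `c s' = s + d` maps the contour with
parameter `s'` to the one with parameter `s`. -/
theorem affine_mem_Omega_iff (hs : 0 < s) (hs' : 0 < s') {c d r₀ : ℝ} (hc : 0 < c)
    (hcs : c * s' = s + d) (hd : |d| < c * r₀) {z : ℂ} (hz : r₀ < ‖z‖) :
    (c : ℂ) * z + d ∈ Omega s ↔ z ∈ Omega s' := by
  have him : ((c : ℂ) * z + d).im = c * z.im := by simp
  have hre : ((c : ℂ) * z + d).re = c * z.re + d := by simp
  have hre2 : c * z.re + d + s = c * (z.re + s') := by linarith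
  have e1 : (c * z.im = 0 ∧ c * z.re + d ≤ 0) ↔ (z.im = 0 ∧ z.re ≤ 0) := by
    rw [abs_lt] at hd
    have key : z.im = 0 → r₀ < |z.re| := by
      intro h0
      have : z = (z.re : ℂ) := Complex.ext rfl (by simpa using h0)
      rw [this, Complex.norm_real, Real.norm_eq_abs] at hz
      exact hz
    constructor
    · rintro ⟨h1, h2⟩
      have h0 : z.im = 0 := by simpa [hc.ne'] using h1
      refine ⟨h0, ?_⟩
      by_contra hcon
      push Not at hcon
      have := key h0
      rw [abs_of_pos hcon] at this
      nlinarith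
    · rintro ⟨h1, h2⟩
      refine ⟨by rw [h1, mul_zero], ?_⟩
      have := key h1
      rw [abs_of_nonpos h2] at this
      nlinarith
  have e2 : (0 < c * z.im) ↔ 0 < z.im := by
    constructor
    · intro h; exact (mul_pos_iff_of_pos_left hc).1 h
    · intro h; positivity
  have e3 : (c * z.im < 0) ↔ z.im < 0 := by
    constructor
    · intro h; by_contra hcon; push Not at hcon; nlinarith
    · intro h; nlinarith
  have e4 : (Real.sqrt 3 * (c * (z.re + s')) + c * z.im = 0) ↔
      (Real.sqrt 3 * (z.re + s') + z.im = 0) := by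
    rw [show Real.sqrt 3 * (c * (z.re + s')) + c * z.im =
      c * (Real.sqrt 3 * (z.re + s') + z.im) by ring, mul_eq_zero]
    simp [hc.ne']
  have e5 : (Real.sqrt 3 * (c * (z.re + s')) - c * z.im = 0) ↔
      (Real.sqrt 3 * (z.re + s') - z.im = 0) := by
    rw [show Real.sqrt 3 * (c * (z.re + s')) - c * z.im =
      c * (Real.sqrt 3 * (z.re + s') - z.im) by ring, mul_eq_zero]
    simp [hc.ne']
  rw [mem_Omega hs, mem_Omega hs', him, hre, hre2, e1, e2, e3, e4, e5]

theorem jumpFactor_affine {c d : ℝ} (hc : 0 < c) (hcs : c * s' = s + d) {z : ℂ} (hz : z + s' ≠ 0) :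
    jumpFactor α s ((c : ℂ) * z + d) =
      upper (Real.log c / (2 * Real.pi * Complex.I)) * jumpFactor α s' z := by
  have h1 : (c : ℂ) * z + d + s = c * (z + s') := by
    have : (c : ℂ) * s' = s + d := by exact_mod_cast hcs
    linear_combination -this
  have h2 : logFactor s ((c : ℂ) * z + d) =
      Real.log c / (2 * Real.pi * Complex.I) + logFactor s' z := by
    rw [logFactor, logFactor, h1, Complex.log_ofReal_mul hc hz, add_div]
  have h3 : piecewiseE α s ((c : ℂ) * z + d) = piecewiseE α s' z := by
    have e2 : (c : ℂ) * z + d ∈ sectorII s ↔ z ∈ sectorII s' := by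
      simp only [sectorII, h1, Complex.arg_real_mul _ hc, Set.mem_ofPred_eq]
    have e3 : (c : ℂ) * z + d ∈ sectorIII s ↔ z ∈ sectorIII s' := by
      simp only [sectorIII, h1, Complex.arg_real_mul _ hc, Set.mem_ofPred_eq]
    have e4 : (c : ℂ) * z + d ∈ sectorIV s ↔ z ∈ sectorIV s' := by
      simp only [sectorIV, h1, Complex.arg_real_mul _ hc, Set.mem_ofPred_eq]
    have e5 : (c : ℂ) * z + d ∈ sectorV s ↔ z ∈ sectorV s' := by
      simp only [sectorV, h1, Complex.arg_real_mul _ hc, Set.mem_ofPred_eq]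
    simp only [piecewiseE]
    split_ifs <;> first | rfl | (exfalso; tauto)
  rw [jumpFactor, jumpFactor, h2, h3, ← mul_assoc, upper_mul]

/-- The product of one solution with the inverse of another one, composed with the affine map
that matches the contours, has no jumps outside a disc. -/
theorem exists_outer_factor (h : IsRHSolution k α l s M a) (h' : IsRHSolution k α l' s' M' a')
    (hs : 0 < s) (hs' : 0 < s') {c d r₀ : ℝ} (hc : 0 < c) (hcs : c * s' = s + d)
    (hd : |d| < c * r₀) :
    ∃ Z : ℂ → Mat, DifferentiableOn ℂ Z {z | r₀ < ‖z‖} ∧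
      ∀ z ∈ Omega s', r₀ < ‖z‖ → Z z = M' z * adjL (M ((c : ℂ) * z + d)) := by
  have haff : Differentiable ℂ (fun z : ℂ => (c : ℂ) * z + d) := by fun_prop
  have hmem : ∀ z : ℂ, r₀ < ‖z‖ → ((c : ℂ) * z + d ∈ Omega s ↔ z ∈ Omega s') := fun z hz =>
    affine_mem_Omega_iff hs hs' hc hcs hd hz
  obtain ⟨Z, hZ, hZM⟩ := exists_extension_of_local
    (f := fun z => M' z * adjL (M ((c : ℂ) * z + d))) (U := {z | r₀ < ‖z‖})
    (isOpen_Omega hs') (dense_Omega hs') (isOpen_exterior r₀) (by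
      intro z hz
      have h1 := h.differentiableAt hs ((hmem z hz.2).2 hz.1)
      exact ((h'.differentiableAt hs' hz.1).mul (adjL.differentiableAt.comp z
        (h1.comp z (haff z)))).differentiableWithinAt) (by
      intro z₀ hz₀ hz₀Ω
      have hz₀' : r₀ < ‖z₀‖ := hz₀
      have hr0 : 0 < r₀ := by
        have := (abs_nonneg d).trans_lt hd
        exact (mul_pos_iff_of_pos_left hc).1 this
      have hz0 : z₀ ≠ 0 := by
        rintro rfl
        rw [norm_zero] at hz₀'; linarith
      have hφ0 : (c : ℂ) * z₀ + d ≠ 0 := by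
        intro h0
        have h1 : (c : ℂ) * z₀ = -(d : ℂ) := by linear_combination h0
        have h2 := congrArg norm h1
        rw [norm_mul, norm_neg, Complex.norm_real, Complex.norm_real, Real.norm_eq_abs,
          Real.norm_eq_abs, abs_of_pos hc] at h2
        nlinarith
      obtain ⟨F, hF, hFM⟩ := h.exists_factor hs (fun h0 => hz₀Ω ((hmem z₀ hz₀').1 h0)) hφ0
      obtain ⟨F', hF', hFM'⟩ := h'.exists_factor hs' hz₀Ω hz0
      refine ⟨fun z => F' z * upper (-(Real.log c / (2 * Real.pi * Complex.I))) *
        adjL (F ((c : ℂ) * z + d)), ?_, ?_⟩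
      · have hcomp : AnalyticAt ℂ (fun z => F ((c : ℂ) * z + d)) z₀ :=
          AnalyticAt.comp (g := F) (f := fun z : ℂ => (c : ℂ) * z + d) hF (haff.analyticAt z₀)
        exact (hF'.mul analyticAt_const).mul (AnalyticAt.adjL_comp hcomp)
      · have htend : Tendsto (fun z : ℂ => (c : ℂ) * z + d) (𝓝[Omega s'] z₀)
            (𝓝[Omega s] ((c : ℂ) * z₀ + d)) := by
          refine tendsto_nhdsWithin_iff.2 ⟨(haff z₀).continuousAt.tendsto.mono_left
            nhdsWithin_le_nhds, ?_⟩
          filter_upwards [self_mem_nhdsWithin,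
            nhdsWithin_le_nhds ((isOpen_exterior r₀).mem_nhds hz₀)] with z hz hzr
          exact (hmem z hzr).2 hz
        filter_upwards [hFM', htend.eventually hFM, self_mem_nhdsWithin] with z h1 h2 h3
        rw [h1, h2, jumpFactor_affine hc hcs (add_ne_zero_of_mem_Omega hs' h3), adjL_mul, adjL_mul,
          adjL_upper]
        calc _ = F' z * ((jumpFactor α s' z * adjL (jumpFactor α s' z)) *
              upper (-(Real.log c / (2 * Real.pi * Complex.I)))) * adjL (F ((c : ℂ) * z + d)) := by
              simp only [mul_assoc]
          _ = _ := by rw [mul_adjL (det_jumpFactor _ _ _), one_mul])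
  exact ⟨Z, hZ, fun z hz hzr => hZM z ⟨hz, hzr⟩⟩

/-- The map `z ↦ c z + d` preserves the upper and the lower half plane, so that principal branches
are compatible with division. -/
theorem log_affine {c d : ℝ} (hc : 0 < c) {z : ℂ} (hz : z ∈ Complex.slitPlane)
    (hz' : (c : ℂ) * z + d ∈ Complex.slitPlane) :
    Complex.log ((c : ℂ) * z + d) = Complex.log z + Complex.log (((c : ℂ) * z + d) / z) := by
  have hz0 := Complex.slitPlane_ne_zero hz
  have hz0' := Complex.slitPlane_ne_zero hz'
  have hargz : z.arg ≠ Real.pi := Complex.slitPlane_arg_ne_pi hz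
  have h1 : Complex.log (((c : ℂ) * z + d) * z⁻¹) = Complex.log ((c : ℂ) * z + d) + Complex.log z⁻¹ := by
    refine (Complex.log_mul_eq_add_log_iff hz0' (inv_ne_zero hz0)).2 ?_
    rw [Complex.arg_inv, if_neg hargz]
    have him : ((c : ℂ) * z + d).im = c * z.im := by simp
    rcases lt_trichotomy z.im 0 with h | h | h
    · have h2 : ((c : ℂ) * z + d).im < 0 := by rw [him]; nlinarith
      have e1 := Complex.arg_neg_iff.2 h
      have e2 := Complex.arg_neg_iff.2 h2
      constructor <;> linarith [Complex.neg_pi_lt_arg z, Complex.neg_pi_lt_arg ((c : ℂ) * z + d)]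
    · have h2 : ((c : ℂ) * z + d).im = 0 := by rw [him, h, mul_zero]
      rw [Complex.mem_slitPlane_iff] at hz hz'
      have e1 : z.arg = 0 := Complex.arg_eq_zero_iff.2 ⟨by grind, h⟩
      have e2 : ((c : ℂ) * z + d).arg = 0 := Complex.arg_eq_zero_iff.2 ⟨by grind, h2⟩
      rw [e1, e2]
      constructor <;> linarith [Real.pi_pos]
    · have h2 : 0 < ((c : ℂ) * z + d).im := by rw [him]; positivity
      have e1 := arg_pos_of_im_pos h
      have e2 := arg_pos_of_im_pos h2
      constructor <;> linarith [Complex.arg_le_pi z, Complex.arg_le_pi ((c : ℂ) * z + d)]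
  rw [div_eq_mul_inv, h1, Complex.log_inv _ hargz]
  ring

theorem cpow_affine {c d : ℝ} (hc : 0 < c) {z : ℂ} (hz : z ∈ Complex.slitPlane)
    (hz' : (c : ℂ) * z + d ∈ Complex.slitPlane) (β : ℂ) :
    ((c : ℂ) * z + d) ^ β = (((c : ℂ) * z + d) / z) ^ β * z ^ β := by
  have hz0 := Complex.slitPlane_ne_zero hz
  have hz0' := Complex.slitPlane_ne_zero hz'
  rw [Complex.cpow_def_of_ne_zero hz0', Complex.cpow_def_of_ne_zero hz0,
    Complex.cpow_def_of_ne_zero (div_ne_zero hz0' hz0), log_affine hc hz hz', ← Complex.exp_add]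
  congr 1; ring

theorem tendsto_affine_cobounded {c d : ℝ} (hc : 0 < c) :
    Tendsto (fun z : ℂ => (c : ℂ) * z + d) (Bornology.cobounded ℂ) (Bornology.cobounded ℂ) := by
  rw [← tendsto_norm_atTop_iff_cobounded]
  refine tendsto_atTop_mono (f := fun z : ℂ => c * ‖z‖ + -|d|) (fun z => ?_)
    ((tendsto_norm_cobounded_atTop.const_mul_atTop hc).atTop_add tendsto_const_nhds)
  have := norm_sub_norm_le ((c : ℂ) * z) (-(d : ℂ))
  rw [norm_neg, norm_mul, Complex.norm_real, Complex.norm_real, Real.norm_eq_abs, Real.norm_eq_abs,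
    abs_of_pos hc, sub_neg_eq_add] at this
  linarith

/-- The limit at infinity of the ratio of the two models, one composed with the affine map. -/
noncomputable def ratioLimit (l g d : ℝ) : Mat := !![(g : ℂ)⁻¹, 0; l * d / (2 * g), g]

theorem det_ratioLimit {l g d : ℝ} (hg : 0 < g) : (ratioLimit l g d).det = 1 := by
  have : (g : ℂ) ≠ 0 := Complex.ofReal_ne_zero.2 hg.ne'
  simp [ratioLimit, Matrix.det_fin_two, this]

/-- The ratio `sinh η / η`, continued to `η = 0`. -/
noncomputable def sinhc : ℂ → ℂ := dslope Complex.sinh 0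

theorem mul_sinhc (η : ℂ) : η * sinhc η = Complex.sinh η := by
  have := sub_smul_dslope Complex.sinh 0 η
  simpa [sinhc] using this

theorem tendsto_sinhc : Tendsto sinhc (𝓝 0) (𝓝 1) := by
  have h1 : ContinuousAt sinhc 0 := continuousAt_dslope_same.2 Complex.differentiable_sinh.differentiableAt
  have h2 : sinhc 0 = 1 := by simp [sinhc, dslope_same, (Complex.hasDerivAt_sinh 0).deriv]
  rw [← h2]; exact h1

/-- The ratio of the models for the exponents `l` and `g² l`, with the affine map `z ↦ g⁴ z + d`:
the growing exponentials cancel. -/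
theorem tendsto_model_ratio (hs : 0 < s) (hs' : 0 < s') {g d : ℝ} (hg : 0 < g)
    (hcs : g ^ 4 * s' = s + d) :
    Tendsto (fun z : ℂ => modelInfinity l (((g ^ 4 : ℝ) : ℂ) * z + d) *
      adjL (modelInfinity (g ^ 2 * l) z)) (Bornology.cobounded ℂ ⊓ 𝓟 (Omega s'))
      (𝓝 (ratioLimit l g d)) ∧
    Tendsto (fun z : ℂ => z * (modelInfinity l (((g ^ 4 : ℝ) : ℂ) * z + d) *
      adjL (modelInfinity (g ^ 2 * l) z)) 0 1) (Bornology.cobounded ℂ ⊓ 𝓟 (Omega s'))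
      (𝓝 (l * d / (2 * g ^ 3))) := by
  have hgc : (g : ℂ) ≠ 0 := Complex.ofReal_ne_zero.2 hg.ne'
  have hc : 0 < g ^ 4 := by positivity
  set 𝓕 := Bornology.cobounded ℂ ⊓ 𝓟 (Omega s') with h𝓕
  set u : ℂ → ℂ := fun z => ((((g ^ 4 : ℝ) : ℂ) * z + d) / z) ^ (1 / 4 : ℂ) with hu
  set p : ℂ → ℂ := fun z => z ^ (1 / 4 : ℂ) with hp
  have hinv : Tendsto (fun z : ℂ => z⁻¹) 𝓕 (𝓝 0) := tendsto_inv₀_cobounded.mono_left inf_le_left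
  have hne : ∀ᶠ z in 𝓕, z ≠ 0 ∧ z ∈ Complex.slitPlane ∧
      ((g ^ 4 : ℝ) : ℂ) * z + d ∈ Complex.slitPlane := by
    have h1 : ∀ᶠ z in 𝓕, |d| / g ^ 4 + 1 < ‖z‖ :=
      (tendsto_norm_cobounded_atTop.mono_left inf_le_left).eventually_gt_atTop _
    filter_upwards [h1, mem_inf_of_right (mem_principal_self _)] with z hz hzΩ
    refine ⟨ne_zero_of_mem_Omega hs' hzΩ, Omega_subset_slitPlane hs' hzΩ, ?_⟩
    refine Omega_subset_slitPlane hs ((affine_mem_Omega_iff hs hs' hc hcs ?_ hz).2 hzΩ)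
    rw [mul_add, mul_div_cancel₀ _ hc.ne']; linarith
  have hulim : Tendsto u 𝓕 (𝓝 g) := by
    have h1 : Tendsto (fun z : ℂ => (((g ^ 4 : ℝ) : ℂ) * z + d) / z) 𝓕 (𝓝 ((g ^ 4 : ℝ) : ℂ)) := by
      have h2 := (hinv.const_mul (d : ℂ)).const_add ((g ^ 4 : ℝ) : ℂ)
      rw [mul_zero, add_zero] at h2
      refine h2.congr' ?_
      filter_upwards [hne] with z hz
      have := hz.1
      field_simp
    have h3 : (((g ^ 4 : ℝ) : ℂ)) ^ (1 / 4 : ℂ) = g := by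
      have h4 : (1 / 4 : ℂ) = ((1 / 4 : ℝ) : ℂ) := by push_cast; ring
      rw [h4, ← Complex.ofReal_cpow hc.le]
      congr 1
      rw [← Real.rpow_natCast g 4, ← Real.rpow_mul hg.le]
      norm_num
    rw [← h3]
    exact h1.cpow tendsto_const_nhds (Complex.ofReal_mem_slitPlane.2 hc)
  have hu4 : ∀ᶠ z in 𝓕, u z ^ 4 = g ^ 4 + d / z := by
    filter_upwards [hne] with z hz
    rw [hu]
    simp only
    rw [fourth_root_pow]
    have := hz.1
    push_cast
    field_simp
  have hden : ∀ᶠ z in 𝓕, u z ^ 2 + g ^ 2 ≠ 0 ∧ u z ≠ 0 := by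
    have h1 : Tendsto (fun z => u z ^ 2 + (g : ℂ) ^ 2) 𝓕 (𝓝 (g ^ 2 + g ^ 2)) :=
      (hulim.pow 2).add_const _
    have h2 : (g : ℂ) ^ 2 + g ^ 2 ≠ 0 := by
      rw [← two_mul]; exact mul_ne_zero two_ne_zero (pow_ne_zero 2 hgc)
    exact (h1.eventually_ne h2).and (hulim.eventually_ne hgc)
  have hp2 : Tendsto (fun z => (p z ^ 2)⁻¹) 𝓕 (𝓝 0) := by
    rw [tendsto_zero_iff_norm_tendsto_zero]
    have h1 : Tendsto (fun z : ℂ => Real.sqrt ‖z⁻¹‖) 𝓕 (𝓝 0) := by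
      have := (Real.continuous_sqrt.tendsto _).comp hinv.norm
      simpa [Function.comp_def] using this
    refine h1.congr fun z => ?_
    have h2 : ‖z⁻¹‖ = ‖(p z ^ 2)⁻¹‖ ^ 2 := by
      rw [← norm_pow, inv_pow, ← pow_mul, hp]
      simp only
      rw [fourth_root_pow]
    rw [h2, Real.sqrt_sq (norm_nonneg _)]
  -- the difference of the exponents
  set κ : ℂ → ℂ := fun z => l * d / (u z ^ 2 + g ^ 2) with hκ
  have hκlim : Tendsto κ 𝓕 (𝓝 (l * d / (2 * g ^ 2))) := by
    have h1 : Tendsto (fun z => u z ^ 2 + (g : ℂ) ^ 2) 𝓕 (𝓝 (2 * g ^ 2)) := by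
      rw [two_mul]; exact (hulim.pow 2).add_const _
    exact tendsto_const_nhds.div h1 (mul_ne_zero two_ne_zero (pow_ne_zero 2 hgc))
  have hη : Tendsto (fun z => κ z * (p z ^ 2)⁻¹) 𝓕 (𝓝 0) := by
    simpa using hκlim.mul hp2
  have hform : ∀ᶠ z in 𝓕, modelInfinity l (((g ^ 4 : ℝ) : ℂ) * z + d) *
      adjL (modelInfinity (g ^ 2 * l) z) =
      !![(u z)⁻¹ * Complex.cosh (κ z * (p z ^ 2)⁻¹),
        z⁻¹ * (κ z * sinhc (κ z * (p z ^ 2)⁻¹) * (u z)⁻¹);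
        u z * (κ z * sinhc (κ z * (p z ^ 2)⁻¹)), u z * Complex.cosh (κ z * (p z ^ 2)⁻¹)] := by
    filter_upwards [hne, hu4, hden] with z hz hz4 hzd
    obtain ⟨hz0, hzs, hzs'⟩ := hz
    have hp0 : p z ≠ 0 := fourth_root_ne hz0
    have hp4 : p z ^ 4 = z := fourth_root_pow z
    have hq : (((g ^ 4 : ℝ) : ℂ) * z + d) ^ (1 / 4 : ℂ) = u z * p z := cpow_affine hc hzs hzs' _
    have hη' : (l : ℂ) * (u z * p z) ^ 2 - ((g ^ 2 * l : ℝ) : ℂ) * p z ^ 2 =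
        κ z * (p z ^ 2)⁻¹ := by
      have h1 : (u z ^ 2 - g ^ 2) * (u z ^ 2 + g ^ 2) * p z ^ 4 = d := by
        have : (u z ^ 2 - (g : ℂ) ^ 2) * (u z ^ 2 + g ^ 2) = d / z := by linear_combination hz4
        rw [this, hp4, div_mul_cancel₀ _ hz0]
      simp only [hκ]
      have h2 := hzd.1
      push_cast
      field_simp
      linear_combination (l : ℂ) * h1
    rw [modelInfinity_eq _ (Complex.slitPlane_ne_zero hzs'), modelInfinity_eq _ hz0, hq,
      modelRoot_ratio _ _ (mul_ne_zero hzd.2 hp0) hp0, hη', ← mul_sinhc]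
    have hu0 := hzd.2
    have hzi : z⁻¹ = (p z ^ 4)⁻¹ := by rw [hp4]
    ext i j
    fin_cases i <;> fin_cases j <;> simp
    · left; field_simp
    · rw [hzi]; field_simp
    · field_simp
    · left; field_simp
  have hS := tendsto_sinhc.comp hη
  have hC : Tendsto (fun z => Complex.cosh (κ z * (p z ^ 2)⁻¹)) 𝓕 (𝓝 1) := by
    have := (Complex.continuous_cosh.tendsto 0).comp hη
    simpa [Function.comp_def] using this
  have hui := hulim.inv₀ hgc
  constructor
  · refine Tendsto.congr' (hform.mono fun z hz => hz.symm) (tendsto_mat fun i j => ?_)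
    fin_cases i <;> fin_cases j
    · simpa [ratioLimit] using hui.mul hC
    · simpa [ratioLimit] using hinv.mul ((hκlim.mul hS).mul hui)
    · have := hulim.mul (hκlim.mul hS)
      refine (this.congr fun z => ?_).trans (le_of_eq ?_)
      · simp
      · congr 1
        simp [ratioLimit]
        field_simp
    · simpa [ratioLimit] using hulim.mul hC
  · have h1 := (hκlim.mul hS).mul hui
    have h2 : (l : ℂ) * d / (2 * g ^ 2) * 1 * (g : ℂ)⁻¹ = l * d / (2 * g ^ 3) := by field_simp
    rw [h2] at h1
    refine h1.congr' ?_
    filter_upwards [hform, hne] with z hz hz0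
    rw [hz]
    have := hz0.1
    simp [← mul_assoc, this]

end Comparison

section OuterFactor

variable {k : ℕ} {α l l' s s' : ℝ} {M M' : ℂ → Mat} {a a' : ℂ}

theorem tendsto_ofReal_ray (hs : 0 < s) :
    Tendsto (fun x : ℝ => (x : ℂ)) atTop (Bornology.cobounded ℂ ⊓ 𝓟 (Omega s)) := by
  refine tendsto_inf.2 ⟨?_, tendsto_principal.2 ?_⟩
  · rw [← tendsto_norm_atTop_iff_cobounded]
    refine tendsto_atTop_mono (fun x => ?_) tendsto_id
    rw [Complex.norm_real]; exact le_abs_self x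
  · filter_upwards [eventually_gt_atTop 0] with x hx
    exact mem_Omega_of_re_pos hs (by simpa using hx)

theorem tendsto_affine_Omega (hs : 0 < s) (hs' : 0 < s') {c d r₀ : ℝ} (hc : 0 < c)
    (hcs : c * s' = s + d) (hd : |d| < c * r₀) :
    Tendsto (fun z : ℂ => (c : ℂ) * z + d) (Bornology.cobounded ℂ ⊓ 𝓟 (Omega s'))
      (Bornology.cobounded ℂ ⊓ 𝓟 (Omega s)) := by
  refine tendsto_inf.2 ⟨(tendsto_affine_cobounded hc).mono_left inf_le_left, tendsto_principal.2 ?_⟩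
  have h1 : ∀ᶠ z in Bornology.cobounded ℂ ⊓ 𝓟 (Omega s'), r₀ < ‖z‖ :=
    (tendsto_norm_cobounded_atTop.mono_left inf_le_left).eventually_gt_atTop _
  filter_upwards [h1, mem_inf_of_right (mem_principal_self _)] with z hz hzΩ
  exact (affine_mem_Omega_iff hs hs' hc hcs hd hz).2 hzΩ

/-- The outer factor, normalized to tend to one at infinity. -/
noncomputable def outerFactor (l g d : ℝ) (a a' : ℂ) (Z : ℂ → Mat) (z : ℂ) : Mat :=
  adjL (lower a') * Z z * lower a * ratioLimit l g d

theorem outerFactor_eq (hs' : 0 < s') {g d : ℝ} {z : ℂ} {Z : ℂ → Mat}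
    (hz : z ∈ Omega s') (hφ : ((g ^ 4 : ℝ) : ℂ) * z + d ∈ Omega s) (hs : 0 < s)
    (hZ : Z z = M' z * adjL (M (((g ^ 4 : ℝ) : ℂ) * z + d))) :
    outerFactor l g d a a' Z z = normalized l' a' M' z *
      adjL (modelInfinity l (((g ^ 4 : ℝ) : ℂ) * z + d) * adjL (modelInfinity l' z)) *
      adjL (normalized l a M (((g ^ 4 : ℝ) : ℂ) * z + d)) * ratioLimit l g d := by
  rw [outerFactor, hZ, eq_normalized (M := M') (l := l') (a := a') (ne_zero_of_mem_Omega hs' hz),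
    eq_normalized (M := M) (l := l) (a := a) (ne_zero_of_mem_Omega hs hφ), adjL_mul, adjL_mul, adjL_mul,
    adjL_adjL]
  set w : ℂ := ((g ^ 4 : ℝ) : ℂ) * z + d
  calc _ = (adjL (lower a') * lower a') * normalized l' a' M' z * modelInfinity l' z *
        adjL (modelInfinity l w) * adjL (normalized l a M w) * (adjL (lower a) * lower a) *
        ratioLimit l g d := by simp only [mul_assoc]
    _ = _ := by
        rw [adjL_mul_self (det_lower _), adjL_mul_self (det_lower _), mul_one, one_mul]
        simp only [mul_assoc]

/-- The normalized outer factor tends to one at infinity; the next term of its `(1,2)` entry contains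
the constant `a'` of the second solution. -/
theorem tendsto_outerFactor (h : IsRHSolution k α l s M a) (h' : IsRHSolution k α l' s' M' a')
    (hs : 0 < s) (hs' : 0 < s') {g d r₀ : ℝ} (hg : 0 < g) (hl : l' = g ^ 2 * l)
    (hcs : g ^ 4 * s' = s + d) (hd : |d| < g ^ 4 * r₀) {Z : ℂ → Mat}
    (hZ : DifferentiableOn ℂ Z {z | r₀ < ‖z‖})
    (hZM : ∀ z ∈ Omega s', r₀ < ‖z‖ → Z z = M' z * adjL (M (((g ^ 4 : ℝ) : ℂ) * z + d))) :
    Tendsto (outerFactor l g d a a' Z) (Bornology.cobounded ℂ) (𝓝 1) ∧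
    Tendsto (fun x : ℝ => (x : ℂ) * outerFactor l g d a a' Z x 0 1) atTop
      (𝓝 (a' - l * d / (2 * g ^ 2) - a / g ^ 2)) := by
  have hgc : (g : ℂ) ≠ 0 := Complex.ofReal_ne_zero.2 hg.ne'
  have hc : 0 < g ^ 4 := by positivity
  obtain ⟨hG, hG1⟩ := tendsto_model_ratio (l := l) hs hs' hg hcs
  rw [← hl] at hG hG1
  set 𝓕 := Bornology.cobounded ℂ ⊓ 𝓟 (Omega s') with h𝓕
  have hφ := tendsto_affine_Omega hs hs' hc hcs hd
  have hev : ∀ᶠ z in 𝓕, outerFactor l g d a a' Z z = normalized l' a' M' z *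
      adjL (modelInfinity l (((g ^ 4 : ℝ) : ℂ) * z + d) * adjL (modelInfinity l' z)) *
      adjL (normalized l a M (((g ^ 4 : ℝ) : ℂ) * z + d)) * ratioLimit l g d := by
    have h1 : ∀ᶠ z in 𝓕, r₀ < ‖z‖ :=
      (tendsto_norm_cobounded_atTop.mono_left inf_le_left).eventually_gt_atTop _
    filter_upwards [h1, mem_inf_of_right (mem_principal_self _)] with z hz hzΩ
    exact outerFactor_eq hs' hzΩ ((affine_mem_Omega_iff hs hs' hc hcs hd hz).2 hzΩ) hs
      (hZM z hzΩ hz)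
  have hYφ : Tendsto (fun z : ℂ => adjL (normalized l a M (((g ^ 4 : ℝ) : ℂ) * z + d))) 𝓕 (𝓝 1) := by
    have h1 := (adjL.continuous.tendsto 1).comp ((h.tendsto_normalized hs).comp hφ)
    rwa [adjL_one] at h1
  have hGa : Tendsto (fun z : ℂ => adjL (modelInfinity l (((g ^ 4 : ℝ) : ℂ) * z + d) *
      adjL (modelInfinity l' z))) 𝓕 (𝓝 (adjL (ratioLimit l g d))) :=
    (adjL.continuous.tendsto _).comp hG
  have hK : Tendsto (fun z : ℂ => adjL (modelInfinity l (((g ^ 4 : ℝ) : ℂ) * z + d) *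
      adjL (modelInfinity l' z)) * adjL (normalized l a M (((g ^ 4 : ℝ) : ℂ) * z + d)) *
      ratioLimit l g d) 𝓕 (𝓝 1) := by
    have h1 := (hGa.mul hYφ).mul_const (ratioLimit l g d)
    rwa [mul_one, adjL_mul_self (det_ratioLimit hg)] at h1
  constructor
  · refine tendsto_cobounded_of_dense (dense_Omega hs') (R := r₀) ?_ ?_
    · exact (((continuousOn_const.mul hZ.continuousOn).mul continuousOn_const).mul
        continuousOn_const)
    · have h1 := (h'.tendsto_normalized hs').mul hK
      rw [mul_one] at h1
      refine h1.congr' (hev.mono fun z hz => ?_)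
      rw [hz]
      simp only [mul_assoc]
  · have hray := tendsto_ofReal_ray hs'
    obtain ⟨m, hm, hW, -⟩ := h.expansion_on_ray hs
    obtain ⟨m', hm', hW', -⟩ := h'.expansion_on_ray hs'
    have haff : Tendsto (fun x : ℝ => g ^ 4 * x + d) atTop atTop :=
      (tendsto_id.const_mul_atTop hc).atTop_add tendsto_const_nhds
    have hx0 : ∀ᶠ x : ℝ in atTop, (x : ℂ) ≠ 0 ∧ ((g ^ 4 : ℝ) : ℂ) * x + d ≠ 0 := by
      filter_upwards [eventually_gt_atTop 0, haff.eventually_gt_atTop 0] with x hx hx'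
      refine ⟨Complex.ofReal_ne_zero.2 hx.ne', ?_⟩
      have := Complex.ofReal_ne_zero.2 hx'.ne'
      push_cast at this ⊢
      exact this
    have hWφ : Tendsto (fun x : ℝ => adjL ((x : ℂ) •
        (normalized l a M (((g ^ 4 : ℝ) : ℂ) * x + d) - 1))) atTop
        (𝓝 (adjL (((g : ℂ) ^ 4)⁻¹ • m))) := by
      refine (adjL.continuous.tendsto _).comp ?_
      have h1 := hW.comp haff
      have h2 : Tendsto (fun x : ℝ => (((g ^ 4 : ℝ) : ℂ) + d * (x : ℂ)⁻¹)⁻¹) atTop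
          (𝓝 ((g : ℂ) ^ 4)⁻¹) := by
        have := ((tendsto_ofReal_inv.const_mul (d : ℂ)).const_add ((g ^ 4 : ℝ) : ℂ)).inv₀
          (by simpa using hgc)
        simpa using this
      refine (h2.smul h1).congr' ?_
      filter_upwards [hx0] with x hx
      simp only [Function.comp_apply]
      push_cast
      rw [smul_smul]
      congr 1
      have hx2 := hx.2
      push_cast at hx2
      have : (g : ℂ) ^ 4 + d * (x : ℂ)⁻¹ = ((g : ℂ) ^ 4 * x + d) / x := by
        have := hx.1
        field_simp
      rw [this, inv_div, div_mul_cancel₀ _ hx2]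
    have h1 := Tendsto.entry (hW'.mul (hK.comp hray)) 0 1
    have h2 := Tendsto.entry (((hGa.comp hray).mul hWφ).mul_const (ratioLimit l g d)) 0 1
    have h3 := (hG1.comp hray).mul_const (-(g : ℂ))
    have h4 := (h1.add h2).add h3
    have hlimit : (m' * 1) 0 1 + (adjL (ratioLimit l g d) * adjL (((g : ℂ) ^ 4)⁻¹ • m) *
        ratioLimit l g d) 0 1 + (l * d / (2 * g ^ 3) * -(g : ℂ)) =
        a' - l * d / (2 * g ^ 2) - a / g ^ 2 := by
      rw [mul_one, hm', adjL_apply, adjL_apply]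
      simp [ratioLimit, Matrix.mul_apply, Fin.sum_univ_two, hm]
      field_simp
      ring
    rw [hlimit] at h4
    refine h4.congr' ?_
    filter_upwards [hray.eventually hev, hx0] with x hx hx0
    rw [hx]
    simp only [Function.comp_apply]
    set Y' := normalized l' a' M' x
    set Y := normalized l a M (((g ^ 4 : ℝ) : ℂ) * x + d)
    set G := modelInfinity l (((g ^ 4 : ℝ) : ℂ) * x + d) * adjL (modelInfinity l' x)
    have e1 : Y' * adjL G * adjL Y * ratioLimit l g d = (Y' - 1) * (adjL G * adjL Y * ratioLimit l g d) +
        adjL G * adjL (Y - 1) * ratioLimit l g d + adjL G * ratioLimit l g d := by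
      rw [map_sub, adjL_one]; noncomm_ring
    have e2 : (adjL G * ratioLimit l g d) 0 1 = -(g : ℂ) * G 0 1 := by
      rw [adjL_apply]
      simp [ratioLimit, Matrix.mul_apply, Fin.sum_univ_two]; ring
    rw [e1, Matrix.add_apply, Matrix.add_apply, e2, map_smul, smul_mul_assoc, mul_smul_comm,
      smul_mul_assoc, Matrix.smul_apply, Matrix.smul_apply, smul_eq_mul, smul_eq_mul]
    ring

end OuterFactor

/-! ### Comparison of two solutions near the origin -/

section Taylor

variable {E : Type*} [NormedAddCommGroup E] [NormedSpace ℂ E] [CompleteSpace E]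

/-- A second order Taylor bound for a bounded holomorphic function, with an explicit constant. -/
theorem norm_taylor_remainder_le {f : ℂ → E} {z : ℂ} {ρ K : ℝ} (hρ : 0 < ρ)
    (hf : DifferentiableOn ℂ f (Metric.ball z ρ)) (hK : ∀ w ∈ Metric.ball z ρ, ‖f w‖ ≤ K) {w : ℂ}
    (hw : w ∈ Metric.ball z (ρ / 2)) :
    ‖f w - f z - (w - z) • deriv f z‖ ≤ 12 * K / ρ ^ 2 * ‖w - z‖ ^ 2 := by
  have hball : Metric.ball z ρ ∈ 𝓝 z := Metric.ball_mem_nhds _ hρ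
  have hsub : Metric.closedBall z (ρ / 2) ⊆ Metric.ball z ρ :=
    Metric.closedBall_subset_ball (by linarith)
  set q : ℂ → E := dslope (dslope f z) z with hq
  have hqd : DifferentiableOn ℂ q (Metric.ball z ρ) :=
    (Complex.differentiableOn_dslope hball).2 ((Complex.differentiableOn_dslope hball).2 hf)
  have hid : ∀ w, f w - f z - (w - z) • deriv f z = (w - z) ^ 2 • q w := by
    intro w
    have h1 := sub_smul_dslope f z w
    have h2 := sub_smul_dslope (dslope f z) z w
    rw [dslope_same] at h2
    rw [← h1, ← smul_sub, ← h2, smul_smul, pow_two]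
  have hder : ‖deriv f z‖ ≤ K / (ρ / 2) :=
    Complex.norm_deriv_le_of_forall_mem_sphere_norm_le (by linarith)
      ((hf.mono hsub).diffContOnCl_ball subset_rfl)
      fun w hw => hK w (hsub (Metric.sphere_subset_closedBall hw))
  have hbound := Complex.norm_le_of_forall_mem_frontier_norm_le (C := 12 * K / ρ ^ 2)
    Metric.isBounded_ball ((hqd.mono hsub).diffContOnCl_ball subset_rfl) (fun v hv => by
      rw [frontier_ball _ (by linarith : ρ / 2 ≠ 0)] at hv
      have hv1 := hsub (Metric.sphere_subset_closedBall hv)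
      rw [mem_sphere_iff_norm] at hv
      have h1 : (ρ / 2) ^ 2 * ‖q v‖ ≤ 3 * K := by
        rw [← hv, ← norm_pow, ← norm_smul, ← hid]
        have h2 := norm_sub_le (f v - f z) ((v - z) • deriv f z)
        have h3 := norm_sub_le (f v) (f z)
        have h4 := hK v hv1
        have h5 := hK z (Metric.mem_ball_self hρ)
        rw [norm_smul, hv] at h2
        have h6 : ρ / 2 * ‖deriv f z‖ ≤ K := by
          calc ρ / 2 * ‖deriv f z‖ ≤ ρ / 2 * (K / (ρ / 2)) := by gcongr
            _ = K := by field_simp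
        linarith
      rw [le_div_iff₀ (by positivity)]
      nlinarith) (subset_closure hw)
  rw [hid, norm_smul, norm_pow, mul_comm]
  gcongr

end Taylor

section InnerFactor

variable {k : ℕ} {α l l' s s' : ℝ} {M M' : ℂ → Mat} {a a' : ℂ}

/-- The ratio of the singular factors of the local form at the points `w` and `z`. -/
noncomputable def localRatio (k : ℕ) (α : ℝ) (z w : ℂ) : Mat :=
  expSigma3 (theta k w - theta k z) * powSigma3 (w / z) (α / 2)

theorem localRatio_self {z : ℂ} (hz : z ≠ 0) : localRatio k α z z = 1 := by
  rw [localRatio, sub_self, expSigma3_zero, div_self hz, one_mul]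
  ext i j; fin_cases i <;> fin_cases j <;> simp [powSigma3]

theorem hasDerivAt_localRatio {z w : ℂ} (hz : z ≠ 0) (hw : w / z ∈ Complex.slitPlane) :
    HasDerivAt (localRatio k α z) ((zeroExponent k α w • sigma3) * localRatio k α z w) w := by
  have hwz := Complex.slitPlane_ne_zero hw
  have hw0 : w ≠ 0 := by rintro rfl; simp at hwz
  have ht : HasDerivAt (theta k) ((-1) ^ k * k / w ^ (k + 1)) w := by
    have := ((hasDerivAt_pow k w).fun_inv (pow_ne_zero k hw0)).const_mul ((-1 : ℂ) ^ (k + 1))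
    simp only [← div_eq_mul_inv] at this
    refine this.congr_deriv ?_
    rcases k with _ | k
    · simp
    · simp only [Nat.add_sub_cancel]; push_cast; field_simp; ring
  have ht' := ht.sub_const (theta k z)
  have hp : ∀ c : ℂ, HasDerivAt (fun w : ℂ => (w / z) ^ c) (c / w * (w / z) ^ c) w := by
    intro c
    refine (((hasDerivAt_id w).div_const z).cpow_const (c := c) hw).congr_deriv ?_
    simp only [id]
    rw [Complex.cpow_sub _ _ hwz, Complex.cpow_one]; field_simp
  have e : ∀ w, localRatio k α z w =
      !![Complex.exp (theta k w - theta k z) * (w / z) ^ (α / 2 : ℂ), 0;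
        0, Complex.exp (-(theta k w - theta k z)) * (w / z) ^ (-(α / 2) : ℂ)] := by
    intro w
    ext i j; fin_cases i <;> fin_cases j <;> simp [localRatio, expSigma3, powSigma3]
  rw [show localRatio k α z = fun w => localRatio k α z w from rfl]
  simp only [e]
  apply hasDerivAt_mat
  intro i j
  fin_cases i <;> fin_cases j <;> simp [sigma3, zeroExponent]
  · refine (ht'.cexp.mul (hp (α / 2))).congr_deriv ?_
    field_simp
  · exact hasDerivAt_const _ _
  · exact hasDerivAt_const _ _
  · have ht'' : HasDerivAt (fun w => theta k z - theta k w) (-((-1) ^ k * k / w ^ (k + 1))) w :=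
      ht.const_sub _
    refine (ht''.cexp.mul (hp (-(α / 2)))).congr_deriv ?_
    field_simp
    ring

/-- The rational form of the logarithmic derivative in terms of the local form at the origin,
valid also on the cut. -/
theorem ratForm_eq_local (hs : 0 < s) {c : ℕ → Mat} {c₀ c₁ : Mat}
    (hc : ∀ z ∈ Omega s, logD M z = ratForm k s c c₀ c₁ z) {P : ℂ → Mat}
    (hP : DifferentiableOn ℂ P (Metric.ball 0 s))
    (hPM : ∀ z ∈ Omega s ∩ Metric.ball 0 s, logD M z = deriv P z * adjL (P z) +
        zeroExponent k α z • (P z * sigma3 * adjL (P z))) {z : ℂ} (hz : z ∈ Metric.ball (0 : ℂ) s)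
    (hz0 : z ≠ 0) :
    deriv P z * adjL (P z) + zeroExponent k α z • (P z * sigma3 * adjL (P z)) =
      ratForm k s c c₀ c₁ z := by
  have := neBot_nhdsWithin_Omega hs z
  have hPa : AnalyticAt ℂ P z := hP.analyticAt (Metric.isOpen_ball.mem_nhds hz)
  have hP1 : ContinuousAt (fun w => adjL (P w)) z := (AnalyticAt.adjL_comp hPa).continuousAt
  have hzs : z + s ≠ 0 := by
    intro h0
    rw [mem_ball_zero_iff, show z = -(s : ℂ) by linear_combination h0, norm_neg,
      Complex.norm_real, Real.norm_eq_abs, abs_of_pos hs] at hz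
    exact lt_irrefl _ hz
  have hL : ContinuousAt (fun w => deriv P w * adjL (P w) +
      zeroExponent k α w • (P w * sigma3 * adjL (P w))) z := by
    have h1 : ContinuousAt (zeroExponent k α) z := by
      have e1 : ContinuousAt (fun w : ℂ => (-1) ^ k * (k : ℂ) / w ^ (k + 1)) z :=
        continuousAt_const.div (continuous_pow (k + 1)).continuousAt (pow_ne_zero _ hz0)
      have e2 : ContinuousAt (fun w : ℂ => (α : ℂ) / (2 * w)) z :=
        continuousAt_const.div (continuousAt_id.const_mul 2) (mul_ne_zero two_ne_zero hz0)
      exact e1.add e2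
    have h2 : ContinuousAt (fun w => P w * sigma3 * adjL (P w)) z :=
      (hPa.continuousAt.mul continuousAt_const).mul hP1
    have h3 : ContinuousAt (fun w => zeroExponent k α w • (P w * sigma3 * adjL (P w))) z :=
      h1.smul h2
    have h4 : ContinuousAt (fun w => deriv P w * adjL (P w)) z := hPa.deriv.continuousAt.mul hP1
    exact h4.add h3
  have hR : ContinuousAt (fun w => ratForm k s c c₀ c₁ w) z := by
    unfold ratForm
    refine ContinuousAt.add (ContinuousAt.add ?_ ?_) continuousAt_const
    · refine tendsto_finsetSum _ fun j _ => ?_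
      exact ((((continuous_pow j).continuousAt).inv₀ (pow_ne_zero _ hz0)).smul_const _)
    · have : ContinuousAt (fun w : ℂ => (w + s)⁻¹) z :=
        ContinuousAt.inv₀ (by fun_prop) hzs
      exact this.smul_const _
  refine tendsto_nhds_unique (l := 𝓝[Omega s] z) (hL.tendsto.mono_left nhdsWithin_le_nhds)
    ((hR.tendsto.mono_left nhdsWithin_le_nhds).congr' ?_)
  filter_upwards [self_mem_nhdsWithin, nhdsWithin_le_nhds (Metric.isOpen_ball.mem_nhds hz)]
    with w hw hwb
  rw [← hc w hw, hPM w ⟨hw, hwb⟩]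

theorem affine_div_mem_slitPlane {c d r₀ : ℝ} (hc : 0 < c) (hd : |d| < c * r₀) {z : ℂ}
    (hz : r₀ < ‖z‖) : ((c : ℂ) * z + d) / z ∈ Complex.slitPlane := by
  have hr0 : 0 < r₀ := (mul_pos_iff_of_pos_left hc).1 ((abs_nonneg d).trans_lt hd)
  have hz0 : z ≠ 0 := by rintro rfl; rw [norm_zero] at hz; linarith
  have hn : 0 < ‖z‖ := norm_pos_iff.2 hz0
  rw [Complex.mem_slitPlane_iff]
  left
  rw [add_div, mul_div_cancel_right₀ _ hz0, Complex.add_re, Complex.ofReal_re]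
  have h1 := (abs_le.1 (Complex.abs_re_le_norm ((d : ℂ) / z))).1
  rw [norm_div, Complex.norm_real, Real.norm_eq_abs] at h1
  have h2 : |d| / ‖z‖ < c := by
    rw [div_lt_iff₀ hn]
    nlinarith
  linarith

theorem powSigma3_mul_powSigma3 (u v c : ℂ) : powSigma3 u c * powSigma3 v c =
    !![u ^ c * v ^ c, 0; 0, u ^ (-c) * v ^ (-c)] := by
  ext i j; fin_cases i <;> fin_cases j <;> simp [powSigma3]

/-- The outer and the inner factors are related by the local form at the origin. -/
theorem outer_mul_local (hs : 0 < s) (hs' : 0 < s') {c d r₀ : ℝ} (hc : 0 < c)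
    (hcs : c * s' = s + d) (hd : |d| < c * r₀) {Z P P' : ℂ → Mat}
    (hZ : DifferentiableOn ℂ Z {z | r₀ < ‖z‖})
    (hZM : ∀ z ∈ Omega s', r₀ < ‖z‖ → Z z = M' z * adjL (M ((c : ℂ) * z + d)))
    (hP : DifferentiableOn ℂ P (Metric.ball 0 s)) (hP' : DifferentiableOn ℂ P' (Metric.ball 0 s'))
    (hP1 : ∀ z ∈ Metric.ball (0 : ℂ) s, (P z).det = 1)
    (hPM : ∀ z ∈ Omega s ∩ Metric.ball 0 s,
        M z = P z * expSigma3 (theta k z) * powSigma3 z (α / 2))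
    (hPM' : ∀ z ∈ Omega s' ∩ Metric.ball 0 s',
        M' z = P' z * expSigma3 (theta k z) * powSigma3 z (α / 2))
    {z : ℂ} (hz : r₀ < ‖z‖) (hzs' : ‖z‖ < s') (hφ : ‖(c : ℂ) * z + d‖ < s) :
    Z z * P ((c : ℂ) * z + d) * localRatio k α z ((c : ℂ) * z + d) = P' z := by
  have hr0 : 0 < r₀ := (mul_pos_iff_of_pos_left hc).1 ((abs_nonneg d).trans_lt hd)
  have := neBot_nhdsWithin_Omega hs' z
  have haff : Continuous fun w : ℂ => (c : ℂ) * w + d := by fun_prop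
  have hz0 : z ≠ 0 := by rintro rfl; rw [norm_zero] at hz; linarith
  have hslit := affine_div_mem_slitPlane hc hd hz
  have hφ0 : (c : ℂ) * z + d ≠ 0 := by
    intro h0; rw [h0, zero_div] at hslit; simp at hslit
  have hZc : ContinuousAt Z z := (hZ.differentiableAt ((isOpen_exterior r₀).mem_nhds hz)).continuousAt
  have hPc : ContinuousAt (fun w => P ((c : ℂ) * w + d)) z := by
    refine ContinuousAt.comp (g := P) ?_ haff.continuousAt
    exact (hP.differentiableAt (Metric.isOpen_ball.mem_nhds (mem_ball_zero_iff.2 hφ))).continuousAt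
  have hPc' : ContinuousAt P' z :=
    (hP'.differentiableAt (Metric.isOpen_ball.mem_nhds (mem_ball_zero_iff.2 hzs'))).continuousAt
  have hlc : ContinuousAt (fun w => localRatio k α w ((c : ℂ) * w + d)) z := by
    unfold localRatio
    refine ContinuousAt.mul ?_ ?_
    · refine ContinuousAt.comp (g := expSigma3) differentiable_expSigma3.continuous.continuousAt ?_
      refine ContinuousAt.sub ?_ (differentiableAt_theta k hz0).continuousAt
      exact ContinuousAt.comp (g := theta k) (differentiableAt_theta k hφ0).continuousAt
        haff.continuousAt
    · refine ContinuousAt.comp (g := fun u => powSigma3 u (α / 2))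
        (differentiableAt_powSigma3 hslit _).continuousAt ?_
      exact haff.continuousAt.div continuousAt_id hz0
  refine tendsto_nhds_unique (l := 𝓝[Omega s'] z) ((((hZc.mul hPc).mul hlc).tendsto).mono_left nhdsWithin_le_nhds)
    ((hPc'.tendsto.mono_left nhdsWithin_le_nhds).congr' ?_)
  have e1 : ∀ᶠ w in 𝓝 z, r₀ < ‖w‖ := (isOpen_exterior r₀).mem_nhds hz
  have e2 : ∀ᶠ w : ℂ in 𝓝 z, ‖w‖ < s' := (isOpen_lt continuous_norm continuous_const).mem_nhds hzs'
  have e3 : ∀ᶠ w : ℂ in 𝓝 z, ‖(c : ℂ) * w + d‖ < s :=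
    (isOpen_lt haff.norm continuous_const).mem_nhds hφ
  filter_upwards [self_mem_nhdsWithin, nhdsWithin_le_nhds e1, nhdsWithin_le_nhds e2,
    nhdsWithin_le_nhds e3] with w hw h1 h2 h3
  have hφΩ := (affine_mem_Omega_iff hs hs' hc hcs hd h1).2 hw
  have hw0 := ne_zero_of_mem_Omega hs' hw
  have hwφ0 := ne_zero_of_mem_Omega hs hφΩ
  set v : ℂ := (c : ℂ) * w + d with hv
  change P' w = Z w * P v * localRatio k α w v
  rw [hZM w hw h1, hPM' w ⟨hw, mem_ball_zero_iff.2 h2⟩, hPM v ⟨hφΩ, mem_ball_zero_iff.2 h3⟩,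
    adjL_mul, adjL_mul, adjL_expSigma3, localRatio]
  have hpow : powSigma3 v (α / 2) = powSigma3 w (α / 2) * powSigma3 (v / w) (α / 2) := by
    rw [powSigma3_mul_powSigma3, powSigma3]
    have hc1 := fun β => cpow_affine hc (Omega_subset_slitPlane hs' hw)
      (Omega_subset_slitPlane hs hφΩ) β
    rw [hv, hc1, hc1]
    simp [mul_comm]
  have hcomm : ∀ x y c : ℂ, expSigma3 x * powSigma3 y c = powSigma3 y c * expSigma3 x := by
    intro x y c
    ext i j; fin_cases i <;> fin_cases j <;> simp [expSigma3, powSigma3, mul_comm]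
  have hdetv : (powSigma3 v (α / 2)).det = 1 := det_powSigma3 hwφ0 _
  calc P' w = P' w * expSigma3 (theta k w) *
        (powSigma3 v (α / 2) * adjL (powSigma3 v (α / 2))) * expSigma3 (-theta k w) := by
        rw [mul_adjL hdetv, mul_one, mul_assoc, expSigma3_mul, add_neg_cancel, expSigma3_zero,
          mul_one]
    _ = P' w * expSigma3 (theta k w) * (powSigma3 w (α / 2) * (powSigma3 (v / w) (α / 2) *
        adjL (powSigma3 v (α / 2)))) * expSigma3 (-theta k w) := by
        rw [← mul_assoc (powSigma3 w (α / 2)), ← hpow]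
    _ = P' w * expSigma3 (theta k w) * powSigma3 w (α / 2) * (adjL (powSigma3 v (α / 2)) *
        (expSigma3 (-theta k v) * ((adjL (P v) * P v) *
          (expSigma3 (theta k v - theta k w) * powSigma3 (v / w) (α / 2))))) := by
        rw [adjL_mul_self (hP1 v (mem_ball_zero_iff.2 h3)), one_mul, ← mul_assoc (expSigma3 _),
          expSigma3_mul, show -theta k v + (theta k v - theta k w) = -theta k w by ring,
          hcomm, adjL_powSigma3]
        have hc2 : powSigma3 (v / w) (α / 2) * powSigma3 v (-(α / 2)) =
            powSigma3 v (-(α / 2)) * powSigma3 (v / w) (α / 2) := by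
          ext i j; fin_cases i <;> fin_cases j <;> simp [powSigma3, mul_comm]
        rw [hc2]
        simp only [mul_assoc]
    _ = _ := by simp only [mul_assoc]

/-- The jump between the inner and the outer factor, before normalization. -/
noncomputable def localJump (k : ℕ) (α : ℝ) (a : ℂ) (P : ℂ → Mat) (z w : ℂ) : Mat :=
  adjL (lower a) * P w * localRatio k α z w * adjL (P z) * lower a

/-- The jump is a function of the two points `z` and `w = c z + d`, which is one for `w = z` and whose
derivative in `w` is the logarithmic derivative of the solution. -/
theorem localJump_expansion (hs : 0 < s) {c : ℕ → Mat} {c₀ c₁ : Mat}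
    (hc : ∀ z ∈ Omega s, logD M z = ratForm k s c c₀ c₁ z) {P : ℂ → Mat}
    (hP : DifferentiableOn ℂ P (Metric.ball 0 s))
    (hP1 : ∀ z ∈ Metric.ball (0 : ℂ) s, (P z).det = 1)
    (hPM : ∀ z ∈ Omega s ∩ Metric.ball 0 s, logD M z = deriv P z * adjL (P z) +
        zeroExponent k α z • (P z * sigma3 * adjL (P z))) {r₁ r₂ : ℝ} (h1 : 0 < r₁) (h2 : r₂ < s) :
    ∃ K ρ : ℝ, 0 < ρ ∧ ∀ z : ℂ, r₁ ≤ ‖z‖ → ‖z‖ ≤ r₂ → ∀ w ∈ Metric.ball z ρ,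
      ‖localJump k α a P z w - 1 -
        (w - z) • (adjL (lower a) * ratForm k s c c₀ c₁ z * lower a)‖ ≤ K * ‖w - z‖ ^ 2 := by
  set ρ : ℝ := min (r₁ / 2) ((s - r₂) / 2) with hρ
  have hρ0 : 0 < ρ := lt_min (by linarith) (by linarith)
  have hρ1 : ρ ≤ r₁ / 2 := min_le_left _ _
  have hρ2 : ρ ≤ (s - r₂) / 2 := min_le_right _ _
  obtain ⟨KP, hKP⟩ := (isCompact_closedBall (0 : ℂ) (r₂ + (s - r₂) / 2)).exists_bound_of_continuousOn
    (hP.continuousOn.mono (Metric.closedBall_subset_ball (by linarith)))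
  have hslit : Metric.closedBall (1 : ℂ) (1 / 2) ⊆ Complex.slitPlane := by
    intro u hu
    rw [Metric.mem_closedBall, dist_eq_norm] at hu
    rw [Complex.mem_slitPlane_iff]
    left
    have := (abs_le.1 ((Complex.abs_re_le_norm (u - 1)).trans hu)).1
    rw [Complex.sub_re, Complex.one_re] at this
    linarith
  obtain ⟨KQ, hKQ⟩ := (isCompact_closedBall (1 : ℂ) (1 / 2)).exists_bound_of_continuousOn
    (f := fun u => powSigma3 u (α / 2)) fun u hu =>
      (differentiableAt_powSigma3 (hslit hu) _).continuousAt.continuousWithinAt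
  obtain ⟨KE, hKE⟩ := (isCompact_closedBall (0 : ℂ) (2 * ((r₁ / 2) ^ k)⁻¹)).exists_bound_of_continuousOn
    differentiable_expSigma3.continuous.continuousOn
  set K : ℝ := ‖adjL (lower a)‖ * |KP| * (|KE| * |KQ|) * (2 * |KP|) * ‖lower a‖ with hK
  refine ⟨12 * K / ρ ^ 2, ρ / 2, by linarith, fun z hz1 hz2 w hw => ?_⟩
  have hzpos : 0 < ‖z‖ := by linarith
  have hz0 : z ≠ 0 := norm_pos_iff.1 hzpos
  have hzs : z ∈ Metric.ball (0 : ℂ) s := mem_ball_zero_iff.2 (by linarith)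
  have hgeom : ∀ v ∈ Metric.ball z ρ, r₁ / 2 ≤ ‖v‖ ∧ ‖v‖ ≤ r₂ + (s - r₂) / 2 ∧
      v / z ∈ Metric.closedBall (1 : ℂ) (1 / 2) := by
    intro v hv
    rw [Metric.mem_ball, dist_eq_norm] at hv
    have e1 := norm_sub_norm_le v z
    have e2 := norm_sub_norm_le z v
    rw [norm_sub_rev] at e2
    refine ⟨by linarith, by linarith, ?_⟩
    rw [Metric.mem_closedBall, dist_eq_norm, div_sub_one hz0, norm_div, div_le_iff₀ hzpos]
    linarith
  have hd : ∀ v ∈ Metric.ball z ρ, HasDerivAt (localJump k α a P z)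
      ((adjL (lower a) * deriv P v * localRatio k α z v + adjL (lower a) * P v *
        ((zeroExponent k α v • sigma3) * localRatio k α z v)) * adjL (P z) * lower a) v := by
    intro v hv
    obtain ⟨g1, g2, g3⟩ := hgeom v hv
    have hPd := (hP.differentiableAt (Metric.isOpen_ball.mem_nhds
      (mem_ball_zero_iff.2 (by linarith : ‖v‖ < s)))).hasDerivAt
    exact (((hPd.const_mul (adjL (lower a))).mul
      (hasDerivAt_localRatio (k := k) (α := α) hz0 (hslit g3))).mul_const _).mul_const _
  have hbd : ∀ v ∈ Metric.ball z ρ, ‖localJump k α a P z v‖ ≤ K := by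
    intro v hv
    obtain ⟨g1, g2, g3⟩ := hgeom v hv
    have b1 : ‖P v‖ ≤ |KP| := (hKP v (by simpa using g2)).trans (le_abs_self _)
    have b2 : ‖adjL (P z)‖ ≤ 2 * |KP| := (norm_adjL_le _).trans (by
      have := (hKP z (by rw [mem_closedBall_zero_iff]; linarith)).trans (le_abs_self _)
      linarith)
    have b3 : ‖powSigma3 (v / z) (α / 2)‖ ≤ |KQ| := (hKQ _ g3).trans (le_abs_self _)
    have hθ : ∀ u : ℂ, r₁ / 2 ≤ ‖u‖ → ‖theta k u‖ ≤ ((r₁ / 2) ^ k)⁻¹ := by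
      intro u hu
      rw [theta, norm_div, norm_pow, norm_neg, norm_one, one_pow, one_div, norm_pow]
      gcongr
    have b4 : ‖expSigma3 (theta k v - theta k z)‖ ≤ |KE| := by
      refine (hKE _ ?_).trans (le_abs_self _)
      rw [mem_closedBall_zero_iff, two_mul]
      exact (norm_sub_le _ _).trans (add_le_add (hθ v g1) (hθ z (by linarith)))
    have b5 : ‖localRatio k α z v‖ ≤ |KE| * |KQ| :=
      (norm_mul_le _ _).trans (mul_le_mul b4 b3 (norm_nonneg _) (abs_nonneg _))
    rw [localJump, hK]
    refine (norm_mul_le _ _).trans (mul_le_mul_of_nonneg_right ?_ (norm_nonneg _))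
    refine (norm_mul_le _ _).trans (mul_le_mul ?_ b2 (norm_nonneg _) (by positivity))
    refine (norm_mul_le _ _).trans (mul_le_mul ?_ b5 (norm_nonneg _) (by positivity))
    exact (norm_mul_le _ _).trans (mul_le_mul_of_nonneg_left b1 (norm_nonneg _))
  have hmain := norm_taylor_remainder_le hρ0 (fun v hv => (hd v hv).differentiableAt.differentiableWithinAt)
    hbd hw
  have hself : localJump k α a P z z = 1 := by
    rw [localJump, localRatio_self hz0, mul_one, mul_assoc (adjL (lower a)), mul_adjL (hP1 z hzs),
      mul_one, adjL_mul_self (det_lower a)]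
  have hder : deriv (localJump k α a P z) z =
      adjL (lower a) * ratForm k s c c₀ c₁ z * lower a := by
    have h3 : deriv (localJump k α a P z) z = _ := (hd z (Metric.mem_ball_self hρ0)).deriv
    rw [h3, localRatio_self hz0, ← ratForm_eq_local hs hc hP hPM hzs hz0]
    simp only [mul_one, mul_add, add_mul, mul_assoc, smul_mul_assoc, mul_smul_comm]
  rw [hself] at hmain
  exact (congrArg (fun X => ‖localJump k α a P z w - 1 - (w - z) • X‖) hder).symm.le.trans hmain

end InnerFactor

/-! ### First order expansion of the jump between the inner and the outer factor -/

section JumpExpansion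

variable {k : ℕ} {α l s : ℝ} {M : ℂ → Mat} {a : ℂ}

/-- A little-o estimate that is uniform over a set, as a bound by a function of `t` alone. -/
theorem exists_uniform_bound {E : Type*} [NormedAddCommGroup E] {F : ℝ × ℂ → E} {S : Set ℂ}
    (hF : F =o[𝓝 (0 : ℝ) ×ˢ 𝓟 S] (fun p => p.1)) :
    ∃ ε : ℝ → ℝ, ε =o[𝓝 0] (fun t : ℝ => t) ∧ ∀ᶠ t in 𝓝 0, ∀ z ∈ S, ‖F (t, z)‖ ≤ ε t := by
  have hF' : ∀ c : ℝ, 0 < c → ∀ᶠ t in 𝓝 (0 : ℝ), ∀ z ∈ S, ‖F (t, z)‖ ≤ c * ‖t‖ := by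
    intro c hc
    have h1 := hF.def hc
    rw [eventually_prod_principal_iff] at h1
    exact h1
  refine ⟨fun t => ⨆ z : S, ‖F (t, z)‖, ?_, ?_⟩
  · refine isLittleO_iff.2 fun c hc => ?_
    filter_upwards [hF' c hc] with t ht
    have h0 : 0 ≤ ⨆ z : S, ‖F (t, z)‖ := Real.iSup_nonneg fun _ => norm_nonneg _
    rw [Real.norm_eq_abs, abs_of_nonneg h0]
    exact Real.iSup_le (fun z => ht z z.2) (by positivity)
  · filter_upwards [hF' 1 one_pos] with t ht z hz
    refine le_ciSup (f := fun z : S => ‖F (t, z)‖) ⟨1 * ‖t‖, ?_⟩ ⟨z, hz⟩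
    rintro _ ⟨w, rfl⟩
    exact ht w w.2

/-- The derivative at `t = 0` of the inverse of `ratioLimit`. -/
noncomputable def gaugeRate (l g' d' : ℝ) : Mat := !![(g' : ℂ), 0; -(l * d' / 2), -g']

/-- The part of `(4 g' z + d') A(z)` that is singular at the origin, with a minus sign. -/
noncomputable def rateOut (k : ℕ) (g' d' : ℝ) (c : ℕ → Mat) (z : ℂ) : Mat :=
  -∑ j ∈ Finset.Icc 1 (k + 1), (z ^ j)⁻¹ • ((4 * g' : ℂ) • c (j + 1) + (d' : ℂ) • c j)

/-- The part of `(4 g' z + d') A(z)` that is regular at the origin. -/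
noncomputable def rateIn (g' d' : ℝ) (s : ℂ) (c : ℕ → Mat) (c₀ c₁ : Mat) (z : ℂ) : Mat :=
  (4 * g' : ℂ) • c 1 + (4 * g' * z + d') • ((z + s)⁻¹ • c₀ + c₁)

theorem sum_shift (c : ℕ → Mat) {z : ℂ} (hz : z ≠ 0) (n : ℕ) :
    ∑ j ∈ Finset.Icc 1 n, (z * (z ^ j)⁻¹) • c j + (z ^ n)⁻¹ • c (n + 1) =
      c 1 + ∑ j ∈ Finset.Icc 1 n, (z ^ j)⁻¹ • c (j + 1) := by
  induction n with
  | zero => simp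
  | succ n ih =>
    rw [Finset.sum_Icc_succ_top (by omega), Finset.sum_Icc_succ_top (by omega), ← add_assoc (c 1),
      ← ih]
    congr 2
    rw [pow_succ]
    congr 1
    field_simp

/-- The additive splitting of the first order term of the jump into a part regular at the origin and a
part vanishing at infinity; the factor `z` shifts the coefficients of the principal part by one. -/
theorem rateIn_sub_rateOut {g' d' : ℝ} {s : ℂ} {c : ℕ → Mat} {c₀ c₁ : Mat} (hck : c (k + 2) = 0)
    {z : ℂ} (hz : z ≠ 0) :
    rateIn g' d' s c c₀ c₁ z - rateOut k g' d' c z =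
      (4 * g' * z + d' : ℂ) • ratForm k s c c₀ c₁ z := by
  have h1 := sum_shift c hz (k + 1)
  rw [hck, smul_zero, add_zero] at h1
  have h2 : ∑ j ∈ Finset.Icc 1 (k + 1), (z ^ j)⁻¹ • ((4 * g' : ℂ) • c (j + 1) + (d' : ℂ) • c j) =
      (4 * g' : ℂ) • ∑ j ∈ Finset.Icc 1 (k + 1), (z ^ j)⁻¹ • c (j + 1) +
      (d' : ℂ) • ∑ j ∈ Finset.Icc 1 (k + 1), (z ^ j)⁻¹ • c j := by
    simp only [smul_add, Finset.sum_add_distrib, Finset.smul_sum, smul_comm ((z ^ _)⁻¹)]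
  have h3 : ∑ j ∈ Finset.Icc 1 (k + 1), (z * (z ^ j)⁻¹) • c j =
      z • ∑ j ∈ Finset.Icc 1 (k + 1), (z ^ j)⁻¹ • c j := by
    simp only [mul_smul, Finset.smul_sum]
  rw [rateIn, rateOut, ratForm, sub_neg_eq_add, h2, eq_sub_of_add_eq' h1.symm, h3]
  module

theorem hasDerivAt_adjL_ratioLimit {g d : ℝ → ℝ} {g' d' : ℝ} (hg0 : g 0 = 1) (hd0 : d 0 = 0)
    (hg : HasDerivAt g g' 0) (hd : HasDerivAt d d' 0) :
    HasDerivAt (fun t => adjL (ratioLimit l (g t) (d t))) (gaugeRate l g' d') 0 := by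
  have hgc : HasDerivAt (fun t => (g t : ℂ)) g' 0 := hg.ofReal_comp
  have hdc : HasDerivAt (fun t => (d t : ℂ)) d' 0 := hd.ofReal_comp
  simp only [adjL_apply, ratioLimit]
  apply hasDerivAt_mat_real
  intro i j
  fin_cases i <;> fin_cases j <;> simp [gaugeRate]
  · exact hgc
  · exact hasDerivAt_const _ _
  · refine ((((hdc.const_mul (l : ℂ))).fun_div (hgc.const_mul 2) (by simp [hg0])).fun_neg).congr_deriv ?_
    simp [hg0, hd0]; ring
  · refine (hgc.fun_inv (by simp [hg0])).congr_deriv ?_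
    simp [hg0]

theorem isLittleO_of_hasDerivAt {E : Type*} [NormedAddCommGroup E] [NormedSpace ℂ E] {f : ℝ → E}
    {f' : E} (hf : HasDerivAt f f' 0) : (fun t : ℝ => f t - f 0 - (t : ℂ) • f') =o[𝓝 0]
      (fun t : ℝ => t) := by
  have := hasDerivAt_iff_isLittleO.1 hf
  simpa using this

theorem hasDerivAt_of_isLittleO {E : Type*} [NormedAddCommGroup E] [NormedSpace ℂ E] {f : ℝ → E}
    {f' : E} (hf : (fun t : ℝ => f t - f 0 - (t : ℂ) • f') =o[𝓝 0] (fun t : ℝ => t)) :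
    HasDerivAt f f' 0 := by
  refine hasDerivAt_iff_isLittleO.2 ?_
  simpa using hf

/-- The jump between the normalized factors, to first order in `t`, uniformly on an annulus. -/
theorem jump_expansion (hs : 0 < s) {c : ℕ → Mat} {c₀ c₁ : Mat}
    (hc : ∀ z ∈ Omega s, logD M z = ratForm k s c c₀ c₁ z) {P : ℂ → Mat}
    (hP : DifferentiableOn ℂ P (Metric.ball 0 s))
    (hP1 : ∀ z ∈ Metric.ball (0 : ℂ) s, (P z).det = 1)
    (hPM : ∀ z ∈ Omega s ∩ Metric.ball 0 s, logD M z = deriv P z * adjL (P z) +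
        zeroExponent k α z • (P z * sigma3 * adjL (P z))) {r₁ r₂ : ℝ} (h1 : 0 < r₁) (h2 : r₂ < s)
    {g d : ℝ → ℝ} {g' d' : ℝ} (hg0 : g 0 = 1) (hd0 : d 0 = 0)
    (hg : HasDerivAt g g' 0) (hd : HasDerivAt d d' 0) :
    (fun p : ℝ × ℂ => adjL (ratioLimit l (g p.1) (d p.1)) *
        localJump k α a P p.2 (((g p.1 ^ 4 : ℝ) : ℂ) * p.2 + d p.1) - 1 -
        (p.1 : ℂ) • (gaugeRate l g' d' + (4 * g' * p.2 + d' : ℂ) •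
          (adjL (lower a) * ratForm k s c c₀ c₁ p.2 * lower a)))
      =o[𝓝 (0 : ℝ) ×ˢ 𝓟 {z : ℂ | r₁ ≤ ‖z‖ ∧ ‖z‖ ≤ r₂}] (fun p => p.1) := by
  obtain ⟨K, ρ, hρ, hKρ⟩ := localJump_expansion (a := a) hs hc hP hP1 hPM h1 h2
  set S : Set ℂ := {z : ℂ | r₁ ≤ ‖z‖ ∧ ‖z‖ ≤ r₂} with hS
  set 𝓕 := 𝓝 (0 : ℝ) ×ˢ 𝓟 S with h𝓕
  set G : ℝ → Mat := fun t => adjL (ratioLimit l (g t) (d t)) with hG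
  set D : ℂ → Mat := fun z => adjL (lower a) * ratForm k s c c₀ c₁ z * lower a with hD
  set v : ℝ × ℂ → ℂ := fun p => ((g p.1 ^ 4 - 1 : ℝ) : ℂ) * p.2 + d p.1 with hv
  set Q : ℝ × ℂ → Mat := fun p => localJump k α a P p.2 (p.2 + v p) with hQ
  have hmem : ∀ᶠ p in 𝓕, p.2 ∈ S := by
    rw [h𝓕, eventually_prod_principal_iff]
    exact Eventually.of_forall fun _ z hz => hz
  have hfst : Tendsto (fun p : ℝ × ℂ => p.1) 𝓕 (𝓝 0) := tendsto_fst
  have hz1 : (fun p : ℝ × ℂ => p.2) =O[𝓕] (fun _ => (1 : ℝ)) := by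
    refine IsBigO.of_bound r₂ ?_
    filter_upwards [hmem] with p hp
    simpa using hp.2
  have hT1 : (fun p : ℝ × ℂ => p.1) =O[𝓕] (fun _ => (1 : ℝ)) := hfst.isBigO_one ℝ
  have hTo1 : (fun p : ℝ × ℂ => p.1) =o[𝓕] (fun _ => (1 : ℝ)) := (isLittleO_one_iff ℝ).2 hfst
  have hTc : (fun p : ℝ × ℂ => (p.1 : ℂ)) =O[𝓕] (fun p => p.1) :=
    IsBigO.of_bound 1 (Eventually.of_forall fun p => by simp)
  -- the displacement `φ_t(z) - z`
  have hvo : (fun p : ℝ × ℂ => v p - (p.1 : ℂ) * (4 * g' * p.2 + d')) =o[𝓕] (fun p => p.1) := by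
    have e1 : HasDerivAt (fun t => ((g t ^ 4 : ℝ) : ℂ)) ((4 * g' : ℝ) : ℂ) 0 := by
      have := (hg.fun_pow 4).ofReal_comp
      simpa [hg0] using this
    have e2 := (isLittleO_of_hasDerivAt e1).comp_tendsto hfst
    have e3 := (isLittleO_of_hasDerivAt (hd.ofReal_comp)).comp_tendsto hfst
    have e4 := (e2.mul_isBigO hz1).add (e3.congr_right (g₂ := fun p : ℝ × ℂ => p.1 * 1)
      (fun p => by simp))
    refine (e4.congr (fun p => ?_) fun p => ?_)
    · simp [hv, hg0, hd0]; ring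
    · simp
  have hvO : v =O[𝓕] (fun p => p.1) := by
    have e1 : (fun p : ℝ × ℂ => (p.1 : ℂ) * (4 * g' * p.2 + d')) =O[𝓕] (fun p => p.1) := by
      have e2 : (fun p : ℝ × ℂ => (4 * g' * p.2 + d' : ℂ)) =O[𝓕] (fun _ => (1 : ℝ)) :=
        (hz1.const_mul_left _).add (isBigO_const_const _ one_ne_zero _)
      simpa using hTc.mul e2
    simpa using hvo.isBigO.add e1
  have hvt : Tendsto v 𝓕 (𝓝 0) := hvO.trans_tendsto hfst
  have hDO : (fun p : ℝ × ℂ => D p.2) =O[𝓕] (fun _ => (1 : ℝ)) := by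
    have hcomp : IsCompact S := by
      refine Metric.isCompact_of_isClosed_isBounded ?_ ?_
      · exact (isClosed_le continuous_const continuous_norm).inter
          (isClosed_le continuous_norm continuous_const)
      · exact Metric.isBounded_closedBall.subset fun z hz => mem_closedBall_zero_iff.2 hz.2
    have hcont : ContinuousOn D S := by
      refine (continuousOn_const.mul ?_).mul continuousOn_const
      intro z hz
      have hz0 : z ≠ 0 := norm_pos_iff.1 (by linarith [hz.1])
      have hzs : z + s ≠ 0 := by
        intro h0
        have := hz.2
        rw [show z = -(s : ℂ) by linear_combination h0, norm_neg,
          Complex.norm_real, Real.norm_eq_abs, abs_of_pos hs] at this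
        linarith
      refine ContinuousAt.continuousWithinAt ?_
      unfold ratForm
      refine ContinuousAt.add (ContinuousAt.add ?_ ?_) continuousAt_const
      · refine tendsto_finsetSum _ fun j _ => ?_
        exact ((((continuous_pow j).continuousAt).inv₀ (pow_ne_zero _ hz0)).smul_const _)
      · have : ContinuousAt (fun w : ℂ => (w + s)⁻¹) z :=
          ContinuousAt.inv₀ (by fun_prop) hzs
        exact this.smul_const _
    obtain ⟨C, hC⟩ := hcomp.exists_bound_of_continuousOn hcont
    refine IsBigO.of_bound C ?_
    filter_upwards [hmem] with p hp
    simpa using hC p.2 hp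
  have hQo : (fun p => Q p - 1 - v p • D p.2) =o[𝓕] (fun p => p.1) := by
    have e1 : (fun p => Q p - 1 - v p • D p.2) =O[𝓕] (fun p => p.1 * p.1) := by
      refine IsBigO.trans ?_ (hvO.mul hvO)
      refine IsBigO.of_bound K ?_
      have hsmall : ∀ᶠ p in 𝓕, v p ∈ Metric.ball (0 : ℂ) ρ :=
        hvt.eventually (Metric.ball_mem_nhds _ hρ)
      filter_upwards [hmem, hsmall] with p hp hpv
      have := hKρ p.2 hp.1 hp.2 (p.2 + v p) (by simpa [dist_eq_norm] using hpv)
      rw [add_sub_cancel_left] at this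
      simpa [hQ, pow_two] using this
    refine e1.trans_isLittleO ?_
    simpa using hTo1.mul_isBigO (isBigO_refl (fun p : ℝ × ℂ => p.1) 𝓕)
  have hvD : (fun p => v p • D p.2) =o[𝓕] (fun _ => (1 : ℝ)) := by
    simpa using (hvO.trans_isLittleO hTo1).smul_isBigO hDO
  have hQ1 : Q =O[𝓕] (fun _ => (1 : ℝ)) := by
    have e1 := ((hQo.trans_isBigO hT1).add hvD).isBigO.add
      (isBigO_const_const (1 : Mat) (one_ne_zero (α := ℝ)) 𝓕)
    refine e1.congr_left fun p => ?_
    simp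
  have hG0 : G 0 = 1 := by
    simp only [hG, hg0, hd0, adjL_apply, ratioLimit]
    ext i j; fin_cases i <;> fin_cases j <;> simp
  have hGo : (fun p : ℝ × ℂ => G p.1 - 1 - (p.1 : ℂ) • gaugeRate l g' d') =o[𝓕] (fun p => p.1) := by
    have e1 := isLittleO_of_hasDerivAt (hasDerivAt_adjL_ratioLimit (l := l) hg0 hd0 hg hd)
    have e2 := e1.comp_tendsto hfst
    refine e2.congr_left fun p => ?_
    rw [← hG0]; rfl
  have hlin : (fun p : ℝ × ℂ => 1 + (p.1 : ℂ) • gaugeRate l g' d') =O[𝓕] (fun _ => (1 : ℝ)) := by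
    refine (isBigO_const_const (1 : Mat) (one_ne_zero (α := ℝ)) 𝓕).add ?_
    have : (fun p : ℝ × ℂ => (p.1 : ℂ) • gaugeRate l g' d') =O[𝓕] (fun p => p.1 * (1 : ℝ)) :=
      hTc.smul (isBigO_const_const _ (one_ne_zero (α := ℝ)) _)
    exact (this.congr_right fun p => by simp).trans hT1
  have t1 := hGo.mul_isBigO hQ1
  have t2 := hlin.mul_isLittleO hQo
  have t3 := hvo.smul_isBigO hDO
  have t4 : (fun p : ℝ × ℂ => ((p.1 : ℂ) • gaugeRate l g' d') * (v p • D p.2)) =o[𝓕]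
      (fun p => p.1 * (1 : ℝ)) := by
    refine IsBigO.mul_isLittleO ?_ hvD
    have : (fun p : ℝ × ℂ => (p.1 : ℂ) • gaugeRate l g' d') =O[𝓕] (fun p => p.1 * (1 : ℝ)) :=
      hTc.smul (isBigO_const_const _ (one_ne_zero (α := ℝ)) _)
    exact this.congr_right fun p => by simp
  simp only [mul_one, one_mul, smul_eq_mul] at t1 t2 t3 t4
  refine (((t1.add t2).add t3).add t4).congr_left fun p => ?_
  have hφ : ((g p.1 ^ 4 : ℝ) : ℂ) * p.2 + d p.1 = p.2 + v p := by
    simp only [hv]; push_cast; ring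
  rw [hφ]
  change (G p.1 - 1 - (p.1 : ℂ) • gaugeRate l g' d') * Q p +
    (1 + (p.1 : ℂ) • gaugeRate l g' d') * (Q p - 1 - v p • D p.2) +
    (v p - (p.1 : ℂ) * (4 * g' * p.2 + d')) • D p.2 +
    (p.1 : ℂ) • gaugeRate l g' d' * (v p • D p.2) = G p.1 * Q p - 1 -
    (p.1 : ℂ) • (gaugeRate l g' d' + (4 * g' * p.2 + d' : ℂ) • D p.2)
  simp only [sub_mul, add_mul, mul_sub, one_mul, mul_one, sub_smul, smul_add, smul_smul]
  abel

end JumpExpansion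

/-! ### Deformations of the Riemann-Hilbert problem -/

section Deformation

variable {k : ℕ} {α l s : ℝ} {M : ℂ → Mat} {a : ℂ}

/-- A curve of solutions with parameters `(g² l, σ)`, where the affine map `z ↦ g⁴ z + d` sends
`-σ` to `-s`.  It is compared with the solution `M` at `(l, s)` after this change of variable,
which maps the unbounded part of one contour onto that of the other one. -/
structure IsDeformation (k : ℕ) (α l s : ℝ) (g d σ : ℝ → ℝ) (g' d' : ℝ)
    (N : ℝ → ℂ → Mat) (b : ℝ → ℂ) : Prop where
  scale_zero : g 0 = 1
  shift_zero : d 0 = 0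
  hasDerivAt_scale : HasDerivAt g g' 0
  hasDerivAt_shift : HasDerivAt d d' 0
  tendsto_vertex : Tendsto σ (𝓝 0) (𝓝 s)
  vertex_eq : ∀ᶠ t in 𝓝 0, g t ^ 4 * σ t = s + d t
  solution : ∀ᶠ t in 𝓝 0, IsRHSolution k α (g t ^ 2 * l) (σ t) (N t) (b t)

variable {g d σ : ℝ → ℝ} {g' d' : ℝ} {N : ℝ → ℂ → Mat} {b : ℝ → ℂ}

theorem differentiableOn_rateOut (c : ℕ → Mat) {r₀ : ℝ} (h0 : 0 < r₀) :
    DifferentiableOn ℂ (rateOut k g' d' c) {z | r₀ < ‖z‖} := by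
  intro z hz
  have hz0 : z ≠ 0 := norm_pos_iff.1 (h0.trans hz)
  apply DifferentiableAt.differentiableWithinAt
  unfold rateOut
  refine DifferentiableAt.fun_neg (DifferentiableAt.fun_sum fun j _ => ?_)
  have : DifferentiableAt ℂ (fun w : ℂ => (w ^ j)⁻¹) z :=
    DifferentiableAt.fun_inv (by fun_prop) (pow_ne_zero _ hz0)
  exact this.smul_const _

theorem add_ofReal_ne_zero_of_norm_lt {z : ℂ} (hz : ‖z‖ < s) : z + s ≠ 0 := by
  intro h0
  rw [show z = -(s : ℂ) by linear_combination h0, norm_neg, Complex.norm_real] at hz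
  exact absurd (le_abs_self s) (not_le.2 hz)

theorem differentiableAt_rateIn (c : ℕ → Mat) (c₀ c₁ : Mat) {z : ℂ} (hz : z + s ≠ 0) :
    DifferentiableAt ℂ (rateIn g' d' s c c₀ c₁) z := by
  unfold rateIn
  have h1 : DifferentiableAt ℂ (fun w : ℂ => (w + s)⁻¹) z :=
    DifferentiableAt.fun_inv (by fun_prop) hz
  have h2 : DifferentiableAt ℂ (fun w : ℂ => (4 * g' * w + d' : ℂ)) z := by fun_prop
  exact (differentiableAt_const _).fun_add (h2.fun_smul ((h1.smul_const _).fun_add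
    (differentiableAt_const _)))

theorem tendsto_rateOut (c : ℕ → Mat) :
    Tendsto (rateOut k g' d' c) (Bornology.cobounded ℂ) (𝓝 0) := by
  have h1 : ∀ j ∈ Finset.Icc 1 (k + 1), Tendsto
      (fun z : ℂ => (z ^ j)⁻¹ • ((4 * g' : ℂ) • c (j + 1) + (d' : ℂ) • c j))
      (Bornology.cobounded ℂ) (𝓝 0) := by
    intro j hj
    have h2 : Tendsto (fun z : ℂ => (z ^ j)⁻¹) (Bornology.cobounded ℂ) (𝓝 0) := by
      have h3 := (tendsto_inv₀_cobounded (α := ℂ)).pow j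
      rw [zero_pow (by have := (Finset.mem_Icc.1 hj).1; omega)] at h3
      simpa only [inv_pow] using h3
    simpa only [zero_smul] using h2.smul_const ((4 * g' : ℂ) • c (j + 1) + (d' : ℂ) • c j)
  have h2 := (tendsto_finsetSum _ h1).neg
  rw [Finset.sum_const_zero, neg_zero] at h2
  exact h2

theorem IsDeformation.tendsto_scale (hD : IsDeformation k α l s g d σ g' d' N b) :
    Tendsto g (𝓝 0) (𝓝 1) := hD.scale_zero ▸ hD.hasDerivAt_scale.continuousAt

theorem IsDeformation.tendsto_shift (hD : IsDeformation k α l s g d σ g' d' N b) :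
    Tendsto d (𝓝 0) (𝓝 0) := by
  have := hD.hasDerivAt_shift.continuousAt.tendsto
  rwa [hD.shift_zero] at this

theorem IsDeformation.eventually_lt (hD : IsDeformation k α l s g d σ g' d' N b) {r R : ℝ}
    (hr : 0 < r) (hR : R < s) :
    ∀ᶠ t in 𝓝 0, 0 < g t ∧ |d t| < g t ^ 4 * r ∧ R < σ t ∧ g t ^ 4 * R + |d t| < s := by
  have hd := hD.tendsto_shift.abs
  rw [abs_zero] at hd
  have hg := hD.tendsto_scale.pow 4
  rw [one_pow] at hg
  have h1 := hd.eventually_lt (hg.mul_const r) (by simpa using hr)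
  have h2 := ((hg.mul_const R).add hd).eventually_lt_const (u := s) (by simpa using hR)
  filter_upwards [hD.tendsto_scale.eventually_const_lt zero_lt_one, h1,
    hD.tendsto_vertex.eventually_const_lt hR, h2] with t e1 e2 e3 e4 using ⟨e1, e2, e3, e4⟩

/-- The factorization of a deformation: outside a small disc, the solutions are compared by the
outer factor, and inside a disc around the origin by the regular factors `P` and `Q t`.  Both
are known to first order in `t`, because the jump between them is. -/
theorem IsDeformation.exists_factorization (hD : IsDeformation k α l s g d σ g' d' N b)
    (h : IsRHSolution k α l s M a) (hs : 0 < s) {c : ℕ → Mat} {c₀ c₁ : Mat}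
    (hc : ∀ z ∈ Omega s, logD M z = ratForm k s c c₀ c₁ z) (hck : c (k + 2) = 0)
    {P : ℂ → Mat} (hP : DifferentiableOn ℂ P (Metric.ball 0 s))
    (hP1 : ∀ z ∈ Metric.ball (0 : ℂ) s, (P z).det = 1)
    (hPM : ∀ z ∈ Omega s ∩ Metric.ball 0 s,
        M z = P z * expSigma3 (theta k z) * powSigma3 z (α / 2))
    (hPL : ∀ z ∈ Omega s ∩ Metric.ball 0 s, logD M z = deriv P z * adjL (P z) +
        zeroExponent k α z • (P z * sigma3 * adjL (P z)))
    {r₁ r₂ R : ℝ} (h1 : 0 < r₁) (h12 : r₁ < r₂) (h2R : r₂ < R) (hR : R < s) :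
    ∃ (Z Q : ℝ → ℂ → Mat) (δ : ℝ → ℝ), δ =o[𝓝 0] (fun t : ℝ => t) ∧ ∀ᶠ t in 𝓝 0,
      (∀ z ∈ Omega (σ t), r₁ ≤ ‖z‖ →
        Z t z = N t z * adjL (M (((g t ^ 4 : ℝ) : ℂ) * z + d t))) ∧
      Tendsto (fun x : ℝ => (x : ℂ) * outerFactor l (g t) (d t) a (b t) (Z t) x 0 1) atTop
        (𝓝 (b t - l * d t / (2 * g t ^ 2) - a / g t ^ 2)) ∧
      (∀ z : ℂ, r₁ < ‖z‖ → ‖outerFactor l (g t) (d t) a (b t) (Z t) z - 1 -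
        (t : ℂ) • (adjL (lower a) * rateOut k g' d' c z * lower a)‖ ≤ r₁ / (‖z‖ - r₁) * δ t) ∧
      DifferentiableOn ℂ (Q t) (Metric.ball 0 R) ∧
      (∀ z ∈ Metric.ball (0 : ℂ) R, (Q t z).det = 1) ∧
      (∀ z ∈ Omega (σ t) ∩ Metric.ball 0 R,
        N t z = Q t z * expSigma3 (theta k z) * powSigma3 z (α / 2)) ∧
      ∀ z : ℂ, ‖z‖ < r₂ → ‖adjL (lower (b t)) * Q t z * adjL (P z) * lower a - 1 -
        (t : ℂ) • (gaugeRate l g' d' + adjL (lower a) * rateIn g' d' s c c₀ c₁ z * lower a)‖ ≤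
          r₂ / (r₂ - ‖z‖) * δ t := by
  have hR0 : 0 < R := h1.trans (h12.trans h2R)
  set r₀ := r₁ / 2 with hr₀
  have h00 : 0 < r₀ := by positivity
  have h01 : r₀ < r₁ := by rw [hr₀]; linarith
  have hgood : ∀ᶠ t in 𝓝 0, (0 < g t ∧ |d t| < g t ^ 4 * r₀ ∧ R < σ t ∧
      g t ^ 4 * R + |d t| < s) ∧ g t ^ 4 * σ t = s + d t ∧
      IsRHSolution k α (g t ^ 2 * l) (σ t) (N t) (b t) :=
    (hD.eventually_lt h00 hR).and (hD.vertex_eq.and hD.solution)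
  have hex : ∀ t, ∃ Z Q : ℂ → Mat, ((0 < g t ∧ |d t| < g t ^ 4 * r₀ ∧ R < σ t ∧
      g t ^ 4 * R + |d t| < s) ∧ g t ^ 4 * σ t = s + d t ∧
      IsRHSolution k α (g t ^ 2 * l) (σ t) (N t) (b t)) →
      DifferentiableOn ℂ Z {z | r₀ < ‖z‖} ∧
      (∀ z ∈ Omega (σ t), r₀ < ‖z‖ →
        Z z = N t z * adjL (M (((g t ^ 4 : ℝ) : ℂ) * z + d t))) ∧
      DifferentiableOn ℂ Q (Metric.ball 0 (σ t)) ∧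
      (∀ z ∈ Metric.ball (0 : ℂ) (σ t), (Q z).det = 1) ∧
      ∀ z ∈ Omega (σ t) ∩ Metric.ball 0 (σ t),
        N t z = Q z * expSigma3 (theta k z) * powSigma3 z (α / 2) := by
    intro t
    by_cases ht : ((0 < g t ∧ |d t| < g t ^ 4 * r₀ ∧ R < σ t ∧
      g t ^ 4 * R + |d t| < s) ∧ g t ^ 4 * σ t = s + d t ∧
      IsRHSolution k α (g t ^ 2 * l) (σ t) (N t) (b t))
    · obtain ⟨⟨e1, e2, e3, -⟩, e4, e5⟩ := ht
      have hσ : 0 < σ t := hR0.trans e3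
      obtain ⟨Z, hZ, hZM⟩ := exists_outer_factor h e5 hs hσ (pow_pos e1 4) e4 e2
      obtain ⟨Q, hQ, hQ1, hQN⟩ := e5.exists_disc_factor hσ
      exact ⟨Z, Q, fun _ => ⟨hZ, hZM, hQ, hQ1, hQN⟩⟩
    · exact ⟨0, 0, fun h' => absurd h' ht⟩
  choose Z Q hZQ using hex
  have hjump := jump_expansion (a := a) (l := l) hs hc hP hP1 hPL h1 (h2R.trans hR) hD.scale_zero
    hD.shift_zero hD.hasDerivAt_scale hD.hasDerivAt_shift
  obtain ⟨ε, hε, hεb⟩ := exists_uniform_bound hjump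
  have hDout : DifferentiableOn ℂ (fun z => adjL (lower a) * rateOut k g' d' c z * lower a)
      {z | r₀ < ‖z‖} :=
    ((differentiableOn_const _).fun_mul (differentiableOn_rateOut c h00)).fun_mul
      (differentiableOn_const _)
  have hDin : DifferentiableOn ℂ (fun z => gaugeRate l g' d' +
      adjL (lower a) * rateIn g' d' s c c₀ c₁ z * lower a) (Metric.ball 0 R) := by
    refine (differentiableOn_const _).fun_add (((differentiableOn_const _).fun_mul ?_).fun_mul
      (differentiableOn_const _))
    intro z hz
    exact (differentiableAt_rateIn c c₀ c₁ (add_ofReal_ne_zero_of_norm_lt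
      ((mem_ball_zero_iff.1 hz).trans hR))).differentiableWithinAt
  have hD0 : Tendsto (fun z => adjL (lower a) * rateOut k g' d' c z * lower a)
      (Bornology.cobounded ℂ) (𝓝 0) := by
    have := ((tendsto_rateOut (k := k) (g' := g') (d' := d') c).const_mul (adjL (lower a))).mul_const
      (lower a)
    simpa only [mul_zero, zero_mul] using this
  obtain ⟨δ, hδ, hδb⟩ := small_norm_factorization h1 h01 h12 h2R
    (zin := fun t z => adjL (lower (b t)) * Q t z * adjL (P z) * lower a)
    (zout := fun t => outerFactor l (g t) (d t) a (b t) (Z t))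
    (H := fun t z => adjL (ratioLimit l (g t) (d t)) *
        localJump k α a P z (((g t ^ 4 : ℝ) : ℂ) * z + d t))
    (Din := fun z => gaugeRate l g' d' + adjL (lower a) * rateIn g' d' s c c₀ c₁ z * lower a)
    (Dout := fun z => adjL (lower a) * rateOut k g' d' c z * lower a)
    (ε := ε)
    (by
      filter_upwards [hgood] with t ht
      refine ((((differentiableOn_const _).fun_mul ?_).fun_mul ?_).fun_mul
        (differentiableOn_const _))
      · exact (hZQ t ht).2.2.1.mono (Metric.ball_subset_ball ht.1.2.2.1.le)
      · exact adjL.differentiable.comp_differentiableOn (hP.mono (Metric.ball_subset_ball hR.le)))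
    (by
      filter_upwards [hgood] with t ht
      exact (((differentiableOn_const _).fun_mul (hZQ t ht).1).fun_mul
        (differentiableOn_const _)).fun_mul (differentiableOn_const _))
    (by
      filter_upwards [hgood] with t ht
      exact (tendsto_outerFactor h ht.2.2 hs (hR0.trans ht.1.2.2.1) ht.1.1 rfl ht.2.1 ht.1.2.1
        (hZQ t ht).1 (hZQ t ht).2.1).1)
    (by
      filter_upwards [hgood] with t ht z hz
      obtain ⟨f1, f2, f3, f4, f5⟩ := hZQ t ht
      obtain ⟨⟨e1, e2, e3, e6⟩, e4, e5⟩ := ht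
      have hz1 : r₀ < ‖z‖ := by rcases hz with hz | hz <;> linarith
      have hz2 : ‖z‖ ≤ R := by rcases hz with hz | hz <;> linarith
      have hφ : ‖((g t ^ 4 : ℝ) : ℂ) * z + d t‖ < s := by
        refine lt_of_le_of_lt (norm_add_le _ _) (lt_of_le_of_lt ?_ e6)
        rw [norm_mul, Complex.norm_real, Complex.norm_real, Real.norm_eq_abs, Real.norm_eq_abs,
          abs_of_pos (pow_pos e1 4)]
        gcongr
      have hm := outer_mul_local hs (hR0.trans e3) (pow_pos e1 4) e4 e2 f1 f2 hP f3 hP1 hPM f5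
        hz1 (hz2.trans_lt e3) hφ
      rw [outerFactor, localJump, ← hm]
      set w : ℂ := ((g t ^ 4 : ℝ) : ℂ) * z + d t
      symm
      calc _ = adjL (lower (b t)) * Z t z * lower a * (ratioLimit l (g t) (d t) *
            adjL (ratioLimit l (g t) (d t))) * adjL (lower a) * P w * localRatio k α z w *
            adjL (P z) * lower a := by simp only [mul_assoc]
        _ = adjL (lower (b t)) * Z t z * (lower a * adjL (lower a)) * P w * localRatio k α z w *
            adjL (P z) * lower a := by
            rw [mul_adjL (det_ratioLimit e1), mul_one]; simp only [mul_assoc]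
        _ = _ := by rw [mul_adjL (det_lower a), mul_one]; simp only [mul_assoc])
    hDin hDout hD0 hε
    (by
      filter_upwards [hεb] with t ht z hz
      have hzm : r₁ ≤ ‖z‖ ∧ ‖z‖ ≤ r₂ := by
        rcases hz with hz | hz <;> constructor <;> linarith
      have hz0 : z ≠ 0 := norm_pos_iff.1 (h1.trans_le hzm.1)
      refine (congrArg norm ?_).le.trans (ht z hzm)
      have e1 := rateIn_sub_rateOut (k := k) (g' := g') (d' := d') (s := (s : ℂ)) (c₀ := c₀)
        (c₁ := c₁) hck hz0
      have e2 : (4 * g' * z + d' : ℂ) • (adjL (lower a) * ratForm k s c c₀ c₁ z * lower a) =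
          adjL (lower a) * rateIn g' d' s c c₀ c₁ z * lower a -
          adjL (lower a) * rateOut k g' d' c z * lower a := by
        rw [← sub_mul, ← mul_sub, e1, mul_smul_comm, smul_mul_assoc]
      rw [e2, add_sub_assoc])
  refine ⟨Z, Q, δ, hδ, ?_⟩
  filter_upwards [hgood, hδb] with t ht hb
  obtain ⟨f1, f2, f3, f4, f5⟩ := hZQ t ht
  have hsub := Metric.ball_subset_ball (x := (0 : ℂ)) ht.1.2.2.1.le
  exact ⟨fun z hz hz1 => f2 z hz (h01.trans_le hz1),
    (tendsto_outerFactor h ht.2.2 hs (hR0.trans ht.1.2.2.1) ht.1.1 rfl ht.2.1 ht.1.2.1 f1 f2).2,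
    hb.1, f3.mono hsub, fun z hz => f4 z (hsub hz), fun z hz => f5 z ⟨hz.1, hsub hz.2⟩, hb.2⟩

end Deformation

/-! ### First order variation along a deformation -/

section Variation

variable {k : ℕ} {α l s : ℝ} {M : ℂ → Mat} {a : ℂ}
variable {g d σ : ℝ → ℝ} {g' d' : ℝ} {N : ℝ → ℂ → Mat} {b : ℝ → ℂ}

theorem hasDerivAt_of_norm_le {E : Type*} [NormedAddCommGroup E] [NormedSpace ℂ E] {f : ℝ → E}
    {f₀ f' : E} {δ : ℝ → ℝ} {C : ℝ} (hδ : δ =o[𝓝 0] (fun t : ℝ => t))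
    (hf : ∀ᶠ t in 𝓝 0, ‖f t - f₀ - (t : ℂ) • f'‖ ≤ C * δ t) :
    f 0 = f₀ ∧ HasDerivAt f f' 0 := by
  have h1 : (fun t : ℝ => f t - f₀ - (t : ℂ) • f') =o[𝓝 0] (fun t : ℝ => t) := by
    refine IsBigO.trans_isLittleO ?_ (hδ.const_mul_left C)
    refine IsBigO.of_bound 1 ?_
    filter_upwards [hf] with t ht
    rw [one_mul]
    exact ht.trans (le_abs_self _)
  have h0 : f 0 = f₀ := by
    have := (h1.def one_pos).self_of_nhds
    simp only [Complex.ofReal_zero, zero_smul, sub_zero, norm_zero, mul_zero, norm_le_zero_iff] at this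
    exact sub_eq_zero.1 this
  exact ⟨h0, hasDerivAt_of_isLittleO (h0 ▸ h1)⟩

theorem conj_lower_entry (X : Mat) : (adjL (lower a) * X * lower a) 0 1 = X 0 1 := by
  rw [Matrix.eta_fin_two X]
  simp [adjL_apply, lower]

theorem sigmaMinus_mul_adjL_lower : sigmaMinus * adjL (lower a) = sigmaMinus := by
  ext i j
  fin_cases i <;> fin_cases j <;> simp [sigmaMinus, adjL_apply, lower]

theorem tendsto_mul_rateOut (c : ℕ → Mat) :
    Tendsto (fun x : ℝ => (x : ℂ) * (adjL (lower a) * rateOut k g' d' c x * lower a) 0 1) atTop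
      (𝓝 (-(4 * g' * c 2 0 1 + d' * c 1 0 1))) := by
  simp only [conj_lower_entry]
  have h1 : ∀ j ∈ Finset.Icc 1 (k + 1), Tendsto (fun x : ℝ => (x : ℂ) * ((x : ℂ) ^ j)⁻¹ *
      (4 * g' * c (j + 1) 0 1 + d' * c j 0 1)) atTop
      (𝓝 (if j = 1 then 4 * g' * c 2 0 1 + d' * c 1 0 1 else 0)) := by
    intro j hj
    split_ifs with hj1
    · subst hj1
      refine tendsto_const_nhds.congr' ?_
      filter_upwards [eventually_gt_atTop 0] with x hx
      have : (x : ℂ) ≠ 0 := Complex.ofReal_ne_zero.2 hx.ne'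
      rw [pow_one, mul_inv_cancel₀ this, one_mul]
    · have h2 : Tendsto (fun x : ℝ => ((x : ℂ)⁻¹) ^ (j - 1)) atTop (𝓝 0) := by
        have h3 := tendsto_ofReal_inv.pow (j - 1)
        rwa [zero_pow (by have := (Finset.mem_Icc.1 hj).1; omega)] at h3
      have h3 := h2.mul_const (4 * g' * c (j + 1) 0 1 + d' * c j 0 1)
      rw [zero_mul] at h3
      refine h3.congr' ?_
      filter_upwards [eventually_gt_atTop 0] with x hx
      have hx0 : (x : ℂ) ≠ 0 := Complex.ofReal_ne_zero.2 hx.ne'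
      obtain ⟨i, rfl⟩ : ∃ i, j = i + 1 := ⟨j - 1, by have := (Finset.mem_Icc.1 hj).1; omega⟩
      rw [Nat.add_sub_cancel, inv_pow, pow_succ]
      field_simp
  have h2 := (tendsto_finsetSum _ h1).neg
  rw [Finset.sum_ite_eq' (Finset.Icc 1 (k + 1)) 1, if_pos (by simp)] at h2
  refine h2.congr fun x => ?_
  rw [rateOut, Matrix.neg_apply, Matrix.sum_apply, mul_neg, Finset.mul_sum]
  congr 1
  refine Finset.sum_congr rfl fun j _ => ?_
  simp only [Matrix.smul_apply, Matrix.add_apply, smul_eq_mul]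
  ring

/-- The infinitesimal variation of a solution along a deformation, as the coefficient of a linear
differential equation. -/
noncomputable def deformationRate (l s : ℝ) (a b' : ℂ) (g' d' : ℝ) (c : ℕ → Mat) (c₀ c₁ : Mat)
    (z : ℂ) : Mat :=
  b' • sigmaMinus + lower a * gaugeRate l g' d' * adjL (lower a) + rateIn g' d' s c c₀ c₁ z

theorem hasDerivAt_lower {b' : ℂ} (hb : HasDerivAt b b' 0) :
    HasDerivAt (fun t => lower (b t)) (b' • sigmaMinus) 0 := by
  unfold lower
  apply hasDerivAt_mat_real
  intro i j
  fin_cases i <;> fin_cases j <;> simp [sigmaMinus]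
  · exact hasDerivAt_const _ _
  · exact hasDerivAt_const _ _
  · exact hb
  · exact hasDerivAt_const _ _

/-- The variation of the constant `a`, read off from the expansion of the outer factor at
infinity. -/
theorem IsDeformation.hasDerivAt_const (hD : IsDeformation k α l s g d σ g' d' N b)
    (h : IsRHSolution k α l s M a) (hs : 0 < s) {c : ℕ → Mat} {c₀ c₁ : Mat}
    (hc : ∀ z ∈ Omega s, logD M z = ratForm k s c c₀ c₁ z) (hck : c (k + 2) = 0) :
    HasDerivAt b (-(4 * g' * c 2 0 1 + d' * c 1 0 1) + l * d' / 2 - 2 * g' * a) 0 := by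
  obtain ⟨P, hP, hP1, hPM, hPL⟩ := h.logD_eq_near_zero hs
  obtain ⟨Z, Q, δ, hδ, hev⟩ := hD.exists_factorization h hs hc hck hP hP1 hPM hPL
    (r₁ := s / 4) (r₂ := s / 2) (R := 3 * s / 4) (by linarith) (by linarith) (by linarith)
    (by linarith)
  set τ : ℂ := -(4 * g' * c 2 0 1 + d' * c 1 0 1) with hτ
  have hgc : HasDerivAt (fun t => (g t : ℂ)) g' 0 := hD.hasDerivAt_scale.ofReal_comp
  have hdc : HasDerivAt (fun t => (d t : ℂ)) d' 0 := hD.hasDerivAt_shift.ofReal_comp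
  have hidc : HasDerivAt (fun t : ℝ => (t : ℂ)) 1 0 := by
    simpa using (hasDerivAt_id (0 : ℝ)).ofReal_comp
  set f : ℝ → ℂ := fun t => l * d t / (2 * g t ^ 2) + a / g t ^ 2 + t * τ with hf
  have hf' : HasDerivAt f (τ + l * d' / 2 - 2 * g' * a) 0 := by
    refine ((((hdc.const_mul (l : ℂ)).fun_div ((hgc.fun_pow 2).const_mul 2)
      (by simp [hD.scale_zero])).fun_add (((_root_.hasDerivAt_const (0 : ℝ) a).fun_div (hgc.fun_pow 2)
      (by simp [hD.scale_zero])))).fun_add (hidc.mul_const τ)).congr_deriv ?_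
    simp [hD.scale_zero, hD.shift_zero]; ring
  have hbf : ∀ᶠ t in 𝓝 0, ‖(fun t => b t - f t) t - 0 - (t : ℂ) • (0 : ℂ)‖ ≤ s / 4 * δ t := by
    filter_upwards [hev] with t ht
    obtain ⟨-, hlim, hest, -⟩ := ht
    have h1 := (hlim.sub ((tendsto_mul_rateOut (k := k) (a := a) (g' := g') (d' := d') c).const_mul
      (t : ℂ))).norm
    have h2 : Tendsto (fun x : ℝ => x * (s / 4 / (x - s / 4) * δ t)) atTop (𝓝 (s / 4 * δ t)) := by
      have h3 : Tendsto (fun x : ℝ => s / 4 * (1 + s / 4 / (x - s / 4)) * δ t) atTop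
          (𝓝 (s / 4 * (1 + 0) * δ t)) := by
        have h4 : Tendsto (fun x : ℝ => x - s / 4) atTop atTop :=
          tendsto_atTop_add_const_right _ _ tendsto_id
        exact ((tendsto_const_nhds.add (h4.const_div_atTop _)).const_mul _).mul_const _
      rw [add_zero, mul_one] at h3
      refine h3.congr' ?_
      filter_upwards [eventually_gt_atTop (s / 4)] with x hx
      have : x - s / 4 ≠ 0 := by linarith
      have e : 1 + s / 4 / (x - s / 4) = x / (x - s / 4) := by
        rw [eq_div_iff this, add_mul, div_mul_cancel₀ _ this]; ring
      rw [e]; ring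
    refine le_trans (le_of_eq ?_) (le_of_tendsto_of_tendsto h1 h2 ?_)
    · simp only [hf, smul_zero, sub_zero]
      congr 1; ring
    · filter_upwards [eventually_gt_atTop (s / 4)] with x hx
      have hx0 : 0 < x := by linarith
      have hn : ‖(x : ℂ)‖ = x := by rw [Complex.norm_real, Real.norm_eq_abs, abs_of_pos hx0]
      have h5 := (entry_norm_le _ 0 1).trans (hest x (by rwa [hn]))
      rw [hn] at h5
      calc _ = ‖(x : ℂ) * ((outerFactor l (g t) (d t) a (b t) (Z t) x - 1 -
            (t : ℂ) • (adjL (lower a) * rateOut k g' d' c x * lower a)) 0 1)‖ := by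
            congr 1
            simp only [Matrix.sub_apply, Matrix.smul_apply, smul_eq_mul]
            rw [Matrix.one_apply_ne (by decide)]
            ring
        _ ≤ _ := by
            rw [norm_mul, hn]
            exact mul_le_mul_of_nonneg_left h5 hx0.le
  obtain ⟨-, h1⟩ := hasDerivAt_of_norm_le hδ hbf
  have h2 := h1.fun_add hf'
  simpa using h2

theorem IsDeformation.eventually_mem_Omega (hD : IsDeformation k α l s g d σ g' d' N b)
    (hs : 0 < s) {z : ℂ} (hz : z ∈ Omega s) : ∀ᶠ t in 𝓝 0, z ∈ Omega (σ t) := by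
  have hz0 : 0 < ‖z‖ := norm_pos_iff.2 (ne_zero_of_mem_Omega hs hz)
  have h1 : Tendsto (fun t => ((g t ^ 4 : ℝ) : ℂ) * z + d t) (𝓝 0) (𝓝 z) := by
    have e1 : Tendsto (fun t => ((g t ^ 4 : ℝ) : ℂ)) (𝓝 0) (𝓝 ((1 : ℝ) : ℂ)) := by
      have := hD.tendsto_scale.pow 4
      rw [one_pow] at this
      exact (Complex.continuous_ofReal.tendsto _).comp this
    have e2 : Tendsto (fun t => (d t : ℂ)) (𝓝 0) (𝓝 ((0 : ℝ) : ℂ)) :=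
      (Complex.continuous_ofReal.tendsto _).comp hD.tendsto_shift
    simpa using (e1.mul_const z).add e2
  filter_upwards [h1.eventually ((isOpen_Omega hs).mem_nhds hz), hD.vertex_eq,
    hD.eventually_lt (r := ‖z‖ / 2) (R := s / 2) (by positivity) (by linarith)] with t e1 e2 e3
  exact (affine_mem_Omega_iff hs (by linarith [e3.2.2.1]) (pow_pos e3.1 4) e2 e3.2.1
    (by linarith)).1 e1

/-- The variation of the solution itself, from the outer factor: any point off the contour
lies outside some small disc about the origin. -/
theorem IsDeformation.hasDerivAt_solution (hD : IsDeformation k α l s g d σ g' d' N b)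
    (h : IsRHSolution k α l s M a) (hs : 0 < s) {c : ℕ → Mat} {c₀ c₁ : Mat}
    (hc : ∀ z ∈ Omega s, logD M z = ratForm k s c c₀ c₁ z) (hck : c (k + 2) = 0) (hb : b 0 = a)
    {b' : ℂ} (hb' : HasDerivAt b b' 0) {z : ℂ} (hz : z ∈ Omega s) :
    HasDerivAt (fun t => N t z) (deformationRate l s a b' g' d' c c₀ c₁ z * M z) 0 := by
  obtain ⟨P, hP, hP1, hPM, hPL⟩ := h.logD_eq_near_zero hs
  have hz0 : z ≠ 0 := ne_zero_of_mem_Omega hs hz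
  have hzn : 0 < ‖z‖ := norm_pos_iff.2 hz0
  have hm1 : 0 < min ‖z‖ s := lt_min hzn hs
  have hm2 := min_le_left ‖z‖ s
  have hm3 := min_le_right ‖z‖ s
  obtain ⟨Z, Q, δ, hδ, hev⟩ := hD.exists_factorization h hs hc hck hP hP1 hPM hPL
    (r₁ := min ‖z‖ s / 4) (r₂ := s / 2) (R := 3 * s / 4) (by linarith) (by linarith) (by linarith)
    (by linarith)
  have hzr : min ‖z‖ s / 4 < ‖z‖ := by linarith
  -- the outer factor
  obtain ⟨hO0, hO⟩ := hasDerivAt_of_norm_le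
    (f := fun t => outerFactor l (g t) (d t) a (b t) (Z t) z)
    (C := min ‖z‖ s / 4 / (‖z‖ - min ‖z‖ s / 4)) hδ (by
      filter_upwards [hev] with t ht using ht.2.2.1 z hzr)
  have hG := hasDerivAt_adjL_ratioLimit (l := l) hD.scale_zero hD.shift_zero hD.hasDerivAt_scale
    hD.hasDerivAt_shift
  have hG0 : adjL (ratioLimit l (g 0) (d 0)) = 1 := by
    rw [hD.scale_zero, hD.shift_zero, Matrix.one_fin_two]; simp [ratioLimit, adjL_apply]
  have hφ : HasDerivAt (fun t => ((g t ^ 4 : ℝ) : ℂ) * z + d t) (4 * g' * z + d') 0 := by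
    have e1 : HasDerivAt (fun t => ((g t ^ 4 : ℝ) : ℂ)) ((4 * g' : ℝ) : ℂ) 0 := by
      have := (hD.hasDerivAt_scale.fun_pow 4).ofReal_comp
      simpa [hD.scale_zero] using this
    refine ((e1.mul_const z).fun_add hD.hasDerivAt_shift.ofReal_comp).congr_deriv ?_
    push_cast; ring
  have hφ0 : ((g 0 ^ 4 : ℝ) : ℂ) * z + d 0 = z := by simp [hD.scale_zero, hD.shift_zero]
  have hMφ : HasDerivAt (fun t => M (((g t ^ 4 : ℝ) : ℂ) * z + d t))
      ((4 * g' * z + d' : ℂ) • (ratForm k s c c₀ c₁ z * M z)) 0 := by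
    have e1 := h.hasDerivAt hs hz
    rw [hc z hz] at e1
    have e2 : HasDerivAt M (ratForm k s c c₀ c₁ z * M z) (((g 0 ^ 4 : ℝ) : ℂ) * z + d 0) := by
      rwa [hφ0]
    exact HasDerivAt.scomp 0 e2 hφ
  have hprod := ((((hasDerivAt_lower hb').fun_mul hO).fun_mul hG).fun_mul
    (_root_.hasDerivAt_const (0 : ℝ) (adjL (lower a)))).fun_mul hMφ
  simp only [hφ0] at hprod
  have hN : (fun t => lower (b t) * outerFactor l (g t) (d t) a (b t) (Z t) z *
      adjL (ratioLimit l (g t) (d t)) * adjL (lower a) * M (((g t ^ 4 : ℝ) : ℂ) * z + d t))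
      =ᶠ[𝓝 0] fun t => N t z := by
    have hφΩ : ∀ᶠ t in 𝓝 0, ((g t ^ 4 : ℝ) : ℂ) * z + d t ∈ Omega s := by
      have := hφ.continuousAt.tendsto
      rw [hφ0] at this
      exact this.eventually ((isOpen_Omega hs).mem_nhds hz)
    filter_upwards [hev, hφΩ, hD.eventually_mem_Omega hs hz,
      hD.tendsto_scale.eventually_const_lt zero_lt_one] with t ht htΩ htz htg
    rw [outerFactor, ht.1 z htz hzr.le]
    set w : ℂ := ((g t ^ 4 : ℝ) : ℂ) * z + d t
    calc _ = (lower (b t) * adjL (lower (b t))) * N t z * adjL (M w) * (lower a *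
          (ratioLimit l (g t) (d t) * adjL (ratioLimit l (g t) (d t))) * adjL (lower a)) * M w := by
          simp only [mul_assoc]
      _ = N t z * (adjL (M w) * M w) := by
          rw [mul_adjL (det_lower _), mul_adjL (det_ratioLimit htg), mul_one,
            mul_adjL (det_lower a), mul_one, one_mul, mul_assoc]
      _ = N t z := by rw [adjL_mul_self (h.det_eq_one hs htΩ), mul_one]
  refine (hprod.congr_of_eventuallyEq hN.symm).congr_deriv ?_
  have hin := rateIn_sub_rateOut (k := k) (g' := g') (d' := d') (s := (s : ℂ)) (c₀ := c₀)
        (c₁ := c₁) hck hz0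
  have hO1 : outerFactor l (g 0) (d 0) a (b 0) (Z 0) z = 1 := hO0
  simp only [hO1, hG0, mul_one, mul_zero, add_zero]
  rw [hb]
  rw [deformationRate, eq_add_of_sub_eq hin]
  have hL : lower a * adjL (lower a) = 1 := mul_adjL (det_lower a)
  rw [hL, one_mul]
  have e2 : lower a * (adjL (lower a) * rateOut k g' d' c z * lower a) * adjL (lower a) =
      rateOut k g' d' c z := by
    calc _ = (lower a * adjL (lower a)) * rateOut k g' d' c z * (lower a * adjL (lower a)) := by
          simp only [mul_assoc]
      _ = _ := by rw [hL, one_mul, mul_one]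
  simp only [add_mul, e2, smul_mul_assoc, sigmaMinus_mul_adjL_lower]
  abel

/-- Uniformly in a disc about the origin, the solutions of a deformation differ from the initial
one by a regular left factor, known to first order. -/
theorem IsDeformation.exists_left_factor (hD : IsDeformation k α l s g d σ g' d' N b)
    (h : IsRHSolution k α l s M a) (hs : 0 < s) {c : ℕ → Mat} {c₀ c₁ : Mat}
    (hc : ∀ z ∈ Omega s, logD M z = ratForm k s c c₀ c₁ z) (hck : c (k + 2) = 0) (hb : b 0 = a)
    {b' : ℂ} (hb' : HasDerivAt b b' 0) {r : ℝ} (hr0 : 0 < r) (hr : r < s) :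
    ∃ X : ℝ → ℂ → Mat, (∀ᶠ t in 𝓝 0, DifferentiableOn ℂ (X t) (Metric.ball 0 r) ∧
        ∀ z ∈ Omega s ∩ Omega (σ t) ∩ Metric.ball 0 r, N t z = X t z * M z) ∧
      (fun p : ℝ × ℂ => X p.1 p.2 - 1 - (p.1 : ℂ) • deformationRate l s a b' g' d' c c₀ c₁ p.2)
        =o[𝓝 (0 : ℝ) ×ˢ 𝓟 (Metric.ball 0 r)] (fun p => p.1) := by
  obtain ⟨P, hP, hP1, hPM, hPL⟩ := h.logD_eq_near_zero hs
  obtain ⟨r₂, hr2, hr2s⟩ := exists_between hr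
  obtain ⟨R, hR, hRs⟩ := exists_between hr2s
  obtain ⟨Z, Q, δ, hδ, hev⟩ := hD.exists_factorization h hs hc hck hP hP1 hPM hPL
    (r₁ := r / 2) (by linarith) (by linarith) hR hRs
  have hsub : Metric.ball (0 : ℂ) r ⊆ Metric.ball 0 s := Metric.ball_subset_ball hr.le
  have hsubR : Metric.ball (0 : ℂ) r ⊆ Metric.ball 0 R := Metric.ball_subset_ball (by linarith)
  refine ⟨fun t z => Q t z * adjL (P z), ?_, ?_⟩
  · filter_upwards [hev] with t ht
    obtain ⟨-, -, -, hQ, hQ1, hQN, -⟩ := ht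
    refine ⟨(hQ.mono hsubR).fun_mul (adjL.differentiable.comp_differentiableOn (hP.mono hsub)),
      fun z hz => ?_⟩
    rw [hQN z ⟨hz.1.2, hsubR hz.2⟩, hPM z ⟨hz.1.1, hsub hz.2⟩]
    calc _ = Q t z * (adjL (P z) * P z) * expSigma3 (theta k z) * powSigma3 z (α / 2) := by
          rw [adjL_mul_self (hP1 z (hsub hz.2)), mul_one]
      _ = _ := by simp only [mul_assoc]
  · set 𝓕 := 𝓝 (0 : ℝ) ×ˢ 𝓟 (Metric.ball (0 : ℂ) r) with h𝓕
    have hmem : ∀ᶠ p in 𝓕, p.2 ∈ Metric.ball (0 : ℂ) r := by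
      rw [h𝓕, eventually_prod_principal_iff]
      exact Eventually.of_forall fun _ z hz => hz
    have hfst : Tendsto (fun p : ℝ × ℂ => p.1) 𝓕 (𝓝 0) := tendsto_fst
    have hT1 : (fun p : ℝ × ℂ => p.1) =o[𝓕] (fun _ => (1 : ℝ)) := (isLittleO_one_iff ℝ).2 hfst
    have hTc : (fun p : ℝ × ℂ => (p.1 : ℂ)) =O[𝓕] (fun p => p.1) :=
      IsBigO.of_bound 1 (Eventually.of_forall fun p => by simp)
    set D : ℂ → Mat := fun z => gaugeRate l g' d' + adjL (lower a) * rateIn g' d' s c c₀ c₁ z *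
      lower a with hDdef
    set V : ℝ × ℂ → Mat := fun p => adjL (lower (b p.1)) * Q p.1 p.2 * adjL (P p.2) * lower a with hV
    have hVo : (fun p => V p - 1 - (p.1 : ℂ) • D p.2) =o[𝓕] (fun p => p.1) := by
      refine IsBigO.trans_isLittleO ?_ (hδ.comp_tendsto hfst)
      refine IsBigO.of_bound (r₂ / (r₂ - r)) ?_
      rw [h𝓕, eventually_prod_principal_iff]
      filter_upwards [hev] with t ht z hz
      have hz' := mem_ball_zero_iff.1 hz
      have hb := ht.2.2.2.2.2.2 z (hz'.trans hr2)
      have hp : 0 < r₂ / (r₂ - ‖z‖) := div_pos (by linarith) (by linarith)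
      have hδ0 : 0 ≤ δ t := by
        have := (norm_nonneg _).trans hb
        exact (mul_nonneg_iff_of_pos_left hp).1 this
      refine hb.trans ?_
      simp only [Function.comp, Real.norm_eq_abs, abs_of_nonneg hδ0]
      gcongr
      · linarith
    have hDO : (fun p : ℝ × ℂ => D p.2) =O[𝓕] (fun _ => (1 : ℝ)) := by
      have hcont : ContinuousOn D (Metric.closedBall 0 r) := by
        intro z hz
        have hzs : z + s ≠ 0 := add_ofReal_ne_zero_of_norm_lt ((mem_closedBall_zero_iff.1 hz).trans_lt hr)
        have e1 := (differentiableAt_rateIn (g' := g') (d' := d') c c₀ c₁ hzs).continuousAt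
        exact (continuousAt_const.add ((continuousAt_const.mul e1).mul
          continuousAt_const)).continuousWithinAt
      obtain ⟨C, hC⟩ := (isCompact_closedBall (0 : ℂ) r).exists_bound_of_continuousOn hcont
      refine IsBigO.of_bound C ?_
      filter_upwards [hmem] with p hp
      simpa using hC p.2 (Metric.ball_subset_closedBall hp)
    have hLo : (fun p : ℝ × ℂ => lower (b p.1) - lower a - (p.1 : ℂ) • (b' • sigmaMinus))
        =o[𝓕] (fun p => p.1) := by
      have := (isLittleO_of_hasDerivAt (hasDerivAt_lower hb')).comp_tendsto hfst
      rw [hb] at this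
      exact this
    have hV1 : (fun p => V p - 1) =O[𝓕] (fun p => p.1) := by
      have e1 : (fun p : ℝ × ℂ => (p.1 : ℂ) • D p.2) =O[𝓕] (fun p => p.1) := by
        simpa using hTc.smul hDO
      simpa using hVo.isBigO.add e1
    have hL1 : (fun p : ℝ × ℂ => lower (b p.1) - lower a) =O[𝓕] (fun p => p.1) := by
      have e1 : (fun p : ℝ × ℂ => (p.1 : ℂ) • (b' • sigmaMinus)) =O[𝓕] (fun p => p.1) := by
        simpa using hTc.smul (isBigO_const_const (b' • sigmaMinus) (one_ne_zero (α := ℝ)) 𝓕)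
      simpa using hLo.isBigO.add e1
    have hlow : (fun _ : ℝ × ℂ => lower a) =O[𝓕] (fun _ => (1 : ℝ)) :=
      isBigO_const_const _ one_ne_zero _
    have e3 : (fun p : ℝ × ℂ => ((lower (b p.1) - lower a - (p.1 : ℂ) • (b' • sigmaMinus)) +
        (lower (b p.1) - lower a) * (V p - 1) + lower a * (V p - 1 - (p.1 : ℂ) • D p.2)) *
        adjL (lower a)) =o[𝓕] (fun p => p.1) := by
      have f1 : (fun p : ℝ × ℂ => (lower (b p.1) - lower a) * (V p - 1)) =o[𝓕] (fun p => p.1) := by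
        simpa using hL1.mul_isLittleO (hV1.trans_isLittleO hT1)
      have f2 : (fun p : ℝ × ℂ => lower a * (V p - 1 - (p.1 : ℂ) • D p.2)) =o[𝓕] (fun p => p.1) := by
        simpa using hlow.mul_isLittleO hVo
      have f3 : (fun _ : ℝ × ℂ => adjL (lower a)) =O[𝓕] (fun _ => (1 : ℝ)) :=
        isBigO_const_const _ one_ne_zero _
      simpa using ((hLo.add f1).add f2).mul_isBigO f3
    refine e3.congr_left fun p => ?_
    have hL : lower a * adjL (lower a) = 1 := mul_adjL (det_lower a)
    have hLb : lower (b p.1) * adjL (lower (b p.1)) = 1 := mul_adjL (det_lower _)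
    have g1 : lower (b p.1) * V p * adjL (lower a) = Q p.1 p.2 * adjL (P p.2) := by
      calc _ = (lower (b p.1) * adjL (lower (b p.1))) * Q p.1 p.2 * adjL (P p.2) *
            (lower a * adjL (lower a)) := by simp only [hV, mul_assoc]
        _ = _ := by rw [hL, hLb, one_mul, mul_one]
    have g3 : lower a * D p.2 * adjL (lower a) = lower a * gaugeRate l g' d' * adjL (lower a) +
        rateIn g' d' s c c₀ c₁ p.2 := by
      calc _ = lower a * gaugeRate l g' d' * adjL (lower a) + (lower a * adjL (lower a)) *
            rateIn g' d' s c c₀ c₁ p.2 * (lower a * adjL (lower a)) := by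
            simp only [hDdef, mul_add, add_mul, mul_assoc]
        _ = _ := by rw [hL, one_mul, mul_one]
    calc _ = lower (b p.1) * V p * adjL (lower a) - lower a * adjL (lower a) -
          (p.1 : ℂ) • (b' • (sigmaMinus * adjL (lower a)) + lower a * D p.2 * adjL (lower a)) := by
          simp only [sub_mul, add_mul, mul_sub, mul_one, smul_mul_assoc, mul_smul_comm, smul_add]
          abel
      _ = _ := by
          rw [g1, sigmaMinus_mul_adjL_lower, g3, hL, deformationRate]
          simp only [smul_add]
          abel

end Variation

/-! ### Variation of the coefficients of the equation in `z` -/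

section Coefficients

variable {k : ℕ} {α l s : ℝ} {M : ℂ → Mat} {a : ℂ}

theorem continuousAt_ratForm (c : ℕ → Mat) (c₀ c₁ : Mat) {z : ℂ} (hz : z ≠ 0)
    (hzs : z + s ≠ 0) : ContinuousAt (ratForm k s c c₀ c₁) z := by
  unfold ratForm
  refine ContinuousAt.add (ContinuousAt.add ?_ ?_) continuousAt_const
  · refine tendsto_finsetSum _ fun j _ => ?_
    exact ((((continuous_pow j).continuousAt).inv₀ (pow_ne_zero _ hz)).smul_const _)
  · have : ContinuousAt (fun w : ℂ => (w + s)⁻¹) z := ContinuousAt.inv₀ (by fun_prop) hzs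
    exact this.smul_const _

/-- The coefficient of `z⁻ʲ` in a rational function, as an integral over a circle. -/
theorem coeff_eq_circleIntegral (c : ℕ → Mat) (c₀ c₁ : Mat) {r : ℝ} (hr : 0 < r) (hrs : r < s)
    {j : ℕ} (hj : j ∈ Finset.Icc 1 (k + 1)) :
    (2 * Real.pi * Complex.I : ℂ)⁻¹ • ∮ z in C(0, r), z ^ (j - 1) • ratForm k s c c₀ c₁ z = c j := by
  have hpi : (2 * Real.pi * Complex.I : ℂ) ≠ 0 := Complex.two_pi_I_ne_zero
  obtain ⟨hj1, hjk⟩ := Finset.mem_Icc.1 hj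
  have hreg : DiffContOnCl ℂ (fun z : ℂ => z ^ (j - 1) • ((z + s)⁻¹ • c₀ + c₁))
      (Metric.ball 0 r) := by
    refine DifferentiableOn.diffContOnCl fun z hz => ?_
    rw [closure_ball _ hr.ne'] at hz
    have hzs : z + s ≠ 0 := add_ofReal_ne_zero_of_norm_lt ((mem_closedBall_zero_iff.1 hz).trans_lt hrs)
    have h1 : DifferentiableAt ℂ (fun w : ℂ => (w + s)⁻¹) z :=
      DifferentiableAt.fun_inv (by fun_prop) hzs
    have h2 : DifferentiableAt ℂ (fun w : ℂ => w ^ (j - 1)) z := by fun_prop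
    exact (h2.fun_smul ((h1.smul_const _).fun_add
      (differentiableAt_const _))).differentiableWithinAt
  have hint : ∀ m ∈ Finset.Icc 1 (k + 1),
      CircleIntegrable (fun z : ℂ => (z - 0) ^ ((j : ℤ) - 1 - m) • c m) 0 r := by
    intro m _
    refine ContinuousOn.circleIntegrable hr.le ?_
    refine ContinuousOn.smul (ContinuousOn.zpow₀ (f := fun z : ℂ => z - 0) (by fun_prop) _
      fun z hz => Or.inl ?_)
      continuousOn_const
    rw [sub_zero]
    exact norm_pos_iff.1 (by rw [mem_sphere_zero_iff_norm.1 hz]; exact hr)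
  have hsum : CircleIntegrable (fun z : ℂ => ∑ m ∈ Finset.Icc 1 (k + 1),
      (z - 0) ^ ((j : ℤ) - 1 - m) • c m) 0 r := by
    refine ContinuousOn.circleIntegrable hr.le ?_
    refine continuousOn_finsetSum _ fun m _ => ?_
    refine ContinuousOn.smul (ContinuousOn.zpow₀ (f := fun z : ℂ => z - 0) (by fun_prop) _
      fun z hz => Or.inl ?_)
      continuousOn_const
    rw [sub_zero]
    exact norm_pos_iff.1 (by rw [mem_sphere_zero_iff_norm.1 hz]; exact hr)
  have hcongr : (∮ z in C(0, r), z ^ (j - 1) • ratForm k s c c₀ c₁ z) =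
      ∮ z in C(0, r), (∑ m ∈ Finset.Icc 1 (k + 1), (z - 0) ^ ((j : ℤ) - 1 - m) • c m +
        z ^ (j - 1) • ((z + s)⁻¹ • c₀ + c₁)) := by
    refine circleIntegral.integral_congr hr.le fun z hz => ?_
    have hz0 : z ≠ 0 := norm_pos_iff.1 (by rw [mem_sphere_zero_iff_norm.1 hz]; exact hr)
    simp only [ratForm]
    rw [add_assoc, smul_add, Finset.smul_sum]
    congr 1
    refine Finset.sum_congr rfl fun m _ => ?_
    rw [smul_smul, sub_zero, zpow_sub₀ hz0, zpow_natCast, div_eq_mul_inv]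
    congr 2
    rw [← zpow_natCast, Nat.cast_sub hj1, Nat.cast_one]
  have hregint : CircleIntegrable (fun z : ℂ => z ^ (j - 1) • ((z + s)⁻¹ • c₀ + c₁)) 0 r := by
    refine (hreg.continuousOn.mono ?_).circleIntegrable hr.le
    rw [closure_ball _ hr.ne']
    exact Metric.sphere_subset_closedBall
  rw [hcongr, circleIntegral.integral_add hsum hregint, hreg.circleIntegral_eq_zero hr.le, add_zero,
    circleIntegral.integral_fun_sum hint]
  simp only [circleIntegral.integral_smul_const]
  rw [Finset.sum_eq_single j]
  · have h1 : (∮ z in C((0 : ℂ), r), (z - 0) ^ ((j : ℤ) - 1 - j)) = 2 * Real.pi * Complex.I := by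
      rw [← circleIntegral.integral_sub_center_inv 0 hr.ne']
      refine circleIntegral.integral_congr hr.le fun z _ => ?_
      rw [show (j : ℤ) - 1 - j = -1 by ring, zpow_neg_one]
    rw [h1, smul_smul, inv_mul_cancel₀ hpi, one_smul]
  · intro m _ hmj
    rw [circleIntegral.integral_sub_zpow_of_ne (by omega), zero_smul]
  · intro h; exact absurd hj h

theorem coeff_norm_le (hs : 0 < s) {c : ℕ → Mat} {c₀ c₁ : Mat} {r₁ r r₂ K : ℝ} (hr : 0 < r)
    (h1 : r₁ < r) (h2 : r < r₂) (hrs : r < s)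
    (hK : ∀ z ∈ Omega s, r₁ < ‖z‖ → ‖z‖ < r₂ → ‖ratForm k s c c₀ c₁ z‖ ≤ K) {j : ℕ}
    (hj : j ∈ Finset.Icc 1 (k + 1)) : ‖c j‖ ≤ r ^ j * K := by
  obtain ⟨hj1, hjk⟩ := Finset.mem_Icc.1 hj
  rw [← coeff_eq_circleIntegral c c₀ c₁ hr hrs hj]
  have hpow : r ^ j * K = r * (r ^ (j - 1) * K) := by
    obtain ⟨i, rfl⟩ : ∃ i, j = i + 1 := ⟨j - 1, by omega⟩
    rw [Nat.add_sub_cancel]; ring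
  rw [hpow]
  refine circleIntegral.norm_two_pi_i_inv_smul_integral_le_of_norm_le_const hr.le fun z hz => ?_
  have hzn : ‖z‖ = r := mem_sphere_zero_iff_norm.1 hz
  have hz0 : z ≠ 0 := norm_pos_iff.1 (by rw [hzn]; exact hr)
  have hzs : z + s ≠ 0 := add_ofReal_ne_zero_of_norm_lt (by rw [hzn]; exact hrs)
  rw [norm_smul, norm_pow, hzn]
  refine mul_le_mul_of_nonneg_left ?_ (by positivity)
  -- the bound extends over the contour by continuity
  have := neBot_nhdsWithin_Omega hs z
  have hcont := (continuousAt_ratForm (k := k) (s := s) c c₀ c₁ hz0 hzs).norm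
  refine le_of_tendsto (hcont.tendsto.mono_left (nhdsWithin_le_nhds (s := Omega s))) ?_
  have hn1 : ∀ᶠ w in 𝓝[Omega s] z, r₁ < ‖w‖ :=
    ((continuous_norm.tendsto z).mono_left nhdsWithin_le_nhds).eventually_const_lt (by rwa [hzn])
  have hn2 : ∀ᶠ w in 𝓝[Omega s] z, ‖w‖ < r₂ :=
    ((continuous_norm.tendsto z).mono_left nhdsWithin_le_nhds).eventually_lt_const (by rwa [hzn])
  filter_upwards [self_mem_nhdsWithin, hn1, hn2] with w hw hw1 hw2 using hK w hw hw1 hw2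

/-- The commutator with a fixed matrix. -/
noncomputable def commL (B : Mat) : Mat →ₗ[ℂ] Mat := LinearMap.mulLeft ℂ B - LinearMap.mulRight ℂ B

theorem commL_apply (B X : Mat) : commL B X = B * X - X * B := rfl

theorem map_ratForm (L : Mat →ₗ[ℂ] Mat) {s : ℂ} (c : ℕ → Mat) (c₀ c₁ : Mat) (z : ℂ) :
    L (ratForm k s c c₀ c₁ z) = ratForm k s (fun j => L (c j)) (L c₀) (L c₁) z := by
  simp only [ratForm, map_add, map_sum, map_smul]

theorem smul_ratForm {s : ℂ} {c : ℕ → Mat} {c₀ : Mat} (hck : c (k + 2) = 0) {z : ℂ} (hz : z ≠ 0)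
    (hzs : z + s ≠ 0) : z • ratForm k s c c₀ 0 z =
      ratForm k s (fun j => c (j + 1)) (-(s • c₀)) (c 1 + c₀) z := by
  have h1 := sum_shift c hz (k + 1)
  rw [hck, smul_zero, add_zero] at h1
  have h2 : z • (z + s)⁻¹ • c₀ = c₀ - (z + s)⁻¹ • (s • c₀) := by
    rw [smul_smul, smul_smul, eq_sub_iff_add_eq, ← add_smul, mul_comm _ s, ← add_mul,
      mul_inv_cancel₀ hzs, one_smul]
  simp only [ratForm, add_zero, smul_add, Finset.smul_sum]
  simp only [smul_smul] at h1 h2 ⊢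
  rw [h1, h2, smul_neg, smul_smul]
  abel

theorem rate_eq_ratForm {s : ℂ} {c : ℕ → Mat} {c₀ c₁ B : Mat} (hc1 : c₁ = (l / 2 : ℂ) • sigmaMinus)
    (hck : c (k + 2) = 0) {z : ℂ} (hz : z ≠ 0) (hzs : z + s ≠ 0) :
    sigmaMinus + commL (B + z • sigmaMinus) (ratForm k s c c₀ c₁ z) =
      ratForm k s (fun j => commL B (c j) + commL sigmaMinus (c (j + 1)))
        (commL B c₀ - s • commL sigmaMinus c₀)
        (sigmaMinus + commL B c₁ + commL sigmaMinus (c 1) + commL sigmaMinus c₀) z := by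
  have h1 : commL (B + z • sigmaMinus) (ratForm k s c c₀ c₁ z) =
      commL B (ratForm k s c c₀ c₁ z) + z • commL sigmaMinus (ratForm k s c c₀ c₁ z) := by
    simp only [commL_apply, add_mul, mul_add, smul_mul_assoc, mul_smul_comm, smul_sub]
    abel
  have h2 : commL sigmaMinus c₁ = 0 := by
    rw [hc1, map_smul, commL_apply, sub_self, smul_zero]
  rw [h1, map_ratForm, map_ratForm, h2, smul_ratForm (by rw [hck, map_zero]) hz hzs]
  simp only [ratForm, smul_add, Finset.sum_add_distrib, smul_neg, smul_sub]
  abel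

theorem sub_sub_smul_ratForm {s : ℂ} (c e f : ℕ → Mat) (c₀ e₀ f₀ c₁ e₁ f₁ : Mat) (t z : ℂ) :
    ratForm k s c c₀ c₁ z - ratForm k s e e₀ e₁ z - t • ratForm k s f f₀ f₁ z =
      ratForm k s (fun j => c j - e j - t • f j) (c₀ - e₀ - t • f₀) (c₁ - e₁ - t • f₁) z := by
  simp only [ratForm, smul_sub, Finset.sum_sub_distrib, Finset.smul_sum, smul_add,
    smul_comm t ((z ^ _)⁻¹), smul_comm t ((z + s)⁻¹)]
  abel

/-- If solutions vary by left factors `X t = 1 + t (B + z σ₋) + o(t)`, uniformly near the origin,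
then their logarithmic derivatives vary according to the zero curvature equation, and so do the
polar parts of these at the origin. -/
theorem hasDerivAt_coeff (h : IsRHSolution k α l s M a) (hs : 0 < s) {c : ℕ → Mat} {c₀ c₁ B : Mat}
    (hc : ∀ z ∈ Omega s, logD M z = ratForm k s c c₀ c₁ z) (hck : c (k + 2) = 0)
    (hc1 : c₁ = (l / 2 : ℂ) • sigmaMinus) (hB : adjL B = -B) {r : ℝ} (hr0 : 0 < r) (hr : r < s)
    {N : ℝ → ℂ → Mat} {C : ℝ → ℕ → Mat} {C₀ C₁ : ℝ → Mat}
    (hC : ∀ᶠ t in 𝓝 0, ∀ z ∈ Omega s, logD (N t) z = ratForm k s (C t) (C₀ t) (C₁ t) z)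
    {X : ℝ → ℂ → Mat} (hX : ∀ᶠ t in 𝓝 0, DifferentiableOn ℂ (X t) (Metric.ball 0 r) ∧
        ∀ z ∈ Omega s ∩ Metric.ball 0 r, N t z = X t z * M z)
    (hXo : (fun p : ℝ × ℂ => X p.1 p.2 - 1 - (p.1 : ℂ) • (B + p.2 • sigmaMinus))
        =o[𝓝 (0 : ℝ) ×ˢ 𝓟 (Metric.ball 0 r)] (fun p => p.1))
    {j : ℕ} (hj : j ∈ Finset.Icc 1 (k + 1)) :
    HasDerivAt (fun t => C t j) (commL B (c j) + commL sigmaMinus (c (j + 1))) 0 := by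
  set S : Set ℂ := {z | z ∈ Omega s ∧ r / 4 < ‖z‖ ∧ ‖z‖ < r / 2} with hS
  set 𝓕 := 𝓝 (0 : ℝ) ×ˢ 𝓟 S with h𝓕
  have hmem : ∀ᶠ p in 𝓕, p.2 ∈ S := by
    rw [h𝓕, eventually_prod_principal_iff]
    exact Eventually.of_forall fun _ z hz => hz
  have hSr : S ⊆ Metric.ball 0 r := fun z hz => mem_ball_zero_iff.2 (by linarith [hz.2.2])
  have hfst : Tendsto (fun p : ℝ × ℂ => p.1) 𝓕 (𝓝 0) := tendsto_fst
  have hT1 : (fun p : ℝ × ℂ => p.1) =o[𝓕] (fun _ => (1 : ℝ)) := (isLittleO_one_iff ℝ).2 hfst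
  have hTc : (fun p : ℝ × ℂ => (p.1 : ℂ)) =O[𝓕] (fun p => p.1) :=
    IsBigO.of_bound 1 (Eventually.of_forall fun p => by simp)
  set G : ℂ → Mat := fun z => B + z • sigmaMinus with hG
  set A : ℂ → Mat := ratForm k s c c₀ c₁ with hA
  have hbound : ∀ F : ℂ → Mat, (∀ z : ℂ, z ≠ 0 → z + s ≠ 0 → ContinuousAt F z) →
      (fun p : ℝ × ℂ => F p.2) =O[𝓕] (fun _ => (1 : ℝ)) := by
    intro F hF
    have hcomp : IsCompact {z : ℂ | r / 4 ≤ ‖z‖ ∧ ‖z‖ ≤ r / 2} := by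
      refine Metric.isCompact_of_isClosed_isBounded ?_ ?_
      · exact (isClosed_le continuous_const continuous_norm).inter
          (isClosed_le continuous_norm continuous_const)
      · exact Metric.isBounded_closedBall.subset fun z hz => mem_closedBall_zero_iff.2 hz.2
    obtain ⟨K, hK⟩ := hcomp.exists_bound_of_continuousOn (f := F) (fun z hz =>
      (hF z (norm_pos_iff.1 (by linarith [hz.1]))
        (add_ofReal_ne_zero_of_norm_lt (by linarith [hz.2]))).continuousWithinAt)
    refine IsBigO.of_bound K ?_
    filter_upwards [hmem] with p hp
    simpa using hK p.2 ⟨hp.2.1.le, hp.2.2.le⟩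
  have hAO := hbound A fun z hz hzs => continuousAt_ratForm c c₀ c₁ hz hzs
  have hGO := hbound G fun z _ _ => by
    have : ContinuousAt (fun w : ℂ => w • sigmaMinus) z := continuousAt_id.smul_const _
    exact continuousAt_const.add this
  obtain ⟨ε, hε, hεb⟩ := exists_uniform_bound hXo
  -- the remainder and its derivative
  have hEo : (fun p : ℝ × ℂ => X p.1 p.2 - 1 - (p.1 : ℂ) • G p.2) =o[𝓕] (fun p => p.1) :=
    hXo.mono (prod_mono le_rfl (principal_mono.2 hSr))
  have hdG : ∀ z, HasDerivAt G sigmaMinus z := by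
    intro z
    have := ((hasDerivAt_id z).smul_const sigmaMinus).const_add B
    rw [one_smul] at this
    exact this
  have hE'o : (fun p : ℝ × ℂ => deriv (X p.1) p.2 - (p.1 : ℂ) • sigmaMinus) =o[𝓕]
      (fun p => p.1) := by
    refine IsBigO.trans_isLittleO ?_ (hε.comp_tendsto hfst)
    refine IsBigO.of_bound (4 / r) ?_
    rw [h𝓕, eventually_prod_principal_iff]
    filter_upwards [hX, hεb] with t htX htε z hz
    have hball : Metric.closedBall z (r / 4) ⊆ Metric.ball 0 r := by
      intro w hw
      rw [mem_ball_zero_iff]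
      have h1 : ‖w - z‖ ≤ r / 4 := by rwa [← dist_eq_norm]
      have h2 : ‖w‖ ≤ ‖w - z‖ + ‖z‖ := by simpa using norm_add_le (w - z) z
      linarith [hz.2.2]
    have hd : DifferentiableOn ℂ (fun w => X t w - 1 - (t : ℂ) • G w) (Metric.ball 0 r) :=
      ((htX.1.sub_const _).fun_sub (fun w _ =>
        ((hdG w).differentiableAt.fun_const_smul (t : ℂ)).differentiableWithinAt))
    have hder : HasDerivAt (fun w => X t w - 1 - (t : ℂ) • G w)
        (deriv (X t) z - (t : ℂ) • sigmaMinus) z :=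
      ((htX.1.differentiableAt (Metric.isOpen_ball.mem_nhds (hSr hz))).hasDerivAt.sub_const
        1).fun_sub ((hdG z).fun_const_smul (t : ℂ))
    have hcauchy := Complex.norm_deriv_le_of_forall_mem_sphere_norm_le (R := r / 4) (C := ε t)
      (by linarith) (DifferentiableOn.diffContOnCl (hd.mono (by
        rw [closure_ball z (by linarith : r / 4 ≠ 0)]; exact hball)))
      (fun w hw => htε w (hball (Metric.sphere_subset_closedBall hw)))
    have hder' : deriv (fun w => X t w - 1 - (t : ℂ) • G w) z = _ := hder.deriv
    refine (congrArg norm hder').symm.le.trans (hcauchy.trans ?_)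
    rw [div_div_eq_mul_div, Function.comp, Real.norm_eq_abs, div_mul_eq_mul_div, mul_comm]
    gcongr
    exact le_abs_self _
  -- expansion of the logarithmic derivative
  set Y : ℝ × ℂ → Mat := fun p => adjL (X p.1 p.2) with hY
  have hYo : (fun p => Y p - 1 + (p.1 : ℂ) • G p.2) =o[𝓕] (fun p => p.1) := by
    have h1 : (fun p : ℝ × ℂ => adjL (X p.1 p.2 - 1 - (p.1 : ℂ) • G p.2)) =o[𝓕] (fun p => p.1) :=
      (adjL.isBigO_comp _ _).trans_isLittleO hEo
    refine h1.congr_left fun p => ?_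
    have h2 : adjL (G p.2) = -G p.2 := by
      have h3 : adjL sigmaMinus = -sigmaMinus := by simp [adjL_apply, sigmaMinus]
      simp only [hG, map_add, map_smul, hB, h3, smul_neg, neg_add]
    rw [map_sub, map_sub, map_smul, adjL_one, h2, smul_neg, sub_neg_eq_add]
  have hTG : (fun p : ℝ × ℂ => (p.1 : ℂ) • G p.2) =O[𝓕] (fun p => p.1) := by
    simpa using hTc.smul hGO
  have hY1 : (fun p => Y p - 1) =O[𝓕] (fun p => p.1) := by
    have := hYo.isBigO.sub hTG
    simpa using this
  have hX1 : (fun p : ℝ × ℂ => X p.1 p.2 - 1) =O[𝓕] (fun p => p.1) := by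
    have := hEo.isBigO.add hTG
    simpa using this
  have hYO : Y =O[𝓕] (fun _ => (1 : ℝ)) := by
    have := (hY1.trans hT1.isBigO).add (isBigO_const_const (1 : Mat) (one_ne_zero (α := ℝ)) 𝓕)
    simpa using this
  have hmain : (fun p : ℝ × ℂ => ((p.1 : ℂ) • sigmaMinus) * (Y p - 1) +
      (deriv (X p.1) p.2 - (p.1 : ℂ) • sigmaMinus) * Y p +
      (X p.1 p.2 - 1) * A p.2 * (Y p - 1) +
      A p.2 * (Y p - 1 + (p.1 : ℂ) • G p.2) + (X p.1 p.2 - 1 - (p.1 : ℂ) • G p.2) * A p.2)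
      =o[𝓕] (fun p => p.1) := by
    have f0 : (fun p : ℝ × ℂ => (p.1 : ℂ) • sigmaMinus) =O[𝓕] (fun p => p.1) := by
      simpa using hTc.smul (isBigO_const_const sigmaMinus (one_ne_zero (α := ℝ)) 𝓕)
    have f1 : (fun p : ℝ × ℂ => ((p.1 : ℂ) • sigmaMinus) * (Y p - 1)) =o[𝓕] (fun p => p.1) := by
      simpa using f0.mul_isLittleO (hY1.trans_isLittleO hT1)
    have f2 : (fun p : ℝ × ℂ => (deriv (X p.1) p.2 - (p.1 : ℂ) • sigmaMinus) * Y p) =o[𝓕]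
        (fun p => p.1) := by simpa using hE'o.mul_isBigO hYO
    have f3 : (fun p : ℝ × ℂ => (X p.1 p.2 - 1) * A p.2 * (Y p - 1)) =o[𝓕] (fun p => p.1) := by
      simpa using (hX1.mul hAO).mul_isLittleO (hY1.trans_isLittleO hT1)
    have f4 : (fun p : ℝ × ℂ => A p.2 * (Y p - 1 + (p.1 : ℂ) • G p.2)) =o[𝓕] (fun p => p.1) := by
      simpa using hAO.mul_isLittleO hYo
    have f5 : (fun p : ℝ × ℂ => (X p.1 p.2 - 1 - (p.1 : ℂ) • G p.2) * A p.2) =o[𝓕]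
        (fun p => p.1) := by simpa using hEo.mul_isBigO hAO
    exact (((f1.add f2).add f3).add f4).add f5
  obtain ⟨η, hη, hηb⟩ := exists_uniform_bound hmain
  refine (hasDerivAt_of_norm_le (f₀ := c j) (C := (r / 3) ^ j) hη ?_).2
  filter_upwards [hηb, hX, hC] with t hηt htX hCt
  refine coeff_norm_le (k := k) (s := s)
    (c := fun j => C t j - c j - (t : ℂ) • (commL B (c j) + commL sigmaMinus (c (j + 1))))
    (c₀ := C₀ t - c₀ - (t : ℂ) • (commL B c₀ - (s : ℂ) • commL sigmaMinus c₀))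
    (c₁ := C₁ t - c₁ - (t : ℂ) • (sigmaMinus + commL B c₁ + commL sigmaMinus (c 1) +
      commL sigmaMinus c₀)) (r₁ := r / 4) (r₂ := r / 2)
    hs (by linarith) (by linarith) (by linarith) (by linarith) (fun z hz hz1 hz2 => ?_) hj
  have hz0 := ne_zero_of_mem_Omega hs hz
  have hzs := add_ne_zero_of_mem_Omega hs hz
  have hzr := hSr (show z ∈ S from ⟨hz, hz1, hz2⟩)
  rw [← sub_sub_smul_ratForm, ← hCt z hz, ← rate_eq_ratForm hc1 hck hz0 hzs]
  have hlog : logD (N t) z = deriv (X t) z * Y (t, z) + X t z * A z * Y (t, z) := by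
    have hev : N t =ᶠ[𝓝 z] fun w => X t w * M w := by
      filter_upwards [((isOpen_Omega hs).inter Metric.isOpen_ball).mem_nhds ⟨hz, hzr⟩] with w hw
        using htX.2 w hw
    have h1 := logD_of_eventuallyEq hev
      (htX.1.differentiableAt (Metric.isOpen_ball.mem_nhds hzr)).hasDerivAt
      (h.hasDerivAt hs hz) (h.det_eq_one hs hz)
    rw [hc z hz] at h1
    exact h1
  refine (congrArg norm ?_).trans_le (hηt z ⟨hz, hz1, hz2⟩)
  rw [hlog, commL_apply]
  change _ + _ - A z - (t : ℂ) • (sigmaMinus + (G z * A z - A z * G z)) = _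
  simp only [smul_add, smul_sub, mul_add, mul_sub, sub_mul, one_mul, mul_one,
    smul_mul_assoc, mul_smul_comm]
  abel

end Coefficients

/-! ### The deformations in `λ` and in `s` -/

section Directions

variable {k : ℕ} {α l s : ℝ} {M : ℂ → ℝ → ℝ → Mat} {a : ℝ → ℝ → ℂ}

theorem hasDerivAt_of_comp_add {E : Type*} [NormedAddCommGroup E] [NormedSpace ℝ E] {f : ℝ → E}
    {f' : E} {x : ℝ} (hf : HasDerivAt (fun t => f (x + t)) f' 0) : HasDerivAt f f' x := by
  have h1 : HasDerivAt (fun t => f (x + t)) f' (-x + x) := by rwa [neg_add_cancel]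
  simpa using h1.comp_const_add (-x) x

/-- Moving `λ` amounts to scaling the variable by `g⁴`, where `g² = λ(t) / λ`. -/
theorem isDeformation_lambda (hM : ∀ l s : ℝ, 0 < l → 0 < s →
      IsRHSolution k α l s (fun z => M z l s) (a l s)) (hl : 0 < l) (hs : 0 < s) :
    IsDeformation k α l s (fun t => Real.sqrt ((l + t) / l))
      (fun t => (Real.sqrt ((l + t) / l) ^ 4 - 1) * s) (fun _ => s) (1 / (2 * l)) (2 * s / l)
      (fun t z => M z (l + t) s) (fun t => a (l + t) s) := by
  have h1 : Real.sqrt ((l + 0) / l) = 1 := by rw [add_zero, div_self hl.ne', Real.sqrt_one]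
  have hg : HasDerivAt (fun t => Real.sqrt ((l + t) / l)) (1 / (2 * l)) 0 := by
    have e1 : HasDerivAt (fun t => (l + t) / l) (1 / l) 0 :=
      ((hasDerivAt_id (0 : ℝ)).const_add l).div_const l
    refine (e1.sqrt (by simp [hl.ne'])).congr_deriv ?_
    rw [h1]; field_simp
  refine ⟨h1, by simp [hl.ne'], hg, ?_, tendsto_const_nhds, ?_, ?_⟩
  · refine (((hg.fun_pow 4).sub_const 1).mul_const s).congr_deriv ?_
    rw [h1]; field_simp; norm_num
  · exact Eventually.of_forall fun t => by ring
  · filter_upwards [lt_mem_nhds (show -l < 0 by linarith)] with t ht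
    have h2 : 0 < l + t := by linarith
    have h3 : Real.sqrt ((l + t) / l) ^ 2 * l = l + t := by
      rw [Real.sq_sqrt (div_nonneg h2.le hl.le)]; field_simp
    rw [h3]
    exact hM _ _ h2 hs

/-- Moving `s` amounts to a translation of the variable. -/
theorem isDeformation_s (hM : ∀ l s : ℝ, 0 < l → 0 < s →
      IsRHSolution k α l s (fun z => M z l s) (a l s)) (hl : 0 < l) (hs : 0 < s) :
    IsDeformation k α l s (fun _ => 1) (fun t => t) (fun t => s + t) 0 1
      (fun t z => M z l (s + t)) (fun t => a l (s + t)) := by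
  refine ⟨rfl, rfl, hasDerivAt_const _ _, hasDerivAt_id _, ?_, ?_, ?_⟩
  · have : Tendsto (fun t : ℝ => s + t) (𝓝 0) (𝓝 (s + 0)) := tendsto_const_nhds.add tendsto_id
    rwa [add_zero] at this
  · exact Eventually.of_forall fun t => by ring
  · filter_upwards [lt_mem_nhds (show -s < 0 by linarith)] with t ht
    rw [one_pow, one_mul]
    exact hM _ _ hl (by linarith)

theorem lower_conj_gaugeRate (l : ℝ) (b : ℂ) (g' d' : ℝ) :
    lower b * gaugeRate l g' d' * adjL (lower b) =
      !![(g' : ℂ), 0; 2 * g' * b - l * d' / 2, -g'] := by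
  ext i j
  fin_cases i <;> fin_cases j <;> simp [lower, gaugeRate, adjL_apply]
  ring

theorem deformationRate_s (b b' : ℂ) (c : ℕ → Mat) (c₀ : Mat) (z : ℂ) :
    deformationRate l s b b' 0 1 c c₀ ((l / 2 : ℂ) • sigmaMinus) z =
      b' • sigmaMinus + (z + s)⁻¹ • c₀ := by
  rw [deformationRate, lower_conj_gaugeRate, rateIn]
  ext i j
  fin_cases i <;> fin_cases j <;> simp [sigmaMinus]
  ring

theorem deformationRate_lambda (hl : 0 < l) {b b' : ℂ} {c : ℕ → Mat} {c₀ : Mat}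
    (h01 : (c 1 + c₀) 0 1 = l / 2) (h00 : (c 1 + c₀) 0 0 = -(1 / 4))
    (h11 : (c 1 + c₀) 1 1 = 1 / 4) (hb' : l * b' = b + 2 * (c 1 + c₀) 1 0) {z : ℂ}
    (hz : z + s ≠ 0) :
    deformationRate l s b b' (1 / (2 * l)) (2 * s / l) c c₀ ((l / 2 : ℂ) • sigmaMinus) z =
      !![0, 1; 2 * b', 0] + z • sigmaMinus := by
  have hlc : (l : ℂ) ≠ 0 := Complex.ofReal_ne_zero.2 hl.ne'
  have hr : rateIn (1 / (2 * l)) (2 * s / l) s c c₀ ((l / 2 : ℂ) • sigmaMinus) z =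
      (2 / l : ℂ) • (c 1 + c₀) + (z + s) • sigmaMinus := by
    have e1 : (4 * ((1 / (2 * l) : ℝ) : ℂ)) = 2 / l := by push_cast; field_simp; norm_num
    have e2 : (4 * ((1 / (2 * l) : ℝ) : ℂ) * z + ((2 * s / l : ℝ) : ℂ)) = 2 / l * (z + s) := by
      rw [e1]; push_cast; field_simp
    rw [rateIn, e2, e1, smul_add, smul_add, smul_smul, smul_smul, mul_assoc, mul_inv_cancel₀ hz,
      mul_one, add_assoc]
    congr 3
    field_simp
  rw [deformationRate, lower_conj_gaugeRate, hr]
  have hbe : b = l * b' - 2 * (c 1 + c₀) 1 0 := by rw [hb']; ring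
  ext i j
  fin_cases i <;> fin_cases j <;>
    simp only [Matrix.add_apply, Matrix.smul_apply, sigmaMinus, Fin.zero_eta, Fin.mk_one,
      Matrix.of_apply, Matrix.cons_val', Matrix.cons_val_zero, Matrix.cons_val_one,
      Matrix.cons_val_fin_one, smul_eq_mul, Fin.isValue] at *
  · rw [h00]; push_cast; field_simp; norm_num
  · rw [h01]; field_simp; norm_num
  · rw [hbe]; push_cast; field_simp; ring
  · rw [h11]; push_cast; field_simp; norm_num

end Directions

/-! ### The Lax triple and the coupled Painlevé III system -/

section LaxTriple

variable {k : ℕ} {α l s : ℝ} {M : ℂ → ℝ → ℝ → Mat} {a : ℝ → ℝ → ℂ}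
  {c : ℝ → ℝ → ℕ → Mat} {c₀ c₁ : ℝ → ℝ → Mat}

theorem IsRHSolution.coeff_one_add_residue_apply {N : ℂ → Mat} {b : ℂ} (h : IsRHSolution k α l s N b)
    (hk : 1 ≤ k) (hs : 0 < s) {c : ℕ → Mat} {c₀ c₁ : Mat}
    (hc : ∀ z ∈ Omega s, logD N z = ratForm k s c c₀ c₁ z) :
    (c 1 + c₀) 1 1 = 1 / 4 := by
  have h1 := h.trace_coeff hs hc (j := 1) (by simp)
  have h2 := (h.trace_det_residue hs hc).1
  have h3 := (h.coeff_relations hk hs hc).2.2.1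
  rw [Matrix.trace_fin_two] at h1
  rw [Matrix.add_apply] at h3 ⊢
  linear_combination h1 + h2 - h3

/-- The derivatives in `λ` of the constant `a`, of the solution, and of the principal part at the origin
of its logarithmic derivative in `z`. -/
theorem variation_lambda (hk : 1 ≤ k) (hM : ∀ l s : ℝ, 0 < l → 0 < s →
      IsRHSolution k α l s (fun z => M z l s) (a l s))
    (hc : ∀ l s : ℝ, 0 < l → 0 < s → ∀ z ∈ Omega s,
      logD (fun z => M z l s) z = ratForm k s (c l s) (c₀ l s) (c₁ l s) z)
    (hck : ∀ l s, c l s (k + 2) = 0) (hl : 0 < l) (hs : 0 < s) :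
    ∃ a' : ℂ, l * a' = a l s + 2 * (c l s 1 + c₀ l s) 1 0 ∧ HasDerivAt (fun x => a x s) a' l ∧
      (∀ z ∈ Omega s, HasDerivAt (fun x => M z x s) (!![0, 1; z + 2 * a', 0] * M z l s) l) ∧
      ∀ j ∈ Finset.Icc 1 (k + 1), HasDerivAt (fun x => c x s j)
        (commL !![0, 1; 2 * a', 0] (c l s j) + commL sigmaMinus (c l s (j + 1))) l := by
  have hlc : (l : ℂ) ≠ 0 := Complex.ofReal_ne_zero.2 hl.ne'
  have h := hM l s hl hs
  have hD := isDeformation_lambda hM hl hs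
  have hcl := hc l s hl hs
  obtain ⟨h1, h01, h00, h10⟩ := h.coeff_relations hk hs hcl
  have h11 := h.coeff_one_add_residue_apply hk hs hcl
  have hb := hD.hasDerivAt_const h hs hcl (hck l s)
  set a' : ℂ := (a l s + 2 * (c l s 1 + c₀ l s) 1 0) / l with ha'
  have ha1 : l * a' = a l s + 2 * (c l s 1 + c₀ l s) 1 0 := by rw [ha']; field_simp
  have hb' : HasDerivAt (fun t => a (l + t) s) a' 0 := by
    refine hb.congr_deriv ?_
    rw [Matrix.add_apply] at h01 h10
    rw [Matrix.sub_apply, Matrix.smul_apply, smul_eq_mul] at h10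
    rw [ha', Matrix.add_apply]
    push_cast
    field_simp
    linear_combination (-4 : ℂ) * h10 - 4 * s * h01
  have hrate : ∀ z : ℂ, z + s ≠ 0 → deformationRate l s (a l s) a' (1 / (2 * l)) (2 * s / l)
      (c l s) (c₀ l s) (c₁ l s) z = !![0, 1; 2 * a', 0] + z • sigmaMinus := by
    intro z hz
    rw [h1]
    exact deformationRate_lambda hl h01 h00 h11 ha1 hz
  refine ⟨a', ha1, hasDerivAt_of_comp_add hb', fun z hz => ?_, fun j hj => ?_⟩
  · have h2 := hD.hasDerivAt_solution h hs hcl (hck l s) (by simp) hb' hz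
    rw [hrate z (add_ne_zero_of_mem_Omega hs hz)] at h2
    refine hasDerivAt_of_comp_add (h2.congr_deriv ?_)
    congr 1
    ext i j
    fin_cases i <;> fin_cases j <;> simp [sigmaMinus]
    ring
  · obtain ⟨X, hX, hXo⟩ := hD.exists_left_factor h hs hcl (hck l s) (by simp) hb' (r := s / 2)
      (by linarith) (by linarith)
    have hB : adjL !![0, 1; 2 * a', 0] = -!![0, 1; 2 * a', 0] := by simp [adjL_apply]
    refine hasDerivAt_of_comp_add (f := fun x => c x s j)
      (hasDerivAt_coeff h hs hcl (hck l s) h1 hB (r := s / 2) (by linarith)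
      (by linarith) (N := fun t z => M z (l + t) s) (C := fun t => c (l + t) s)
      (C₀ := fun t => c₀ (l + t) s) (C₁ := fun t => c₁ (l + t) s) (X := X) ?_ ?_ ?_ hj)
    · filter_upwards [lt_mem_nhds (show -l < 0 by linarith)] with t ht
      exact hc (l + t) s (by linarith) hs
    · filter_upwards [hX] with t ht
      exact ⟨ht.1, fun z hz => ht.2 z ⟨⟨hz.1, hz.1⟩, hz.2⟩⟩
    · refine hXo.congr' ?_ EventuallyEq.rfl
      change ∀ᶠ p in _, _
      rw [eventually_prod_principal_iff]
      refine Eventually.of_forall fun t z hz => ?_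
      beta_reduce
      rw [hrate z (add_ofReal_ne_zero_of_norm_lt
        (by have := mem_ball_zero_iff.1 hz; linarith))]

/-- The derivatives in `s` of the constant `a` and of the solution. -/
theorem variation_s (hk : 1 ≤ k) (hM : ∀ l s : ℝ, 0 < l → 0 < s →
      IsRHSolution k α l s (fun z => M z l s) (a l s))
    (hc : ∀ l s : ℝ, 0 < l → 0 < s → ∀ z ∈ Omega s,
      logD (fun z => M z l s) z = ratForm k s (c l s) (c₀ l s) (c₁ l s) z)
    (hck : ∀ l s, c l s (k + 2) = 0) (hl : 0 < l) (hs : 0 < s) :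
    HasDerivAt (fun t => a l t) (l / 2 - c l s 1 0 1) s ∧
      ∀ z ∈ Omega s, HasDerivAt (fun t => M z l t)
        (((l / 2 - c l s 1 0 1) • sigmaMinus + (z + s)⁻¹ • c₀ l s) * M z l s) s := by
  have h := hM l s hl hs
  have hD := isDeformation_s hM hl hs
  have hcl := hc l s hl hs
  have h1 := (h.coeff_relations hk hs hcl).1
  have hb' : HasDerivAt (fun t => a l (s + t)) (l / 2 - c l s 1 0 1) 0 := by
    refine (hD.hasDerivAt_const h hs hcl (hck l s)).congr_deriv ?_
    push_cast
    ring
  refine ⟨hasDerivAt_of_comp_add hb', fun z hz => ?_⟩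
  have h2 := hD.hasDerivAt_solution h hs hcl (hck l s) (by simp) hb' hz
  rw [h1, deformationRate_s] at h2
  exact hasDerivAt_of_comp_add h2

theorem commL_entries (β : ℂ) (X Y : Mat) :
    (commL !![0, 1; β, 0] X + commL sigmaMinus Y) 0 1 = X 1 1 - X 0 0 ∧
    (commL !![0, 1; β, 0] X + commL sigmaMinus Y) 0 0 = X 1 0 - β * X 0 1 - Y 0 1 := by
  rw [Matrix.eta_fin_two X, Matrix.eta_fin_two Y]
  constructor
  · simp [commL_apply, sigmaMinus]
  · simp [commL_apply, sigmaMinus]; ring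

theorem sum_reflect_convolution {J : ℕ} (hJ : J ∈ Finset.Icc (k + 2) (2 * k + 2)) (f : ℕ → ℕ → ℂ) :
    ∑ m ∈ Finset.Icc (J - k - 1) (k + 1), f (J - m) m =
      ∑ m ∈ Finset.Icc (J - k - 1) (k + 1), f m (J - m) := by
  rw [Finset.mem_Icc] at hJ
  refine Finset.sum_nbij' (fun m => J - m) (fun m => J - m) ?_ ?_ ?_ ?_ ?_
  all_goals
    intro m hm
    rw [Finset.mem_Icc] at hm
  · rw [Finset.mem_Icc]; omega
  · rw [Finset.mem_Icc]; omega
  · omega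
  · omega
  · rw [show J - (J - m) = m by omega]

/-- The coefficient `c (k + 2)`, which does not occur in `ratForm`, may be taken to be zero. -/
theorem IsRHSolution.exists_truncated_ratForm {N : ℂ → Mat} {b : ℂ} (h : IsRHSolution k α l s N b)
    (hs : 0 < s) : ∃ (c : ℕ → Mat) (c₀ c₁ : Mat), c (k + 2) = 0 ∧
      ∀ z ∈ Omega s, logD N z = ratForm k s c c₀ c₁ z := by
  obtain ⟨c, c₀, c₁, hc⟩ := h.exists_ratForm hs
  refine ⟨Function.update c (k + 2) 0, c₀, c₁, by simp, fun z hz => ?_⟩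
  rw [hc z hz, ratForm, ratForm]
  congr 2
  refine Finset.sum_congr rfl fun j hj => ?_
  rw [Function.update_of_ne (by have := (Finset.mem_Icc.1 hj).2; omega)]

end LaxTriple

end

end CoupledPIII

open CoupledPIII
open scoped Matrix.Norms.Operator

theorem proposition6p3 (k : ℕ) (hk : 1 ≤ k) (α : ℝ) (hα : -1 < α)
    (M : ℂ → ℝ → ℝ → CoupledPIII.Mat) (a : ℝ → ℝ → ℂ)
    (hM : ∀ l s : ℝ, 0 < l → 0 < s →
      CoupledPIII.IsRHSolution k α l s (fun z => M z l s) (a l s)) :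
    ∃ b : ℕ → ℝ → ℝ → ℂ,
      (∀ l s : ℝ, b (k + 2) l s = 0) ∧
      ∀ l s : ℝ, 0 < l → 0 < s →
        -- the derivatives of `a` and `b_j` below exist
        DifferentiableAt ℝ (fun x => a x s) l ∧
        DifferentiableAt ℝ (fun t => a l t) s ∧
        (∀ j ∈ Finset.Icc 1 (k + 1),
          DifferentiableAt ℝ (fun x => b j x s) l ∧
          DifferentiableAt ℝ (fun x => CoupledPIII.dl (b j) x s) l) ∧
        -- the Lax triple
        (∀ z ∈ CoupledPIII.Omega s, ∀ p q : Fin 2,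
          HasDerivAt (fun w : ℂ => M w l s p q)
            ((CoupledPIII.laxZ k a b z l s * M z l s) p q) z ∧
          HasDerivAt (fun x : ℝ => M z x s p q)
            ((CoupledPIII.laxL a z l s * M z l s) p q) l ∧
          HasDerivAt (fun t : ℝ => M z l t p q)
            ((CoupledPIII.laxS a b z l s * M z l s) p q) s) ∧
        -- the coupled Painlevé III system
        CoupledPIII.CoupledSystemAt k α a b l s ∧
        -- the relation between `a` and `b_1`
        deriv (fun t => a l t) s = (l : ℂ) / 2 - b 1 l s := by
  have hex : ∀ l s : ℝ, ∃ (c : ℕ → Mat) (c₀ c₁ : Mat), c (k + 2) = 0 ∧ (0 < l → 0 < s →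
      ∀ z ∈ Omega s, logD (fun z => M z l s) z = ratForm k s c c₀ c₁ z) := by
    intro l s
    by_cases h : 0 < l ∧ 0 < s
    · obtain ⟨c, c₀, c₁, h1, h2⟩ := (hM l s h.1 h.2).exists_truncated_ratForm h.2
      exact ⟨c, c₀, c₁, h1, fun _ _ => h2⟩
    · exact ⟨0, 0, 0, rfl, fun hl hs => absurd ⟨hl, hs⟩ h⟩
  choose c c₀ c₁ hck hc using hex
  set b : ℕ → ℝ → ℝ → ℂ := fun j l s => c l s j 0 1 with hb
  refine ⟨b, fun l s => by simp [hb, hck], fun l s hl hs => ?_⟩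
  -- the variation in `λ`, at every point of the quadrant
  have hvar := fun (l s : ℝ) (hl : 0 < l) (hs : 0 < s) => variation_lambda hk hM hc hck hl hs
  have htrace : ∀ l s : ℝ, 0 < l → 0 < s → ∀ j ∈ Finset.Icc 1 (k + 1),
      c l s j 1 1 = -c l s j 0 0 := by
    intro l s hl hs j hj
    have := (hM l s hl hs).trace_coeff hs (hc l s hl hs) hj
    rw [Matrix.trace_fin_two] at this
    linear_combination this
  have hb1 : ∀ l s : ℝ, 0 < l → 0 < s → ∀ j ∈ Finset.Icc 1 (k + 1),
      HasDerivAt (fun x => b j x s) (-2 * c l s j 0 0) l := by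
    intro l s hl hs j hj
    obtain ⟨a', -, -, -, hcoeff⟩ := hvar l s hl hs
    refine (HasDerivAt.entryReal (hcoeff j hj) 0 1).congr_deriv ?_
    rw [(commL_entries _ _ _).1, htrace l s hl hs j hj]
    ring
  have hdb : ∀ l s : ℝ, 0 < l → 0 < s → ∀ j ∈ Finset.Icc 1 (k + 1),
      dl (b j) l s = -2 * c l s j 0 0 := fun l s hl hs j hj => (hb1 l s hl hs j hj).deriv
  obtain ⟨a', ha', hda, hMl, hcoeff⟩ := hvar l s hl hs
  obtain ⟨has, hMs⟩ := variation_s hk hM hc hck hl hs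
  have hdla : dl a l s = a' := hda.deriv
  have hb2 : ∀ j ∈ Finset.Icc 1 (k + 1), HasDerivAt (fun x => dl (b j) x s)
      (-2 * (c l s j 1 0 - 2 * a' * b j l s - b (j + 1) l s)) l := by
    intro j hj
    have h1 := (HasDerivAt.entryReal (hcoeff j hj) 0 0).const_mul (-2)
    rw [(commL_entries _ _ _).2] at h1
    refine h1.congr_of_eventuallyEq ?_
    filter_upwards [lt_mem_nhds hl] with x hx using hdb x s hx hs j hj
  have hddb : ∀ j ∈ Finset.Icc 1 (k + 1), ddl (b j) l s =
      -2 * (c l s j 1 0 - 2 * a' * b j l s - b (j + 1) l s) := fun j hj => (hb2 j hj).deriv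
  have h := hM l s hl hs
  have hcl := hc l s hl hs
  obtain ⟨h1, h01, h00, h10⟩ := h.coeff_relations hk hs hcl
  obtain ⟨htr, hdet⟩ := h.trace_det_residue hs hcl
  have h1mem : 1 ∈ Finset.Icc 1 (k + 1) := by simp
  -- the coefficient matrices in terms of `a` and `b`
  have hA : ∀ j ∈ Finset.Icc 1 (k + 1), coeffA a b j l s = c l s j := by
    intro j hj
    rw [coeffA, hdb l s hl hs j hj, hddb j hj, hdla, Matrix.eta_fin_two (c l s j),
      htrace l s hl hs j hj]
    ext p q
    fin_cases p <;> fin_cases q <;> simp [hb]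
    all_goals ring
  have hA0 : coeffA0 a b l s = c₀ l s := by
    rw [coeffA0, hdb l s hl hs 1 h1mem, hddb 1 h1mem, hdla, Matrix.eta_fin_two (c₀ l s)]
    simp only [Matrix.add_apply, Matrix.sub_apply, Matrix.smul_apply, smul_eq_mul] at h01 h00 h10 ha'
    simp only [hb, Nat.reduceAdd]
    ext p q
    fin_cases p <;> fin_cases q <;>
      simp only [Fin.zero_eta, Fin.mk_one, Matrix.of_apply, Matrix.cons_val', Matrix.cons_val_zero,
        Matrix.cons_val_one, Matrix.cons_val_fin_one, Fin.isValue]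
    · linear_combination -h00
    · linear_combination -h01
    · linear_combination h10 + ha' + (2 * a' - s) * (-h01) + 2 * a' * h01
    · linear_combination h00 - htr
  have hL : ∀ z, laxZ k a b z l s = ratForm k s (c l s) (c₀ l s) (c₁ l s) z := by
    intro z
    rw [laxZ, ratForm, hA0, h1]
    congr 2
    exact Finset.sum_congr rfl fun j hj => by rw [hA j hj]
  refine ⟨hda.differentiableAt, has.differentiableAt,
    fun j hj => ⟨(hb1 l s hl hs j hj).differentiableAt, (hb2 j hj).differentiableAt⟩,
    fun z hz p q => ⟨?_, ?_, ?_⟩, ⟨?_, fun J hJ => ?_⟩, has.deriv⟩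
  · rw [hL z, ← hcl z hz]
    exact HasDerivAt.entry (h.hasDerivAt hs hz) p q
  · rw [laxL, hdla]
    exact HasDerivAt.entryReal (hMl z hz) p q
  · have h2 : deriv (fun t => a l t) s = l / 2 - c l s 1 0 1 := has.deriv
    rw [laxS, hA0, h2]
    exact HasDerivAt.entryReal (hMs z hz) p q
  · -- the residue at `-s` is nilpotent
    rw [← hA0] at hdet
    simp only [coeffA0, Matrix.of_apply, Matrix.cons_val', Matrix.cons_val_zero,
      Matrix.cons_val_one, Matrix.cons_val_fin_one] at hdet
    linear_combination (-4 : ℂ) * hdet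
  · have h2 := h.trace_convolution hk hs hcl hJ
    rw [← h2]
    have hmem : ∀ m ∈ Finset.Icc (J - k - 1) (k + 1),
        m ∈ Finset.Icc 1 (k + 1) ∧ J - m ∈ Finset.Icc 1 (k + 1) := by
      intro m hm
      simp only [Finset.mem_Icc] at hm hJ ⊢
      omega
    set u : ℕ → ℕ → ℂ := fun i m => c l s i 0 1 * c l s m 1 0 with hu
    have h3 : ∀ m ∈ Finset.Icc (J - k - 1) (k + 1), (c l s (J - m) * c l s m).trace =
        (2 * (c l s (J - m) 0 0 * c l s m 0 0) + u (J - m) m) + u m (J - m) := by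
      intro m hm
      obtain ⟨hm1, hm2⟩ := hmem m hm
      rw [trace_mul_fin_two, htrace l s hl hs m hm1, htrace l s hl hs (J - m) hm2, hu]
      ring
    have h4 : ∑ m ∈ Finset.Icc (J - k - 1) (k + 1), (c l s (J - m) * c l s m).trace =
        ∑ m ∈ Finset.Icc (J - k - 1) (k + 1),
          ((2 * (c l s (J - m) 0 0 * c l s m 0 0) + u (J - m) m) + u (J - m) m) := by
      rw [Finset.sum_congr rfl h3, Finset.sum_add_distrib, ← sum_reflect_convolution hJ u,
        ← Finset.sum_add_distrib]
    rw [h4]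
    refine Finset.sum_congr rfl fun m hm => ?_
    obtain ⟨hm1, hm2⟩ := hmem m hm
    rw [hddb m hm1, hdb l s hl hs m hm1, hdb l s hl hs (J - m) hm2, hdla]
    simp only [hb, hu]
    ring
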